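/- Let $M$ be a compact oriented Riemannian manifold without boundary, of dimension $n\ge 2$, with metric $\mathsf g$ and Riemannian volume form $\mu$. Let $\beta_0$ be a smooth closed 2-form on $M$ and $e\colon(0,\infty)\to\mathbb R$ a smooth function. Let $\mathrm{Diff}(M)$ be the group of orientation-preserving diffeomorphisms, $\mathfrak X^*(M)=\{\alpha\otimes\mu:\alpha\in\Omega^1(M)\}$ with $\langle\alpha\otimes\mu,w\rangle=\int_M\alpha(w)\,\mu$, and identify $T^*\mathrm{Diff}(M)\simeq\mathrm{Diff}(M)\times\mathfrak X^*(M)$ by $\langle(\varphi,m),\dot\varphi\rangle=\langle m,\dot\varphi\circ\varphi^{-1}\rangle$. Let $\mathcal G=\{\eta\in\mathrm{Diff}(M):\eta_*\mu=\mu,\ \eta_*\beta_0=\beta_0\}$ act by $(\varphi,m)\mapsto(\varphi\circ\eta,m)$, let $\mathfrak{cmh}=\mathfrak X(M)\ltimes\big(C^\infty(M)\oplus\Omega^{n-2}(M)/\mathrm d\Omega^{n-3}(M)\big)$ with smooth dual $\mathfrak{cmh}^*=\mathfrak X^*(M)\times(\Omega^n(M)\oplus\Omega^2_{cl}(M))\ni(m,\varrho,\beta)$,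 where $\varrho=\rho\mu$, $\langle\varrho,\theta\rangle=\int_M\theta\varrho$ and $\langle\beta,[P]\rangle=\int_M\beta\wedge P$ (which depends only on the class of $P$ modulo $\mathrm d\Omega^{n-3}(M)$). Set $\Pi(\varphi,m)=(m,\varphi_*\mu,\varphi_*\beta_0)$. On the set $\rho>0$ of $\mathfrak{cmh}^*$ put $$\bar H(m,\rho,\beta)=\tfrac12\langle m,v\rangle+\int_M e(\rho)\rho\,\mu+\tfrac12\int_M\beta\wedge\star\beta,\qquad m=\rho v^\flat\otimes\mu,$$ and let $H(\varphi,m)$ be the same expression with $\rho=\mathrm{Jac}(\varphi^{-1})$ (that is, $\varphi_*\mu=\rho\mu$) and $\beta=\varphi_*\beta_0$. Functionals on $T^*\mathrm{Diff}(M)$ and $\mathfrak{cmh}^*$ are differentiated along smooth curves, with derivatives in the smooth duals. Then the following hold. 1. $\Pi$ takes values in $\mathfrak{cmh}^*$, and $\Pi(\varphi,m)=\Pi(\varphi',m')$ if and only if $m'=m$ and $\varphi'=\varphi\circ\eta$ for some $\eta\in\mathcal G$; so $\Pi$ embeds $T^*\mathrm{Diff}(M)/\mathcal G$ into $\mathfrak{cmh}^*$.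 It is a Poisson map from the canonical bracket of $T^*\mathrm{Diff}(M)$ to the Lie–Poisson bracket $$\{F,G\}=\Big\langle m,\mathcal L_{\frac{\delta F}{\delta m}}\tfrac{\delta G}{\delta m}\Big\rangle+\Big\langle\varrho,\mathcal L_{\frac{\delta F}{\delta m}}\tfrac{\delta G}{\delta\varrho}-\mathcal L_{\frac{\delta G}{\delta m}}\tfrac{\delta F}{\delta\varrho}\Big\rangle+\Big\langle\beta,\mathcal L_{\frac{\delta F}{\delta m}}\tfrac{\delta G}{\delta\beta}-\mathcal L_{\frac{\delta G}{\delta m}}\tfrac{\delta F}{\delta\beta}\Big\rangle .$$ 2. The momentum map of the cotangent lifted action of $\mathrm{Diff}(M)$ on pairs $(\varrho,\beta)$ with covectors $(\theta,[P])$ is $\rho(\mathrm d\theta+\iota_u\beta)\otimes\mu$, where $\iota_u\varrho=\mathrm dP$: for all smooth vector fields $w$, $\langle-\mathcal L_w\varrho,\theta\rangle+\langle-\mathcal L_w\beta,[P]\rangle=\langle\rho(\mathrm d\theta+\iota_u\beta)\otimes\mu,w\rangle$. 3. $H=\bar H\circ\Pi$ is $\mathcal G$-invariant, and where $\rho>0$,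 $\frac{\delta\bar H}{\delta m}=v$, $\frac{\delta\bar H}{\delta\varrho}=-\tfrac12|v|^2+e(\rho)+\rho e'(\rho)$ and $\frac{\delta\bar H}{\delta\beta}=[\star\beta]$. 4. For smooth curves $(m,\rho,\beta)$ in $\mathfrak{cmh}^*$ with $\rho>0$, the Lie–Poisson equations $\dot F=\{\bar H,F\}$ (for all $F$) are equivalent to the system $$\begin{cases}\dot m+\mathcal L_vm+\rho\,\iota_u\beta\otimes\mu+\rho\,\mathrm d\big(\tfrac{\delta\bar H}{\delta\varrho}\big)\otimes\mu=0,\\ \dot\rho+\operatorname{div}(\rho v)=0,\\ \dot\beta+\mathcal L_v\beta=0,\end{cases}\qquad \iota_u\varrho=\mathrm d\big(\tfrac{\delta\bar H}{\delta\beta}\big),\quad m=\rho v^\flat\otimes\mu.\tag{R}$$ 5. A smooth curve $(\varphi,m)$ in $T^*\mathrm{Diff}(M)$ solves the Euler–Lagrange (Hamilton) equations of $H$, i.e. of the phase space Lagrangian $\langle m,\dot\varphi\circ\varphi^{-1}\rangle-H(\varphi,m)$, if and only if $\dot\varphi=v\circ\varphi$, with $m=\rho v^\flat\otimes\mu$,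 and $\Pi(\varphi,m)$ solves (R). 6. Let $n=3$. For every smooth curve $(m,\rho,\beta)$ in $\mathfrak{cmh}^*$ with $\rho>0$ there are unique smooth curves of vector fields $v$ and $\mathbf B$ with $m=\rho v^\flat\otimes\mu$ and $\iota_{\mathbf B}\mu=\beta$. The form $\iota_{\mathbf B}\mu$ is closed if and only if $\operatorname{div}\mathbf B=0$, and for such $\mathbf B$ the system (R) for $(\rho v^\flat\otimes\mu,\rho,\iota_{\mathbf B}\mu)$ is equivalent to the compressible ideal MHD equations $$\begin{cases}\dot v+\nabla_vv+\rho^{-1}\,\mathbf B\times\operatorname{curl}\mathbf B+\rho^{-1}\nabla P(\rho)=0,\\ \dot\rho+\operatorname{div}(\rho v)=0,\\ \dot{\mathbf B}+\operatorname{curl}\mathbf E=0,\quad\mathbf E=\mathbf B\times v,\end{cases}\qquad P(\rho)=\rho^2e'(\rho).$$ -/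

import Mathlib

open scoped Manifold ContDiff
open Set MeasureTheory

universe u

noncomputable section

namespace CompMHD

/-! ### Vector fields, differential forms, diffeomorphisms

`M` is a manifold without boundary modelled on `ℝⁿ = EuclideanSpace ℝ (Fin n)`.  Fields are plain
sections; smoothness is a predicate. -/

/-- The model space `ℝⁿ`. -/
abbrev Model (n : ℕ) : Type := EuclideanSpace ℝ (Fin n)

/-- Vector fields on `M` (not necessarily smooth). -/
abbrev VF (n : ℕ) (M : Type u) [TopologicalSpace M] [ChartedSpace (Model n) M] : Type u :=
  (x : M) → TangentSpace (𝓡 n) x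

/-- Differential `k`-forms on `M` (not necessarily smooth).  The value at `x` is an alternating form
on `T_x M`, which in Mathlib is a copy of `ℝⁿ` (identified through the preferred chart at `x`). -/
abbrev Form (n : ℕ) (M : Type u) (k : ℕ) : Type u := M → Model n [⋀^Fin k]→L[ℝ] ℝ

/-- Smooth diffeomorphisms of `M`. -/
abbrev Diffeo (n : ℕ) (M : Type u) [TopologicalSpace M] [ChartedSpace (Model n) M] : Type u :=
  Diffeomorph (𝓡 n) (𝓡 n) M M ∞

/-- Smooth Riemannian metrics on `M`. -/
abbrev Metric (n : ℕ) (M : Type u) [TopologicalSpace M] [ChartedSpace (Model n) M]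
    [IsManifold (𝓡 n) ∞ M] : Type u :=
  Bundle.ContMDiffRiemannianMetric (𝓡 n) ∞ (Model n) (fun x : M => TangentSpace (𝓡 n) x)

section Calculus

variable {n : ℕ} {M : Type u} [TopologicalSpace M] [ChartedSpace (Model n) M]

/-- The standard basis of `T_x M` given by the preferred chart at `x`. -/
def stdBasis (x : M) (i : Fin n) : TangentSpace (𝓡 n) x :=
  (EuclideanSpace.single i (1 : ℝ) : Model n)

/-- The pullback `f^* σ`. -/
def pullback {k : ℕ} (f : M → M) (σ : Form n M k) : Form n M k := fun x =>
  (σ (f x)).compContinuousLinearMap (mfderiv (𝓡 n) (𝓡 n) f x : Model n →L[ℝ] Model n)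

/-- The push-forward `φ_* σ = (φ⁻¹)^* σ`. -/
def pushforward {k : ℕ} (φ : Diffeo n M) (σ : Form n M k) : Form n M k := pullback φ.symm σ

/-- The expression of `σ` in the preferred chart at `x₀`: the pullback of `σ` to `ℝⁿ` by the inverse
of the chart. -/
def chartForm {k : ℕ} (x₀ : M) (σ : Form n M k) (y : Model n) : Model n [⋀^Fin k]→L[ℝ] ℝ :=
  (σ ((extChartAt (𝓡 n) x₀).symm y)).compContinuousLinearMap
    (mfderiv 𝓘(ℝ, Model n) (𝓡 n) (extChartAt (𝓡 n) x₀).symm y : Model n →L[ℝ] Model n)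

/-- The expression of a vector field in the preferred chart at `x₀`. -/
def chartVF (x₀ : M) (X : VF n M) (y : Model n) : Model n :=
  mfderiv (𝓡 n) 𝓘(ℝ, Model n) (extChartAt (𝓡 n) x₀) ((extChartAt (𝓡 n) x₀).symm y)
    (X ((extChartAt (𝓡 n) x₀).symm y))

/-- Smooth functions. -/
def SmoothFun (f : M → ℝ) : Prop := ContMDiff (𝓡 n) 𝓘(ℝ, ℝ) ∞ f

/-- Smooth vector fields, i.e. elements of `𝔛(M)`. -/
def SmoothVF [IsManifold (𝓡 n) ∞ M] (X : VF n M) : Prop :=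
  ContMDiff (𝓡 n) (𝓡 n).tangent ∞ (fun x => (⟨x, X x⟩ : TangentBundle (𝓡 n) M))

/-- Smooth forms, i.e. elements of `Ω^k(M)`: smooth coefficients in all charts of `chartAt`. -/
def SmoothForm {k : ℕ} (σ : Form n M k) : Prop :=
  ∀ x₀ : M, ContDiffOn ℝ ∞ (chartForm x₀ σ) (extChartAt (𝓡 n) x₀).target

/-! Families depending on a parameter `z` that are jointly smooth in `(z, x)` for `z ∈ S`
(`S` will be an open subset of `ℝ` or `ℝ × ℝ`). -/

variable {Z : Type} [NormedAddCommGroup Z] [NormedSpace ℝ Z]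

/-- Jointly smooth families of functions. -/
def SmoothFamFun (n : ℕ) {M : Type u} [TopologicalSpace M] [ChartedSpace (Model n) M]
    (S : Set Z) (f : Z → M → ℝ) : Prop :=
  ContMDiffOn (𝓘(ℝ, Z).prod (𝓡 n)) 𝓘(ℝ, ℝ) ∞ (fun p : Z × M => f p.1 p.2) (S ×ˢ univ)

/-- Jointly smooth families of vector fields. -/
def SmoothFamVF [IsManifold (𝓡 n) ∞ M] (S : Set Z) (X : Z → VF n M) : Prop :=
  ContMDiffOn (𝓘(ℝ, Z).prod (𝓡 n)) (𝓡 n).tangent ∞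
    (fun p : Z × M => (⟨p.2, X p.1 p.2⟩ : TangentBundle (𝓡 n) M)) (S ×ˢ univ)

/-- Jointly smooth families of forms. -/
def SmoothFamForm {k : ℕ} (S : Set Z) (σ : Z → Form n M k) : Prop :=
  ∀ x₀ : M, ContDiffOn ℝ ∞ (fun p : Z × Model n => chartForm x₀ (σ p.1) p.2)
    (S ×ˢ (extChartAt (𝓡 n) x₀).target)

/-- Jointly smooth families of diffeomorphisms. -/
def SmoothFamDiffeo (S : Set Z) (φ : Z → Diffeo n M) : Prop :=
  ContMDiffOn (𝓘(ℝ, Z).prod (𝓡 n)) (𝓡 n) ∞ (fun p : Z × M => φ p.1 p.2) (S ×ˢ univ)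

/-- `w = φ̇ ∘ φ⁻¹` at time `t`: the Eulerian velocity field of the curve `φ` in `Diff(M)`. -/
def IsVelocity (φ : ℝ → Diffeo n M) (t : ℝ) (w : VF n M) : Prop :=
  ∀ y : M, HasMFDerivAt 𝓘(ℝ, ℝ) (𝓡 n) (fun s => φ s y) t
    (ContinuousLinearMap.toSpanSingleton ℝ (w (φ t y)))

/-- The exterior derivative `d`, computed in the preferred chart at each point. -/
def extd {k : ℕ} (σ : Form n M k) : Form n M (k + 1) := fun x =>
  (extDeriv (chartForm x σ) (extChartAt (𝓡 n) x x)).compContinuousLinearMap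
    (mfderiv (𝓡 n) 𝓘(ℝ, Model n) (extChartAt (𝓡 n) x) x : Model n →L[ℝ] Model n)

/-- The interior product `ι_X σ`. -/
def iota {k : ℕ} (X : VF n M) (σ : Form n M (k + 1)) : Form n M k := fun x =>
  (σ x).curryLeft (X x)

/-- The Lie derivative of forms, `𝓛_X = ι_X d + d ι_X`. -/
def lieD (X : VF n M) : {k : ℕ} → Form n M k → Form n M k
  | 0, σ => iota X (extd σ)
  | _ + 1, σ => iota X (extd σ) + extd (iota X σ)

/-- The differential of a function, as a 1-form. -/
def dFun (f : M → ℝ) : Form n M 1 := fun x =>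
  ContinuousAlternatingMap.ofSubsingleton ℝ (Model n) ℝ (0 : Fin 1)
    (mfderiv (𝓡 n) 𝓘(ℝ, ℝ) f x : Model n →L[ℝ] ℝ)

/-- The derivative `𝓛_X f = X f` of a function along a vector field. -/
def lieFun (X : VF n M) (f : M → ℝ) (x : M) : ℝ := dFun f x (fun _ => X x)

/-- Exact forms (the zero form in degree `0`). -/
def IsExactForm : {k : ℕ} → Form n M k → Prop
  | 0, P => P = 0
  | _ + 1, P => ∃ Q, SmoothForm Q ∧ extd Q = P

/-- The function `σ / μ`, for a top-degree form `σ` and a volume form `μ`. -/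
def density (μ : Form n M n) (σ : M → Model n [⋀^Fin n]→ₗ[ℝ] ℝ) (x : M) : ℝ :=
  σ x (stdBasis x) / μ x (stdBasis x)

/-- The density function `ρ = Jac(φ⁻¹)`, defined by `φ_* μ = ρ μ`. -/
def rhoOf (μ : Form n M n) (φ : Diffeo n M) : M → ℝ :=
  density μ (fun x => (pushforward φ μ x).toAlternatingMap)

/-- Orientation-preserving diffeomorphisms. -/
def OrientationPreserving (μ : Form n M n) (φ : Diffeo n M) : Prop := ∀ x, 0 < rhoOf μ φ x

/-- The symmetry group `𝒢 = Diff_μ(M) ∩ Diff_{β₀}(M)`. -/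
def symGroup (μ : Form n M n) (β₀ : Form n M 2) : Set (Diffeo n M) :=
  {η | pushforward η μ = μ ∧ pushforward η β₀ = β₀}

/-- A smooth partition of unity subordinate to the preferred charts. -/
def chartPartition (n : ℕ) (M : Type u) [TopologicalSpace M] [ChartedSpace (Model n) M]
    [IsManifold (𝓡 n) ∞ M] [CompactSpace M] [T2Space M] :
    SmoothPartitionOfUnity M (𝓡 n) M univ :=
  (SmoothPartitionOfUnity.exists_isSubordinate_chartAt_source (𝓡 n) M).choose

/-- The measure `|μ|` of a volume form `μ`: in the chart at `i` it has density `|μ(∂₁,…,∂ₙ)|` with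
respect to Lebesgue measure; the charts are glued by a partition of unity. -/
def volMeasure [IsManifold (𝓡 n) ∞ M] [CompactSpace M] [T2Space M] [MeasurableSpace M]
    (μ : Form n M n) : Measure M :=
  Measure.sum fun i : M =>
    (((volume : Measure (Model n)).restrict (extChartAt (𝓡 n) i).target).withDensity fun y =>
      ENNReal.ofReal (chartPartition n M i ((extChartAt (𝓡 n) i).symm y) *
        |chartForm i μ y (fun j => EuclideanSpace.single j (1 : ℝ))|)).map
      (extChartAt (𝓡 n) i).symm

/-- `∫_M f μ`, for `M` oriented by the volume form `μ`. -/
def integ [IsManifold (𝓡 n) ∞ M] [CompactSpace M] [T2Space M] [MeasurableSpace M]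
    (μ : Form n M n) (f : M → ℝ) : ℝ :=
  ∫ x, f x ∂(volMeasure μ)

end Calculus

/-! ### Riemannian geometry -/

section Riemannian

variable {n : ℕ} {M : Type u} [TopologicalSpace M] [ChartedSpace (Model n) M]
  [IsManifold (𝓡 n) ∞ M]

/-- `μ` is the Riemannian volume form of `g` for one of the orientations of `M`: it is smooth and
takes the values `±1` on orthonormal frames.  Choosing such a `μ` is choosing an orientation. -/
def IsRiemannianVolume (g : Metric n M) (μ : Form n M n) : Prop :=
  SmoothForm μ ∧ ∀ (x : M) (e : Fin n → TangentSpace (𝓡 n) x),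
    (μ x e) ^ 2 = (Matrix.of fun i j => g.inner x (e i) (e j)).det

/-- The inverse Gram matrix `g^{ij}` of the standard basis of `T_x M`. -/
def invGram (g : Metric n M) (x : M) : Matrix (Fin n) (Fin n) ℝ :=
  (Matrix.of fun i j => g.inner x (stdBasis x i) (stdBasis x j))⁻¹

/-- The vector `a^♯` of a linear form `a` on `T_x M`: `g(a^♯, w) = a w`. -/
def sharpAt (g : Metric n M) (x : M) (a : TangentSpace (𝓡 n) x → ℝ) : TangentSpace (𝓡 n) x :=
  ∑ i, ∑ j, (invGram g x i j * a (stdBasis x j)) • stdBasis x i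

/-- The vector field `α^♯` of a 1-form. -/
def sharp (g : Metric n M) (α : Form n M 1) : VF n M := fun x =>
  sharpAt g x fun w => α x (fun _ => w)

/-- The 1-form `X^♭ = g(X, ·)`. -/
def flat (g : Metric n M) (X : VF n M) : Form n M 1 := fun x =>
  ContinuousAlternatingMap.ofSubsingleton ℝ (Model n) ℝ (0 : Fin 1)
    (g.inner x (X x) : Model n →L[ℝ] ℝ)

/-- The gradient. -/
def grad (g : Metric n M) (f : M → ℝ) : VF n M := sharp g (dFun f)

/-- The coefficients of `g` in the preferred chart at `x₀`. -/
def chartMetric (g : Metric n M) (x₀ : M) (a b y : Model n) : ℝ :=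
  g.inner ((extChartAt (𝓡 n) x₀).symm y)
    (mfderiv 𝓘(ℝ, Model n) (𝓡 n) (extChartAt (𝓡 n) x₀).symm y a)
    (mfderiv 𝓘(ℝ, Model n) (𝓡 n) (extChartAt (𝓡 n) x₀).symm y b)

/-- The Levi-Civita covariant derivative `∇_X Y = DY·X + Γ(X,Y)` in the preferred chart at `x`, with
`g(Γ(X,Y),w) = ½ ((D_X g)(Y,w) + (D_Y g)(X,w) - (D_w g)(X,Y))`. -/
def covDeriv (g : Metric n M) (X Y : VF n M) : VF n M := fun x =>
  let p : Model n := extChartAt (𝓡 n) x x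
  let X₀ : Model n := chartVF x X p
  let Y₀ : Model n := chartVF x Y p
  let D : TangentSpace (𝓡 n) x :=
    (mfderiv 𝓘(ℝ, Model n) (𝓡 n) (extChartAt (𝓡 n) x).symm p (fderiv ℝ (chartVF x Y) p X₀) : Model n)
  D + sharpAt g x fun w =>
    let w₀ : Model n := mfderiv (𝓡 n) 𝓘(ℝ, Model n) (extChartAt (𝓡 n) x) x w
    (fderiv ℝ (chartMetric g x Y₀ w₀) p X₀ + fderiv ℝ (chartMetric g x X₀ w₀) p Y₀
      - fderiv ℝ (chartMetric g x X₀ Y₀) p w₀) / 2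

/-- The divergence, `𝓛_X μ = (div X) μ`. -/
def divergence {j : ℕ} {M : Type u} [TopologicalSpace M] [ChartedSpace (Model (j + 1)) M]
    (μ : Form (j + 1) M (j + 1)) (X : VF (j + 1) M) : M → ℝ :=
  density μ fun x => (lieD X μ x).toAlternatingMap

end Riemannian

/-! ### Magnetic forms: dimension `n = k + 2` -/

section Magnetic

variable {k : ℕ} {M : Type u} [TopologicalSpace M] [ChartedSpace (Model (k + 2)) M]

/-- The wedge product `β ∧ P` of a 2-form and an `(n-2)`-form. -/
def wedge (β : Form (k + 2) M 2) (P : Form (k + 2) M k) (x : M) :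
    Model (k + 2) [⋀^Fin (k + 2)]→ₗ[ℝ] ℝ :=
  ((LinearMap.mul' ℝ ℝ).compAlternatingMap
    ((β x).toAlternatingMap.domCoprod (P x).toAlternatingMap)).domDomCongr
      (finSumFinEquiv.trans (finCongr (Nat.add_comm 2 k)))

/-- The Lie derivative of a 1-form density: `𝓛_X (α ⊗ μ) = (lieDensity μ X α) ⊗ μ`. -/
def lieDensity (μ : Form (k + 2) M (k + 2)) (X : VF (k + 2) M) (α : Form (k + 2) M 1) :
    Form (k + 2) M 1 := fun x =>
  lieD X α x + divergence μ X x • α x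

variable [IsManifold (𝓡 (k + 2)) ∞ M]

/-- The Hodge star of a 2-form, `⋆β = ½ ∑ β(b^i, b^j) ι_{b_j} ι_{b_i} μ`, where `(b^i)` is the basis
of `T_x M` dual to `(b_i)` with respect to `g`. -/
def hodge (g : Metric (k + 2) M) (μ : Form (k + 2) M (k + 2)) (β : Form (k + 2) M 2) :
    Form (k + 2) M k := fun x =>
  (1 / 2 : ℝ) • ∑ i, ∑ j,
    (β x ![∑ a, invGram g x i a • stdBasis x a, ∑ b, invGram g x j b • stdBasis x b]) •
      ((μ x).curryLeft (stdBasis x i)).curryLeft (stdBasis x j)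

variable [CompactSpace M] [T2Space M] [MeasurableSpace M]

/-- `⟨α ⊗ μ, X⟩ = ∫_M (ι_X α) μ`. -/
def pair (μ : Form (k + 2) M (k + 2)) (α : Form (k + 2) M 1) (X : VF (k + 2) M) : ℝ :=
  integ μ fun x => α x (fun _ => X x)

/-- `⟨β, [P]⟩ = ∫_M β ∧ P`. -/
def pairForm (μ : Form (k + 2) M (k + 2)) (β : Form (k + 2) M 2) (P : Form (k + 2) M k) : ℝ :=
  integ μ (density μ (wedge β P))

end Magnetic

/-! ### The Lie algebra `𝔠𝔪𝔥 = 𝔛(M) ⋉ (C^∞(M) ⊕ Ω^{n-2}(M)/dΩ^{n-3}(M))` and its dual -/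

/-- An element `(v, θ, [P])` of `𝔠𝔪𝔥`; the class `[P]` is given by a representative. -/
structure CMH (k : ℕ) (M : Type u) [TopologicalSpace M] [ChartedSpace (Model (k + 2)) M] where
  /-- the vector field -/
  v : VF (k + 2) M
  /-- the function -/
  θ : M → ℝ
  /-- a representative of the class of `(n-2)`-forms -/
  P : Form (k + 2) M k

/-- An element `(m, ϱ, β) = (α ⊗ μ, ρ μ, β)` of
`𝔠𝔪𝔥^* = 𝔛^*(M) × (Ω^n(M) ⊕ Ω²_cl(M))`, given by `(α, ρ, β)`. -/
structure CMHDual (k : ℕ) (M : Type u) [TopologicalSpace M] [ChartedSpace (Model (k + 2)) M] where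
  /-- the 1-form `α` of the momentum `m = α ⊗ μ` -/
  α : Form (k + 2) M 1
  /-- the density function -/
  ρ : M → ℝ
  /-- the magnetic 2-form -/
  β : Form (k + 2) M 2

section Reduction

variable {k : ℕ} {M : Type u} [TopologicalSpace M] [ChartedSpace (Model (k + 2)) M]

/-- Smoothness of the components of an element of `𝔠𝔪𝔥`. -/
def CMH.Smooth [IsManifold (𝓡 (k + 2)) ∞ M] (a : CMH k M) : Prop :=
  SmoothVF a.v ∧ SmoothFun (n := k + 2) a.θ ∧ SmoothForm a.P

/-- Membership in `𝔠𝔪𝔥^*`: all components are smooth and `β` is closed. -/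
def CMHDual.Mem (ξ : CMHDual k M) : Prop :=
  SmoothForm ξ.α ∧ SmoothFun (n := k + 2) ξ.ρ ∧ SmoothForm ξ.β ∧ extd ξ.β = 0

/-- Smooth curves in `𝔠𝔪𝔥^*` over `S ⊆ ℝ`. -/
def SmoothCurve (S : Set ℝ) (ξ : ℝ → CMHDual k M) : Prop :=
  SmoothFamForm S (fun t => (ξ t).α) ∧ SmoothFamFun (k + 2) S (fun t => (ξ t).ρ) ∧
    SmoothFamForm S (fun t => (ξ t).β) ∧ ∀ t ∈ S, extd (ξ t).β = 0

/-- Time derivative of a curve of forms at fixed points of `M`. -/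
def dtForm {j : ℕ} (σ : ℝ → Form (k + 2) M j) (t : ℝ) : Form (k + 2) M j := fun x =>
  deriv (fun s => σ s x) t

/-- Time derivative of a curve of functions. -/
def dtFun (f : ℝ → M → ℝ) (t : ℝ) : M → ℝ := fun x => deriv (fun s => f s x) t

/-- Time derivative of a curve of vector fields at fixed points of `M`. -/
def dtVF (X : ℝ → VF (k + 2) M) (t : ℝ) : VF (k + 2) M := fun x => deriv (fun s => X s x) t

/-- The map `Π : (φ, m) ↦ (m, φ_* μ, φ_* β₀)` from `T^*Diff(M) = Diff(M) × 𝔛^*(M)` to `𝔠𝔪𝔥^*`;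
here `m = α ⊗ μ`. -/
def proj (μ : Form (k + 2) M (k + 2)) (β₀ : Form (k + 2) M 2) (φ : Diffeo (k + 2) M)
    (α : Form (k + 2) M 1) : CMHDual k M :=
  ⟨α, rhoOf μ φ, pushforward φ β₀⟩

variable [IsManifold (𝓡 (k + 2)) ∞ M] [CompactSpace M] [T2Space M] [MeasurableSpace M]

/-- The pairing of `𝔠𝔪𝔥^*` and `𝔠𝔪𝔥`. -/
def dualPair (μ : Form (k + 2) M (k + 2)) (ξ : CMHDual k M) (a : CMH k M) : ℝ :=
  pair μ ξ.α a.v + integ μ (fun x => a.θ x * ξ.ρ x) + pairForm μ ξ.β a.P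

/-- `(δF/δm, δF/δϱ, δF/δβ) = a` at `ξ`: along every smooth curve in `𝔠𝔪𝔥^*` through `ξ` the
functional `F` has derivative `⟨ξ̇, a⟩`. -/
def HasVarDeriv (μ : Form (k + 2) M (k + 2)) (F : CMHDual k M → ℝ) (ξ : CMHDual k M)
    (a : CMH k M) : Prop :=
  ∀ (δ : ℝ) (c : ℝ → CMHDual k M), 0 < δ → SmoothCurve (Ioo (-δ) δ) c → c 0 = ξ →
    HasDerivAt (fun ε => F (c ε))
      (dualPair μ ⟨dtForm (fun ε => (c ε).α) 0, dtFun (fun ε => (c ε).ρ) 0,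
        dtForm (fun ε => (c ε).β) 0⟩ a) 0

/-- The Lie-Poisson bracket `{F, G}(ξ)` on `𝔠𝔪𝔥^*`, for variational derivatives `a` of `F` and `b`
of `G` at `ξ`:
`⟨m, 𝓛_{a.v} b.v⟩ + ⟨ϱ, 𝓛_{a.v} b.θ - 𝓛_{b.v} a.θ⟩ + ⟨β, 𝓛_{a.v} [b.P] - 𝓛_{b.v} [a.P]⟩`. -/
def lpBracket (μ : Form (k + 2) M (k + 2)) (ξ : CMHDual k M) (a b : CMH k M) : ℝ :=
  pair μ ξ.α (VectorField.mlieBracket (𝓡 (k + 2)) a.v b.v) +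
    integ μ (fun x => (lieFun a.v b.θ x - lieFun b.v a.θ x) * ξ.ρ x) +
    pairForm μ ξ.β (lieD a.v b.P - lieD b.v a.P)

/-! The cotangent bundle `T^*Diff(M)`, identified with `Diff(M) × 𝔛^*(M)` by right translations:
`⟨(φ, m), φ̇⟩ = ⟨m, φ̇ ∘ φ⁻¹⟩`. -/

/-- `DF(φ, m) = (ν, v)`, with `ν ⊗ μ = (δF/δφ) ∘ φ⁻¹` and `v = δF/δm`: along every smooth curve in
`Diff(M) × 𝔛^*(M)` through `(φ, m)` with `w = φ̇ ∘ φ⁻¹`, the functional has derivative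
`⟨ν ⊗ μ, w⟩ + ⟨ṁ, v⟩`. -/
def HasCotDeriv (μ : Form (k + 2) M (k + 2)) (F : Diffeo (k + 2) M → Form (k + 2) M 1 → ℝ)
    (φ : Diffeo (k + 2) M) (α : Form (k + 2) M 1) (ν : Form (k + 2) M 1) (v : VF (k + 2) M) :
    Prop :=
  ∀ (δ : ℝ) (c : ℝ → Diffeo (k + 2) M) (a : ℝ → Form (k + 2) M 1) (w : VF (k + 2) M), 0 < δ →
    SmoothFamDiffeo (Ioo (-δ) δ) c → SmoothFamForm (Ioo (-δ) δ) a → c 0 = φ → a 0 = α →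
    IsVelocity c 0 w →
    HasDerivAt (fun ε => F (c ε) (a ε)) (pair μ ν w + pair μ (dtForm a 0) v) 0

/-- The canonical Poisson bivector of `T^*Diff(M)` at `(φ, m)`, `m = α ⊗ μ`, on the covectors
`(ν₁, v₁)` and `(ν₂, v₂)`. -/
def canBracket (μ : Form (k + 2) M (k + 2)) (α : Form (k + 2) M 1)
    (ν₁ : Form (k + 2) M 1) (v₁ : VF (k + 2) M) (ν₂ : Form (k + 2) M 1) (v₂ : VF (k + 2) M) : ℝ :=
  pair μ α (VectorField.mlieBracket (𝓡 (k + 2)) v₁ v₂) - pair μ ν₁ v₂ + pair μ ν₂ v₁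

/-- The equations of motion on `T^*Diff(M)` of the Hamiltonian `H`: these are the Euler-Lagrange
equations of the phase space Lagrangian `⟨m, φ̇⟩ - H(φ, m)`, that is, Hamilton's equations for the
canonical symplectic form `-dΘ`, `Θ = ⟨m, dφ⟩`.  For every smooth variation `(Φ, A)(t, ε)` of the
curve, with `V = ∂_t Φ ∘ Φ⁻¹` and `W = ∂_ε Φ ∘ Φ⁻¹`, one has
`∂_ε (⟨A, V⟩ - H(Φ, A)) = ∂_t ⟨A, W⟩` at `ε = 0`. -/
def IsHamiltonianCurve (μ : Form (k + 2) M (k + 2))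
    (H : Diffeo (k + 2) M → Form (k + 2) M 1 → ℝ) (J : Set ℝ)
    (φ : ℝ → Diffeo (k + 2) M) (α : ℝ → Form (k + 2) M 1) : Prop :=
  ∀ (δ : ℝ) (Φ : ℝ → ℝ → Diffeo (k + 2) M) (A : ℝ → ℝ → Form (k + 2) M 1)
    (V W : ℝ → ℝ → VF (k + 2) M), 0 < δ →
    SmoothFamDiffeo (J ×ˢ Ioo (-δ) δ) (fun p : ℝ × ℝ => Φ p.1 p.2) →
    SmoothFamForm (J ×ˢ Ioo (-δ) δ) (fun p : ℝ × ℝ => A p.1 p.2) →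
    (∀ t ∈ J, Φ t 0 = φ t ∧ A t 0 = α t) →
    (∀ t ∈ J, ∀ ε ∈ Ioo (-δ) δ, IsVelocity (fun s => Φ s ε) t (V t ε) ∧
      IsVelocity (fun r => Φ t r) ε (W t ε)) →
    ∀ t ∈ J, ∃ c : ℝ,
      HasDerivAt (fun ε => pair μ (A t ε) (V t ε) - H (Φ t ε) (A t ε)) c 0 ∧
      HasDerivAt (fun s => pair μ (A s 0) (W s 0)) c t

/-- The velocity `v` of a momentum `m = ρ v^♭ ⊗ μ = α ⊗ μ`. -/
def velocity (g : Metric (k + 2) M) (ξ : CMHDual k M) : VF (k + 2) M := fun x =>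
  (ξ.ρ x)⁻¹ • sharp g ξ.α x

/-- The Hamiltonian `H̄(m, ρ, β) = ½ ⟨m, v⟩ + ∫ e(ρ) ρ μ + ½ ∫ β ∧ ⋆β`, `m = ρ v^♭ ⊗ μ`. -/
def hamBar (g : Metric (k + 2) M) (μ : Form (k + 2) M (k + 2)) (e : ℝ → ℝ) (ξ : CMHDual k M) : ℝ :=
  (1 / 2) * pair μ ξ.α (velocity g ξ) + integ μ (fun x => e (ξ.ρ x) * ξ.ρ x) +
    (1 / 2) * pairForm μ ξ.β (hodge g μ ξ.β)

/-- The Hamiltonian `H(φ, m) = ½ ⟨m, v⟩ + ∫ e(ρ) ρ μ + ½ ∫ β ∧ ⋆β` on `T^*Diff(M)`, where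
`ρ = Jac(φ⁻¹)`, `β = φ_* β₀` and `m = ρ v^♭ ⊗ μ`. -/
def ham (g : Metric (k + 2) M) (μ : Form (k + 2) M (k + 2)) (e : ℝ → ℝ) (β₀ : Form (k + 2) M 2)
    (φ : Diffeo (k + 2) M) (α : Form (k + 2) M 1) : ℝ :=
  (1 / 2) * pair μ α (fun x => (rhoOf μ φ x)⁻¹ • sharp g α x) +
    integ μ (fun x => e (rhoOf μ φ x) * rhoOf μ φ x) +
    (1 / 2) * pairForm μ (pushforward φ β₀) (hodge g μ (pushforward φ β₀))

/-- The reduced system on `J`, for a curve `ξ = (m, ρ, β)`, `m = α ⊗ μ`: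
`ṁ + 𝓛_v m + ρ ι_u β ⊗ μ + ρ d(δH/δϱ) ⊗ μ = 0`, `ρ̇ + div(ρ v) = 0`, `β̇ + 𝓛_v β = 0`, where
`ι_u ϱ = d(δH/δβ)` and `m = ρ v^♭ ⊗ μ`. -/
def SolvesReduced (g : Metric (k + 2) M) (μ : Form (k + 2) M (k + 2)) (e : ℝ → ℝ) (J : Set ℝ)
    (ξ : ℝ → CMHDual k M) : Prop :=
  ∀ t ∈ J, ∃ (a : CMH k M) (u : VF (k + 2) M), a.Smooth ∧ SmoothVF u ∧
    HasVarDeriv μ (hamBar g μ e) (ξ t) a ∧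
    (∀ x, (ξ t).ρ x • iota u μ x = extd a.P x) ∧
    (∀ x, (ξ t).α x = (ξ t).ρ x • flat g a.v x) ∧
    (∀ x, dtForm (fun s => (ξ s).α) t x + lieDensity μ a.v (ξ t).α x +
      (ξ t).ρ x • iota u (ξ t).β x + (ξ t).ρ x • dFun a.θ x = 0) ∧
    (∀ x, dtFun (fun s => (ξ s).ρ) t x + divergence μ (fun y => (ξ t).ρ y • a.v y) x = 0) ∧
    (∀ x, dtForm (fun s => (ξ s).β) t x + lieD a.v (ξ t).β x = 0)

end Reduction

/-! ### Compressible ideal magnetohydrodynamics on a 3-manifold -/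

section MHD

variable {M : Type u} [TopologicalSpace M] [ChartedSpace (Model 3) M] [IsManifold (𝓡 3) ∞ M]

/-- The cross product, `g(X × Y, w) = μ(X, Y, w)`. -/
def cross (g : Metric 3 M) (μ : Form 3 M 3) (X Y : VF 3 M) : VF 3 M :=
  sharp g (iota Y (iota X μ))

/-- The curl, `curl X = (⋆ d X^♭)^♯`. -/
def curl (g : Metric 3 M) (μ : Form 3 M 3) (X : VF 3 M) : VF 3 M :=
  sharp g (hodge (k := 1) g μ (extd (flat g X)))

/-- The equations of compressible inviscid magnetohydrodynamics, with pressure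
`P(ρ) = ρ² e'(ρ)`. -/
def SolvesMHD (g : Metric 3 M) (μ : Form 3 M 3) (e : ℝ → ℝ) (J : Set ℝ)
    (v : ℝ → VF 3 M) (ρ : ℝ → M → ℝ) (B : ℝ → VF 3 M) : Prop :=
  ∀ t ∈ J, ∀ x : M,
    dtVF (k := 1) v t x + covDeriv g (v t) (v t) x +
      (ρ t x)⁻¹ • cross g μ (B t) (curl g μ (B t)) x +
      (ρ t x)⁻¹ • grad g (fun y => (ρ t y) ^ 2 * deriv e (ρ t y)) x = 0 ∧
    dtFun ρ t x + divergence μ (fun y => ρ t y • v t y) x = 0 ∧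
    dtVF (k := 1) B t x + curl g μ (cross g μ (B t) (v t)) x = 0

/-- The element `(m, ρ, β)` of `𝔠𝔪𝔥^*` with `m = ρ v^♭ ⊗ μ` and `β = ι_B μ`. -/
def ofMHD (g : Metric 3 M) (μ : Form 3 M 3) (v : VF 3 M) (ρ : M → ℝ) (B : VF 3 M) :
    CMHDual 1 M :=
  ⟨fun x => ρ x • flat g v x, ρ, iota B μ⟩

end MHD

end CompMHD

end

open CompMHD

/-!
Every identity in the theorem is reduced to exterior algebra at a point, to Cartan's formula in a
chart and to Stokes' theorem; the equivalences between weak and pointwise equations come from the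
non-degeneracy of the pairings.

*At a point.* The basic facts about a form `μ` of top degree are `ℓ ∧ ι_x μ = ℓ(x) μ`
(`extMul_curryLeft_top`) and `β ∧ ι_y ι_x μ = β(x, y) μ` (`wedge2_curryLeft_curryLeft`). They are
proved by expanding forms in a basis, as are the independence of the Hodge star from the basis
(`hodgeV_basis`) and the identification of `wedge2` with the exterior product obtained from
Mathlib's `domCoprod` (`domCoprod_eq_wedge2`).

*Integration.* A partition of unity and the vanishing of the integral of a compactly supported
divergence give Stokes' theorem `∫_M dσ = 0` (`integ_extd`). Together with Cartan's formula
(`cartan_formula`, `lieD_one_apply`) it yields the integrations by parts `pair_bracket`,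
`integ_lieFun_mul`, `pairForm_lieD_left` and `pairForm_lieD_right`. Hence the formula for the momentum
map (`momentum_map`), and the description of the Lie-Poisson bracket `{F, G}` at `ξ` as the pairing of a
vector `lpField μ ξ δF` with `δG` (`lpBracket_eq`).

*Diffeomorphisms.* If `w` is the velocity of `c_t`, then `d/dt (c_t)_* σ = -𝓛_w (c_t)_* σ`
(`hasDerivAt_pushforward`). So the functionals pulled back by `Π` are differentiable on the cotangent
bundle (`hasCotDeriv_proj`), and `Π` is Poisson (`canBracket_eq`). For a family with two parameters the
velocities satisfy `∂_ε V - ∂_t W = [V, W]` (`velocity_bracket`), which gives the first variation of the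
action (`first_variation`).

*Weak equations.* The pairings are non-degenerate (`form_eq_zero_of_pair`, `dualPair_inj`), and a variational
derivative is unique except that only `dP` is determined by its last component (`HasVarDeriv.unique`). The
Lie-Poisson equations and the reduced system are therefore both equivalent to the pointwise equation
`ξ' = lpField μ ξ δH̄`, called `EvolvesAt` (`solvesReduced_iff`, `liePoisson_iff`). Every vector field supported
in a chart is the velocity of a variation `y ↦ y + ε X(y)` (`exists_variation`), so Hamilton's equations
localize as well (`isHamiltonianCurve_iff`); along a curve with `φ' = v ∘ φ` the density and the 2-form are
transported automatically, and only the momentum equation remains (`reduction`).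

*Dimension three.* From `⋆ ι_B μ = B^♭` (`hodge_iota`), `𝓛_v v^♭ = (∇_v v)^♭ + ½ d|v|²` (`lieD_flat`) and
`ρ d(e + ρ e') = d(ρ² e')` (`enthalpy_pressure`), the momentum equation becomes the velocity equation times
`ρ`, plus the continuity equation times `v^♭` (`momentum_residual`, `evolvesAt_ofMHD_iff`).
-/

noncomputable section

namespace CompMHD

open scoped Topology
open Filter
open ContinuousAlternatingMap (alternatizeUncurryFin alternatizeUncurryFinCLM alternatizeUncurryFin_apply
  alternatizeUncurryFin_add alternatizeUncurryFinCLM_apply curryLeft_apply_apply ofSubsingletonLIE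
  alternatizeUncurryFin_alternatizeUncurryFinCLM_comp_of_symmetric)

set_option linter.unusedSectionVars false

/-! ### Exterior algebra of a finite-dimensional space -/

section ExteriorAlgebra

variable {E : Type*} [NormedAddCommGroup E] [NormedSpace ℝ E] {k : ℕ}

/-- The exterior product `ℓ ∧ P` of a linear form and an alternating form. -/
def extMul (ℓ : E →L[ℝ] ℝ) (P : E [⋀^Fin k]→L[ℝ] ℝ) : E [⋀^Fin (k + 1)]→L[ℝ] ℝ :=
  alternatizeUncurryFin (ℓ.smulRight P)

theorem extMul_apply (ℓ : E →L[ℝ] ℝ) (P : E [⋀^Fin k]→L[ℝ] ℝ) (v : Fin (k + 1) → E) :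
    extMul ℓ P v = ∑ i : Fin (k + 1), (-1) ^ (i : ℕ) * (ℓ (v i) * P (i.removeNth v)) := by
  simp [extMul, alternatizeUncurryFin_apply]

theorem extMul_add_left (ℓ m : E →L[ℝ] ℝ) (P : E [⋀^Fin k]→L[ℝ] ℝ) :
    extMul (ℓ + m) P = extMul ℓ P + extMul m P := by
  ext v; simp [extMul_apply, ← Finset.sum_add_distrib]; congr; ext; ring

theorem extMul_smul_left (c : ℝ) (ℓ : E →L[ℝ] ℝ) (P : E [⋀^Fin k]→L[ℝ] ℝ) :
    extMul (c • ℓ) P = c • extMul ℓ P := by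
  ext v; simp [extMul_apply, Finset.mul_sum]; congr; ext; ring

theorem extMul_add_right (ℓ : E →L[ℝ] ℝ) (P Q : E [⋀^Fin k]→L[ℝ] ℝ) :
    extMul ℓ (P + Q) = extMul ℓ P + extMul ℓ Q := by
  ext v; simp [extMul_apply, ← Finset.sum_add_distrib]; congr; ext; ring

theorem extMul_smul_right (c : ℝ) (ℓ : E →L[ℝ] ℝ) (P : E [⋀^Fin k]→L[ℝ] ℝ) :
    extMul ℓ (c • P) = c • extMul ℓ P := by
  ext v; simp [extMul_apply, Finset.mul_sum]; congr; ext; ring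

theorem extMul_neg_right (ℓ : E →L[ℝ] ℝ) (P : E [⋀^Fin k]→L[ℝ] ℝ) :
    extMul ℓ (-P) = -extMul ℓ P := by
  ext v; simp [extMul_apply]

theorem extMul_zero_right (ℓ : E →L[ℝ] ℝ) : extMul ℓ (0 : E [⋀^Fin k]→L[ℝ] ℝ) = 0 := by
  ext v; simp [extMul_apply]

theorem extMul_sum_left {ι : Type*} (s : Finset ι) (ℓ : ι → E →L[ℝ] ℝ) (P : E [⋀^Fin k]→L[ℝ] ℝ) :
    extMul (∑ i ∈ s, ℓ i) P = ∑ i ∈ s, extMul (ℓ i) P := by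
  classical
  induction s using Finset.induction_on with
  | empty => ext v; simp [extMul_apply]
  | insert a s ha ih => rw [Finset.sum_insert ha, Finset.sum_insert ha, extMul_add_left, ih]

theorem extMul_sum_right {ι : Type*} (s : Finset ι) (ℓ : E →L[ℝ] ℝ) (P : ι → E [⋀^Fin k]→L[ℝ] ℝ) :
    extMul ℓ (∑ i ∈ s, P i) = ∑ i ∈ s, extMul ℓ (P i) := by
  classical
  induction s using Finset.induction_on with
  | empty => exact extMul_zero_right ℓ
  | insert a s ha ih => rw [Finset.sum_insert ha, Finset.sum_insert ha, extMul_add_right, ih]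

theorem extMul_comm (ℓ m : E →L[ℝ] ℝ) (P : E [⋀^Fin k]→L[ℝ] ℝ) :
    extMul ℓ (extMul m P) = -extMul m (extMul ℓ P) := by
  have h : ∀ ℓ : E →L[ℝ] ℝ, extMul ℓ (extMul ℓ P) = 0 := by
    intro ℓ
    have h1 : alternatizeUncurryFinCLM ℝ E ℝ ∘L (ℓ.smulRight (ℓ.smulRight P)) =
        ℓ.smulRight (extMul ℓ P) := by
      ext x v; simp [extMul]
    have h2 := alternatizeUncurryFin_alternatizeUncurryFinCLM_comp_of_symmetric
      (f := ℓ.smulRight (ℓ.smulRight P)) (fun x y => by ext v; simp; ring)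
    rwa [h1] at h2
  have h1 := h (ℓ + m)
  simp only [extMul_add_left, extMul_add_right, h] at h1
  simpa [eq_neg_iff_add_eq_zero, add_comm] using h1

theorem removeNth_succ_vecCons {α : Type*} (x : α) (v : Fin (k + 1) → α) (i : Fin (k + 1)) :
    Fin.removeNth i.succ (Matrix.vecCons x v : Fin (k + 2) → α)
      = Matrix.vecCons x (Fin.removeNth i v) := by
  ext j
  refine Fin.cases ?_ (fun j => ?_) j <;> simp [Fin.removeNth]

/-- Contraction is an antiderivation, in the form of the contraction of an alternatized map. -/
theorem curryLeft_alternatizeUncurryFin (A : E →L[ℝ] E [⋀^Fin (k + 1)]→L[ℝ] ℝ) (x : E)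
    (B : E →L[ℝ] E [⋀^Fin k]→L[ℝ] ℝ) (hB : ∀ v, B v = (A v).curryLeft x) :
    (alternatizeUncurryFin A).curryLeft x = A x - alternatizeUncurryFin B := by
  ext v
  simp only [curryLeft_apply_apply, alternatizeUncurryFin_apply,
    ContinuousAlternatingMap.sub_apply, hB]
  rw [Fin.sum_univ_succ, sub_eq_add_neg, ← Finset.sum_neg_distrib]
  have h0 : Fin.removeNth 0 (Matrix.vecCons x v : Fin (k + 2) → E) = v := by
    ext j; simp [Fin.removeNth]
  congr 1
  · simp only [h0]; simp
  · refine Finset.sum_congr rfl fun i _ => ?_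
    rw [removeNth_succ_vecCons]; simp [pow_succ]

theorem curryLeft_extMul (ℓ : E →L[ℝ] ℝ) (P : E [⋀^Fin (k + 1)]→L[ℝ] ℝ) (x : E) :
    (extMul ℓ P).curryLeft x = ℓ x • P - extMul ℓ (P.curryLeft x) :=
  curryLeft_alternatizeUncurryFin _ x _ fun v => by ext w; simp

variable [FiniteDimensional ℝ E] {ι : Type*} [Fintype ι]

/-- The coordinate forms of a basis, as continuous linear forms. -/
def coordL (b : Module.Basis ι ℝ E) (i : ι) : E →L[ℝ] ℝ := LinearMap.toContinuousLinearMap (b.coord i)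

@[simp] theorem coordL_apply (b : Module.Basis ι ℝ E) (i : ι) (x : E) :
    coordL b i x = b.repr x i := rfl

theorem sum_coordL_smul (b : Module.Basis ι ℝ E) (x : E) : ∑ i, coordL b i x • b i = x := by
  simpa using b.sum_repr x

theorem clm_eq_sum_coordL (b : Module.Basis ι ℝ E) (ℓ : E →L[ℝ] ℝ) :
    ℓ = ∑ i, ℓ (b i) • coordL b i := by
  ext x
  conv_lhs => rw [← sum_coordL_smul b x]
  simp [map_sum, mul_comm, -Module.Basis.sum_repr]

theorem alternatizeUncurryFin_eq_sum (b : Module.Basis ι ℝ E)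
    (A : E →L[ℝ] E [⋀^Fin k]→L[ℝ] ℝ) :
    alternatizeUncurryFin A = ∑ p, extMul (coordL b p) (A (b p)) := by
  have h : A = ∑ p, (coordL b p).smulRight (A (b p)) := by
    ext x : 1
    conv_lhs => rw [← sum_coordL_smul b x]
    simp [map_sum, sum_apply, -Module.Basis.sum_repr]
  conv_lhs => rw [h, ← alternatizeUncurryFinCLM_apply, map_sum]
  rfl

theorem form_eq_zero_of_finrank_lt (τ : E [⋀^Fin k]→L[ℝ] ℝ) (h : Module.finrank ℝ E < k) :
    τ = 0 := by
  ext v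
  refine τ.toAlternatingMap.map_linearDependent v fun hv => ?_
  have := hv.fintype_card_le_finrank
  simp at this
  omega

/-- `ℓ ∧ ι_x μ = ℓ(x) μ` for `μ` of top degree: contract `ℓ ∧ μ = 0` with `x`. -/
theorem extMul_curryLeft_top (h : Module.finrank ℝ E = k + 1) (μ : E [⋀^Fin (k + 1)]→L[ℝ] ℝ)
    (ℓ : E →L[ℝ] ℝ) (x : E) : extMul ℓ (μ.curryLeft x) = ℓ x • μ := by
  have h1 := curryLeft_extMul ℓ μ x
  rw [form_eq_zero_of_finrank_lt (extMul ℓ μ) (by omega)] at h1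
  have h2 : (0 : E [⋀^Fin (k + 2)]→L[ℝ] ℝ).curryLeft x = 0 := by ext; simp
  rw [h2] at h1
  exact (sub_eq_zero.1 h1.symm).symm

/-- A form of degree one less than the dimension which is annihilated by every `ℓ ∧ ·` vanishes:
a tuple of basis vectors misses some `b i`, so its value can be read off from `coordL b i ∧ σ`. -/
theorem form_eq_zero_of_extMul (b : Module.Basis (Fin (k + 2)) ℝ E)
    (σ : E [⋀^Fin (k + 1)]→L[ℝ] ℝ) (h : ∀ ℓ : E →L[ℝ] ℝ, extMul ℓ σ = 0) : σ = 0 := by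
  have : σ.toAlternatingMap = 0 := by
    refine Module.Basis.ext_alternating b fun f hf => ?_
    obtain ⟨i, hi⟩ : ∃ i, ∀ j, f j ≠ i := by
      by_contra hc
      push Not at hc
      have := Fintype.card_le_of_surjective f hc
      simp at this
    have h1 := curryLeft_extMul (coordL b i) σ (b i)
    rw [h] at h1
    have h2 := congrArg (fun τ : E [⋀^Fin _]→L[ℝ] ℝ => τ fun j => b (f j)) h1
    have h3 : ∀ j, (Finsupp.single (f j) (1 : ℝ)) i = 0 := fun j => by
      simp [hi j]
    simp [extMul_apply, h3] at h2
    simpa using h2.symm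
  ext v
  exact congrArg (fun τ : E [⋀^Fin _]→ₗ[ℝ] ℝ => τ v) this

theorem form_apply_basis_ne_zero (b : Module.Basis (Fin k) ℝ E) (μ : E [⋀^Fin k]→L[ℝ] ℝ)
    (h : μ ≠ 0) : μ b ≠ 0 := by
  intro h0
  apply h
  have : μ.toAlternatingMap = 0 := by
    refine Module.Basis.ext_alternating b fun f hf => ?_
    have hb := (Fintype.bijective_iff_injective_and_card f).2 ⟨hf, rfl⟩
    have := μ.toAlternatingMap.map_perm b (Equiv.ofBijective f hb)
    change μ (fun i => b (f i)) = 0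
    change μ (b ∘ _) = _ at this
    rw [show (fun i => b (f i)) = b ∘ (Equiv.ofBijective f hb) from rfl, this]
    simp [h0]
  ext v
  exact congrArg (fun τ : E [⋀^Fin _]→ₗ[ℝ] ℝ => τ v) this

theorem form_eq_of_apply_basis (b : Module.Basis (Fin k) ℝ E) (μ ν : E [⋀^Fin k]→L[ℝ] ℝ)
    (h : μ b = ν b) : μ = ν := by
  by_contra hne
  exact form_apply_basis_ne_zero b (μ - ν) (sub_ne_zero.2 hne) (by simp [h])

/-- The vector `U` with `ι_U μ = σ`, for a volume form `μ` and a form `σ` of degree `n - 1`. -/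
def vecOf (b : Module.Basis (Fin (k + 2)) ℝ E) (μ : E [⋀^Fin (k + 2)]→L[ℝ] ℝ)
    (σ : E [⋀^Fin (k + 1)]→L[ℝ] ℝ) : E :=
  ∑ i, (extMul (coordL b i) σ b / μ b) • b i

theorem clm_vecOf (b : Module.Basis (Fin (k + 2)) ℝ E) {μ : E [⋀^Fin (k + 2)]→L[ℝ] ℝ}
    (σ : E [⋀^Fin (k + 1)]→L[ℝ] ℝ) (h : μ ≠ 0) (ℓ : E →L[ℝ] ℝ) :
    ℓ (vecOf b μ σ) • μ = extMul ℓ σ := by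
  apply form_eq_of_apply_basis b
  have hb := form_apply_basis_ne_zero b μ h
  conv_rhs => rw [clm_eq_sum_coordL b ℓ, extMul_sum_left]
  simp only [vecOf, map_sum, map_smul, ContinuousAlternatingMap.smul_apply,
    ContinuousAlternatingMap.sum_apply, extMul_smul_left, smul_eq_mul,
    Finset.sum_mul]
  refine Finset.sum_congr rfl fun i _ => ?_
  field_simp

theorem curryLeft_vecOf (b : Module.Basis (Fin (k + 2)) ℝ E) {μ : E [⋀^Fin (k + 2)]→L[ℝ] ℝ}
    (σ : E [⋀^Fin (k + 1)]→L[ℝ] ℝ) (h : μ ≠ 0) : μ.curryLeft (vecOf b μ σ) = σ := by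
  rw [← sub_eq_zero]
  refine form_eq_zero_of_extMul b _ fun ℓ => ?_
  rw [sub_eq_add_neg, extMul_add_right, extMul_neg_right,
    extMul_curryLeft_top (by simp [Module.finrank_eq_card_basis b]), clm_vecOf b σ h,
    add_neg_cancel]

theorem curryLeft_top_injective (h : Module.finrank ℝ E = k + 1) {μ : E [⋀^Fin (k + 1)]→L[ℝ] ℝ}
    (hμ : μ ≠ 0) {x y : E} (hxy : μ.curryLeft x = μ.curryLeft y) : x = y := by
  refine (SeparatingDual.eq_iff_forall_dual_eq (R := ℝ)).2 fun ℓ => ?_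
  have := extMul_curryLeft_top h μ ℓ x
  rw [hxy, extMul_curryLeft_top h μ ℓ y] at this
  exact (smul_left_injective ℝ hμ this).symm

/-- The linear form underlying an alternating form of degree one. -/
def lin1 : (E [⋀^Fin 1]→L[ℝ] ℝ) →L[ℝ] (E →L[ℝ] ℝ) :=
  ((ofSubsingletonLIE (𝕜 := ℝ) (E := E) (F := ℝ) (0 : Fin 1)).symm.toContinuousLinearEquiv : _ →L[ℝ] _)

omit [FiniteDimensional ℝ E] in
theorem lin1_apply (γ : E [⋀^Fin 1]→L[ℝ] ℝ) (x : E) : lin1 γ x = γ (fun _ => x) := rfl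

/-- The exterior product of a `2`-form and a `k`-form, `β ∧ P = ½ Alt (β(·,·) P)`. -/
def wedge2 (β : E [⋀^Fin 2]→L[ℝ] ℝ) (P : E [⋀^Fin k]→L[ℝ] ℝ) : E [⋀^Fin (k + 2)]→L[ℝ] ℝ :=
  (1 / 2 : ℝ) • alternatizeUncurryFin (alternatizeUncurryFinCLM ℝ E ℝ ∘L
    ((ContinuousLinearMap.smulRightL ℝ E (E [⋀^Fin k]→L[ℝ] ℝ)).flip P) ∘L lin1 ∘L β.curryLeft)

theorem wedge2_eq_sum (b : Module.Basis ι ℝ E) (β : E [⋀^Fin 2]→L[ℝ] ℝ)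
    (P : E [⋀^Fin k]→L[ℝ] ℝ) : wedge2 β P =
      (1 / 2 : ℝ) • ∑ p, extMul (coordL b p) (extMul (lin1 (β.curryLeft (b p))) P) := by
  rw [wedge2, alternatizeUncurryFin_eq_sum b]
  rfl

theorem wedge2_eq_sum_sum (b : Module.Basis ι ℝ E) (β : E [⋀^Fin 2]→L[ℝ] ℝ)
    (P : E [⋀^Fin k]→L[ℝ] ℝ) : wedge2 β P =
      (1 / 2 : ℝ) • ∑ p, ∑ q, β ![b p, b q] • extMul (coordL b p) (extMul (coordL b q) P) := by
  rw [wedge2_eq_sum b]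
  congr 1
  refine Finset.sum_congr rfl fun p _ => ?_
  conv_lhs => rw [clm_eq_sum_coordL b (lin1 (β.curryLeft (b p))), extMul_sum_left,
    extMul_sum_right]
  refine Finset.sum_congr rfl fun q _ => ?_
  rw [extMul_smul_left, extMul_smul_right]
  congr 1
  rw [lin1_apply, curryLeft_apply_apply]
  congr 1
  ext i; fin_cases i <;> rfl

/-- `β ∧ ι_y ι_x μ = β(x, y) μ`. -/
theorem wedge2_curryLeft_curryLeft (b : Module.Basis (Fin (k + 2)) ℝ E) (β : E [⋀^Fin 2]→L[ℝ] ℝ)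
    (μ : E [⋀^Fin (k + 2)]→L[ℝ] ℝ) (x y : E) :
    wedge2 β ((μ.curryLeft x).curryLeft y) = β ![x, y] • μ := by
  have hf : Module.finrank ℝ E = (k + 1) + 1 := by simp [Module.finrank_eq_card_basis b]
  have h1 : ∀ ℓ : E →L[ℝ] ℝ, extMul ℓ ((μ.curryLeft x).curryLeft y)
      = ℓ y • μ.curryLeft x - ℓ x • μ.curryLeft y := by
    intro ℓ
    have := curryLeft_extMul ℓ (μ.curryLeft x) y
    rw [extMul_curryLeft_top hf] at this
    have h5 : (ℓ x • μ).curryLeft y = ℓ x • μ.curryLeft y := by ext; simp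
    rw [h5] at this
    rw [this, sub_sub_cancel]
  rw [wedge2_eq_sum b]
  simp only [h1, sub_eq_add_neg, extMul_add_right, Finset.sum_add_distrib,
    ← neg_smul, extMul_smul_right, extMul_curryLeft_top hf, smul_smul, ← Finset.sum_smul]
  rw [← add_smul, smul_smul]
  congr 1
  have h2 : ∀ x y, ∑ i, lin1 (β.curryLeft (b i)) y * (coordL b i) x = β ![x, y] := by
    intro x y
    have h3 : β ![x, y] = lin1 (β.curryLeft x) y := by
      rw [lin1_apply, curryLeft_apply_apply]; congr 1; ext i; fin_cases i <;> rfl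
    rw [h3]
    conv_rhs => rw [← sum_coordL_smul b x]
    simp [map_sum, sum_apply, mul_comm, -Module.Basis.sum_repr]
  have h4 : β ![y, x] = -β ![x, y] := by
    have := β.toAlternatingMap.map_swap ![x, y] (i := 0) (j := 1) (by decide)
    change β _ = -β _ at this
    rw [← this]; congr 1; ext i; fin_cases i <;> rfl
  simp only [neg_mul, Finset.sum_neg_distrib, h2, h4]
  ring

end ExteriorAlgebra

section Wedge

variable {E : Type*} [NormedAddCommGroup E] [NormedSpace ℝ E] {k : ℕ}

/-- The signed sum `∑ sgn(σ) F(v ∘ σ)` over all permutations. -/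
def altSum {n : ℕ} (F : (Fin n → E) → ℝ) (v : Fin n → E) : ℝ :=
  ∑ σ : Equiv.Perm (Fin n), (Equiv.Perm.sign σ : ℤ) * F (v ∘ σ)

omit [NormedAddCommGroup E] [NormedSpace ℝ E] in
/-- Expansion of a signed sum over permutations along the image of `0`. -/
theorem altSum_succ {n : ℕ} (F : (Fin (n + 1) → E) → ℝ) (v : Fin (n + 1) → E) :
    altSum F v = ∑ i : Fin (n + 1), (-1) ^ (i : ℕ) *
      altSum (fun w => F (Fin.cons (v i) w)) (i.removeNth v) := by
  -- A permutation of `n + 1` letters is the image of `0` together with a permutation of the rest.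
  let f : Fin (n + 1) × Equiv.Perm (Fin n) → Equiv.Perm (Fin (n + 1)) := fun p =>
    (Fin.cycleRange p.1).symm * Equiv.Perm.decomposeFin.symm (0, p.2)
  have hf0 : ∀ p, f p 0 = p.1 := fun p => by simp [f]
  have hfs : ∀ p j, f p (Fin.succ j) = p.1.succAbove (p.2 j) := fun p j => by simp [f]
  have hbij : Function.Bijective f := by
    refine (Fintype.bijective_iff_injective_and_card f).2 ⟨fun p q hpq => ?_, ?_⟩
    · have h1 : p.1 = q.1 := by rw [← hf0 p, ← hf0 q, hpq]
      refine Prod.ext h1 (Equiv.ext fun j => ?_)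
      have h2 := hfs p j
      rw [hpq, hfs q j, h1] at h2
      exact (Fin.succAbove_right_injective h2).symm
    · simp [Fintype.card_perm, Nat.factorial_succ]
  rw [altSum, ← Function.Bijective.sum_comp hbij, Fintype.sum_prod_type]
  refine Finset.sum_congr rfl fun i _ => ?_
  rw [altSum, Finset.mul_sum]
  refine Finset.sum_congr rfl fun τ _ => ?_
  have hs : Equiv.Perm.sign (f (i, τ)) = (-1) ^ (i : ℕ) * Equiv.Perm.sign τ := by
    simp [f, Equiv.Perm.decomposeFin.symm_sign]
  have hv : v ∘ f (i, τ) = Fin.cons (v i) (i.removeNth v ∘ τ) := by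
    ext j
    refine Fin.cases ?_ (fun j => ?_) j
    · simp [hf0]
    · simp [hfs, Fin.removeNth]
  rw [hs, hv]
  push_cast
  ring

theorem altSum_mul_alternating {n : ℕ} (c : ℝ) (P : E [⋀^Fin n]→L[ℝ] ℝ) (v : Fin n → E) :
    altSum (fun w => c * P w) v = n.factorial * (c * P v) := by
  have h : ∀ σ : Equiv.Perm (Fin n), ((Equiv.Perm.sign σ : ℤ) : ℝ) * (c * P (v ∘ σ)) = c * P v := by
    intro σ
    have h1 : P (v ∘ σ) = Equiv.Perm.sign σ • P v := P.toAlternatingMap.map_perm v σ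
    rw [h1]
    rcases Int.units_eq_one_or (Equiv.Perm.sign σ) with h | h <;> rw [h] <;> simp
  simp only [altSum, h, Finset.sum_const, Finset.card_univ, Fintype.card_perm, Fintype.card_fin,
    nsmul_eq_mul]

/-- `β ∧ P` as a full antisymmetrization, in which every term occurs `2 · k!` times. -/
theorem altSum_wedge2 (β : E [⋀^Fin 2]→L[ℝ] ℝ) (P : E [⋀^Fin k]→L[ℝ] ℝ) (v : Fin (k + 2) → E) :
    altSum (fun u => β ![u 0, u 1] * P (fun j => u j.succ.succ)) v =
      2 * k.factorial * wedge2 β P v := by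
  rw [altSum_succ, wedge2]
  simp only [altSum_succ, Fin.cons_zero, Fin.cons_one, Fin.cons_succ, altSum_mul_alternating,
    ContinuousAlternatingMap.smul_apply, alternatizeUncurryFin_apply, smul_eq_mul, ContinuousLinearMap.comp_apply,
    alternatizeUncurryFinCLM_apply]
  simp only [Finset.mul_sum]
  refine Finset.sum_congr rfl fun i _ => ?_
  simp only [zsmul_eq_mul, Finset.mul_sum]
  refine Finset.sum_congr rfl fun j _ => ?_
  have h3 : ∀ x y, β ![x, y] = lin1 (β.curryLeft x) y := by
    intro x y
    rw [lin1_apply, curryLeft_apply_apply]; congr 1; ext i; fin_cases i <;> rfl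
  rw [h3]
  simp
  ring

/-- The exterior product built from `AlternatingMap.domCoprod` agrees with `wedge2`. -/
theorem domCoprod_eq_wedge2 (β : E [⋀^Fin 2]→L[ℝ] ℝ) (P : E [⋀^Fin k]→L[ℝ] ℝ) :
    ((LinearMap.mul' ℝ ℝ).compAlternatingMap
      (β.toAlternatingMap.domCoprod P.toAlternatingMap)).domDomCongr
        (finSumFinEquiv.trans (finCongr (Nat.add_comm 2 k))) = (wedge2 β P).toAlternatingMap := by
  set e : Fin 2 ⊕ Fin k ≃ Fin (k + 2) := finSumFinEquiv.trans (finCongr (Nat.add_comm 2 k))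
  ext v
  -- Both sides are compared after multiplication by `2! · k!`, which turns `domCoprod` into a sum over
  -- all permutations.
  have h := congrArg (fun T => LinearMap.mul' ℝ ℝ (T (v ∘ e)))
    (MultilinearMap.domCoprod_alternization_eq (R' := ℝ) β.toAlternatingMap P.toAlternatingMap)
  simp only [MultilinearMap.alternatization_apply, map_sum] at h
  have h2 : ∑ σ : Equiv.Perm (Fin 2 ⊕ Fin k), LinearMap.mul' ℝ ℝ (Equiv.Perm.sign σ •
      (MultilinearMap.domDomCongr σ (MultilinearMap.domCoprod (β.toAlternatingMap :
        MultilinearMap ℝ (fun _ : Fin 2 => E) ℝ) (P.toAlternatingMap :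
        MultilinearMap ℝ (fun _ : Fin k => E) ℝ))) (v ∘ e)) =
      altSum (fun u => β ![u 0, u 1] * P (fun j => u j.succ.succ)) v := by
    rw [altSum, ← (Equiv.permCongr e).sum_comp]
    refine Finset.sum_congr rfl fun σ _ => ?_
    rw [Equiv.Perm.sign_permCongr]
    have h3 : LinearMap.mul' ℝ ℝ ((MultilinearMap.domDomCongr σ (MultilinearMap.domCoprod
        (β.toAlternatingMap : MultilinearMap ℝ (fun _ : Fin 2 => E) ℝ) (P.toAlternatingMap :
        MultilinearMap ℝ (fun _ : Fin k => E) ℝ))) (v ∘ e)) =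
        β ![(v ∘ (Equiv.permCongr e) σ) 0, (v ∘ (Equiv.permCongr e) σ) 1] *
          P (fun j => (v ∘ (Equiv.permCongr e) σ) j.succ.succ) := by
      simp only [MultilinearMap.domDomCongr_apply, MultilinearMap.domCoprod_apply,
        LinearMap.mul'_apply]
      have e0 : e.symm 0 = Sum.inl 0 := by rw [Equiv.symm_apply_eq]; ext; simp [e]
      have e1 : e.symm 1 = Sum.inl 1 := by rw [Equiv.symm_apply_eq]; ext; simp [e]
      have e2 : ∀ j : Fin k, e.symm j.succ.succ = Sum.inr j := fun j => by
        rw [Equiv.symm_apply_eq]; ext; simp [e]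
      congr 1
      · change β _ = β _
        congr 1; ext i; fin_cases i
        · simp [Equiv.permCongr_apply, e0]
        · simp [Equiv.permCongr_apply, e1]
      · change P _ = P _
        congr 1; ext j
        simp only [Function.comp_apply, Equiv.permCongr_apply, e2]
    rw [Units.smul_def, map_zsmul, zsmul_eq_mul, h3]
  rw [h2, altSum_wedge2] at h
  have hk : (2 * k.factorial : ℝ) ≠ 0 := by positivity
  have h4 : (2 * (k.factorial : ℝ)) * wedge2 β P v = 2 * k.factorial *
      LinearMap.mul' ℝ ℝ ((β.toAlternatingMap.domCoprod P.toAlternatingMap) (v ∘ e)) := by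
    rw [h, AlternatingMap.smul_apply, map_nsmul, nsmul_eq_mul]
    simp only [Fintype.card_fin]
    push_cast
    norm_num [Nat.factorial]
  exact (mul_left_cancel₀ hk h4).symm

end Wedge

/-! ### Inner products in coordinates -/

/-- Contraction `τ ↦ (x ↦ ι_x τ)` as a continuous linear map. -/
def curryL {E : Type*} [NormedAddCommGroup E] [NormedSpace ℝ E] {k : ℕ} :
    (E [⋀^Fin (k + 1)]→L[ℝ] ℝ) →L[ℝ] E →L[ℝ] (E [⋀^Fin k]→L[ℝ] ℝ) :=
  (ContinuousAlternatingMap.curryLeftLI (𝕜 := ℝ) (E := E) (F := ℝ)).toContinuousLinearMap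

section MetricAlgebra

variable {E : Type*} [NormedAddCommGroup E] [NormedSpace ℝ E] [FiniteDimensional ℝ E] {n k : ℕ}

/-- `G` is an inner product. -/
structure IsInner (G : E →L[ℝ] E →L[ℝ] ℝ) : Prop where
  symm : ∀ x y, G x y = G y x
  pos : ∀ x, x ≠ 0 → 0 < G x x

/-- The Gram matrix of a basis. -/
def gram (b : Module.Basis (Fin n) ℝ E) (G : E →L[ℝ] E →L[ℝ] ℝ) : Matrix (Fin n) (Fin n) ℝ :=
  Matrix.of fun i j => G (b i) (b j)

/-- A vector in the kernel of the Gram matrix would give one orthogonal to the whole space. -/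
theorem gram_det_ne_zero (b : Module.Basis (Fin n) ℝ E) {G : E →L[ℝ] E →L[ℝ] ℝ} (hG : IsInner G) :
    (gram b G).det ≠ 0 := by
  intro h
  obtain ⟨c, hc, hcm⟩ := Matrix.exists_mulVec_eq_zero_iff.2 h
  have h1 : ∀ i, G (b i) (∑ j, c j • b j) = 0 := fun i => by
    have := congrFun hcm i
    simpa [Matrix.mulVec, dotProduct, gram, map_sum, mul_comm] using this
  have h2 : ∑ j, c j • b j ≠ 0 := fun h0 => hc <| funext fun i =>
    Fintype.linearIndependent_iff.1 b.linearIndependent c h0 i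
  refine (hG.pos _ h2).ne' ?_
  conv_lhs => enter [1]; rw [map_sum]
  simp only [sum_apply, map_smul, smul_apply, h1, smul_zero, Finset.sum_const_zero]

/-- The vector `a^♯` in terms of a basis. -/
def sharpV (b : Module.Basis (Fin n) ℝ E) (G : E →L[ℝ] E →L[ℝ] ℝ) (a : E → ℝ) : E :=
  ∑ i, ∑ j, ((gram b G)⁻¹ i j * a (b j)) • b i

theorem gramInv_mul (b : Module.Basis (Fin n) ℝ E) {G : E →L[ℝ] E →L[ℝ] ℝ} (hG : IsInner G)
    (i l : Fin n) : ∑ a, (gram b G)⁻¹ i a * G (b a) (b l) = if i = l then 1 else 0 := by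
  have h := congrFun (congrFun (Matrix.nonsing_inv_mul (gram b G)
    (isUnit_iff_ne_zero.2 (gram_det_ne_zero b hG))) i) l
  rw [Matrix.mul_apply, Matrix.one_apply] at h
  exact h

theorem gramInv_symm (b : Module.Basis (Fin n) ℝ E) {G : E →L[ℝ] E →L[ℝ] ℝ} (hG : IsInner G)
    (i j : Fin n) : (gram b G)⁻¹ i j = (gram b G)⁻¹ j i := by
  have h : (gram b G).transpose = gram b G := by ext i j; simp [gram, hG.symm]
  conv_lhs => rw [← h, ← Matrix.transpose_nonsing_inv, Matrix.transpose_apply]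

theorem inner_sharpV (b : Module.Basis (Fin n) ℝ E) {G : E →L[ℝ] E →L[ℝ] ℝ} (hG : IsInner G)
    (a : E →L[ℝ] ℝ) (w : E) : G (sharpV b G a) w = a w := by
  have h : G (sharpV b G a) = a := by
    apply ContinuousLinearMap.coe_injective
    refine b.ext fun l => ?_
    simp only [sharpV, map_sum, map_smul, ContinuousLinearMap.coe_coe, sum_apply,
      smul_apply, smul_eq_mul]
    rw [Finset.sum_comm]
    have h1 : ∀ j, ∑ i, (gram b G)⁻¹ i j * a (b j) * G (b i) (b l) =
        a (b j) * if j = l then 1 else 0 := fun j => by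
      rw [← gramInv_mul b hG j l, Finset.mul_sum]
      refine Finset.sum_congr rfl fun i _ => ?_
      rw [gramInv_symm b hG i j]; ring
    simp [h1]
  rw [h]

theorem eq_of_inner_eq {G : E →L[ℝ] E →L[ℝ] ℝ} (hG : IsInner G) {x y : E}
    (h : ∀ w, G x w = G y w) : x = y := by
  by_contra hne
  have h1 := hG.pos (x - y) (sub_ne_zero.2 hne)
  simp [h] at h1

/-- The basis dual to `b` with respect to `G`. -/
def dualVec (b : Module.Basis (Fin n) ℝ E) (G : E →L[ℝ] E →L[ℝ] ℝ) (i : Fin n) : E :=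
  ∑ a, (gram b G)⁻¹ i a • b a

theorem inner_dualVec (b : Module.Basis (Fin n) ℝ E) {G : E →L[ℝ] E →L[ℝ] ℝ} (hG : IsInner G)
    (i : Fin n) (w : E) : G (dualVec b G i) w = coordL b i w := by
  have h : G (dualVec b G i) = coordL b i := by
    apply ContinuousLinearMap.coe_injective
    refine b.ext fun l => ?_
    simp only [dualVec, map_sum, map_smul, ContinuousLinearMap.coe_coe, sum_apply,
      smul_apply, smul_eq_mul, gramInv_mul b hG, coordL_apply, Module.Basis.repr_self,
      Finsupp.single_apply]
    simp [eq_comm]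
  rw [h]

/-- The Hodge star of a `2`-form in terms of a basis. -/
def hodgeV (b : Module.Basis (Fin (k + 2)) ℝ E) (G : E →L[ℝ] E →L[ℝ] ℝ)
    (μ : E [⋀^Fin (k + 2)]→L[ℝ] ℝ) (β : E [⋀^Fin 2]→L[ℝ] ℝ) : E [⋀^Fin k]→L[ℝ] ℝ :=
  (1 / 2 : ℝ) • ∑ i, ∑ j, β ![dualVec b G i, dualVec b G j] •
    (μ.curryLeft (b i)).curryLeft (b j)

omit [FiniteDimensional ℝ E] in
theorem form2_eq (β : E [⋀^Fin 2]→L[ℝ] ℝ) (x y : E) : β ![x, y] = lin1 (β.curryLeft x) y := by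
  rw [lin1_apply, curryLeft_apply_apply]; congr 1; ext i; fin_cases i <;> rfl

omit [FiniteDimensional ℝ E] in
theorem form2_swap (β : E [⋀^Fin 2]→L[ℝ] ℝ) (x y : E) : β ![y, x] = -β ![x, y] := by
  have := β.toAlternatingMap.map_swap ![x, y] (i := 0) (j := 1) (by decide)
  change β _ = -β _ at this
  rw [← this]; congr 1; ext i; fin_cases i <;> rfl

/-- The Hodge star does not depend on the basis used to compute it. -/
theorem hodgeV_basis (b c : Module.Basis (Fin (k + 2)) ℝ E) {G : E →L[ℝ] E →L[ℝ] ℝ}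
    (hG : IsInner G) (μ : E [⋀^Fin (k + 2)]→L[ℝ] ℝ) (β : E [⋀^Fin 2]→L[ℝ] ℝ) :
    hodgeV b G μ β = hodgeV c G μ β := by
  -- The dual basis is transformed by the same coefficients as the vectors, only transposed.
  have h1 : ∀ l, dualVec c G l = ∑ i, coordL c l (b i) • dualVec b G i := by
    intro l
    refine eq_of_inner_eq hG fun w => ?_
    conv_rhs => enter [1]; rw [map_sum]
    simp only [map_smul, sum_apply, smul_apply, inner_dualVec _ hG]
    conv_lhs => rw [← sum_coordL_smul b w]
    simp [map_sum, mul_comm, -Module.Basis.sum_repr]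
  have h2 : ∀ l m, β ![dualVec c G l, dualVec c G m] =
      ∑ i, ∑ j, coordL c l (b i) * coordL c m (b j) * β ![dualVec b G i, dualVec b G j] := by
    intro l m
    simp only [form2_eq, h1 l, h1 m, map_sum, map_smul, sum_apply, smul_apply, smul_eq_mul,
      Finset.mul_sum]
    rw [Finset.sum_comm]
    refine Finset.sum_congr rfl fun i _ => Finset.sum_congr rfl fun j _ => ?_
    ring
  have h3 : ∀ i j, (μ.curryLeft (b i)).curryLeft (b j) =
      ∑ l, ∑ m, (coordL c l (b i) * coordL c m (b j)) • (μ.curryLeft (c l)).curryLeft (c m) := by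
    intro i j
    change curryL (curryL μ (b i)) (b j) = ∑ l, ∑ m,
      (coordL c l (b i) * coordL c m (b j)) • curryL (curryL μ (c l)) (c m)
    conv_lhs => rw [← sum_coordL_smul c (b i), ← sum_coordL_smul c (b j)]
    simp only [map_sum, map_smul, sum_apply, smul_apply]
    rw [Finset.sum_comm]
    simp only [Finset.smul_sum, smul_smul, mul_comm]
  unfold hodgeV
  congr 1
  simp only [h2, h3, Finset.sum_smul, Finset.smul_sum, smul_smul]
  have e1 : ∀ (f : Fin (k + 2) → Fin (k + 2) → Fin (k + 2) → Fin (k + 2) → E [⋀^Fin k]→L[ℝ] ℝ),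
      ∑ i, ∑ j, ∑ l, ∑ m, f i j l m = ∑ l, ∑ m, ∑ i, ∑ j, f i j l m := by
    intro f
    calc _ = ∑ i, ∑ l, ∑ j, ∑ m, f i j l m :=
          Finset.sum_congr rfl fun i _ => Finset.sum_comm
      _ = ∑ i, ∑ l, ∑ m, ∑ j, f i j l m :=
          Finset.sum_congr rfl fun i _ => Finset.sum_congr rfl fun l _ => Finset.sum_comm
      _ = ∑ l, ∑ i, ∑ m, ∑ j, f i j l m := Finset.sum_comm
      _ = _ := Finset.sum_congr rfl fun l _ => Finset.sum_comm
  rw [e1]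
  refine Finset.sum_congr rfl fun l _ => Finset.sum_congr rfl fun m _ =>
    Finset.sum_congr rfl fun i _ => Finset.sum_congr rfl fun j _ => ?_
  congr 1
  ring

/-- The inner product of `2`-forms, `⟨γ, β⟩ = ½ γ_{ij} β^{ij}`. -/
def formInner (b : Module.Basis (Fin n) ℝ E) (G : E →L[ℝ] E →L[ℝ] ℝ)
    (γ β : E [⋀^Fin 2]→L[ℝ] ℝ) : ℝ :=
  (1 / 2 : ℝ) * ∑ i, ∑ j, β ![dualVec b G i, dualVec b G j] * γ ![b i, b j]

theorem wedge2_add_right (β : E [⋀^Fin 2]→L[ℝ] ℝ) (P Q : E [⋀^Fin k]→L[ℝ] ℝ) :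
    wedge2 β (P + Q) = wedge2 β P + wedge2 β Q := by
  simp only [wedge2_eq_sum (Module.finBasis ℝ E), extMul_add_right, Finset.sum_add_distrib,
    smul_add]

theorem wedge2_smul_right (c : ℝ) (β : E [⋀^Fin 2]→L[ℝ] ℝ) (P : E [⋀^Fin k]→L[ℝ] ℝ) :
    wedge2 β (c • P) = c • wedge2 β P := by
  simp only [wedge2_eq_sum (Module.finBasis ℝ E), extMul_smul_right, ← Finset.smul_sum,
    smul_comm c]

theorem wedge2_sum_right {ι : Type*} (s : Finset ι) (β : E [⋀^Fin 2]→L[ℝ] ℝ)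
    (P : ι → E [⋀^Fin k]→L[ℝ] ℝ) : wedge2 β (∑ i ∈ s, P i) = ∑ i ∈ s, wedge2 β (P i) := by
  classical
  induction s using Finset.induction_on with
  | empty => simpa using wedge2_smul_right 0 β (0 : E [⋀^Fin k]→L[ℝ] ℝ)
  | insert a s ha ih => rw [Finset.sum_insert ha, Finset.sum_insert ha, wedge2_add_right, ih]

/-- `γ ∧ ⋆β = ⟨γ, β⟩ μ`. -/
theorem wedge2_hodgeV (b : Module.Basis (Fin (k + 2)) ℝ E) (G : E →L[ℝ] E →L[ℝ] ℝ)
    (μ : E [⋀^Fin (k + 2)]→L[ℝ] ℝ) (γ β : E [⋀^Fin 2]→L[ℝ] ℝ) :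
    wedge2 γ (hodgeV b G μ β) = formInner b G γ β • μ := by
  simp only [hodgeV, wedge2_smul_right, wedge2_sum_right, wedge2_curryLeft_curryLeft b,
    formInner, smul_smul, ← Finset.sum_smul]

/-- Symmetry of the inner product of 2-forms, from the symmetry of the inverse Gram matrix. -/
theorem formInner_comm (b : Module.Basis (Fin n) ℝ E) {G : E →L[ℝ] E →L[ℝ] ℝ} (hG : IsInner G)
    (γ β : E [⋀^Fin 2]→L[ℝ] ℝ) : formInner b G γ β = formInner b G β γ := by
  have h : ∀ β γ : E [⋀^Fin 2]→L[ℝ] ℝ, ∀ i j,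
      β ![dualVec b G i, dualVec b G j] * γ ![b i, b j] = ∑ a, ∑ c,
        (gram b G)⁻¹ i a * (gram b G)⁻¹ j c * (β ![b a, b c] * γ ![b i, b j]) := by
    intro β γ i j
    simp only [form2_eq, dualVec, map_sum, map_smul, sum_apply, smul_apply, smul_eq_mul,
      Finset.sum_mul, Finset.mul_sum]
    rw [Finset.sum_comm]
    refine Finset.sum_congr rfl fun i _ => Finset.sum_congr rfl fun j _ => ?_
    ring
  simp only [formInner, h]
  congr 1
  have e1 : ∀ (f : Fin n → Fin n → Fin n → Fin n → ℝ),
      ∑ i, ∑ j, ∑ l, ∑ m, f i j l m = ∑ l, ∑ m, ∑ i, ∑ j, f i j l m := by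
    intro f
    calc _ = ∑ i, ∑ l, ∑ j, ∑ m, f i j l m :=
          Finset.sum_congr rfl fun i _ => Finset.sum_comm
      _ = ∑ i, ∑ l, ∑ m, ∑ j, f i j l m :=
          Finset.sum_congr rfl fun i _ => Finset.sum_congr rfl fun l _ => Finset.sum_comm
      _ = ∑ l, ∑ i, ∑ m, ∑ j, f i j l m := Finset.sum_comm
      _ = _ := Finset.sum_congr rfl fun l _ => Finset.sum_comm
  rw [e1]
  refine Finset.sum_congr rfl fun l _ => Finset.sum_congr rfl fun m _ =>
    Finset.sum_congr rfl fun i _ => Finset.sum_congr rfl fun j _ => ?_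
  rw [gramInv_symm b hG i l, gramInv_symm b hG j m]
  ring

end MetricAlgebra

/-! ### Exterior calculus on a vector space -/

section EuclideanCalculus

variable {E : Type*} [NormedAddCommGroup E] [NormedSpace ℝ E] {k : ℕ}

/-- `extMul` as a continuous bilinear map. -/
def extMulL (E : Type*) [NormedAddCommGroup E] [NormedSpace ℝ E] (k : ℕ) :
    (E →L[ℝ] ℝ) →L[ℝ] (E [⋀^Fin k]→L[ℝ] ℝ) →L[ℝ] (E [⋀^Fin (k + 1)]→L[ℝ] ℝ) :=
  (ContinuousLinearMap.compL ℝ (E [⋀^Fin k]→L[ℝ] ℝ) (E →L[ℝ] E [⋀^Fin k]→L[ℝ] ℝ)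
    (E [⋀^Fin (k + 1)]→L[ℝ] ℝ) (alternatizeUncurryFinCLM ℝ E ℝ)) ∘L
      ContinuousLinearMap.smulRightL ℝ E (E [⋀^Fin k]→L[ℝ] ℝ)

theorem hasFDerivAt_curryL {F : Type*} [NormedAddCommGroup F] [NormedSpace ℝ F]
    {τ : F → E [⋀^Fin (k + 1)]→L[ℝ] ℝ} {τ' : F →L[ℝ] E [⋀^Fin (k + 1)]→L[ℝ] ℝ} {y : F}
    (hτ : HasFDerivAt τ τ' y) :
    HasFDerivAt (fun z => curryL (τ z)) (curryL (E := E) (k := k) ∘L τ') y := by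
  have hc : HasFDerivAt (𝕜 := ℝ) (E := E [⋀^Fin (k + 1)]→L[ℝ] ℝ)
      (F := E →L[ℝ] E [⋀^Fin k]→L[ℝ] ℝ) curryL curryL (τ y) :=
    ContinuousLinearMap.hasFDerivAt (𝕜 := ℝ) (E := E [⋀^Fin (k + 1)]→L[ℝ] ℝ)
      (F := E →L[ℝ] E [⋀^Fin k]→L[ℝ] ℝ) curryL
  exact HasFDerivAt.comp (F := E [⋀^Fin (k + 1)]→L[ℝ] ℝ) (G := E →L[ℝ] E [⋀^Fin k]→L[ℝ] ℝ) y hc hτ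

theorem fderiv_curryLeft {τ : E → E [⋀^Fin (k + 1)]→L[ℝ] ℝ} {X : E → E} {y : E}
    (hτ : DifferentiableAt ℝ τ y) (hX : DifferentiableAt ℝ X y) (v : E) :
    fderiv ℝ (fun z => (τ z).curryLeft (X z)) y v =
      (fderiv ℝ τ y v).curryLeft (X y) + (τ y).curryLeft (fderiv ℝ X y v) := by
  have h1 := hasFDerivAt_curryL hτ.hasFDerivAt
  have h2 := (h1.clm_apply hX.hasFDerivAt).fderiv
  have h3 := congrArg (fun L => L v) h2
  refine h3.trans ?_
  simp only [add_apply, ContinuousLinearMap.comp_apply, ContinuousLinearMap.flip_apply]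
  exact add_comm _ _

/-- Cartan's formula on a vector space: the right-hand side is the derivative of the pullback of
`τ` by the flow of `X`. -/
theorem cartan_formula {τ : E → E [⋀^Fin (k + 1)]→L[ℝ] ℝ} {X : E → E} {y : E}
    (hτ : DifferentiableAt ℝ τ y) (hX : DifferentiableAt ℝ X y) :
    (extDeriv τ y).curryLeft (X y) + extDeriv (fun z => (τ z).curryLeft (X z)) y =
      fderiv ℝ τ y (X y) +
        (τ y).fderivCompContinuousLinearMap (ContinuousLinearMap.id ℝ E) (fderiv ℝ X y) := by
  -- The derivative of `τ` contracted with `X` in its form argument; these terms occur on the left with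
  -- both signs.
  set B : E →L[ℝ] E [⋀^Fin k]→L[ℝ] ℝ :=
    (curryL ∘L fderiv ℝ τ y).flip (X y) with hB
  have h1 : fderiv ℝ (fun z => (τ z).curryLeft (X z)) y = B + (τ y).curryLeft ∘L fderiv ℝ X y := by
    ext1 v
    rw [fderiv_curryLeft hτ hX]; rfl
  rw [extDeriv, extDeriv, h1, alternatizeUncurryFin_add,
    curryLeft_alternatizeUncurryFin _ _ B (fun v => rfl),
    ContinuousAlternatingMap.fderivCompContinuousLinearMap_eq_alternatizeUncurryFin]
  have h2 : alternatizeUncurryFin ((τ y).curryLeft ∘L fderiv ℝ X y) =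
      (alternatizeUncurryFinCLM ℝ E ℝ ∘L ((ContinuousAlternatingMap.compContinuousLinearMapCLM
        (ContinuousLinearMap.id ℝ E) ∘L (τ y).curryLeft).postcomp E)) (fderiv ℝ X y) := by
    simp only [ContinuousLinearMap.comp_apply, alternatizeUncurryFinCLM_apply]
    congr 1
  rw [← h2]
  abel

theorem extDeriv_one_apply (γ : E → E [⋀^Fin 1]→L[ℝ] ℝ) (y u v : E) :
    extDeriv γ y ![u, v] = lin1 (fderiv ℝ γ y u) v - lin1 (fderiv ℝ γ y v) u := by
  rw [extDeriv, alternatizeUncurryFin_apply, lin1_apply, lin1_apply]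
  have h1 : (![v] : Fin 1 → E) = fun _ => v := by ext1 i; fin_cases i; rfl
  have h2 : Fin.removeNth 1 (Matrix.vecCons u fun _ : Fin 1 => v) = fun _ => u := by
    ext1 i; fin_cases i; rfl
  simp [Fin.sum_univ_succ, sub_eq_add_neg, h1, h2]
  
theorem extDeriv_two_apply (β : E → E [⋀^Fin 2]→L[ℝ] ℝ) (y u v w : E) :
    extDeriv β y ![u, v, w] =
      fderiv ℝ β y u ![v, w] - fderiv ℝ β y v ![u, w] + fderiv ℝ β y w ![u, v] := by
  rw [extDeriv, alternatizeUncurryFin_apply]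
  simp [Fin.sum_univ_succ, sub_eq_add_neg, add_assoc]
  congr 3 <;> (ext i; fin_cases i <;> rfl)

theorem fderiv_extMul {ℓ : E → E →L[ℝ] ℝ} {P : E → E [⋀^Fin k]→L[ℝ] ℝ} {y : E}
    (hℓ : DifferentiableAt ℝ ℓ y) (hP : DifferentiableAt ℝ P y) (v : E) :
    fderiv ℝ (fun z => extMul (ℓ z) (P z)) y v =
      extMul (ℓ y) (fderiv ℝ P y v) + extMul (fderiv ℝ ℓ y v) (P y) := by
  have h := ((extMulL E k).hasFDerivAt_of_bilinear hℓ.hasFDerivAt hP.hasFDerivAt).fderiv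
  exact congrArg (fun L => L v) h

variable [FiniteDimensional ℝ E]

theorem extDeriv_eq_sum {ι : Type*} [Fintype ι] (b : Module.Basis ι ℝ E)
    (τ : E → E [⋀^Fin k]→L[ℝ] ℝ) (y : E) :
    extDeriv τ y = ∑ p, extMul (coordL b p) (fderiv ℝ τ y (b p)) :=
  alternatizeUncurryFin_eq_sum b _

/-- `d(γ ∧ P) = dγ ∧ P - γ ∧ dP` for a `1`-form `γ`. -/
theorem extDeriv_extMul {γ : E → E [⋀^Fin 1]→L[ℝ] ℝ} {P : E → E [⋀^Fin k]→L[ℝ] ℝ} {y : E}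
    (hγ : DifferentiableAt ℝ γ y) (hP : DifferentiableAt ℝ P y) :
    extDeriv (fun z => extMul (lin1 (γ z)) (P z)) y =
      wedge2 (extDeriv γ y) (P y) - extMul (lin1 (γ y)) (extDeriv P y) := by
  set b := Module.finBasis ℝ E
  have hl : DifferentiableAt ℝ (fun z => lin1 (γ z)) y := lin1.differentiableAt.comp y hγ
  have hl' : ∀ v, fderiv ℝ (fun z => lin1 (γ z)) y v = lin1 (fderiv ℝ γ y v) := fun v =>
    congrArg (fun L => L v) (lin1.hasFDerivAt.comp y hγ.hasFDerivAt).fderiv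
  have h1 : ∀ p, lin1 (fderiv ℝ γ y (b p)) =
      ∑ q, lin1 (fderiv ℝ γ y (b p)) (b q) • coordL b q := fun p => clm_eq_sum_coordL b _
  have h2 : ∑ p, extMul (coordL b p) (extMul (lin1 (fderiv ℝ γ y (b p))) (P y)) =
      ∑ p, ∑ q, lin1 (fderiv ℝ γ y (b p)) (b q) •
        extMul (coordL b p) (extMul (coordL b q) (P y)) := by
    refine Finset.sum_congr rfl fun p _ => ?_
    conv_lhs => rw [h1 p, extMul_sum_left, extMul_sum_right]
    simp only [extMul_smul_left, extMul_smul_right]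
  -- The derivative terms of `γ` occur transposed in `dγ`; exchanging the two covectors gives a sign.
  have h3 : ∑ p, ∑ q, lin1 (fderiv ℝ γ y (b q)) (b p) •
        extMul (coordL b p) (extMul (coordL b q) (P y)) =
      -∑ p, ∑ q, lin1 (fderiv ℝ γ y (b p)) (b q) •
        extMul (coordL b p) (extMul (coordL b q) (P y)) := by
    rw [Finset.sum_comm, ← Finset.sum_neg_distrib]
    refine Finset.sum_congr rfl fun p _ => ?_
    rw [← Finset.sum_neg_distrib]
    refine Finset.sum_congr rfl fun q _ => ?_
    rw [extMul_comm, smul_neg]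
  have hA : ∑ p, extMul (coordL b p) (extMul (lin1 (fderiv ℝ γ y (b p))) (P y)) =
      wedge2 (extDeriv γ y) (P y) := by
    rw [wedge2_eq_sum_sum b]
    have h4 : ∑ p, ∑ q, extDeriv γ y ![b p, b q] • extMul (coordL b p) (extMul (coordL b q) (P y)) =
        ∑ p, ∑ q, lin1 (fderiv ℝ γ y (b p)) (b q) •
          extMul (coordL b p) (extMul (coordL b q) (P y)) -
        ∑ p, ∑ q, lin1 (fderiv ℝ γ y (b q)) (b p) •
          extMul (coordL b p) (extMul (coordL b q) (P y)) := by
      rw [← Finset.sum_sub_distrib]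
      refine Finset.sum_congr rfl fun p _ => ?_
      rw [← Finset.sum_sub_distrib]
      refine Finset.sum_congr rfl fun q _ => ?_
      rw [extDeriv_one_apply]
      exact sub_smul (lin1 (fderiv ℝ γ y (b p)) (b q)) (lin1 (fderiv ℝ γ y (b q)) (b p))
        (extMul (coordL b p) (extMul (coordL b q) (P y)))
    rw [h4, h3, h2, sub_neg_eq_add, smul_add, ← add_smul]
    norm_num
  have hB : ∑ p, extMul (coordL b p) (extMul (lin1 (γ y)) (fderiv ℝ P y (b p))) =
      -extMul (lin1 (γ y)) (extDeriv P y) := by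
    have hR : extDeriv P y = _ := extDeriv_eq_sum b P y
    rw [hR, extMul_sum_right, ← Finset.sum_neg_distrib]
    exact Finset.sum_congr rfl fun p _ => extMul_comm _ _ _
  have hL : extDeriv (fun z => extMul (lin1 (γ z)) (P z)) y = _ := extDeriv_eq_sum b _ y
  rw [hL]
  simp only [fderiv_extMul hl hP, hl', extMul_add_right, Finset.sum_add_distrib]
  rw [hA, hB, neg_add_eq_sub]

/-- `wedge2` as a continuous bilinear map. -/
def wedge2L (E : Type*) [NormedAddCommGroup E] [NormedSpace ℝ E] [FiniteDimensional ℝ E] (k : ℕ) :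
    (E [⋀^Fin 2]→L[ℝ] ℝ) →L[ℝ] (E [⋀^Fin k]→L[ℝ] ℝ) →L[ℝ] (E [⋀^Fin (k + 2)]→L[ℝ] ℝ) :=
  (1 / 2 : ℝ) • ∑ p, ((ContinuousLinearMap.compL ℝ (E [⋀^Fin k]→L[ℝ] ℝ)
    (E [⋀^Fin (k + 1)]→L[ℝ] ℝ) (E [⋀^Fin (k + 2)]→L[ℝ] ℝ)
    (extMulL E (k + 1) (coordL (Module.finBasis ℝ E) p))) ∘L extMulL E k ∘L lin1 ∘L
      curryL.flip (Module.finBasis ℝ E p))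

theorem wedge2L_apply (β : E [⋀^Fin 2]→L[ℝ] ℝ) (P : E [⋀^Fin k]→L[ℝ] ℝ) :
    wedge2L E k β P = wedge2 β P := by
  rw [wedge2_eq_sum (Module.finBasis ℝ E), wedge2L]
  simp only [smul_apply, sum_apply]
  rfl

/-- `d(β ∧ Q) = β ∧ dQ` for a closed `2`-form `β`. -/
theorem extDeriv_wedge2 {β : E → E [⋀^Fin 2]→L[ℝ] ℝ} {Q : E → E [⋀^Fin k]→L[ℝ] ℝ} {y : E}
    (hβ : DifferentiableAt ℝ β y) (hQ : DifferentiableAt ℝ Q y) (hd : extDeriv β y = 0) :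
    extDeriv (fun z => wedge2 (β z) (Q z)) y = wedge2 (β y) (extDeriv Q y) := by
  set b := Module.finBasis ℝ E
  have hd' : ∀ v, fderiv ℝ (fun z => wedge2 (β z) (Q z)) y v =
      wedge2 (β y) (fderiv ℝ Q y v) + wedge2 (fderiv ℝ β y v) (Q y) := by
    intro v
    have h := ((wedge2L E k).hasFDerivAt_of_bilinear hβ.hasFDerivAt hQ.hasFDerivAt).fderiv
    simp only [← wedge2L_apply]
    exact congrArg (fun L => L v) h
  rw [extDeriv_eq_sum b]
  simp only [hd', extMul_add_right, Finset.sum_add_distrib]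
  have h1 : ∑ r, extMul (coordL b r) (wedge2 (β y) (fderiv ℝ Q y (b r))) =
      wedge2 (β y) (extDeriv Q y) := by
    rw [extDeriv_eq_sum b Q]
    simp only [wedge2_eq_sum b, extMul_smul_right, extMul_sum_right, ← Finset.smul_sum]
    congr 1
    rw [Finset.sum_comm]
    refine Finset.sum_congr rfl fun p _ => Finset.sum_congr rfl fun r _ => ?_
    rw [extMul_comm (coordL b r) (coordL b p), extMul_comm (coordL b r) (lin1 _),
      extMul_neg_right, neg_neg]
  rw [h1, add_eq_left]
  -- In the remaining sum the triple product `N` is invariant under cyclic permutations of the indices,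
  -- and the cyclic sums of `c` vanish because `dβ = 0`.
  set c : Fin _ → Fin _ → Fin _ → ℝ := fun r p q => fderiv ℝ β y (b r) ![b p, b q]
  set N : Fin _ → Fin _ → Fin _ → E [⋀^Fin (k + 3)]→L[ℝ] ℝ := fun r p q =>
    extMul (coordL b r) (extMul (coordL b p) (extMul (coordL b q) (Q y)))
  have hN : ∀ r p q, N p q r = N r p q := fun r p q => by
    simp only [N]
    rw [extMul_comm (coordL b q) (coordL b r), extMul_neg_right,
      extMul_comm (coordL b p) (coordL b r), neg_neg]
  have hc : ∀ r p q, c r p q + c p q r + c q r p = 0 := fun r p q => by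
    have := extDeriv_two_apply β y (b r) (b p) (b q)
    rw [hd] at this
    change (0 : ℝ) = _ at this
    have h1 := form2_swap (fderiv ℝ β y (b p)) (b r) (b q)
    simp only [c]
    linarith
  have h2 : ∑ r, extMul (coordL b r) (wedge2 (fderiv ℝ β y (b r)) (Q y)) =
      (1 / 2 : ℝ) • ∑ r, ∑ p, ∑ q, c r p q • N r p q := by
    simp only [wedge2_eq_sum_sum b, extMul_smul_right, extMul_sum_right, Finset.smul_sum, c, N]
  have h3 : ∀ c : Fin _ → Fin _ → Fin _ → ℝ, ∑ r, ∑ p, ∑ q, c p q r • N r p q =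
      ∑ r, ∑ p, ∑ q, c r p q • N r p q := by
    intro c
    rw [Finset.sum_comm]
    refine Finset.sum_congr rfl fun p _ => ?_
    rw [Finset.sum_comm]
    refine Finset.sum_congr rfl fun q _ => Finset.sum_congr rfl fun r _ => ?_
    rw [hN r p q]
  have h4 : ∑ r, ∑ p, ∑ q, c q r p • N r p q = ∑ r, ∑ p, ∑ q, c r p q • N r p q :=
    (h3 fun r p q => c p q r).trans (h3 c)
  have h5 : (3 : ℝ) • ∑ r, ∑ p, ∑ q, c r p q • N r p q = 0 := by
    calc _ = ∑ r, ∑ p, ∑ q, c r p q • N r p q + ∑ r, ∑ p, ∑ q, c p q r • N r p q +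
          ∑ r, ∑ p, ∑ q, c q r p • N r p q := by rw [h3 c, h4]; module
      _ = ∑ r, ∑ p, ∑ q, (c r p q + c p q r + c q r p) • N r p q := by
          simp only [add_smul, Finset.sum_add_distrib]
      _ = 0 := by simp [hc]
  rw [h2, (smul_eq_zero.1 h5).resolve_left (by norm_num), smul_zero]

/-- `(𝓛_X α)(W) = X(α(W)) - α([X, W])`. -/
theorem lieDerivative_one_apply {α : E → E [⋀^Fin 1]→L[ℝ] ℝ} {X W : E → E} {y : E}
    (hα : DifferentiableAt ℝ α y) (hX : DifferentiableAt ℝ X y) (hW : DifferentiableAt ℝ W y) :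
    lin1 ((extDeriv α y).curryLeft (X y) + extDeriv (fun z => (α z).curryLeft (X z)) y) (W y) =
      fderiv ℝ (fun z => lin1 (α z) (W z)) y (X y) -
        lin1 (α y) (VectorField.lieBracket ℝ X W y) := by
  rw [cartan_formula hα hX]
  have hl : HasFDerivAt (fun z => lin1 (α z)) (lin1 ∘L fderiv ℝ α y) y :=
    lin1.hasFDerivAt.comp y hα.hasFDerivAt
  rw [(hl.clm_apply hW.hasFDerivAt).fderiv]
  have h4 : ∀ (A : E →L[ℝ] E) (w : E), lin1 ((α y).fderivCompContinuousLinearMap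
      (ContinuousLinearMap.id ℝ E) A) w = lin1 (α y) (A w) := by
    intro A w
    have h5 : ∀ j : Fin 1, Function.update (fun _ : Fin 1 => ContinuousLinearMap.id ℝ E) 0 A j = A :=
      fun j => by rw [Subsingleton.elim j 0]; simp
    simp [lin1_apply, h5]
  simp only [map_add, add_apply, h4, VectorField.lieBracket, map_sub,
    ContinuousLinearMap.flip_apply, ContinuousLinearMap.comp_apply]
  ring

end EuclideanCalculus

/-! ### Smoothness of form-valued maps -/
section SmoothForms
variable {E : Type*} [NormedAddCommGroup E] [NormedSpace ℝ E] [FiniteDimensional ℝ E]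
  {D : Type*} [NormedAddCommGroup D] [NormedSpace ℝ D]

theorem contDiff_curryL (E : Type*) [NormedAddCommGroup E] [NormedSpace ℝ E] (k : ℕ) {m : WithTop ℕ∞} :
    ContDiff ℝ m (fun σ : E [⋀^Fin (k + 1)]→L[ℝ] ℝ => curryL σ) :=
  ContinuousLinearMap.contDiff (𝕜 := ℝ) (E := E [⋀^Fin (k + 1)]→L[ℝ] ℝ)
    (F := E →L[ℝ] (E [⋀^Fin k]→L[ℝ] ℝ)) curryL

/-- Evaluation of a `C^m` form on `C^m` vector fields, by contracting with one
field at a time. -/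
theorem contDiffAt_form_apply {k : ℕ} {m : WithTop ℕ∞} {σ : D → E [⋀^Fin k]→L[ℝ] ℝ} {v : Fin k → D → E} {z : D}
    (hσ : ContDiffAt ℝ m σ z) (hv : ∀ i, ContDiffAt ℝ m (v i) z) :
    ContDiffAt ℝ m (fun z => σ z fun i => v i z) z := by
  induction k with
  | zero =>
    have : (fun z => σ z fun i => v i z) = fun z => (ContinuousAlternatingMap.apply ℝ E ℝ (0 : Fin 0 → E)) (σ z) := by
      funext z
      have : (fun i => v i z) = (0 : Fin 0 → E) := Subsingleton.elim _ _
      rw [this]; rfl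
    rw [this]
    exact (ContinuousAlternatingMap.apply ℝ E ℝ (0 : Fin 0 → E)).contDiff.contDiffAt.comp z hσ
  | succ k ih =>
    have h1 : ContDiffAt ℝ m (fun z => (σ z).curryLeft (v 0 z)) z := by
      have h : ContDiffAt ℝ m (fun z => curryL (σ z)) z :=
        ContDiffAt.comp z (contDiff_curryL E k).contDiffAt hσ
      exact h.clm_apply (hv 0)
    have := ih h1 (v := fun i => v i.succ) (fun i => hv _)
    refine this.congr_of_eventuallyEq (Filter.Eventually.of_forall fun z => ?_)
    simp only [curryLeft_apply_apply]
    congr 1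
    funext i
    refine Fin.cases ?_ (fun i => ?_) i <;> simp

/-- Evaluations on constant vectors detect smoothness: forms on a finite-dimensional space embed
linearly into a finite power of `ℝ`. -/
theorem contDiffAt_form {k : ℕ} {m : WithTop ℕ∞} {σ : D → E [⋀^Fin k]→L[ℝ] ℝ} {z : D}
    (h : ∀ v : Fin k → E, ContDiffAt ℝ m (fun z => σ z v) z) : ContDiffAt ℝ m σ z := by
  let b := Module.finBasis ℝ E
  let T : (E [⋀^Fin k]→L[ℝ] ℝ) →ₗ[ℝ] ((Fin k → Fin (Module.finrank ℝ E)) → ℝ) :=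
    { toFun := fun σ r => σ fun i => b (r i)
      map_add' := fun _ _ => rfl
      map_smul' := fun _ _ => rfl }
  have hT : LinearMap.ker T = ⊥ := by
    rw [LinearMap.ker_eq_bot']
    intro σ hσ
    apply ContinuousAlternatingMap.toAlternatingMap_injective
    refine Module.Basis.ext_alternating b fun r _ => ?_
    exact congrFun hσ r
  obtain ⟨R, hR⟩ := LinearMap.exists_leftInverse_of_injective T hT
  have : σ = fun z => (LinearMap.toContinuousLinearMap R) (T (σ z)) := by
    funext z
    exact (LinearMap.congr_fun hR (σ z)).symm
  rw [this]
  refine (LinearMap.toContinuousLinearMap R).contDiff.contDiffAt.comp z ?_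
  exact contDiffAt_pi.2 fun r => h _

theorem contDiffAt_form_comp {k : ℕ} {m : WithTop ℕ∞} {F : Type*} [NormedAddCommGroup F] [NormedSpace ℝ F]
    [FiniteDimensional ℝ F] {σ : D → E [⋀^Fin k]→L[ℝ] ℝ}
    {L : D → F →L[ℝ] E} {z : D} (hσ : ContDiffAt ℝ m σ z) (hL : ContDiffAt ℝ m L z) :
    ContDiffAt ℝ m (fun z => (σ z).compContinuousLinearMap (L z)) z := by
  refine contDiffAt_form fun v => ?_
  exact contDiffAt_form_apply (v := fun i z => L z (v i)) hσ fun i => hL.clm_apply contDiffAt_const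

theorem contDiffAt_curryLeft {k : ℕ} {m : WithTop ℕ∞} {σ : D → E [⋀^Fin (k + 1)]→L[ℝ] ℝ} {X : D → E} {z : D}
    (hσ : ContDiffAt ℝ m σ z) (hX : ContDiffAt ℝ m X z) :
    ContDiffAt ℝ m (fun z => (σ z).curryLeft (X z)) z := by
  have h : ContDiffAt ℝ m (fun z => curryL (σ z)) z :=
    ContDiffAt.comp z (contDiff_curryL E k).contDiffAt hσ
  exact h.clm_apply hX

end SmoothForms

section Charts
variable {n : ℕ} {M : Type u} [TopologicalSpace M] [ChartedSpace (Model n) M]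

/-- The differential of the preferred chart at `x₀`. -/
def dchart (x₀ x : M) : Model n →L[ℝ] Model n :=
  mfderiv (𝓡 n) 𝓘(ℝ, Model n) (extChartAt (𝓡 n) x₀) x

/-- The differential of the inverse of the preferred chart at `x₀`. -/
def dsymm (x₀ : M) (y : Model n) : Model n →L[ℝ] Model n :=
  mfderiv 𝓘(ℝ, Model n) (𝓡 n) (extChartAt (𝓡 n) x₀).symm y

theorem chartForm_apply {k : ℕ} (x₀ : M) (σ : Form n M k) (y : Model n) :
    chartForm x₀ σ y = (σ ((extChartAt (𝓡 n) x₀).symm y)).compContinuousLinearMap (dsymm x₀ y) := rfl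

theorem chartVF_apply (x₀ : M) (X : VF n M) (y : Model n) :
    chartVF x₀ X y = dchart x₀ ((extChartAt (𝓡 n) x₀).symm y) (X ((extChartAt (𝓡 n) x₀).symm y)) := rfl

theorem isOpen_tgt (x₀ : M) : IsOpen (extChartAt (𝓡 n) x₀).target := isOpen_extChartAt_target x₀

variable [IsManifold (𝓡 n) ∞ M]

theorem mdifferentiableAt_symm {x₀ : M} {y : Model n} (hy : y ∈ (extChartAt (𝓡 n) x₀).target) :
    MDifferentiableAt 𝓘(ℝ, Model n) (𝓡 n) (extChartAt (𝓡 n) x₀).symm y :=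
  ((contMDiffOn_extChartAt_symm (n := ∞) x₀).contMDiffAt ((isOpen_tgt x₀).mem_nhds hy)).mdifferentiableAt
    (by simp)

theorem contMDiffAt_symm {x₀ : M} {y : Model n} (hy : y ∈ (extChartAt (𝓡 n) x₀).target) :
    ContMDiffAt 𝓘(ℝ, Model n) (𝓡 n) ∞ (extChartAt (𝓡 n) x₀).symm y :=
  ((contMDiffOn_extChartAt_symm (n := ∞) x₀).contMDiffAt ((isOpen_tgt x₀).mem_nhds hy))

theorem contMDiffAt_chart {x₀ x : M} (hx : x ∈ (extChartAt (𝓡 n) x₀).source) :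
    ContMDiffAt (𝓡 n) 𝓘(ℝ, Model n) ∞ (extChartAt (𝓡 n) x₀) x :=
  contMDiffAt_extChartAt' (by simpa using hx)

theorem mdifferentiableAt_chart {x₀ x : M} (hx : x ∈ (extChartAt (𝓡 n) x₀).source) :
    MDifferentiableAt (𝓡 n) 𝓘(ℝ, Model n) (extChartAt (𝓡 n) x₀) x :=
  (contMDiffAt_chart hx).mdifferentiableAt (by simp)

theorem dchart_comp_dsymm {x₀ : M} {y : Model n} (hy : y ∈ (extChartAt (𝓡 n) x₀).target) :
    (dchart x₀ ((extChartAt (𝓡 n) x₀).symm y)).comp (dsymm x₀ y) = ContinuousLinearMap.id ℝ _ := by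
  have := mfderiv_extChartAt_comp_mfderivWithin_extChartAt_symm (I := 𝓡 n) hy
  simp only [modelWithCornersSelf_coe, range_id, mfderivWithin_univ] at this
  exact this

theorem dsymm_comp_dchart {x₀ x : M} (hx : x ∈ (extChartAt (𝓡 n) x₀).source) :
    (dsymm x₀ (extChartAt (𝓡 n) x₀ x)).comp (dchart x₀ x) = ContinuousLinearMap.id ℝ _ := by
  have := mfderivWithin_extChartAt_symm_comp_mfderiv_extChartAt' (I := 𝓡 n) (by simpa using hx) 
  simp only [modelWithCornersSelf_coe, range_id, mfderivWithin_univ] at this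
  exact this

theorem dchart_dsymm {x₀ : M} {y : Model n} (hy : y ∈ (extChartAt (𝓡 n) x₀).target) (v : Model n) :
    dchart x₀ ((extChartAt (𝓡 n) x₀).symm y) (dsymm x₀ y v) = v :=
  DFunLike.congr_fun (dchart_comp_dsymm hy) v

theorem dsymm_dchart' {x₀ x : M} (hx : x ∈ (extChartAt (𝓡 n) x₀).source) (v : Model n) :
    dsymm x₀ (extChartAt (𝓡 n) x₀ x) (dchart x₀ x v) = v :=
  DFunLike.congr_fun (dsymm_comp_dchart hx) v

theorem dsymm_dchart {x₀ : M} {y : Model n} (hy : y ∈ (extChartAt (𝓡 n) x₀).target) (v : Model n) :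
    dsymm x₀ y (dchart x₀ ((extChartAt (𝓡 n) x₀).symm y) v) = v := by
  have := dsymm_dchart' ((extChartAt (𝓡 n) x₀).map_target hy) v
  rwa [(extChartAt (𝓡 n) x₀).right_inv hy] at this

theorem dchart_self (x : M) : dchart x x = ContinuousLinearMap.id ℝ (Model n) := by
  have h1 : dchart x x = tangentCoordChange (𝓡 n) x x x := by
    unfold dchart
    exact mfderiv_chartAt_eq_tangentCoordChange (by simp)
  ext1 v
  rw [h1]
  exact tangentCoordChange_self (by simp)

theorem dsymm_self (x : M) : dsymm x (extChartAt (𝓡 n) x x) = ContinuousLinearMap.id ℝ (Model n) := by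
  have := dsymm_comp_dchart (n := n) (x₀ := x) (x := x) (by simp)
  rwa [dchart_self, ContinuousLinearMap.comp_id] at this

theorem compCLM_id {E : Type*} [NormedAddCommGroup E] [NormedSpace ℝ E] {k : ℕ} (σ : E [⋀^Fin k]→L[ℝ] ℝ) :
    σ.compContinuousLinearMap (ContinuousLinearMap.id ℝ E) = σ := rfl

theorem chartForm_self {k : ℕ} (σ : Form n M k) (x : M) :
    chartForm x σ (extChartAt (𝓡 n) x x) = σ x := by
  rw [chartForm_apply, dsymm_self (n := n), compCLM_id, extChartAt_to_inv (I := 𝓡 n)]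

theorem chartVF_self (X : VF n M) (x : M) : chartVF x X (extChartAt (𝓡 n) x x) = X x := by
  have h : ∀ p : M, p = x → (dchart x p (X p) : Model n) = X x := by
    rintro p rfl; rw [dchart_self]; rfl
  exact h _ (extChartAt_to_inv (I := 𝓡 n) x)

theorem form_eq_chartForm {k : ℕ} (σ : Form n M k) {x₀ x : M} (hx : x ∈ (extChartAt (𝓡 n) x₀).source) :
    σ x = (chartForm x₀ σ (extChartAt (𝓡 n) x₀ x)).compContinuousLinearMap (dchart x₀ x) := by
  ext v
  rw [chartForm_apply, (extChartAt (𝓡 n) x₀).left_inv hx]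
  simp only [ContinuousAlternatingMap.compContinuousLinearMap_apply]
  congr 1; funext i
  exact (dsymm_dchart' hx (v i)).symm

theorem vf_eq_chartVF (X : VF n M) {x₀ x : M} (hx : x ∈ (extChartAt (𝓡 n) x₀).source) :
    X x = dsymm x₀ (extChartAt (𝓡 n) x₀ x) (chartVF x₀ X (extChartAt (𝓡 n) x₀ x)) := by
  rw [chartVF_apply, (extChartAt (𝓡 n) x₀).left_inv hx]
  exact (dsymm_dchart' hx (X x)).symm

theorem dsymm_chartVF (X : VF n M) {x₀ : M} {y : Model n} (hy : y ∈ (extChartAt (𝓡 n) x₀).target) :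
    dsymm x₀ y (chartVF x₀ X y) = X ((extChartAt (𝓡 n) x₀).symm y) := dsymm_dchart hy _

/-- The chart expression of a map has the expected derivative. -/
theorem hasFDerivAt_chart_comp {f : M → M} {x₀ x₁ : M} {y : Model n}
    (hy : y ∈ (extChartAt (𝓡 n) x₀).target)
    (hf : MDifferentiableAt (𝓡 n) (𝓡 n) f ((extChartAt (𝓡 n) x₀).symm y))
    (h1 : f ((extChartAt (𝓡 n) x₀).symm y) ∈ (extChartAt (𝓡 n) x₁).source) :
    HasFDerivAt (fun y => extChartAt (𝓡 n) x₁ (f ((extChartAt (𝓡 n) x₀).symm y)))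
      ((dchart x₁ (f ((extChartAt (𝓡 n) x₀).symm y))).comp
        ((mfderiv (𝓡 n) (𝓡 n) f ((extChartAt (𝓡 n) x₀).symm y) : Model n →L[ℝ] Model n).comp (dsymm x₀ y))) y := by
  have a := (mdifferentiableAt_symm hy).hasMFDerivAt
  have b := hf.hasMFDerivAt
  have c := (mdifferentiableAt_chart h1).hasMFDerivAt
  have d := HasMFDerivAt.comp y b a
  exact (HasMFDerivAt.comp y c d).hasFDerivAt

theorem chartForm_pullback {k : ℕ} {f : M → M} {x₀ x₁ : M} {y : Model n} (σ : Form n M k)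
    (hy : y ∈ (extChartAt (𝓡 n) x₀).target)
    (hf : MDifferentiableAt (𝓡 n) (𝓡 n) f ((extChartAt (𝓡 n) x₀).symm y))
    (h1 : f ((extChartAt (𝓡 n) x₀).symm y) ∈ (extChartAt (𝓡 n) x₁).source) :
    chartForm x₀ (pullback f σ) y =
      (chartForm x₁ σ (extChartAt (𝓡 n) x₁ (f ((extChartAt (𝓡 n) x₀).symm y)))).compContinuousLinearMap
        (fderiv ℝ (fun y => extChartAt (𝓡 n) x₁ (f ((extChartAt (𝓡 n) x₀).symm y))) y) := by
  rw [(hasFDerivAt_chart_comp hy hf h1).fderiv, chartForm_apply]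
  unfold pullback
  rw [form_eq_chartForm σ h1]
  rfl

theorem chartForm_change {k : ℕ} {x₀ x₁ : M} {y : Model n} (σ : Form n M k)
    (hy : y ∈ (extChartAt (𝓡 n) x₀).target)
    (h1 : (extChartAt (𝓡 n) x₀).symm y ∈ (extChartAt (𝓡 n) x₁).source) :
    chartForm x₀ σ y =
      (chartForm x₁ σ (extChartAt (𝓡 n) x₁ ((extChartAt (𝓡 n) x₀).symm y))).compContinuousLinearMap
        (fderiv ℝ (fun y => extChartAt (𝓡 n) x₁ ((extChartAt (𝓡 n) x₀).symm y)) y) := by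
  have := chartForm_pullback (f := id) (x₁ := x₁) σ hy mdifferentiableAt_id h1
  have h2 : pullback id σ = σ := by
    funext x; unfold pullback; rw [mfderiv_id]; rfl
  rw [h2] at this
  exact this

end Charts

/-! ### Fields and forms in charts -/
section ChartCalculus
variable {n : ℕ} {M : Type u} [TopologicalSpace M] [ChartedSpace (Model n) M] [IsManifold (𝓡 n) ∞ M]

theorem minSmoothness_two_le_infty : minSmoothness ℝ 2 ≤ (∞ : WithTop ℕ∞) := by
  rw [minSmoothness_of_isRCLikeNormedField]
  exact WithTop.coe_le_coe.2 (le_top : (2 : ℕ∞) ≤ ⊤)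

theorem contDiffAt_transition {x₀ x₁ : M} {y : Model n} (hy : y ∈ (extChartAt (𝓡 n) x₀).target)
    (h1 : (extChartAt (𝓡 n) x₀).symm y ∈ (extChartAt (𝓡 n) x₁).source) :
    ContDiffAt ℝ ∞ (fun y => extChartAt (𝓡 n) x₁ ((extChartAt (𝓡 n) x₀).symm y)) y :=
  ((contMDiffAt_chart h1).comp y (contMDiffAt_symm hy)).contDiffAt

theorem continuousAt_chart_symm {x₀ : M} {y : Model n} (hy : y ∈ (extChartAt (𝓡 n) x₀).target) :
    ContinuousAt (extChartAt (𝓡 n) x₀).symm y := (contMDiffAt_symm hy).continuousAt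

theorem eventually_symm_mem {x₀ x₁ : M} {y : Model n} (hy : y ∈ (extChartAt (𝓡 n) x₀).target)
    (h1 : (extChartAt (𝓡 n) x₀).symm y ∈ (extChartAt (𝓡 n) x₁).source) :
    ∀ᶠ y' in 𝓝 y, y' ∈ (extChartAt (𝓡 n) x₀).target ∧
      (extChartAt (𝓡 n) x₀).symm y' ∈ (extChartAt (𝓡 n) x₁).source :=
  Filter.Eventually.and ((isOpen_tgt x₀).mem_nhds hy)
    ((continuousAt_chart_symm hy).eventually ((isOpen_extChartAt_source x₁).mem_nhds h1))

theorem chartForm_iota {k : ℕ} (X : VF n M) (σ : Form n M (k + 1)) {x₀ : M} {y : Model n}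
    (hy : y ∈ (extChartAt (𝓡 n) x₀).target) :
    chartForm x₀ (iota X σ) y = (chartForm x₀ σ y).curryLeft (chartVF x₀ X y) := by
  ext v
  rw [chartForm_apply, chartForm_apply, ContinuousAlternatingMap.compContinuousLinearMap_apply,
    curryLeft_apply_apply, ContinuousAlternatingMap.compContinuousLinearMap_apply]
  change σ _ (Matrix.vecCons _ _) = σ _ _
  refine congrArg _ (funext fun i => ?_)
  refine Fin.cases ?_ (fun i => ?_) i
  · simpa using (dsymm_chartVF X hy).symm
  · rfl

/-- The exterior derivative, defined at each point in the preferred chart there, is computed by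
`extDeriv` in every chart. -/
theorem chartForm_extd {k : ℕ} {σ : Form n M k} (hσ : SmoothForm σ) {x₀ : M} {y : Model n}
    (hy : y ∈ (extChartAt (𝓡 n) x₀).target) :
    chartForm x₀ (extd σ) y = extDeriv (chartForm x₀ σ) y := by
  set p := (extChartAt (𝓡 n) x₀).symm y with hp
  have hps : p ∈ (extChartAt (𝓡 n) p).source := mem_extChartAt_source p
  have e : chartForm x₀ σ =ᶠ[𝓝 y] fun y =>
      (chartForm p σ (extChartAt (𝓡 n) p ((extChartAt (𝓡 n) x₀).symm y))).compContinuousLinearMap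
        (fderiv ℝ (fun y => extChartAt (𝓡 n) p ((extChartAt (𝓡 n) x₀).symm y)) y) := by
    filter_upwards [eventually_symm_mem hy hps] with y' h
    exact chartForm_change σ h.1 h.2
  have hd : DifferentiableAt ℝ (chartForm p σ) (extChartAt (𝓡 n) p p) :=
    ((hσ p).contDiffAt ((isOpen_tgt p).mem_nhds (mem_extChartAt_target p))).differentiableAt (by simp)
  rw [e.extDeriv_eq, extDeriv_pullback (r := ∞) (f := fun y => extChartAt (𝓡 n) p ((extChartAt (𝓡 n) x₀).symm y))
    hd (contDiffAt_transition hy hps) minSmoothness_two_le_infty]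
  have := (hasFDerivAt_chart_comp (f := id) (x₁ := p) hy mdifferentiableAt_id hps).fderiv
  simp only [id] at this
  rw [this, chartForm_apply]
  change ((extDeriv (chartForm p σ) (extChartAt (𝓡 n) p p)).compContinuousLinearMap (dchart p p)).compContinuousLinearMap (dsymm x₀ y) = _
  rw [mfderiv_id]
  rfl

theorem extd_apply {k : ℕ} (σ : Form n M k) (x : M) :
    extd σ x = extDeriv (chartForm x σ) (extChartAt (𝓡 n) x x) := by
  change (extDeriv (chartForm x σ) (extChartAt (𝓡 n) x x)).compContinuousLinearMap (dchart x x) = _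
  rw [dchart_self]; rfl

theorem contDiffAt_chartForm {k : ℕ} {σ : Form n M k} (hσ : SmoothForm σ) {x₀ : M} {y : Model n}
    (hy : y ∈ (extChartAt (𝓡 n) x₀).target) : ContDiffAt ℝ ∞ (chartForm x₀ σ) y :=
  (hσ x₀).contDiffAt ((isOpen_tgt x₀).mem_nhds hy)

theorem extDeriv_extDeriv_eq_zero {E : Type*} [NormedAddCommGroup E] [NormedSpace ℝ E] {k : ℕ}
    {σ : E → E [⋀^Fin k]→L[ℝ] ℝ} {y : E} (h : ContDiffAt ℝ ∞ σ y) : extDeriv (extDeriv σ) y = 0 :=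
  extDeriv_extDeriv_apply h minSmoothness_two_le_infty

theorem extd_extd {k : ℕ} {σ : Form n M k} (hσ : SmoothForm σ) : extd (extd σ) = 0 := by
  funext x
  rw [extd_apply]
  have e : chartForm x (extd σ) =ᶠ[𝓝 (extChartAt (𝓡 n) x x)] extDeriv (chartForm x σ) := by
    filter_upwards [(isOpen_tgt x).mem_nhds (mem_extChartAt_target x)] with y hy
    exact chartForm_extd hσ hy
  rw [e.extDeriv_eq]
  exact extDeriv_extDeriv_eq_zero (contDiffAt_chartForm hσ (mem_extChartAt_target x))

/-- The differential of a function as a linear form on `ℝⁿ`. -/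
def mfd (n : ℕ) {M : Type u} [TopologicalSpace M] [ChartedSpace (Model n) M] (f : M → ℝ) (x : M) :
    Model n →L[ℝ] ℝ :=
  mfderiv (𝓡 n) 𝓘(ℝ, ℝ) f x

theorem chartForm_dFun {f : M → ℝ} (hf : SmoothFun (n := n) f) {x₀ : M} {y : Model n}
    (hy : y ∈ (extChartAt (𝓡 n) x₀).target) (v : Fin 1 → Model n) :
    chartForm x₀ (dFun f) y v = fderiv ℝ (fun y => f ((extChartAt (𝓡 n) x₀).symm y)) y (v 0) := by
  have a := (mdifferentiableAt_symm hy).hasMFDerivAt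
  have b := (hf.mdifferentiableAt (x := (extChartAt (𝓡 n) x₀).symm y) (by simp)).hasMFDerivAt
  have c : HasFDerivAt (fun y => f ((extChartAt (𝓡 n) x₀).symm y))
      ((mfd n f ((extChartAt (𝓡 n) x₀).symm y)).comp (dsymm x₀ y)) y :=
    (HasMFDerivAt.comp y b a).hasFDerivAt
  rw [c.fderiv, chartForm_apply]
  rfl

theorem dFun_apply' {f : M → ℝ} (hf : SmoothFun (n := n) f) (x : M) (v : Fin 1 → Model n) :
    dFun f x v = fderiv ℝ (fun y => f ((extChartAt (𝓡 n) x).symm y)) (extChartAt (𝓡 n) x x) (v 0) := by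
  rw [← chartForm_dFun hf (mem_extChartAt_target x), chartForm_self]

theorem fun_chart_differentiableAt {f : M → ℝ} (hf : SmoothFun (n := n) f) {x₀ : M} {y : Model n}
    (hy : y ∈ (extChartAt (𝓡 n) x₀).target) :
    ContDiffAt ℝ ∞ (fun y => f ((extChartAt (𝓡 n) x₀).symm y)) y :=
  (hf.contMDiffAt.comp y (contMDiffAt_symm hy)).contDiffAt

/-- The Lie bracket at `x`, computed in the preferred chart at `x`. -/
theorem mlieBracket_eq_chart (X Y : VF n M) (x : M) :
    VectorField.mlieBracket (𝓡 n) X Y x =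
      VectorField.lieBracket ℝ (chartVF x X) (chartVF x Y) (extChartAt (𝓡 n) x x) := by
  have key : ∀ X : VF n M, (VectorField.mpullbackWithin 𝓘(ℝ, Model n) (𝓡 n) (extChartAt (𝓡 n) x).symm X (range (𝓡 n)))
      =ᶠ[𝓝 (extChartAt (𝓡 n) x x)] chartVF x X := by
    intro X
    filter_upwards [(isOpen_tgt x).mem_nhds (mem_extChartAt_target x)] with y hy
    rw [VectorField.mpullbackWithin_apply, chartVF_apply]
    have hr : range (𝓡 n) = univ := ModelWithCorners.range_eq_univ _
    rw [hr, mfderivWithin_univ]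
    have h1 : (dsymm x y).comp (dchart x ((extChartAt (𝓡 n) x).symm y)) = ContinuousLinearMap.id ℝ _ :=
      ContinuousLinearMap.ext fun v => dsymm_dchart hy v
    have := ContinuousLinearMap.inverse_eq (M := Model n) (M₂ := Model n) h1 (dchart_comp_dsymm hy)
    exact DFunLike.congr_fun (this : (dsymm x y).inverse = _) _
  rw [← VectorField.mlieBracketWithin_univ, VectorField.mlieBracketWithin_apply]
  have hi : (mfderiv (𝓡 n) 𝓘(ℝ, Model n) (extChartAt (𝓡 n) x) x : Model n →L[ℝ] Model n).inverse = ContinuousLinearMap.id ℝ (Model n) := by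
    have := dchart_self (n := n) x
    unfold dchart at this
    rw [this]; exact ContinuousLinearMap.inverse_id (R := ℝ) (M := Model n)
  have hr : (extChartAt (𝓡 n) x).symm ⁻¹' univ ∩ range (𝓡 n) = univ := by simp
  rw [hr]
  change (mfderiv (𝓡 n) 𝓘(ℝ, Model n) (extChartAt (𝓡 n) x) x : Model n →L[ℝ] Model n).inverse _ = _
  rw [hi]
  change VectorField.lieBracketWithin (𝕜 := ℝ) (E := Model n) _ _ univ _ = _
  refine (congrFun VectorField.lieBracketWithin_univ _).trans ?_
  exact Filter.EventuallyEq.lieBracket_vectorField_eq (key X) (key Y)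

end ChartCalculus

section Families
variable {n : ℕ} {M : Type u} [TopologicalSpace M] [ChartedSpace (Model n) M] [IsManifold (𝓡 n) ∞ M]
  {Z : Type} [NormedAddCommGroup Z] [NormedSpace ℝ Z]

theorem smoothFamForm_iff {k : ℕ} {S : Set Z} (hS : IsOpen S) {σ : Z → Form n M k} :
    SmoothFamForm S σ ↔ ∀ x₀ : M, ∀ z ∈ S, ∀ y ∈ (extChartAt (𝓡 n) x₀).target,
      ContDiffAt ℝ ∞ (fun p : Z × Model n => chartForm x₀ (σ p.1) p.2) (z, y) :=
  ⟨fun h x₀ _ hz _ hy => (h x₀).contDiffAt ((hS.prod (isOpen_tgt x₀)).mem_nhds ⟨hz, hy⟩),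
    fun h x₀ p hp => (h x₀ p.1 hp.1 p.2 hp.2).contDiffWithinAt⟩

theorem contMDiffAt_prod_symm {x₀ : M} {z : Z} {y : Model n} (hy : y ∈ (extChartAt (𝓡 n) x₀).target) :
    ContMDiffAt 𝓘(ℝ, Z × Model n) (𝓘(ℝ, Z).prod (𝓡 n)) ∞
      (fun p : Z × Model n => (p.1, (extChartAt (𝓡 n) x₀).symm p.2)) (z, y) :=
  ContMDiffAt.prodMk contDiff_fst.contMDiff.contMDiffAt
    (ContMDiffAt.comp (z, y) (contMDiffAt_symm hy) contDiff_snd.contMDiff.contMDiffAt)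

theorem contMDiffAt_prod_chart {x₀ x : M} {z : Z} (hx : x ∈ (extChartAt (𝓡 n) x₀).source) :
    ContMDiffAt (𝓘(ℝ, Z).prod (𝓡 n)) 𝓘(ℝ, Z × Model n) ∞
      (fun p : Z × M => (p.1, extChartAt (𝓡 n) x₀ p.2)) (z, x) :=
  ContMDiffAt.prodMk_space contMDiffAt_fst
    (ContMDiffAt.comp (z, x) (contMDiffAt_chart hx) contMDiffAt_snd)

theorem eventually_mem_source' {x₀ x : M} {z : Z} (hx : x ∈ (extChartAt (𝓡 n) x₀).source) :
    ∀ᶠ p : Z × M in 𝓝 (z, x), p.2 ∈ (extChartAt (𝓡 n) x₀).source :=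
  continuousAt_snd.eventually ((isOpen_extChartAt_source x₀).mem_nhds hx)

theorem smoothFamFun_iff {S : Set Z} (hS : IsOpen S) {f : Z → M → ℝ} :
    SmoothFamFun n S f ↔ ∀ x₀ : M, ∀ z ∈ S, ∀ y ∈ (extChartAt (𝓡 n) x₀).target,
      ContDiffAt ℝ ∞ (fun p : Z × Model n => f p.1 ((extChartAt (𝓡 n) x₀).symm p.2)) (z, y) := by
  constructor
  · intro h x₀ z hz y hy
    have h1 : ContMDiffAt (𝓘(ℝ, Z).prod (𝓡 n)) 𝓘(ℝ, ℝ) ∞ (fun p : Z × M => f p.1 p.2) (z, (extChartAt (𝓡 n) x₀).symm y) :=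
      h.contMDiffAt ((hS.prod isOpen_univ).mem_nhds ⟨hz, mem_univ _⟩)
    exact (ContMDiffAt.comp (z, y) h1 (contMDiffAt_prod_symm hy)).contDiffAt
  · intro h p hp
    refine ContMDiffAt.contMDiffWithinAt ?_
    have hx := mem_extChartAt_source (I := 𝓡 n) p.2
    have h1 := (h p.2 p.1 hp.1 _ ((extChartAt (𝓡 n) p.2).map_source hx)).contMDiffAt
    refine (ContMDiffAt.comp (p.1, p.2) h1 (contMDiffAt_prod_chart hx)).congr_of_eventuallyEq ?_
    filter_upwards [eventually_mem_source' (Z := Z) (z := p.1) hx] with q hq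
    simp only [Function.comp]
    rw [(extChartAt (𝓡 n) p.2).left_inv hq]

/-- In a chart, smoothness of a family of vector fields is smoothness of its components. -/
theorem contMDiffAt_tangent_iff {X : Z → VF n M} {x₀ x : M} {z : Z} (hx : x ∈ (extChartAt (𝓡 n) x₀).source) :
    ContMDiffAt (𝓘(ℝ, Z).prod (𝓡 n)) (𝓡 n).tangent ∞
      (fun p : Z × M => (⟨p.2, X p.1 p.2⟩ : TangentBundle (𝓡 n) M)) (z, x) ↔
    ContMDiffAt (𝓘(ℝ, Z).prod (𝓡 n)) 𝓘(ℝ, Model n) ∞ (fun p : Z × M => dchart x₀ p.2 (X p.1 p.2)) (z, x) := by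
  rw [Bundle.Trivialization.contMDiffAt_iff (IB := 𝓡 n) (e := trivializationAt (Model n) (TangentSpace (𝓡 n)) x₀)]
  · refine (and_iff_right contMDiffAt_snd).trans ?_
    refine Filter.EventuallyEq.contMDiffAt_iff ?_
    filter_upwards [eventually_mem_source' (Z := Z) (z := z) hx] with q hq
    have := TangentBundle.continuousLinearMapAt_trivializationAt (I := 𝓡 n) (x₀ := x₀) (x := q.2) (by simpa using hq)
    refine Eq.trans ?_ (DFunLike.congr_fun this (X q.1 q.2))
    symm
    exact congrFun (Bundle.Trivialization.coe_linearMapAt_of_mem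
      (trivializationAt (Model n) (TangentSpace (𝓡 n)) x₀) (by simpa using hq)) (X q.1 q.2)
  · simpa [Bundle.Trivialization.mem_source] using hx

theorem smoothFamVF_iff {S : Set Z} (hS : IsOpen S) {X : Z → VF n M} :
    SmoothFamVF S X ↔ ∀ x₀ : M, ∀ z ∈ S, ∀ y ∈ (extChartAt (𝓡 n) x₀).target,
      ContDiffAt ℝ ∞ (fun p : Z × Model n => chartVF x₀ (X p.1) p.2) (z, y) := by
  constructor
  · intro h x₀ z hz y hy
    have h1 := (contMDiffAt_tangent_iff ((extChartAt (𝓡 n) x₀).map_target hy)).1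
      (h.contMDiffAt ((hS.prod isOpen_univ).mem_nhds ⟨hz, mem_univ _⟩))
    exact (ContMDiffAt.comp (z, y) h1 (contMDiffAt_prod_symm hy)).contDiffAt
  · intro h p hp
    refine ContMDiffAt.contMDiffWithinAt ?_
    have hx := mem_extChartAt_source (I := 𝓡 n) p.2
    refine (contMDiffAt_tangent_iff (x₀ := p.2) (z := p.1) hx).2 ?_
    have h1 := (h p.2 p.1 hp.1 _ ((extChartAt (𝓡 n) p.2).map_source hx)).contMDiffAt
    refine (ContMDiffAt.comp (p.1, p.2) h1 (contMDiffAt_prod_chart hx)).congr_of_eventuallyEq ?_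
    filter_upwards [eventually_mem_source' (Z := Z) (z := p.1) hx] with q hq
    simp only [Function.comp, chartVF_apply]
    rw [(extChartAt (𝓡 n) p.2).left_inv hq]

end Families

/-! ### Operations on smooth families -/
section SmoothOps
variable {n : ℕ} {M : Type u} [TopologicalSpace M] [ChartedSpace (Model n) M] [IsManifold (𝓡 n) ∞ M]
  {Z : Type} [NormedAddCommGroup Z] [NormedSpace ℝ Z] {S : Set Z} {k : ℕ}

theorem SmoothForm.fam {σ : Form n M k} (h : SmoothForm σ) (S : Set Z) : SmoothFamForm S (fun _ => σ) :=
  fun x₀ => (h x₀).comp contDiff_snd.contDiffOn fun _ hp => hp.2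

theorem SmoothFamForm.at {σ : Z → Form n M k} (h : SmoothFamForm S σ) {z : Z} (hz : z ∈ S) :
    SmoothForm (σ z) :=
  fun x₀ => (h x₀).comp (f := fun y => (z, y)) (contDiff_prodMk_right z).contDiffOn fun _ hy => ⟨hz, hy⟩

theorem SmoothFun.fam {f : M → ℝ} (h : SmoothFun (n := n) f) (S : Set Z) : SmoothFamFun n S (fun _ => f) :=
  (ContMDiff.comp (I' := 𝓡 n) h contMDiff_snd).contMDiffOn

theorem SmoothFamFun.at {f : Z → M → ℝ} (h : SmoothFamFun n S f) {z : Z} (hz : z ∈ S) :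
    SmoothFun (n := n) (f z) := by
  have h1 : ContMDiff (𝓡 n) (𝓘(ℝ, Z).prod (𝓡 n)) ∞ (fun x : M => (z, x)) := contMDiff_const.prodMk contMDiff_id
  exact contMDiffOn_univ.1 (ContMDiffOn.comp (t := S ×ˢ univ) h (h1.contMDiffOn (s := univ)) fun _ _ => ⟨hz, mem_univ _⟩)

theorem SmoothVF.fam {X : VF n M} (h : SmoothVF X) (S : Set Z) : SmoothFamVF S (fun _ => X) :=
  (ContMDiff.comp (I' := 𝓡 n) h contMDiff_snd).contMDiffOn

theorem SmoothFamVF.at {X : Z → VF n M} (h : SmoothFamVF S X) {z : Z} (hz : z ∈ S) :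
    SmoothVF (X z) := by
  have h1 : ContMDiff (𝓡 n) (𝓘(ℝ, Z).prod (𝓡 n)) ∞ (fun x : M => (z, x)) := contMDiff_const.prodMk contMDiff_id
  exact contMDiffOn_univ.1 (ContMDiffOn.comp (t := S ×ˢ univ) h (h1.contMDiffOn (s := univ)) fun _ _ => ⟨hz, mem_univ _⟩)

theorem SmoothFamForm.comp {Z' : Type} [NormedAddCommGroup Z'] [NormedSpace ℝ Z'] {σ : Z → Form n M k}
    (h : SmoothFamForm S σ) {g : Z' → Z} {S' : Set Z'} (hg : ContDiffOn ℝ ∞ g S') (hm : MapsTo g S' S) :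
    SmoothFamForm S' (fun z => σ (g z)) :=
  fun x₀ => (h x₀).comp (f := fun p : Z' × Model n => (g p.1, p.2))
    ((hg.comp contDiff_fst.contDiffOn fun _ hp => hp.1).prodMk contDiff_snd.contDiffOn)
    fun _ hp => ⟨hm hp.1, hp.2⟩

theorem SmoothFamFun.comp {Z' : Type} [NormedAddCommGroup Z'] [NormedSpace ℝ Z'] {f : Z → M → ℝ}
    (h : SmoothFamFun n S f) {g : Z' → Z} {S' : Set Z'} (hg : ContDiffOn ℝ ∞ g S') (hm : MapsTo g S' S) :
    SmoothFamFun n S' (fun z => f (g z)) :=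
  ContMDiffOn.comp (t := S ×ˢ univ) (f := fun p : Z' × M => (g p.1, p.2)) h
    ((hg.contMDiffOn.comp contMDiff_fst.contMDiffOn fun _ hp => hp.1).prodMk contMDiff_snd.contMDiffOn)
    fun _ hp => ⟨hm hp.1, mem_univ _⟩

theorem SmoothFamVF.comp {Z' : Type} [NormedAddCommGroup Z'] [NormedSpace ℝ Z'] {X : Z → VF n M}
    (h : SmoothFamVF S X) {g : Z' → Z} {S' : Set Z'} (hg : ContDiffOn ℝ ∞ g S') (hm : MapsTo g S' S) :
    SmoothFamVF S' (fun z => X (g z)) :=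
  ContMDiffOn.comp (t := S ×ˢ univ) (f := fun p : Z' × M => (g p.1, p.2)) h
    ((hg.contMDiffOn.comp contMDiff_fst.contMDiffOn fun _ hp => hp.1).prodMk contMDiff_snd.contMDiffOn)
    fun _ hp => ⟨hm hp.1, mem_univ _⟩

theorem SmoothFamFun.mono {f : Z → M → ℝ} (h : SmoothFamFun n S f) {T : Set Z} (hT : T ⊆ S) :
    SmoothFamFun n T f := ContMDiffOn.mono h (prod_mono hT le_rfl)

theorem SmoothFamForm.mono {σ : Z → Form n M k} (h : SmoothFamForm S σ) {T : Set Z} (hT : T ⊆ S) :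
    SmoothFamForm T σ := fun x₀ => (h x₀).mono (prod_mono hT le_rfl)

/-! ### Smooth families of functions -/

theorem smoothFamFun_const (c : ℝ) : SmoothFamFun n S (fun (_ : Z) (_ : M) => c) :=
  contMDiffOn_const

theorem SmoothFamFun.add {f g : Z → M → ℝ} (hf : SmoothFamFun n S f) (hg : SmoothFamFun n S g) :
    SmoothFamFun n S (fun z x => f z x + g z x) := ContMDiffOn.add hf hg

theorem SmoothFamFun.mul {f g : Z → M → ℝ} (hf : SmoothFamFun n S f) (hg : SmoothFamFun n S g) :
    SmoothFamFun n S (fun z x => f z x * g z x) := ContMDiffOn.mul hf hg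

theorem SmoothFamFun.compReal {f : Z → M → ℝ} (hf : SmoothFamFun n S f) {e : ℝ → ℝ} {I : Set ℝ}
    (he : ContDiffOn ℝ ∞ e I) (hI : ∀ z ∈ S, ∀ x, f z x ∈ I) :
    SmoothFamFun n S (fun z x => e (f z x)) :=
  he.contMDiffOn.comp hf fun p hp => hI p.1 hp.1 p.2

theorem SmoothFamFun.inv {f : Z → M → ℝ} (hf : SmoothFamFun n S f) (h0 : ∀ z ∈ S, ∀ x, f z x ≠ 0) :
    SmoothFamFun n S (fun z x => (f z x)⁻¹) :=
  hf.compReal (e := fun r => r⁻¹) (I := {0}ᶜ) (contDiffOn_inv ℝ) fun z hz x => h0 z hz x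

/-! ### Smooth families of forms and vector fields -/

theorem chartForm_smul (x₀ : M) (f : M → ℝ) (σ : Form n M k) (y : Model n) :
    chartForm x₀ (fun x => f x • σ x) y = f ((extChartAt (𝓡 n) x₀).symm y) • chartForm x₀ σ y := rfl

theorem chartVF_sub (x₀ : M) (X Y : VF n M) (y : Model n) :
    chartVF x₀ (X - Y) y = chartVF x₀ X y - chartVF x₀ Y y := map_sub (dchart x₀ _) _ _

theorem chartVF_smul (x₀ : M) (f : M → ℝ) (X : VF n M) (y : Model n) :
    chartVF x₀ (fun x => f x • X x) y = f ((extChartAt (𝓡 n) x₀).symm y) • chartVF x₀ X y :=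
  map_smul (dchart x₀ _) _ _

theorem SmoothFamForm.add {σ τ : Z → Form n M k} (hσ : SmoothFamForm S σ) (hτ : SmoothFamForm S τ) :
    SmoothFamForm S (fun z => σ z + τ z) := fun x₀ => (hσ x₀).add (hτ x₀)

theorem SmoothFamForm.smul {σ : Z → Form n M k} {f : Z → M → ℝ} (hS : IsOpen S) (hf : SmoothFamFun n S f)
    (hσ : SmoothFamForm S σ) : SmoothFamForm S (fun z x => f z x • σ z x) := by
  rw [smoothFamForm_iff hS] at *
  rw [smoothFamFun_iff hS] at hf
  exact fun x₀ z hz y hy => (hf x₀ z hz y hy).smul (hσ x₀ z hz y hy)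

theorem SmoothFamVF.smul {X : Z → VF n M} {f : Z → M → ℝ} (hS : IsOpen S) (hf : SmoothFamFun n S f)
    (hX : SmoothFamVF S X) : SmoothFamVF S (fun z x => f z x • X z x) := by
  rw [smoothFamVF_iff hS] at *
  rw [smoothFamFun_iff hS] at hf
  intro x₀ z hz y hy
  refine ((hf x₀ z hz y hy).smul (hX x₀ z hz y hy)).congr_of_eventuallyEq (Eventually.of_forall fun p => ?_)
  exact chartVF_smul _ _ _ _

theorem SmoothFamVF.sub {X Y : Z → VF n M} (hS : IsOpen S) (hX : SmoothFamVF S X)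
    (hY : SmoothFamVF S Y) : SmoothFamVF S (fun z => X z - Y z) := by
  rw [smoothFamVF_iff hS] at *
  intro x₀ z hz y hy
  refine ((hX x₀ z hz y hy).sub (hY x₀ z hz y hy)).congr_of_eventuallyEq (Eventually.of_forall fun p => ?_)
  exact chartVF_sub _ _ _ _

theorem eventually_snd_tgt {x₀ : M} {z : Z} {y : Model n} (hy : y ∈ (extChartAt (𝓡 n) x₀).target) :
    ∀ᶠ p : Z × Model n in 𝓝 (z, y), p.2 ∈ (extChartAt (𝓡 n) x₀).target :=
  continuousAt_snd.eventually ((isOpen_tgt x₀).mem_nhds hy)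

theorem eventually_mem_prod (hS : IsOpen S) {x₀ : M} {z : Z} {y : Model n} (hz : z ∈ S)
    (hy : y ∈ (extChartAt (𝓡 n) x₀).target) :
    ∀ᶠ p : Z × Model n in 𝓝 (z, y), p.1 ∈ S ∧ p.2 ∈ (extChartAt (𝓡 n) x₀).target :=
  (hS.prod (isOpen_tgt x₀)).mem_nhds ⟨hz, hy⟩

theorem SmoothFamForm.iota {X : Z → VF n M} {σ : Z → Form n M (k + 1)} (hS : IsOpen S)
    (hX : SmoothFamVF S X) (hσ : SmoothFamForm S σ) :
    SmoothFamForm S (fun z => CompMHD.iota (X z) (σ z)) := by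
  rw [smoothFamForm_iff hS] at *
  rw [smoothFamVF_iff hS] at hX
  intro x₀ z hz y hy
  refine (contDiffAt_curryLeft (hσ x₀ z hz y hy) (hX x₀ z hz y hy)).congr_of_eventuallyEq ?_
  filter_upwards [eventually_snd_tgt hy] with p hp
  exact chartForm_iota _ _ hp

/-- The derivative in the second variable of a smooth function of two variables is smooth. -/
theorem contDiffAt_fderiv_snd {E F : Type*} [NormedAddCommGroup E] [NormedSpace ℝ E] [NormedAddCommGroup F]
    [NormedSpace ℝ F] {f : Z × E → F} {p : Z × E} (h : ContDiffAt ℝ ∞ f p) :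
    ContDiffAt ℝ ∞ (fun q : Z × E => fderiv ℝ (fun y => f (q.1, y)) q.2) p := by
  have h1 : ContDiffAt ℝ ∞ (fun r : (Z × E) × E => f (r.1.1, r.2)) (p, p.2) :=
    ContDiffAt.comp (p, p.2) h (by fun_prop)
  exact ContDiffAt.fderiv (f := fun (q : Z × E) (y : E) => f (q.1, y)) (g := fun q => q.2) (m := ∞)
    h1 (by fun_prop) (by simp)

theorem contDiffAt_fderiv_fst {E F : Type*} [NormedAddCommGroup E] [NormedSpace ℝ E] [NormedAddCommGroup F]
    [NormedSpace ℝ F] {f : Z × E → F} {p : Z × E} (h : ContDiffAt ℝ ∞ f p) :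
    ContDiffAt ℝ ∞ (fun q : Z × E => fderiv ℝ (fun z => f (z, q.2)) q.1) p := by
  have h1 : ContDiffAt ℝ ∞ (fun r : (Z × E) × Z => f (r.2, r.1.2)) (p, p.1) :=
    ContDiffAt.comp (p, p.1) h (by fun_prop)
  exact ContDiffAt.fderiv (f := fun (q : Z × E) (z : Z) => f (z, q.2)) (g := fun q => q.1) (m := ∞)
    h1 (by fun_prop) (by simp)

theorem SmoothFamForm.extd {σ : Z → Form n M k} (hS : IsOpen S) (hσ : SmoothFamForm S σ) :
    SmoothFamForm S (fun z => CompMHD.extd (σ z)) := by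
  have h0 := hσ
  rw [smoothFamForm_iff hS] at hσ ⊢
  intro x₀ z hz y hy
  have h1 := contDiffAt_fderiv_snd (hσ x₀ z hz y hy)
  have h2 : ContDiffAt ℝ ∞ (fun q : Z × Model n => extDeriv (chartForm x₀ (σ q.1)) q.2) (z, y) :=
    ContDiffAt.comp (z, y) (ContinuousLinearMap.contDiff (𝕜 := ℝ)
      (E := Model n →L[ℝ] Model n [⋀^Fin k]→L[ℝ] ℝ) (F := Model n [⋀^Fin (k + 1)]→L[ℝ] ℝ)
      (alternatizeUncurryFinCLM ℝ (Model n) ℝ)).contDiffAt h1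
  refine h2.congr_of_eventuallyEq ?_
  filter_upwards [eventually_mem_prod hS hz hy] with p hp
  exact chartForm_extd (h0.at hp.1) hp.2

theorem SmoothFamForm.lieD {X : Z → VF n M} {σ : Z → Form n M k} (hS : IsOpen S)
    (hX : SmoothFamVF S X) (hσ : SmoothFamForm S σ) :
    SmoothFamForm S (fun z => CompMHD.lieD (X z) (σ z)) := by
  cases k with
  | zero => exact SmoothFamForm.iota hS hX (hσ.extd hS)
  | succ k => exact (SmoothFamForm.iota hS hX (hσ.extd hS)).add ((SmoothFamForm.iota hS hX hσ).extd hS)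

theorem form_apply_chart (σ : Form n M k) (X : Fin k → VF n M) {x₀ : M} {y : Model n}
    (hy : y ∈ (extChartAt (𝓡 n) x₀).target) :
    σ ((extChartAt (𝓡 n) x₀).symm y) (fun i => X i ((extChartAt (𝓡 n) x₀).symm y)) =
      chartForm x₀ σ y (fun i => chartVF x₀ (X i) y) := by
  rw [chartForm_apply, ContinuousAlternatingMap.compContinuousLinearMap_apply]
  exact congrArg _ (funext fun i => (dsymm_chartVF (X i) hy).symm)

theorem SmoothFamForm.apply {σ : Z → Form n M k} {X : Fin k → Z → VF n M} (hS : IsOpen S)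
    (hσ : SmoothFamForm S σ) (hX : ∀ i, SmoothFamVF S (X i)) :
    SmoothFamFun n S (fun z x => σ z x (fun i => X i z x)) := by
  rw [smoothFamForm_iff hS] at *
  simp only [smoothFamVF_iff hS] at hX
  rw [smoothFamFun_iff hS]
  intro x₀ z hz y hy
  refine (contDiffAt_form_apply (hσ x₀ z hz y hy) (v := fun i p => chartVF x₀ (X i p.1) p.2)
    fun i => hX i x₀ z hz y hy).congr_of_eventuallyEq ?_
  filter_upwards [eventually_snd_tgt hy] with p hp
  exact form_apply_chart (σ p.1) (fun i => X i p.1) hp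

theorem SmoothFamFun.dFun {f : Z → M → ℝ} (hS : IsOpen S) (hf : SmoothFamFun n S f) :
    SmoothFamForm S (fun z => (CompMHD.dFun (f z) : Form n M 1)) := by
  have h0 := hf
  rw [smoothFamFun_iff hS] at hf
  rw [smoothFamForm_iff hS]
  intro x₀ z hz y hy
  refine contDiffAt_form fun v => ?_
  have h1 := (contDiffAt_fderiv_snd (hf x₀ z hz y hy)).clm_apply (contDiffAt_const (c := v 0))
  refine h1.congr_of_eventuallyEq ?_
  filter_upwards [eventually_mem_prod hS hz hy] with p hp
  exact chartForm_dFun (h0.at hp.1) hp.2 v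

theorem SmoothFamForm.contDiffAt_param {σ : Z → Form n M k} (hS : IsOpen S) (hσ : SmoothFamForm S σ)
    {z : Z} (hz : z ∈ S) (x : M) : ContDiffAt ℝ ∞ (fun z => σ z x) z := by
  rw [smoothFamForm_iff hS] at hσ
  have h := hσ x z hz _ (mem_extChartAt_target x)
  have h2 : ContDiffAt ℝ ∞ (fun z => chartForm x (σ z) (extChartAt (𝓡 n) x x)) z :=
    ContDiffAt.comp (f := fun z => (z, extChartAt (𝓡 n) x x)) z h (by fun_prop)
  simpa only [chartForm_self] using h2

theorem SmoothFamVF.contDiffAt_param {X : Z → VF n M} (hS : IsOpen S) (hX : SmoothFamVF S X)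
    {z : Z} (hz : z ∈ S) (x : M) : ContDiffAt ℝ ∞ (F := Model n) (fun z => X z x) z := by
  rw [smoothFamVF_iff hS] at hX
  have h := hX x z hz _ (mem_extChartAt_target x)
  have h2 : ContDiffAt ℝ ∞ (fun z => chartVF x (X z) (extChartAt (𝓡 n) x x)) z :=
    ContDiffAt.comp (f := fun z => (z, extChartAt (𝓡 n) x x)) z h (by fun_prop)
  have e : (fun z => chartVF x (X z) (extChartAt (𝓡 n) x x)) = fun z => (X z x : Model n) :=
    funext fun z => chartVF_self (X z) x
  rwa [e] at h2

theorem SmoothFamFun.contDiffAt_param {f : Z → M → ℝ} (hS : IsOpen S) (hf : SmoothFamFun n S f)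
    {z : Z} (hz : z ∈ S) (x : M) : ContDiffAt ℝ ∞ (fun z => f z x) z := by
  rw [smoothFamFun_iff hS] at hf
  have h := hf x z hz _ (mem_extChartAt_target x)
  have h2 : ContDiffAt ℝ ∞ (fun z => f z ((extChartAt (𝓡 n) x).symm (extChartAt (𝓡 n) x x))) z :=
    ContDiffAt.comp (f := fun z => (z, extChartAt (𝓡 n) x x)) z h (by fun_prop)
  simpa only [extChartAt_to_inv] using h2

theorem chartForm_deriv {σ : ℝ → Form n M k} {S : Set ℝ} (hS : IsOpen S) (hσ : SmoothFamForm S σ) {t : ℝ} (ht : t ∈ S)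
    (x₀ : M) (y : Model n) :
    chartForm x₀ (fun x => deriv (fun s => σ s x) t) y = deriv (fun s => chartForm x₀ (σ s) y) t := by
  set p := (extChartAt (𝓡 n) x₀).symm y
  have h1 : HasDerivAt (fun s => σ s p) (deriv (fun s => σ s p) t) t :=
    ((hσ.contDiffAt_param hS ht p).differentiableAt (by simp)).hasDerivAt
  have h2 := (ContinuousAlternatingMap.compContinuousLinearMapCLM (𝕜 := ℝ) (F := ℝ) (ι := Fin k)
    (dsymm x₀ y)).hasFDerivAt.comp_hasDerivAt t h1
  exact h2.deriv.symm

theorem SmoothFamForm.deriv {σ : ℝ → Form n M k} {S : Set ℝ} (hS : IsOpen S) (hσ : SmoothFamForm S σ) :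
    SmoothFamForm S (fun t x => _root_.deriv (fun s => σ s x) t) := by
  have h0 := hσ
  rw [smoothFamForm_iff hS] at hσ ⊢
  intro x₀ t ht y hy
  have h1 := (contDiffAt_fderiv_fst (hσ x₀ t ht y hy)).clm_apply (contDiffAt_const (c := (1 : ℝ)))
  refine h1.congr_of_eventuallyEq ?_
  filter_upwards [eventually_mem_prod hS ht hy] with p hp
  exact chartForm_deriv hS h0 hp.1 x₀ p.2

theorem SmoothFamFun.deriv {f : ℝ → M → ℝ} {S : Set ℝ} (hS : IsOpen S) (hf : SmoothFamFun n S f) :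
    SmoothFamFun n S (fun t x => _root_.deriv (fun s => f s x) t) := by
  rw [smoothFamFun_iff hS] at *
  intro x₀ t ht y hy
  exact (contDiffAt_fderiv_fst (hf x₀ t ht y hy)).clm_apply (contDiffAt_const (c := (1 : ℝ)))

theorem chartVF_deriv {X : ℝ → VF n M} {S : Set ℝ} (hS : IsOpen S) (hX : SmoothFamVF S X) {t : ℝ} (ht : t ∈ S)
    (x₀ : M) (y : Model n) :
    chartVF x₀ (fun x => _root_.deriv (F := Model n) (fun s => X s x) t) y = _root_.deriv (fun s => chartVF x₀ (X s) y) t := by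
  have h1 : HasDerivAt (F := Model n) (fun s => X s ((extChartAt (𝓡 n) x₀).symm y)) _ t :=
    ((hX.contDiffAt_param hS ht ((extChartAt (𝓡 n) x₀).symm y)).differentiableAt (by simp)).hasDerivAt
  exact ((dchart x₀ ((extChartAt (𝓡 n) x₀).symm y)).hasFDerivAt.comp_hasDerivAt t h1).deriv.symm

theorem SmoothFamVF.deriv {X : ℝ → VF n M} {S : Set ℝ} (hS : IsOpen S) (hX : SmoothFamVF S X) :
    SmoothFamVF S (fun t x => _root_.deriv (F := Model n) (fun s => X s x) t) := by
  have h0 := hX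
  rw [smoothFamVF_iff hS] at hX
  refine (smoothFamVF_iff hS).2 ?_
  intro x₀ t ht y hy
  have h1 := (contDiffAt_fderiv_fst (hX x₀ t ht y hy)).clm_apply (contDiffAt_const (c := (1 : ℝ)))
  refine h1.congr_of_eventuallyEq ?_
  filter_upwards [eventually_mem_prod hS ht hy] with p hp
  exact chartVF_deriv hS h0 hp.1 x₀ p.2

/-! ### Exterior products and densities -/

/-- Naturality of the exterior product, read off from the basis-free expression `altSum_wedge2`. -/
theorem wedge2_comp {E F : Type*} [NormedAddCommGroup E] [NormedSpace ℝ E] [FiniteDimensional ℝ E]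
    [NormedAddCommGroup F] [NormedSpace ℝ F] [FiniteDimensional ℝ F]
    (β : E [⋀^Fin 2]→L[ℝ] ℝ) (P : E [⋀^Fin k]→L[ℝ] ℝ) (L : F →L[ℝ] E) :
    (wedge2 β P).compContinuousLinearMap L =
      wedge2 (β.compContinuousLinearMap L) (P.compContinuousLinearMap L) := by
  ext v
  have hk : (2 * k.factorial : ℝ) ≠ 0 := by positivity
  refine mul_left_cancel₀ hk ?_
  rw [ContinuousAlternatingMap.compContinuousLinearMap_apply, ← altSum_wedge2, ← altSum_wedge2]
  refine Finset.sum_congr rfl fun s _ => ?_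
  simp only [ContinuousAlternatingMap.compContinuousLinearMap_apply]
  congr 2
  congr 1
  ext i; fin_cases i <;> rfl

theorem extMul_comp {E F : Type*} [NormedAddCommGroup E] [NormedSpace ℝ E]
    [NormedAddCommGroup F] [NormedSpace ℝ F]
    (ℓ : E →L[ℝ] ℝ) (P : E [⋀^Fin k]→L[ℝ] ℝ) (L : F →L[ℝ] E) :
    (extMul ℓ P).compContinuousLinearMap L =
      extMul (ℓ.comp L) (P.compContinuousLinearMap L) := by
  ext v
  simp only [ContinuousAlternatingMap.compContinuousLinearMap_apply, extMul_apply]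
  rfl

theorem contDiffAt_wedge2 {D E : Type*} [NormedAddCommGroup E] [NormedSpace ℝ E] [FiniteDimensional ℝ E]
    [NormedAddCommGroup D] [NormedSpace ℝ D] {m : WithTop ℕ∞}
    {β : D → E [⋀^Fin 2]→L[ℝ] ℝ} {P : D → E [⋀^Fin k]→L[ℝ] ℝ} {z : D} (hβ : ContDiffAt ℝ m β z)
    (hP : ContDiffAt ℝ m P z) : ContDiffAt ℝ m (fun z => wedge2 (β z) (P z)) z := by
  refine contDiffAt_form fun v => ?_
  have hk : (2 * k.factorial : ℝ) ≠ 0 := by positivity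
  have e : ∀ z, wedge2 (β z) (P z) v = (2 * k.factorial : ℝ)⁻¹ *
      altSum (fun u => β z ![u 0, u 1] * P z (fun j => u j.succ.succ)) v := by
    intro z; rw [altSum_wedge2, inv_mul_cancel_left₀ hk]
  simp only [e, altSum]
  refine contDiffAt_const.mul (ContDiffAt.sum fun s _ => contDiffAt_const.mul (ContDiffAt.mul ?_ ?_))
  · exact contDiffAt_form_apply hβ (v := fun i _ => _) fun i => contDiffAt_const
  · exact contDiffAt_form_apply hP (v := fun i _ => _) fun i => contDiffAt_const

theorem contDiffAt_extMul {D E : Type*} [NormedAddCommGroup E] [NormedSpace ℝ E] [FiniteDimensional ℝ E]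
    [NormedAddCommGroup D] [NormedSpace ℝ D] {m : WithTop ℕ∞}
    {γ : D → E [⋀^Fin 1]→L[ℝ] ℝ} {P : D → E [⋀^Fin k]→L[ℝ] ℝ} {z : D} (hγ : ContDiffAt ℝ m γ z)
    (hP : ContDiffAt ℝ m P z) : ContDiffAt ℝ m (fun z => extMul (lin1 (γ z)) (P z)) z := by
  refine contDiffAt_form fun v => ?_
  simp only [extMul_apply, lin1_apply]
  refine ContDiffAt.sum fun s _ => contDiffAt_const.mul (ContDiffAt.mul ?_ ?_)
  · exact contDiffAt_form_apply hγ (v := fun i _ => _) fun i => contDiffAt_const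
  · exact contDiffAt_form_apply hP (v := fun i _ => _) fun i => contDiffAt_const

/-- The form `β ∧ P` for a `2`-form `β`. -/
def wedgeF (β : Form n M 2) (P : Form n M k) : Form n M (k + 2) := fun x => wedge2 (β x) (P x)

/-- The form `γ ∧ P` for a `1`-form `γ`. -/
def extMulF (γ : Form n M 1) (P : Form n M k) : Form n M (k + 1) := fun x => extMul (lin1 (γ x)) (P x)

theorem chartForm_wedgeF (β : Form n M 2) (P : Form n M k) (x₀ : M) (y : Model n) :
    chartForm x₀ (wedgeF β P) y = wedge2 (chartForm x₀ β y) (chartForm x₀ P y) :=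
  wedge2_comp _ _ _

theorem chartForm_extMulF (γ : Form n M 1) (P : Form n M k) (x₀ : M) (y : Model n) :
    chartForm x₀ (extMulF γ P) y = extMul (lin1 (chartForm x₀ γ y)) (chartForm x₀ P y) :=
  extMul_comp _ _ _

theorem SmoothFamForm.wedgeF {β : Z → Form n M 2} {P : Z → Form n M k} (hS : IsOpen S)
    (hβ : SmoothFamForm S β) (hP : SmoothFamForm S P) :
    SmoothFamForm S (fun z => CompMHD.wedgeF (β z) (P z)) := by
  rw [smoothFamForm_iff hS] at *
  intro x₀ z hz y hy
  simp only [chartForm_wedgeF]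
  exact contDiffAt_wedge2 (hβ x₀ z hz y hy) (hP x₀ z hz y hy)

theorem SmoothFamForm.extMulF {γ : Z → Form n M 1} {P : Z → Form n M k} (hS : IsOpen S)
    (hγ : SmoothFamForm S γ) (hP : SmoothFamForm S P) :
    SmoothFamForm S (fun z => CompMHD.extMulF (γ z) (P z)) := by
  rw [smoothFamForm_iff hS] at *
  intro x₀ z hz y hy
  simp only [chartForm_extMulF]
  exact contDiffAt_extMul (hγ x₀ z hz y hy) (hP x₀ z hz y hy)

/-- The standard basis of `ℝⁿ`. -/
def stdB (n : ℕ) : Module.Basis (Fin n) ℝ (Model n) := (EuclideanSpace.basisFun (Fin n) ℝ).toBasis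

theorem stdB_apply (i : Fin n) : stdB n i = EuclideanSpace.single i (1 : ℝ) := by
  simp [stdB]

theorem coe_stdB : (stdB n : Fin n → Model n) = fun i => EuclideanSpace.single i (1 : ℝ) :=
  funext stdB_apply

theorem stdBasis_eq (x : M) : (stdBasis x : Fin n → Model n) = stdB n := (coe_stdB).symm

/-- The function `σ / μ` for a top-degree form `σ`. -/
def dens (μ σ : Form n M n) : M → ℝ := density μ fun x => (σ x).toAlternatingMap

theorem dens_apply (μ σ : Form n M n) (x : M) : dens μ σ x = σ x (stdB n) / μ x (stdB n) := by
  rw [← stdBasis_eq x]; rfl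

theorem dens_smul_eq {μ σ : Form n M n} {x : M} (hμ : μ x ≠ 0) : dens μ σ x • μ x = σ x := by
  apply form_eq_of_apply_basis (stdB n)
  rw [dens_apply, ContinuousAlternatingMap.smul_apply, smul_eq_mul,
    div_mul_cancel₀ _ (form_apply_basis_ne_zero _ _ hμ)]

theorem dens_eq {μ σ : Form n M n} {x : M} (hμ : μ x ≠ 0) {c : ℝ} (h : σ x = c • μ x) :
    dens μ σ x = c := by
  have h1 := dens_smul_eq (σ := σ) hμ
  rw [h] at h1
  exact smul_left_injective ℝ hμ h1

theorem chartForm_ne_zero {μ : Form n M k} (hμ : ∀ x, μ x ≠ 0) {x₀ : M} {y : Model n}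
    (hy : y ∈ (extChartAt (𝓡 n) x₀).target) : chartForm x₀ μ y ≠ 0 := by
  intro h
  have h1 := form_eq_chartForm μ ((extChartAt (𝓡 n) x₀).map_target hy)
  rw [(extChartAt (𝓡 n) x₀).right_inv hy, h] at h1
  exact hμ _ (h1.trans rfl)

theorem dens_chart {μ σ : Form n M n} (hμ : ∀ x, μ x ≠ 0) {x₀ : M} {y : Model n}
    (hy : y ∈ (extChartAt (𝓡 n) x₀).target) :
    dens μ σ ((extChartAt (𝓡 n) x₀).symm y) = chartForm x₀ σ y (stdB n) / chartForm x₀ μ y (stdB n) := by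
  have h := dens_smul_eq (σ := σ) (hμ ((extChartAt (𝓡 n) x₀).symm y))
  rw [chartForm_apply x₀ σ, ← h, eq_div_iff (form_apply_basis_ne_zero _ _ (chartForm_ne_zero hμ hy))]
  rfl

theorem SmoothFamForm.dens {μ : Form n M n} {σ : Z → Form n M n} (hS : IsOpen S) (hμ : SmoothForm μ)
    (h0 : ∀ x, μ x ≠ 0) (hσ : SmoothFamForm S σ) : SmoothFamFun n S (fun z => CompMHD.dens μ (σ z)) := by
  rw [smoothFamForm_iff hS] at hσ
  rw [smoothFamFun_iff hS]
  intro x₀ z hz y hy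
  have h1 : ContDiffAt ℝ ∞ (fun p : Z × Model n => chartForm x₀ (σ p.1) p.2 (stdB n)) (z, y) :=
    contDiffAt_form_apply (v := fun i _ => stdB n i) (hσ x₀ z hz y hy) fun i => contDiffAt_const
  have h2 : ContDiffAt ℝ ∞ (fun p : Z × Model n => chartForm x₀ μ p.2 (stdB n)) (z, y) :=
    contDiffAt_form_apply (v := fun i _ => stdB n i)
      (ContDiffAt.comp (z, y) (contDiffAt_chartForm hμ hy) contDiffAt_snd) fun i => contDiffAt_const
  refine (h1.div h2 (form_apply_basis_ne_zero _ _ (chartForm_ne_zero h0 hy))).congr_of_eventuallyEq ?_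
  filter_upwards [eventually_snd_tgt hy] with p hp
  exact dens_chart h0 hp

end SmoothOps

/-! ### Integration -/
section Euclid
variable {E F : Type*} [NormedAddCommGroup E] [NormedSpace ℝ E] [NormedAddCommGroup F] [NormedSpace ℝ F]

/-- Extension by zero of a function that vanishes off a compact subset of an open set. -/
theorem contDiff_indicator {T K : Set E} (hT : IsOpen T) (hK : IsCompact K) (hKT : K ⊆ T) {m : WithTop ℕ∞}
    {u : E → F} (hu : ContDiffOn ℝ m u T) (h0 : ∀ y ∈ T, y ∉ K → u y = 0) :
    ContDiff ℝ m (T.indicator u) ∧ HasCompactSupport (T.indicator u) := by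
  constructor
  · rw [contDiff_iff_contDiffAt]
    intro y
    by_cases hy : y ∈ T
    · refine (hu.contDiffAt (hT.mem_nhds hy)).congr_of_eventuallyEq ?_
      filter_upwards [hT.mem_nhds hy] with z hz
      exact indicator_of_mem hz _
    · refine (contDiffAt_const (c := (0 : F))).congr_of_eventuallyEq ?_
      filter_upwards [hK.isClosed.isOpen_compl.mem_nhds fun h => hy (hKT h)] with z hz
      by_cases hzT : z ∈ T
      · rw [indicator_of_mem hzT, h0 z hzT hz]
      · exact indicator_of_notMem hzT _
  · refine HasCompactSupport.intro hK fun y hy => ?_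
    by_cases hyT : y ∈ T
    · rw [indicator_of_mem hyT, h0 y hyT hy]
    · exact indicator_of_notMem hyT _

theorem integral_fderiv_eq_zero [FiniteDimensional ℝ E] [MeasurableSpace E] [BorelSpace E] {u : E → ℝ}
    (ν : Measure E) [ν.IsAddHaarMeasure] (hu : ContDiff ℝ 1 u) (hc : HasCompactSupport u) (v : E) :
    ∫ x, fderiv ℝ u x v ∂ν = 0 := by
  have h1 : Continuous fun x => fderiv ℝ u x v :=
    (hu.continuous_fderiv (by simp)).clm_apply continuous_const
  have h2 : HasCompactSupport fun x => fderiv ℝ u x v := hc.fderiv_apply (𝕜 := ℝ) v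
  have h := integral_mul_fderiv_eq_neg_fderiv_mul_of_integrable (μ := ν) (f := u) (g := fun _ => (1 : ℝ)) (v := v)
    (by simpa using h1.integrable_of_hasCompactSupport h2) (by simp)
    (by simpa using hu.continuous.integrable_of_hasCompactSupport hc)
    (fun x _ => (hu.differentiable (by simp)) x) (fun x _ => differentiableAt_const _)
  simpa using h.symm

/-- Stokes' theorem for compactly supported forms of degree `k` on `ℝ^(k+1)`. -/
theorem integral_extDeriv_eq_zero [FiniteDimensional ℝ E] [MeasurableSpace E] [BorelSpace E] {k : ℕ}
    (ν : Measure E) [ν.IsAddHaarMeasure] {τ : E → E [⋀^Fin k]→L[ℝ] ℝ} (hτ : ContDiff ℝ 1 τ)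
    (hc : HasCompactSupport τ) (v : Fin (k + 1) → E) : ∫ y, extDeriv τ y v ∂ν = 0 := by
  have e : ∀ y, extDeriv τ y v = ∑ i, (-1 : ℝ) ^ i.val * fderiv ℝ (fun y => τ y (i.removeNth v)) y (v i) := by
    intro y
    rw [extDeriv_apply (hτ.differentiable (by simp) y)]
    simp
  have hd : ∀ w : Fin k → E, ContDiff ℝ 1 fun y => τ y w := fun w =>
    contDiff_iff_contDiffAt.2 fun y => contDiffAt_form_apply (v := fun i _ => w i) hτ.contDiffAt fun _ => contDiffAt_const
  have hcw : ∀ w : Fin k → E, HasCompactSupport fun y => τ y w := fun w =>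
    hc.comp_left (g := fun σ : E [⋀^Fin k]→L[ℝ] ℝ => σ w) rfl
  simp only [e]
  rw [integral_finsetSum]
  · refine Finset.sum_eq_zero fun i _ => ?_
    rw [integral_const_mul, integral_fderiv_eq_zero ν (hd _) (hcw _), mul_zero]
  · intro i _
    refine Integrable.const_mul ?_ _
    exact (((hd _).continuous_fderiv (by simp)).clm_apply continuous_const).integrable_of_hasCompactSupport
      ((hcw _).fderiv_apply (𝕜 := ℝ) _)

/-- A form of top degree is pulled back by a linear map through the determinant. -/
theorem form_comp_basis {n : ℕ} (b : Module.Basis (Fin n) ℝ E) (σ : E [⋀^Fin n]→L[ℝ] ℝ) (L : E →L[ℝ] E) :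
    σ.compContinuousLinearMap L b = L.det * σ b := by
  have h := AlternatingMap.eq_smul_basis_det b σ.toAlternatingMap
  have h1 : σ (fun i => L (b i)) = σ b * b.det (fun i => L (b i)) :=
    congrArg (fun T : E [⋀^Fin n]→ₗ[ℝ] ℝ => T (fun i => L (b i))) h
  have h2 : b.det (fun i => L (b i)) = L.det * b.det b := Module.Basis.det_comp b L.toLinearMap b
  rw [Module.Basis.det_self, mul_one] at h2
  change σ (fun i => L (b i)) = _
  rw [h1, h2, mul_comm]

end Euclid

section Integration
variable {n : ℕ} {M : Type u} [TopologicalSpace M] [ChartedSpace (Model n) M] [IsManifold (𝓡 n) ∞ M]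
  [CompactSpace M] [T2Space M]

theorem chartPartition_subordinate (i : M) :
    tsupport (chartPartition n M i) ⊆ (extChartAt (𝓡 n) i).source := by
  rw [extChartAt_source]
  exact (SmoothPartitionOfUnity.exists_isSubordinate_chartAt_source (𝓡 n) M).choose_spec i

/-- The finitely many indices at which the partition of unity is not zero. -/
def chartIndex (n : ℕ) (M : Type u) [TopologicalSpace M] [ChartedSpace (Model n) M] [IsManifold (𝓡 n) ∞ M]
    [CompactSpace M] [T2Space M] : Finset M :=
  ((chartPartition n M).locallyFinite.finite_nonempty_of_compact).toFinset

theorem chartPartition_eq_zero {i : M} (hi : i ∉ chartIndex n M) (x : M) : chartPartition n M i x = 0 := by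
  by_contra h
  exact hi (by
    rw [chartIndex, Set.Finite.mem_toFinset]
    exact ⟨x, h⟩)

theorem sum_chartPartition (x : M) : ∑ i ∈ chartIndex n M, chartPartition n M i x = 1 := by
  rw [← (chartPartition n M).sum_eq_one (mem_univ x)]
  symm
  refine finsum_eq_sum_of_support_subset _ fun i hi => ?_
  by_contra h
  exact hi (chartPartition_eq_zero h x)

theorem smooth_chartPartition (i : M) : SmoothFun (n := n) (fun x => chartPartition n M i x) :=
  (chartPartition n M i).contMDiff

theorem isCompact_chart_image {i : M} {K : Set M} (hK : IsClosed K) (h : K ⊆ (extChartAt (𝓡 n) i).source) :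
    IsCompact (extChartAt (𝓡 n) i '' K) :=
  hK.isCompact.image_of_continuousOn ((continuousOn_extChartAt i).mono h)

theorem chart_image_subset {i : M} {K : Set M} (h : K ⊆ (extChartAt (𝓡 n) i).source) :
    extChartAt (𝓡 n) i '' K ⊆ (extChartAt (𝓡 n) i).target := by
  rintro _ ⟨x, hx, rfl⟩
  exact (extChartAt (𝓡 n) i).map_source (h hx)

theorem symm_notMem {i : M} {K : Set M} {y : Model n} (hy : y ∈ (extChartAt (𝓡 n) i).target)
    (h : y ∉ extChartAt (𝓡 n) i '' K) : (extChartAt (𝓡 n) i).symm y ∉ K :=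
  fun hK => h ⟨_, hK, (extChartAt (𝓡 n) i).right_inv hy⟩

theorem continuousOn_symm (i : M) : ContinuousOn (extChartAt (𝓡 n) i).symm (extChartAt (𝓡 n) i).target :=
  continuousOn_extChartAt_symm i

/-- A product `f · G` of a function supported in a chart and a continuous function on the chart is
integrable. -/
theorem integrableOn_chart {i : M} {f : M → ℝ} (hf : Continuous f) (hs : tsupport f ⊆ (extChartAt (𝓡 n) i).source)
    {G : Model n → ℝ} (hG : ContinuousOn G (extChartAt (𝓡 n) i).target) :
    IntegrableOn (fun y => f ((extChartAt (𝓡 n) i).symm y) * G y) (extChartAt (𝓡 n) i).target volume := by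
  have hu : ContDiffOn ℝ 0 (fun y => f ((extChartAt (𝓡 n) i).symm y) * G y) (extChartAt (𝓡 n) i).target :=
    contDiffOn_zero.2 ((hf.comp_continuousOn (continuousOn_symm i)).mul hG)
  obtain ⟨h1, h2⟩ := contDiff_indicator (isOpen_tgt i) (isCompact_chart_image (isClosed_tsupport f) hs)
    (chart_image_subset hs) hu (fun y hy h => by
      rw [image_eq_zero_of_notMem_tsupport (symm_notMem hy h), zero_mul])
  rw [← integrable_indicator_iff (isOpen_tgt i).measurableSet]
  exact h1.continuous.integrable_of_hasCompactSupport h2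

variable [MeasurableSpace M] [BorelSpace M] {μ : Form n M n}

/-- The coefficient of a top-degree form in a chart. -/
def coef (μ : Form n M n) (i : M) (y : Model n) : ℝ := chartForm i μ y (stdB n)

omit [CompactSpace M] [T2Space M] [MeasurableSpace M] [BorelSpace M] in
theorem contDiffOn_coef (hμ : SmoothForm μ) (i : M) : ContDiffOn ℝ ∞ (coef μ i) (extChartAt (𝓡 n) i).target :=
  fun _ hy => (contDiffAt_form_apply (v := fun j _ => stdB n j) (contDiffAt_chartForm hμ hy)
    fun _ => contDiffAt_const).contDiffWithinAt

omit [CompactSpace M] [T2Space M] [MeasurableSpace M] [BorelSpace M] in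
theorem coef_ne_zero (h0 : ∀ x, μ x ≠ 0) {i : M} {y : Model n} (hy : y ∈ (extChartAt (𝓡 n) i).target) : coef μ i y ≠ 0 :=
  form_apply_basis_ne_zero _ _ (chartForm_ne_zero h0 hy)

/-- The part of the volume measure carried by the chart at `i`. -/
def partMeasure (μ : Form n M n) (i : M) : Measure M :=
  (((volume : Measure (Model n)).restrict (extChartAt (𝓡 n) i).target).withDensity fun y =>
      ENNReal.ofReal (chartPartition n M i ((extChartAt (𝓡 n) i).symm y) * |coef μ i y|)).map
      (extChartAt (𝓡 n) i).symm

/-- By compactness only finitely many members of the partition of unity contribute. -/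
theorem volMeasure_eq_sum (μ : Form n M n) :
    volMeasure μ = ∑ i ∈ chartIndex n M, partMeasure μ i := by
  have h : volMeasure μ = Measure.sum (partMeasure μ) := by
    unfold volMeasure partMeasure coef
    rw [coe_stdB]
  rw [h]
  ext s hs
  rw [Measure.sum_apply _ hs, Measure.finsetSum_apply]
  refine tsum_eq_sum fun i hi => ?_
  have : partMeasure μ i = 0 := by
    unfold partMeasure
    simp [chartPartition_eq_zero hi]
  simp [this]

theorem continuousOn_density (hμ : SmoothForm μ) (i : M) : ContinuousOn
    (fun y => chartPartition n M i ((extChartAt (𝓡 n) i).symm y) * |coef μ i y|) (extChartAt (𝓡 n) i).target :=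
  (((smooth_chartPartition i).continuous).comp_continuousOn (continuousOn_symm i)).mul (contDiffOn_coef hμ i).continuousOn.abs

theorem aemeasurable_symm (i : M) {ν : Measure (Model n)} : AEMeasurable (extChartAt (𝓡 n) i).symm
    (ν.restrict (extChartAt (𝓡 n) i).target) :=
  (continuousOn_symm i).aemeasurable (isOpen_tgt i).measurableSet

theorem aemeasurable_density (hμ : SmoothForm μ) (i : M) : AEMeasurable
    (fun y => ENNReal.ofReal (chartPartition n M i ((extChartAt (𝓡 n) i).symm y) * |coef μ i y|))
    (volume.restrict (extChartAt (𝓡 n) i).target) :=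
  ((continuousOn_density hμ i).aemeasurable (isOpen_tgt i).measurableSet).ennreal_ofReal

theorem isFiniteMeasure_part (hμ : SmoothForm μ) (i : M) : IsFiniteMeasure (partMeasure μ i) := by
  have h := integrableOn_chart (smooth_chartPartition (n := n) i).continuous (chartPartition_subordinate i)
    (contDiffOn_coef hμ i).continuousOn.abs
  have h2 := h.lintegral_lt_top
  have : IsFiniteMeasure (((volume : Measure (Model n)).restrict (extChartAt (𝓡 n) i).target).withDensity fun y =>
      ENNReal.ofReal (chartPartition n M i ((extChartAt (𝓡 n) i).symm y) * |coef μ i y|)) :=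
    isFiniteMeasure_withDensity h2.ne
  exact Measure.isFiniteMeasure_map _ _

theorem isFiniteMeasure_vol (hμ : SmoothForm μ) : IsFiniteMeasure (volMeasure μ) := by
  rw [volMeasure_eq_sum]
  have : ∀ i, IsFiniteMeasure (partMeasure μ i) := isFiniteMeasure_part hμ
  infer_instance

theorem integrable_of_continuous (hμ : SmoothForm μ) {f : M → ℝ} (hf : Continuous f) : Integrable f (volMeasure μ) := by
  have := isFiniteMeasure_vol hμ
  obtain ⟨C, hC⟩ := (isCompact_range hf).isBounded.exists_norm_le
  exact Integrable.of_bound hf.aestronglyMeasurable C (Eventually.of_forall fun x => hC _ ⟨x, rfl⟩)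

theorem integral_part (hμ : SmoothForm μ) (i : M) {f : M → ℝ} (hf : Continuous f) :
    ∫ x, f x ∂(partMeasure μ i) = ∫ y in (extChartAt (𝓡 n) i).target,
      |coef μ i y| * (chartPartition n M i ((extChartAt (𝓡 n) i).symm y) * f ((extChartAt (𝓡 n) i).symm y)) := by
  unfold partMeasure
  rw [integral_map ((aemeasurable_symm i).mono_ac (withDensity_absolutelyContinuous _ _)) hf.aestronglyMeasurable,
    integral_withDensity_eq_integral_toReal_smul₀ (aemeasurable_density hμ i) (Eventually.of_forall fun _ => ENNReal.ofReal_lt_top)]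
  refine integral_congr_ae (Eventually.of_forall fun y => ?_)
  simp only [smul_eq_mul]
  rw [ENNReal.toReal_ofReal (mul_nonneg ((chartPartition n M).nonneg _ _) (abs_nonneg _))]
  ring

omit [CompactSpace M] [T2Space M] [MeasurableSpace M] [BorelSpace M] in
/-- Change of variables between two charts. -/
theorem integral_chart_change (i j : M) {f : M → ℝ}
    (hf : ∀ x, f x ≠ 0 → x ∈ (extChartAt (𝓡 n) i).source ∧ x ∈ (extChartAt (𝓡 n) j).source) :
    ∫ y in (extChartAt (𝓡 n) i).target, |coef μ i y| * f ((extChartAt (𝓡 n) i).symm y) =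
      ∫ y in (extChartAt (𝓡 n) j).target, |coef μ j y| * f ((extChartAt (𝓡 n) j).symm y) := by
  -- The integrand vanishes off the overlap of the charts, where the change of variables applies.
  have red : ∀ i j : M, (∀ x, f x ≠ 0 → x ∈ (extChartAt (𝓡 n) i).source ∧ x ∈ (extChartAt (𝓡 n) j).source) →
      ∫ y in (extChartAt (𝓡 n) i).target, |coef μ i y| * f ((extChartAt (𝓡 n) i).symm y) =
      ∫ y in (extChartAt (𝓡 n) i).target ∩ (extChartAt (𝓡 n) i).symm ⁻¹' (extChartAt (𝓡 n) j).source,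
        |coef μ i y| * f ((extChartAt (𝓡 n) i).symm y) := by
    intro i j hf
    refine setIntegral_eq_of_subset_of_forall_sdiff_eq_zero (isOpen_tgt i).measurableSet inter_subset_left ?_
    intro y hy
    by_contra h
    have h1 : f ((extChartAt (𝓡 n) i).symm y) ≠ 0 := fun h0 => h (by rw [h0, mul_zero])
    exact hy.2 ⟨hy.1, (hf _ h1).2⟩
  rw [red i j hf, red j i fun x hx => (hf x hx).symm]
  set U := (extChartAt (𝓡 n) i).target ∩ (extChartAt (𝓡 n) i).symm ⁻¹' (extChartAt (𝓡 n) j).source with hU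
  set τ : Model n → Model n := fun y => extChartAt (𝓡 n) j ((extChartAt (𝓡 n) i).symm y)
  have him : (extChartAt (𝓡 n) j).target ∩ (extChartAt (𝓡 n) j).symm ⁻¹' (extChartAt (𝓡 n) i).source = τ '' U := by
    ext z
    constructor
    · rintro ⟨h1, h2⟩
      refine ⟨extChartAt (𝓡 n) i ((extChartAt (𝓡 n) j).symm z), ⟨(extChartAt (𝓡 n) i).map_source h2, ?_⟩, ?_⟩
      · change (extChartAt (𝓡 n) i).symm _ ∈ (extChartAt (𝓡 n) j).source
        rw [(extChartAt (𝓡 n) i).left_inv h2]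
        exact (extChartAt (𝓡 n) j).map_target h1
      · simp only [τ]
        rw [(extChartAt (𝓡 n) i).left_inv h2, (extChartAt (𝓡 n) j).right_inv h1]
    · rintro ⟨y, ⟨h1, h2⟩, rfl⟩
      refine ⟨(extChartAt (𝓡 n) j).map_source h2, ?_⟩
      rw [mem_preimage, (extChartAt (𝓡 n) j).left_inv h2]
      exact (extChartAt (𝓡 n) i).map_target h1
  have hUo : IsOpen U := (continuousOn_extChartAt_symm i).isOpen_inter_preimage (isOpen_tgt i)
    (isOpen_extChartAt_source j)
  have hinj : InjOn τ U := by
    intro y hy z hz h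
    have h2 := (extChartAt (𝓡 n) j).injOn hy.2 hz.2 h
    exact (extChartAt (𝓡 n) i).symm.injOn hy.1 hz.1 h2
  rw [him, integral_image_eq_integral_abs_det_fderiv_smul volume hUo.measurableSet
    (fun y hy => ((contDiffAt_transition hy.1 hy.2).differentiableAt (by simp)).hasFDerivAt.hasFDerivWithinAt) hinj]
  refine setIntegral_congr_fun hUo.measurableSet fun y hy => ?_
  simp only [smul_eq_mul]
  rw [(extChartAt (𝓡 n) j).left_inv hy.2]
  have h3 : coef μ i y = (fderiv ℝ τ y).det * coef μ j (τ y) := by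
    unfold coef
    rw [chartForm_change μ hy.1 hy.2, form_comp_basis]
  rw [h3, abs_mul, mul_assoc]

theorem integ_eq_sum (hμ : SmoothForm μ) {f : M → ℝ} (hf : Continuous f) :
    integ μ f = ∑ i ∈ chartIndex n M, ∫ y in (extChartAt (𝓡 n) i).target,
      |coef μ i y| * (chartPartition n M i ((extChartAt (𝓡 n) i).symm y) * f ((extChartAt (𝓡 n) i).symm y)) := by
  unfold integ
  have h := integrable_of_continuous hμ hf
  rw [volMeasure_eq_sum] at h ⊢
  rw [integral_finsetSum_measure fun i hi => ?_]
  · exact Finset.sum_congr rfl fun i _ => integral_part hμ i hf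
  · exact h.mono_measure (Finset.single_le_sum (f := fun i => partMeasure μ i) (fun _ _ => Measure.zero_le _) hi)

/-- The integral of a function supported in a chart is computed in that chart. -/
theorem integ_eq_chart (hμ : SmoothForm μ) {f : M → ℝ} (hf : Continuous f) {j : M}
    (hs : tsupport f ⊆ (extChartAt (𝓡 n) j).source) :
    integ μ f = ∫ y in (extChartAt (𝓡 n) j).target, |coef μ j y| * f ((extChartAt (𝓡 n) j).symm y) := by
  rw [integ_eq_sum hμ hf]
  have h1 : ∀ i ∈ chartIndex n M, ∫ y in (extChartAt (𝓡 n) i).target,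
      |coef μ i y| * (chartPartition n M i ((extChartAt (𝓡 n) i).symm y) * f ((extChartAt (𝓡 n) i).symm y)) =
      ∫ y in (extChartAt (𝓡 n) j).target,
      |coef μ j y| * (chartPartition n M i ((extChartAt (𝓡 n) j).symm y) * f ((extChartAt (𝓡 n) j).symm y)) := by
    intro i _
    refine integral_chart_change i j (f := fun x => chartPartition n M i x * f x) fun x hx => ?_
    exact ⟨chartPartition_subordinate i (subset_tsupport _ (left_ne_zero_of_mul hx)),
      hs (subset_tsupport _ (right_ne_zero_of_mul hx))⟩
  rw [Finset.sum_congr rfl h1, ← integral_finsetSum]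
  · refine integral_congr_ae (Eventually.of_forall fun y => ?_)
    simp only
    rw [← Finset.mul_sum, ← Finset.sum_mul, sum_chartPartition, one_mul]
  · intro i _
    have h2 := integrableOn_chart (i := j) (f := fun x => chartPartition n M i x * f x)
      ((smooth_chartPartition i).continuous.mul hf)
      ((closure_mono fun x hx => right_ne_zero_of_mul hx).trans hs) (contDiffOn_coef hμ j).continuousOn.abs
    refine h2.congr (Eventually.of_forall fun y => ?_)
    simp only
    ring

theorem integ_sum (hμ : SmoothForm μ) {ι : Type*} (s : Finset ι) {f : ι → M → ℝ} (hf : ∀ i ∈ s, Continuous (f i)) :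
    integ μ (fun x => ∑ i ∈ s, f i x) = ∑ i ∈ s, integ μ (f i) :=
  integral_finsetSum _ fun i hi => integrable_of_continuous hμ (hf i hi)

theorem integ_add (hμ : SmoothForm μ) {f g : M → ℝ} (hf : Continuous f) (hg : Continuous g) :
    integ μ (fun x => f x + g x) = integ μ f + integ μ g :=
  integral_add (integrable_of_continuous hμ hf) (integrable_of_continuous hμ hg)

theorem integ_sub (hμ : SmoothForm μ) {f g : M → ℝ} (hf : Continuous f) (hg : Continuous g) :
    integ μ (fun x => f x - g x) = integ μ f - integ μ g :=
  integral_sub (integrable_of_continuous hμ hf) (integrable_of_continuous hμ hg)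

theorem integ_neg (f : M → ℝ) : integ μ (fun x => -f x) = -integ μ f := integral_neg f

theorem integ_const_mul (c : ℝ) (f : M → ℝ) : integ μ (fun x => c * f x) = c * integ μ f :=
  integral_const_mul c f

/-- Nonempty open sets have positive volume. -/
theorem volMeasure_pos (hμ : SmoothForm μ) (h0 : ∀ x, μ x ≠ 0) {U : Set M} (hU : IsOpen U) (hne : U.Nonempty) :
    0 < volMeasure μ U := by
  obtain ⟨x, hx⟩ := hne
  -- Near a point of `U` some member of the partition of unity is positive.
  obtain ⟨i, hi⟩ := (chartPartition n M).exists_pos_of_mem (mem_univ x)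
  have hiF : i ∈ chartIndex n M := by
    by_contra h
    rw [chartPartition_eq_zero h] at hi
    exact lt_irrefl _ hi
  have hxs : x ∈ (extChartAt (𝓡 n) i).source := chartPartition_subordinate i (subset_tsupport _ hi.ne')
  set T := (extChartAt (𝓡 n) i).target
  set V : Set (Model n) := T ∩ (extChartAt (𝓡 n) i).symm ⁻¹' (U ∩ {x | 0 < chartPartition n M i x})
  have hVo : IsOpen V := (continuousOn_extChartAt_symm i).isOpen_inter_preimage (isOpen_tgt i)
    (hU.inter (isOpen_lt continuous_const (smooth_chartPartition (n := n) i).continuous))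
  have hVne : V.Nonempty := ⟨extChartAt (𝓡 n) i x, (extChartAt (𝓡 n) i).map_source hxs, by
    rw [mem_preimage, (extChartAt (𝓡 n) i).left_inv hxs]; exact ⟨hx, hi⟩⟩
  have h1 : 0 < partMeasure μ i U := by
    unfold partMeasure
    rw [Measure.map_apply_of_aemeasurable ((aemeasurable_symm i).mono_ac (withDensity_absolutelyContinuous _ _)) hU.measurableSet]
    refine pos_iff_ne_zero.2 fun hz => ?_
    have hz2 : (((volume : Measure (Model n)).restrict T).withDensity fun y =>
      ENNReal.ofReal (chartPartition n M i ((extChartAt (𝓡 n) i).symm y) * |coef μ i y|)) V = 0 :=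
      measure_mono_null (fun y hy => hy.2.1) hz
    rw [withDensity_apply _ hVo.measurableSet, Measure.restrict_restrict hVo.measurableSet,
      inter_eq_left.2 (inter_subset_left : V ⊆ T)] at hz2
    have hm := (aemeasurable_density hμ i).mono_measure (Measure.restrict_mono (inter_subset_left : V ⊆ T) le_rfl)
    have hz3 := (lintegral_eq_zero_iff' hm).1 hz2
    have hz4 : ∀ᵐ y ∂(volume.restrict V), False := by
      filter_upwards [hz3, ae_restrict_mem hVo.measurableSet] with y h1 h2
      have : 0 < chartPartition n M i ((extChartAt (𝓡 n) i).symm y) * |coef μ i y| :=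
        mul_pos h2.2.2 (abs_pos.2 (coef_ne_zero h0 h2.1))
      simp only [Pi.zero_apply, ENNReal.ofReal_eq_zero] at h1
      linarith
    rw [ae_iff] at hz4
    simp at hz4
    exact (hVo.measure_pos volume hVne).ne' hz4
  rw [volMeasure_eq_sum]
  refine h1.trans_le ?_
  exact (Finset.single_le_sum (f := fun i => partMeasure μ i) (fun _ _ => Measure.zero_le _) hiF) U

/-- A nonnegative continuous function with vanishing integral is zero. -/
theorem eq_zero_of_integ_eq_zero (hμ : SmoothForm μ) (h0 : ∀ x, μ x ≠ 0) {f : M → ℝ} (hf : Continuous f)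
    (hp : ∀ x, 0 ≤ f x) (h : integ μ f = 0) (x : M) : f x = 0 := by
  by_contra hx
  have h1 := (integral_eq_zero_iff_of_nonneg hp (integrable_of_continuous hμ hf)).1 h
  have h2 : volMeasure μ {x | f x ≠ 0} = 0 := by
    have := ae_iff.1 h1
    simpa using this
  exact (volMeasure_pos hμ h0 (isOpen_ne_fun hf continuous_const) ⟨x, hx⟩).ne' h2

omit [CompactSpace M] [T2Space M] [MeasurableSpace M] [BorelSpace M] in
theorem SmoothFun.continuous {f : M → ℝ} (hf : SmoothFun (n := n) f) : Continuous f := ContMDiff.continuous hf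

omit [CompactSpace M] [T2Space M] [MeasurableSpace M] [BorelSpace M] in
theorem SmoothFamFun.continuousOn {S : Set ℝ} {f : ℝ → M → ℝ} (hf : SmoothFamFun n S f) :
    ContinuousOn (fun p : ℝ × M => f p.1 p.2) (S ×ˢ univ) := ContMDiffOn.continuousOn hf

/-- Differentiation under the integral sign. -/
theorem hasDerivAt_integ (hμ : SmoothForm μ) {S : Set ℝ} (hS : IsOpen S) {f : ℝ → M → ℝ} (hf : SmoothFamFun n S f)
    {t : ℝ} (ht : t ∈ S) :
    HasDerivAt (fun s => integ μ (f s)) (integ μ (fun x => deriv (fun s => f s x) t)) t := by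
  obtain ⟨r, hr, hrS⟩ := Metric.nhds_basis_closedBall.mem_iff.1 (hS.mem_nhds ht)
  have hd := hf.deriv hS
  have := isFiniteMeasure_vol hμ
  have hK : IsCompact (Metric.closedBall t r ×ˢ (univ : Set M)) := (isCompact_closedBall t r).prod isCompact_univ
  have hc : ContinuousOn (fun p : ℝ × M => deriv (fun s => f s p.2) p.1) (Metric.closedBall t r ×ˢ univ) :=
    hd.continuousOn.mono (prod_mono hrS le_rfl)
  -- The constant dominates the derivative on a compact time interval; the measure is finite.
  obtain ⟨C, hC⟩ := (hK.image_of_continuousOn hc).isBounded.exists_norm_le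
  refine (hasDerivAt_integral_of_dominated_loc_of_deriv_le (μ := volMeasure μ) (F := f)
    (F' := fun s x => deriv (fun s => f s x) s) (bound := fun _ => C) (Metric.closedBall_mem_nhds t hr)
    ?_ (integrable_of_continuous hμ (hf.at ht).continuous) ?_ ?_ (integrable_const C) ?_).2
  · filter_upwards [hS.mem_nhds ht] with s hs
    exact (hf.at hs).continuous.aestronglyMeasurable
  · exact (hd.at ht).continuous.aestronglyMeasurable
  · exact Eventually.of_forall fun x s hs => hC _ ⟨(s, x), ⟨hs, mem_univ _⟩, rfl⟩
  · exact Eventually.of_forall fun x s hs =>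
      ((hf.contDiffAt_param hS (hrS hs) x).differentiableAt (by simp)).hasDerivAt

end Integration

section Stokes
variable {k : ℕ} {M : Type u} [TopologicalSpace M] [ChartedSpace (Model (k + 1)) M] [IsManifold (𝓡 (k + 1)) ∞ M]

theorem extDeriv_const_zero {E : Type*} [NormedAddCommGroup E] [NormedSpace ℝ E] {k : ℕ} (y : E) :
    extDeriv (fun _ : E => (0 : E [⋀^Fin k]→L[ℝ] ℝ)) y = 0 := by
  rw [extDeriv, fderiv_fun_const]
  exact map_zero (alternatizeUncurryFinCLM ℝ E ℝ)

theorem chartForm_eq_zero_of_notMem {n : ℕ} {M : Type u} [TopologicalSpace M] [ChartedSpace (Model n) M]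
    {j : ℕ} {σ : Form n M j} {x₀ : M} {y : Model n}
    (h : σ ((extChartAt (𝓡 n) x₀).symm y) = 0) : chartForm x₀ σ y = 0 := by
  rw [chartForm_apply, h]; rfl

theorem extd_eq_zero_of_notMem {n : ℕ} {M : Type u} [TopologicalSpace M] [ChartedSpace (Model n) M]
    [IsManifold (𝓡 n) ∞ M] {j : ℕ} {σ : Form n M j} {K : Set M} (hK : IsClosed K)
    (h : ∀ x ∉ K, σ x = 0) {x : M} (hx : x ∉ K) : extd σ x = 0 := by
  rw [extd_apply]
  have e : chartForm x σ =ᶠ[𝓝 (extChartAt (𝓡 n) x x)] fun _ => 0 := by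
    have hc := continuousAt_chart_symm (n := n) (mem_extChartAt_target x)
    have hm : (extChartAt (𝓡 n) x).symm (extChartAt (𝓡 n) x x) ∈ Kᶜ := by
      rwa [extChartAt_to_inv (I := 𝓡 n)]
    filter_upwards [hc.eventually (hK.isOpen_compl.mem_nhds hm)] with y hy
    exact chartForm_eq_zero_of_notMem (h _ hy)
  rw [e.extDeriv_eq]
  exact extDeriv_const_zero _

theorem extd_sum {n : ℕ} {M : Type u} [TopologicalSpace M] [ChartedSpace (Model n) M]
    [IsManifold (𝓡 n) ∞ M] {j : ℕ} {ι : Type*} (s : Finset ι) {σ : ι → Form n M j} (hσ : ∀ i ∈ s, SmoothForm (σ i)) (x : M) :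
    extd (fun x => ∑ i ∈ s, σ i x) x = ∑ i ∈ s, extd (σ i) x := by
  simp only [extd_apply]
  have e : chartForm x (fun x => ∑ i ∈ s, σ i x) = fun y => ∑ i ∈ s, chartForm x (σ i) y := by
    funext y; ext v
    simp [chartForm_apply, ContinuousAlternatingMap.sum_apply]
  rw [e, extDeriv, fderiv_fun_sum fun i hi => (contDiffAt_chartForm (hσ i hi) (mem_extChartAt_target x)).differentiableAt (by simp)]
  exact map_sum (alternatizeUncurryFinCLM ℝ (Model n) ℝ) _ _

variable [CompactSpace M] [T2Space M] [MeasurableSpace M] [BorelSpace M] {μ : Form (k + 1) M (k + 1)}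

theorem SmoothForm.dens {n : ℕ} {M : Type u} [TopologicalSpace M] [ChartedSpace (Model n) M]
    [IsManifold (𝓡 n) ∞ M] {μ σ : Form n M n} (hμ : SmoothForm μ)
    (h0 : ∀ x, μ x ≠ 0) (hσ : SmoothForm σ) : SmoothFun (n := n) (CompMHD.dens μ σ) :=
  (SmoothFamForm.dens isOpen_univ hμ h0 (hσ.fam (univ : Set ℝ))).at (mem_univ 0)

theorem SmoothForm.extd {n : ℕ} {M : Type u} [TopologicalSpace M] [ChartedSpace (Model n) M]
    [IsManifold (𝓡 n) ∞ M] {j : ℕ} {σ : Form n M j} (hσ : SmoothForm σ) : SmoothForm (CompMHD.extd σ) :=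
  ((hσ.fam (univ : Set ℝ)).extd isOpen_univ).at (mem_univ 0)

theorem SmoothForm.smul {n : ℕ} {M : Type u} [TopologicalSpace M] [ChartedSpace (Model n) M]
    [IsManifold (𝓡 n) ∞ M] {j : ℕ} {f : M → ℝ} {σ : Form n M j} (hf : SmoothFun (n := n) f) (hσ : SmoothForm σ) :
    SmoothForm (fun x => f x • σ x) :=
  (SmoothFamForm.smul isOpen_univ (hf.fam (univ : Set ℝ)) (hσ.fam univ)).at (mem_univ 0)

/-- Stokes' theorem for a form supported in a chart. -/
theorem integ_extd_chart (hμ : SmoothForm μ) (h0 : ∀ x, μ x ≠ 0) {σ : Form (k + 1) M k} (hσ : SmoothForm σ) {j : M}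
    {K : Set M} (hK : IsClosed K) (hKj : K ⊆ (extChartAt (𝓡 (k + 1)) j).source) (h : ∀ x ∉ K, σ x = 0) :
    integ μ (dens μ (extd σ)) = 0 := by
  have hs : tsupport (dens μ (extd σ)) ⊆ (extChartAt (𝓡 (k + 1)) j).source := by
    refine (closure_minimal (fun x hx => ?_) hK).trans hKj
    by_contra hxK
    apply hx
    rw [dens_apply, extd_eq_zero_of_notMem hK h hxK]; simp
  rw [integ_eq_chart hμ (SmoothForm.dens hμ h0 hσ.extd).continuous hs]
  set T := (extChartAt (𝓡 (k + 1)) j).target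
  have hsign : ∀ y ∈ T, (fun z => SignType.sign (coef μ j z)) =ᶠ[𝓝 y] fun _ => SignType.sign (coef μ j y) := by
    intro y hy
    have hc := (contDiffOn_coef hμ j).continuousOn.continuousAt ((isOpen_tgt j).mem_nhds hy)
    rcases lt_or_gt_of_ne (coef_ne_zero h0 hy) with hn | hp
    · filter_upwards [hc.eventually (gt_mem_nhds hn)] with z hz
      rw [sign_neg hz, sign_neg hn]
    · filter_upwards [hc.eventually (lt_mem_nhds hp)] with z hz
      rw [sign_pos hz, sign_pos hp]
  -- the sign of the coefficient of `μ` is locally constant, so it may be moved into the form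
  set s : Model (k + 1) → Model (k + 1) [⋀^Fin k]→L[ℝ] ℝ := fun y =>
    ((SignType.sign (coef μ j y) : ℤ) : ℝ) • chartForm j σ y
  have es : ∀ y ∈ T, s =ᶠ[𝓝 y] fun z => ((SignType.sign (coef μ j y) : ℤ) : ℝ) • chartForm j σ z := by
    intro y hy
    filter_upwards [hsign y hy] with z hz
    simp only [s]
    rw [hz]
  have hsm : ContDiffOn ℝ 1 s T := fun y hy =>
    ((((contDiffAt_chartForm hσ hy).const_smul _).congr_of_eventuallyEq (es y hy)).of_le (by simp)).contDiffWithinAt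
  obtain ⟨h1, h2⟩ := contDiff_indicator (isOpen_tgt j) (isCompact_chart_image hK hKj) (chart_image_subset hKj) hsm
    (fun y hy hyK => by
      simp only [s]
      rw [chartForm_eq_zero_of_notMem (h _ (symm_notMem hy hyK)), smul_zero])
  rw [← integral_extDeriv_eq_zero volume h1 h2 (stdB (k + 1)), ← integral_indicator (isOpen_tgt j).measurableSet]
  refine integral_congr_ae (Eventually.of_forall fun y => ?_)
  simp only
  by_cases hy : y ∈ T
  · rw [indicator_of_mem hy]
    have e1 : T.indicator s =ᶠ[𝓝 y] fun z => ((SignType.sign (coef μ j y) : ℤ) : ℝ) • chartForm j σ z := by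
      filter_upwards [es y hy, (isOpen_tgt j).mem_nhds hy] with z h1 h2
      rw [indicator_of_mem h2, h1]
    have e3 := extDeriv_smul (x := y) ((SignType.sign (coef μ j y) : ℤ) : ℝ) (chartForm j σ)
    change extDeriv (fun z => ((SignType.sign (coef μ j y) : ℤ) : ℝ) • chartForm j σ z) y = _ at e3
    rw [e1.extDeriv_eq, e3, dens_chart h0 hy, chartForm_extd hσ hy, ContinuousAlternatingMap.smul_apply, smul_eq_mul]
    have hc := coef_ne_zero h0 hy
    have e2 : |coef μ j y| = ((SignType.sign (coef μ j y) : ℤ) : ℝ) * coef μ j y := by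
      rcases lt_or_gt_of_ne hc with hn | hp
      · rw [sign_neg hn, abs_of_neg hn]; simp
      · rw [sign_pos hp, abs_of_pos hp]; simp
    rw [e2, mul_assoc]
    congr 1
    unfold coef at hc ⊢
    field_simp
  · rw [indicator_of_notMem hy]
    have hyK : y ∉ extChartAt (𝓡 (k + 1)) j '' K := fun hh => hy (chart_image_subset hKj hh)
    have e1 : T.indicator s =ᶠ[𝓝 y] fun _ => 0 := by
      filter_upwards [(isCompact_chart_image hK hKj).isClosed.isOpen_compl.mem_nhds hyK] with z hz
      by_cases hzT : z ∈ T
      · rw [indicator_of_mem hzT]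
        simp only [s]
        rw [chartForm_eq_zero_of_notMem (h _ (symm_notMem hzT hz)), smul_zero]
      · exact indicator_of_notMem hzT _
    rw [e1.extDeriv_eq, extDeriv_const_zero]
    rfl

/-- Stokes' theorem on a closed manifold. -/
theorem integ_extd (hμ : SmoothForm μ) (h0 : ∀ x, μ x ≠ 0) {σ : Form (k + 1) M k} (hσ : SmoothForm σ) :
    integ μ (dens μ (extd σ)) = 0 := by
  set F := chartIndex (k + 1) M
  have hsm : ∀ i, SmoothForm (fun x => chartPartition (k + 1) M i x • σ x) := fun i =>
    SmoothForm.smul (smooth_chartPartition i) hσ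
  have e1 : σ = fun x => ∑ i ∈ F, chartPartition (k + 1) M i x • σ x := by
    funext x
    rw [← Finset.sum_smul, sum_chartPartition, one_smul]
  have e2 : dens μ (extd σ) = fun x => ∑ i ∈ F, dens μ (extd (fun x => chartPartition (k + 1) M i x • σ x)) x := by
    funext x
    conv_lhs => rw [e1]
    simp only [dens_apply]
    rw [extd_sum F (fun i _ => hsm i), ContinuousAlternatingMap.sum_apply, Finset.sum_div]
  rw [e2, integ_sum hμ F fun i _ => (SmoothForm.dens hμ h0 (hsm i).extd).continuous]
  refine Finset.sum_eq_zero fun i _ => ?_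
  refine integ_extd_chart hμ h0 (hsm i) (isClosed_tsupport _) (chartPartition_subordinate i) fun x hx => ?_
  rw [image_eq_zero_of_notMem_tsupport hx, zero_smul]

end Stokes

/-! ### Integration by parts -/
section NonFamily
variable {n : ℕ} {M : Type u} [TopologicalSpace M] [ChartedSpace (Model n) M] [IsManifold (𝓡 n) ∞ M] {k : ℕ}

theorem SmoothForm.iota {X : VF n M} {σ : Form n M (k + 1)} (hX : SmoothVF X) (hσ : SmoothForm σ) :
    SmoothForm (CompMHD.iota X σ) :=
  (SmoothFamForm.iota isOpen_univ (hX.fam (univ : Set ℝ)) (hσ.fam univ)).at (mem_univ 0)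

theorem SmoothForm.lieD {X : VF n M} {σ : Form n M k} (hX : SmoothVF X) (hσ : SmoothForm σ) :
    SmoothForm (CompMHD.lieD X σ) :=
  (SmoothFamForm.lieD isOpen_univ (hX.fam (univ : Set ℝ)) (hσ.fam univ)).at (mem_univ 0)

theorem SmoothForm.wedgeF {β : Form n M 2} {P : Form n M k} (hβ : SmoothForm β) (hP : SmoothForm P) :
    SmoothForm (CompMHD.wedgeF β P) :=
  (SmoothFamForm.wedgeF isOpen_univ (hβ.fam (univ : Set ℝ)) (hP.fam univ)).at (mem_univ 0)

theorem SmoothForm.extMulF {γ : Form n M 1} {P : Form n M k} (hγ : SmoothForm γ) (hP : SmoothForm P) :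
    SmoothForm (CompMHD.extMulF γ P) :=
  (SmoothFamForm.extMulF isOpen_univ (hγ.fam (univ : Set ℝ)) (hP.fam univ)).at (mem_univ 0)

theorem SmoothForm.apply {σ : Form n M k} {X : Fin k → VF n M} (hσ : SmoothForm σ) (hX : ∀ i, SmoothVF (X i)) :
    SmoothFun (n := n) (fun x => σ x (fun i => X i x)) :=
  (SmoothFamForm.apply isOpen_univ (hσ.fam (univ : Set ℝ)) (X := fun i _ => X i) fun i => (hX i).fam univ).at (mem_univ 0)

theorem SmoothForm.add {σ τ : Form n M k} (hσ : SmoothForm σ) (hτ : SmoothForm τ) : SmoothForm (σ + τ) :=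
  fun x₀ => (hσ x₀).add (hτ x₀)

theorem SmoothForm.sub {σ τ : Form n M k} (hσ : SmoothForm σ) (hτ : SmoothForm τ) : SmoothForm (σ - τ) :=
  fun x₀ => (hσ x₀).sub (hτ x₀)

theorem SmoothForm.neg {σ : Form n M k} (hσ : SmoothForm σ) : SmoothForm (-σ) :=
  fun x₀ => (hσ x₀).neg

theorem SmoothFun.dFun {f : M → ℝ} (hf : SmoothFun (n := n) f) : SmoothForm (CompMHD.dFun f : Form n M 1) :=
  (SmoothFamFun.dFun isOpen_univ (hf.fam (univ : Set ℝ))).at (mem_univ 0)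

theorem SmoothVF.smul {f : M → ℝ} {X : VF n M} (hf : SmoothFun (n := n) f) (hX : SmoothVF X) :
    SmoothVF (fun x => f x • X x) :=
  (SmoothFamVF.smul isOpen_univ (hf.fam (univ : Set ℝ)) (hX.fam univ)).at (mem_univ 0)

theorem SmoothVF.sub {X Y : VF n M} (hX : SmoothVF X) (hY : SmoothVF Y) : SmoothVF (X - Y) :=
  (SmoothFamVF.sub isOpen_univ (hX.fam (univ : Set ℝ)) (hY.fam univ)).at (mem_univ 0)

theorem SmoothVF.contDiffAt_chart {X : VF n M} (hX : SmoothVF X) {x₀ : M} {y : Model n}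
    (hy : y ∈ (extChartAt (𝓡 n) x₀).target) : ContDiffAt ℝ ∞ (chartVF x₀ X) y := by
  have h := (smoothFamVF_iff isOpen_univ).1 (hX.fam (univ : Set ℝ)) x₀ 0 (mem_univ _) y hy
  exact ContDiffAt.comp (f := fun y => ((0 : ℝ), y)) y h (by fun_prop)

theorem smoothVF_iff {X : VF n M} : SmoothVF X ↔ ∀ x₀ : M, ∀ y ∈ (extChartAt (𝓡 n) x₀).target,
    ContDiffAt ℝ ∞ (chartVF x₀ X) y := by
  refine ⟨fun h x₀ y hy => h.contDiffAt_chart hy, fun h => ?_⟩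
  refine SmoothFamVF.at (S := (univ : Set ℝ)) (X := fun _ => X) (z := 0) ?_ (mem_univ _)
  exact (smoothFamVF_iff isOpen_univ).2 fun x₀ z _ y hy => ContDiffAt.comp (z, y) (h x₀ y hy) contDiffAt_snd

theorem eventually_tgt (x : M) : ∀ᶠ y in 𝓝 (extChartAt (𝓡 n) x x), y ∈ (extChartAt (𝓡 n) x).target :=
  (isOpen_tgt x).mem_nhds (mem_extChartAt_target x)

theorem extd_add {σ τ : Form n M k} (hσ : SmoothForm σ) (hτ : SmoothForm τ) : extd (σ + τ) = extd σ + extd τ := by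
  funext x
  change _ = extd σ x + extd τ x
  rw [extd_apply, extd_apply, extd_apply]
  exact extDeriv_add ((contDiffAt_chartForm hσ (mem_extChartAt_target x)).differentiableAt (by simp))
    ((contDiffAt_chartForm hτ (mem_extChartAt_target x)).differentiableAt (by simp))

theorem extd_const_smul (c : ℝ) (σ : Form n M k) : extd (c • σ) = c • extd σ := by
  funext x
  change _ = c • extd σ x
  rw [extd_apply, extd_apply]
  exact extDeriv_smul (x := extChartAt (𝓡 n) x x) c (chartForm x σ)

theorem mfd_chart {f : M → ℝ} (hf : SmoothFun (n := n) f) (x : M) :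
    mfd n f x = fderiv ℝ (fun y => f ((extChartAt (𝓡 n) x).symm y)) (extChartAt (𝓡 n) x x) := by
  ext v
  exact dFun_apply' hf x (fun _ => v)

/-- `d(f σ) = df ∧ σ + f dσ`. -/
theorem extd_smul {f : M → ℝ} {σ : Form n M k} (hf : SmoothFun (n := n) f) (hσ : SmoothForm σ) (x : M) :
    extd (fun x => f x • σ x) x = extMul (mfd n f x) (σ x) + f x • extd σ x := by
  rw [extd_apply, extd_apply, mfd_chart hf]
  have hx := mem_extChartAt_target (I := 𝓡 n) x
  have h1 := ((fun_chart_differentiableAt hf hx).differentiableAt (by simp)).hasFDerivAt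
  have h2 := ((contDiffAt_chartForm hσ hx).differentiableAt (by simp)).hasFDerivAt
  have h3 : HasFDerivAt (chartForm x (fun x => f x • σ x)) _ (extChartAt (𝓡 n) x x) := h1.smul h2
  rw [extDeriv, h3.fderiv, alternatizeUncurryFin_add, chartForm_self, extChartAt_to_inv]
  refine (add_comm _ _).trans (congrArg₂ (· + ·) rfl ?_)
  exact map_smul (alternatizeUncurryFinCLM ℝ (Model n) ℝ) _ _

theorem extd_extMulF {γ : Form n M 1} {P : Form n M k} (hγ : SmoothForm γ) (hP : SmoothForm P) (x : M) :
    extd (extMulF γ P) x = wedgeF (extd γ) P x - extMulF γ (extd P) x := by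
  have hx := mem_extChartAt_target (I := 𝓡 n) x
  rw [extd_apply]
  change _ = wedge2 (extd γ x) (P x) - extMul (lin1 (γ x)) (extd P x)
  rw [extd_apply γ, extd_apply P]
  have e : chartForm x (extMulF γ P) = fun y => extMul (lin1 (chartForm x γ y)) (chartForm x P y) :=
    funext fun y => chartForm_extMulF γ P x y
  rw [e, extDeriv_extMul ((contDiffAt_chartForm hγ hx).differentiableAt (by simp))
    ((contDiffAt_chartForm hP hx).differentiableAt (by simp)), chartForm_self, chartForm_self]

theorem extd_wedgeF {β : Form n M 2} {Q : Form n M k} (hβ : SmoothForm β) (hQ : SmoothForm Q) (hd : extd β = 0) (x : M) :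
    extd (wedgeF β Q) x = wedgeF β (extd Q) x := by
  have hx := mem_extChartAt_target (I := 𝓡 n) x
  have hd' : extDeriv (chartForm x β) (extChartAt (𝓡 n) x x) = 0 := by
    rw [← extd_apply, hd]; rfl
  rw [extd_apply]
  change _ = wedge2 (β x) (extd Q x)
  rw [extd_apply Q]
  have e : chartForm x (wedgeF β Q) = fun y => wedge2 (chartForm x β y) (chartForm x Q y) :=
    funext fun y => chartForm_wedgeF β Q x y
  rw [e, extDeriv_wedge2 ((contDiffAt_chartForm hβ hx).differentiableAt (by simp))
    ((contDiffAt_chartForm hQ hx).differentiableAt (by simp)) hd', chartForm_self]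

theorem extd_iota_chart {X : VF n M} (σ : Form n M (k + 1)) (x : M) :
    extd (iota X σ) x = extDeriv (fun y => (chartForm x σ y).curryLeft (chartVF x X y)) (extChartAt (𝓡 n) x x) := by
  rw [extd_apply]
  refine Filter.EventuallyEq.extDeriv_eq ?_
  filter_upwards [eventually_tgt x] with y hy
  exact chartForm_iota X σ hy

theorem lieFun_chart {f : M → ℝ} (hf : SmoothFun (n := n) f) (X : VF n M) (x : M) :
    lieFun X f x = fderiv ℝ (fun y => f ((extChartAt (𝓡 n) x).symm y)) (extChartAt (𝓡 n) x x) (X x) :=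
  dFun_apply' hf x (fun _ => X x)

/-- `(𝓛_X α)(W) = X(α(W)) - α([X, W])`. -/
theorem lieD_one_apply {α : Form n M 1} {X W : VF n M} (hα : SmoothForm α) (hX : SmoothVF X) (hW : SmoothVF W) (x : M) :
    lieD X α x (fun _ => W x) = lieFun X (fun x => α x (fun _ => W x)) x -
      α x (fun _ => VectorField.mlieBracket (𝓡 n) X W x) := by
  have hx := mem_extChartAt_target (I := 𝓡 n) x
  have h := lieDerivative_one_apply ((contDiffAt_chartForm hα hx).differentiableAt (by simp))
    ((hX.contDiffAt_chart hx).differentiableAt (by simp)) ((hW.contDiffAt_chart hx).differentiableAt (by simp))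
  rw [← extd_iota_chart, ← extd_apply, chartForm_self, chartVF_self, chartVF_self, ← mlieBracket_eq_chart] at h
  have hs : SmoothFun (n := n) (fun x => α x (fun _ => W x)) := hα.apply fun _ => hW
  rw [lieFun_chart hs]
  refine h.trans ?_
  refine congrArg₂ (· - ·) (DFunLike.congr_fun (Filter.EventuallyEq.fderiv_eq ?_) (X x)) rfl
  filter_upwards [eventually_tgt x] with y hy
  exact (form_apply_chart α (fun _ => W) hy).symm

/-- The coordinates, in any chart, of a constant field of the chart at `x₀` multiplied by a function. -/
theorem chartVF_bump (x₀ : M) (χ : M → ℝ) (v : Model n) (x₁ : M) {y : Model n}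
    (hy : y ∈ (extChartAt (𝓡 n) x₁).target) (h : (extChartAt (𝓡 n) x₁).symm y ∈ (extChartAt (𝓡 n) x₀).source) :
    chartVF x₁ (fun x => χ x • dsymm x₀ (extChartAt (𝓡 n) x₀ x) v : VF n M) y =
      χ ((extChartAt (𝓡 n) x₁).symm y) •
        fderiv ℝ (fun y => extChartAt (𝓡 n) x₁ ((extChartAt (𝓡 n) x₀).symm y))
          (extChartAt (𝓡 n) x₀ ((extChartAt (𝓡 n) x₁).symm y)) v := by
  have h1 : (extChartAt (𝓡 n) x₀).symm (extChartAt (𝓡 n) x₀ ((extChartAt (𝓡 n) x₁).symm y)) ∈ (extChartAt (𝓡 n) x₁).source := by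
    rw [(extChartAt (𝓡 n) x₀).left_inv h]; exact (extChartAt (𝓡 n) x₁).map_target hy
  have h2 := (hasFDerivAt_chart_comp (f := id) (x₁ := x₁) ((extChartAt (𝓡 n) x₀).map_source h) mdifferentiableAt_id h1).fderiv
  simp only [id] at h2
  refine (chartVF_smul x₁ χ (fun x => dsymm x₀ (extChartAt (𝓡 n) x₀ x) v : VF n M) y).trans ?_
  refine congrArg _ ?_
  rw [h2, mfderiv_id, (extChartAt (𝓡 n) x₀).left_inv h]
  rfl

/-- A vector field with prescribed value at `x₀`, supported in the chart at `x₀`. -/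
theorem exists_local_vf [T2Space M] (x₀ : M) (v : Model n) : ∃ X : VF n M, SmoothVF X ∧ X x₀ = v ∧
    tsupport (fun x => (X x : Model n)) ⊆ (extChartAt (𝓡 n) x₀).source := by
  obtain ⟨f⟩ : Nonempty (SmoothBumpFunction (𝓡 n) x₀) := inferInstance
  have hf : SmoothFun (n := n) (f : M → ℝ) := f.contMDiff
  have hs : tsupport (f : M → ℝ) ⊆ (extChartAt (𝓡 n) x₀).source := f.tsupport_subset_extChartAt_source
  refine ⟨(fun x => f x • dsymm x₀ (extChartAt (𝓡 n) x₀ x) v : VF n M), ?_, ?_, ?_⟩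
  · refine smoothVF_iff.2 ?_
    intro x₁ y hy
    by_cases h : (extChartAt (𝓡 n) x₁).symm y ∈ (extChartAt (𝓡 n) x₀).source
    · have h1 : (extChartAt (𝓡 n) x₀).symm (extChartAt (𝓡 n) x₀ ((extChartAt (𝓡 n) x₁).symm y)) ∈ (extChartAt (𝓡 n) x₁).source := by
        rw [(extChartAt (𝓡 n) x₀).left_inv h]; exact (extChartAt (𝓡 n) x₁).map_target hy
      have h3 := (contDiffAt_transition ((extChartAt (𝓡 n) x₀).map_source h) h1).fderiv_right (m := ∞) (by simp)
      have h4 := ContDiffAt.comp y h3 (contDiffAt_transition hy h)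
      refine ((fun_chart_differentiableAt hf hy).smul (h4.clm_apply (contDiffAt_const (c := v)))).congr_of_eventuallyEq ?_
      filter_upwards [eventually_symm_mem hy h] with z hz
      exact chartVF_bump x₀ f v x₁ hz.1 hz.2
    · have hc := (continuousAt_chart_symm hy).eventually ((isClosed_tsupport (f : M → ℝ)).isOpen_compl.mem_nhds fun hh => h (hs hh))
      refine (contDiffAt_const (c := (0 : Model n))).congr_of_eventuallyEq ?_
      filter_upwards [hc] with z hz
      refine (chartVF_smul x₁ f (fun x => dsymm x₀ (extChartAt (𝓡 n) x₀ x) v : VF n M) z).trans ?_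
      rw [image_eq_zero_of_notMem_tsupport hz, zero_smul]
  · change f x₀ • (dsymm x₀ (extChartAt (𝓡 n) x₀ x₀) v : Model n) = v
    rw [f.eq_one, one_smul, dsymm_self]; rfl
  · refine (closure_mono fun x hx => ?_).trans hs
    intro h0
    exact hx (by change f x • _ = _; rw [h0, zero_smul])

end NonFamily

section Volume
variable {k : ℕ} {M : Type u} [TopologicalSpace M] [ChartedSpace (Model (k + 2)) M] [IsManifold (𝓡 (k + 2)) ∞ M]
  {μ : Form (k + 2) M (k + 2)}

/-- The vector field `U` with `ι_U μ = σ`. -/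
def vecF (μ : Form (k + 2) M (k + 2)) (σ : Form (k + 2) M (k + 1)) : VF (k + 2) M := fun x =>
  (vecOf (stdB (k + 2)) (μ x) (σ x) : Model (k + 2))

theorem finrank_model (n : ℕ) : Module.finrank ℝ (Model n) = n := by simp

theorem iota_vecF (h0 : ∀ x, μ x ≠ 0) (σ : Form (k + 2) M (k + 1)) : iota (vecF μ σ) μ = σ :=
  funext fun x => curryLeft_vecOf (stdB (k + 2)) (σ x) (h0 x)

theorem vf_eq_of_iota (h0 : ∀ x, μ x ≠ 0) {X Y : VF (k + 2) M} {x : M} (h : iota X μ x = iota Y μ x) : X x = Y x :=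
  curryLeft_top_injective (k := k + 1) (by simp) (h0 x) h

theorem chartVF_vecF (h0 : ∀ x, μ x ≠ 0) (σ : Form (k + 2) M (k + 1)) {x₀ : M} {y : Model (k + 2)}
    (hy : y ∈ (extChartAt (𝓡 (k + 2)) x₀).target) :
    chartVF x₀ (vecF μ σ) y = vecOf (stdB (k + 2)) (chartForm x₀ μ y) (chartForm x₀ σ y) := by
  have h1 := chartForm_ne_zero h0 hy
  refine curryLeft_top_injective (k := k + 1) (by simp) h1 ?_
  rw [curryLeft_vecOf _ _ h1, ← chartForm_iota _ _ hy, iota_vecF h0]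

/-- If `ι_X μ = τ` then the coordinates of `X` are, up to sign, those of `τ` divided by that of `μ`;
so `vecF` preserves smoothness in families. -/
theorem SmoothFamForm.vecF {Z : Type} [NormedAddCommGroup Z] [NormedSpace ℝ Z] {S : Set Z} (hS : IsOpen S)
    (hμ : SmoothForm μ) (h0 : ∀ x, μ x ≠ 0) {σ : Z → Form (k + 2) M (k + 1)} (hσ : SmoothFamForm S σ) :
    SmoothFamVF S (fun z => CompMHD.vecF μ (σ z)) := by
  rw [smoothFamForm_iff hS] at hσ
  rw [smoothFamVF_iff hS]
  intro x₀ z hz y hy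
  have h1 : ContDiffAt ℝ ∞ (fun p : Z × Model (k + 2) => chartForm x₀ μ p.2 (stdB (k + 2))) (z, y) :=
    contDiffAt_form_apply (v := fun i _ => stdB (k + 2) i)
      (ContDiffAt.comp (z, y) (contDiffAt_chartForm hμ hy) contDiffAt_snd) fun i => contDiffAt_const
  have h2 : ContDiffAt ℝ ∞ (fun p : Z × Model (k + 2) =>
      vecOf (stdB (k + 2)) (chartForm x₀ μ p.2) (chartForm x₀ (σ p.1) p.2)) (z, y) := by
    unfold vecOf
    refine ContDiffAt.sum fun i _ => ContDiffAt.smul (ContDiffAt.div ?_ h1 ?_) contDiffAt_const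
    · simp only [extMul_apply]
      refine ContDiffAt.sum fun j _ => contDiffAt_const.mul (contDiffAt_const.mul ?_)
      exact contDiffAt_form_apply (v := fun i _ => _) (hσ x₀ z hz y hy) fun i => contDiffAt_const
    · exact form_apply_basis_ne_zero _ _ (chartForm_ne_zero h0 hy)
  refine h2.congr_of_eventuallyEq ?_
  filter_upwards [eventually_snd_tgt hy] with p hp
  exact chartVF_vecF h0 _ hp

theorem SmoothForm.vecF (hμ : SmoothForm μ) (h0 : ∀ x, μ x ≠ 0) {σ : Form (k + 2) M (k + 1)} (hσ : SmoothForm σ) :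
    SmoothVF (CompMHD.vecF μ σ) :=
  (SmoothFamForm.vecF isOpen_univ hμ h0 (hσ.fam (univ : Set ℝ))).at (mem_univ 0)

theorem extd_top (μ : Form (k + 2) M (k + 2)) (x : M) : extd μ x = 0 :=
  form_eq_zero_of_finrank_lt _ (by simp)

theorem lieD_top (μ : Form (k + 2) M (k + 2)) (X : VF (k + 2) M) : lieD X μ = extd (iota X μ) := by
  funext x
  change (extd μ x).curryLeft (X x) + _ = _
  rw [extd_top]
  have : (0 : Model (k + 2) [⋀^Fin (k + 2 + 1)]→L[ℝ] ℝ).curryLeft (X x) = 0 := rfl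
  rw [this, zero_add]

theorem divergence_eq (μ : Form (k + 2) M (k + 2)) (X : VF (k + 2) M) : divergence μ X = dens μ (extd (iota X μ)) := by
  rw [← lieD_top]; rfl

theorem smooth_divergence (hμ : SmoothForm μ) (h0 : ∀ x, μ x ≠ 0) {X : VF (k + 2) M} (hX : SmoothVF X) :
    SmoothFun (n := k + 2) (divergence μ X) := by
  rw [divergence_eq]
  exact SmoothForm.dens hμ h0 (SmoothForm.iota hX hμ).extd

theorem iota_smul (f : M → ℝ) (X : VF (k + 2) M) {j : ℕ} (σ : Form (k + 2) M (j + 1)) :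
    iota (fun x => f x • X x) σ = fun x => f x • iota X σ x :=
  funext fun x => map_smul (curryL (σ x)) (f x) (X x)

/-- `div (f X) = X f + f div X`. -/
theorem divergence_smul (hμ : SmoothForm μ) (h0 : ∀ x, μ x ≠ 0) {f : M → ℝ} {X : VF (k + 2) M}
    (hf : SmoothFun (n := k + 2) f) (hX : SmoothVF X) (x : M) :
    divergence μ (fun x => f x • X x) x = lieFun X f x + f x * divergence μ X x := by
  rw [divergence_eq, divergence_eq]
  refine dens_eq (h0 x) ?_
  rw [iota_smul, extd_smul hf (SmoothForm.iota hX hμ), add_smul, mul_smul, dens_smul_eq (h0 x)]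
  congr 1
  exact extMul_curryLeft_top (k := k + 1) (by simp) (μ x) _ (X x)

variable [CompactSpace M] [T2Space M] [MeasurableSpace M] [BorelSpace M]

theorem integ_divergence (hμ : SmoothForm μ) (h0 : ∀ x, μ x ≠ 0) {X : VF (k + 2) M} (hX : SmoothVF X) :
    integ μ (divergence μ X) = 0 := by
  rw [divergence_eq]
  exact integ_extd hμ h0 (SmoothForm.iota hX hμ)

omit [CompactSpace M] [T2Space M] [MeasurableSpace M] [BorelSpace M] in
theorem smooth_lieFun {f : M → ℝ} {X : VF (k + 2) M} (hf : SmoothFun (n := k + 2) f) (hX : SmoothVF X) :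
    SmoothFun (n := k + 2) (lieFun X f) := hf.dFun.apply fun _ => hX

/-- `∫ (X f) μ = -∫ f div X μ`. -/
theorem integ_lieFun (hμ : SmoothForm μ) (h0 : ∀ x, μ x ≠ 0) {f : M → ℝ} {X : VF (k + 2) M}
    (hf : SmoothFun (n := k + 2) f) (hX : SmoothVF X) :
    integ μ (lieFun X f) = -integ μ (fun x => f x * divergence μ X x) := by
  have h := integ_divergence hμ h0 (hX.smul hf)
  have e : divergence μ (fun x => f x • X x) = fun x => lieFun X f x + f x * divergence μ X x :=
    funext fun x => divergence_smul hμ h0 hf hX x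
  rw [e] at h
  have h' := integ_add hμ (smooth_lieFun hf hX).continuous (hf.continuous.mul (smooth_divergence hμ h0 hX).continuous)
  exact eq_neg_of_add_eq_zero_left (h'.symm.trans h)

/-- Integration by parts for functions: `∫ (𝓛_X θ) f μ = -∫ θ div(f X) μ`. -/
theorem integ_lieFun_mul (hμ : SmoothForm μ) (h0 : ∀ x, μ x ≠ 0) {f ρ : M → ℝ} {X : VF (k + 2) M}
    (hf : SmoothFun (n := k + 2) f) (hρ : SmoothFun (n := k + 2) ρ) (hX : SmoothVF X) :
    integ μ (fun x => lieFun X f x * ρ x) = -integ μ (fun x => f x * divergence μ (fun y => ρ y • X y) x) := by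
  rw [← integ_lieFun hμ h0 hf (hX.smul hρ)]
  refine congrArg _ (funext fun x => ?_)
  have : dFun f x (fun _ => ρ x • X x) = ρ x • dFun f x (fun _ => X x) := map_smul (mfd (k + 2) f x) (ρ x) (X x)
  change dFun f x (fun _ => X x) * ρ x = dFun f x (fun _ => ρ x • X x)
  rw [this, smul_eq_mul, mul_comm]

/-- `⟨α ⊗ μ, [X, W]⟩ = -⟨𝓛_X (α ⊗ μ), W⟩`. -/
theorem pair_bracket (hμ : SmoothForm μ) (h0 : ∀ x, μ x ≠ 0) {α : Form (k + 2) M 1} {X W : VF (k + 2) M}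
    (hα : SmoothForm α) (hX : SmoothVF X) (hW : SmoothVF W) :
    pair μ α (VectorField.mlieBracket (𝓡 (k + 2)) X W) = -pair μ (lieDensity μ X α) W := by
  have hh : SmoothFun (n := k + 2) (fun x => α x (fun _ => W x)) := hα.apply fun _ => hW
  have hl : SmoothFun (n := k + 2) (fun x => lieD X α x (fun _ => W x)) := (SmoothForm.lieD hX hα).apply fun _ => hW
  have e : (fun x => α x (fun _ => VectorField.mlieBracket (𝓡 (k + 2)) X W x)) =
      fun x => lieFun X (fun x => α x (fun _ => W x)) x - lieD X α x (fun _ => W x) := by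
    funext x; rw [lieD_one_apply hα hX hW]; ring
  have e2 : (fun x => lieDensity μ X α x (fun _ => W x)) = fun x =>
      lieD X α x (fun _ => W x) + α x (fun _ => W x) * divergence μ X x := by
    funext x
    exact congrArg (fun r => lieD X α x (fun _ => W x) + r) (mul_comm (divergence μ X x) (α x (fun _ => W x)))
  unfold pair
  have h1 := integ_add hμ hl.continuous (hh.continuous.mul (smooth_divergence hμ h0 hX).continuous)
  have h2 := integ_sub hμ (smooth_lieFun hh hX).continuous hl.continuous
  rw [integ_lieFun hμ h0 hh hX] at h2
  rw [e, e2]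
  refine h2.trans (Eq.trans ?_ (congrArg Neg.neg h1).symm)
  have e3 : ∀ a b : ℝ, -a - b = -(b + a) := fun a b => by ring
  exact e3 _ _

omit [BorelSpace M] in
theorem pairForm_eq (β : Form (k + 2) M 2) (P : Form (k + 2) M k) :
    pairForm μ β P = integ μ (dens μ (wedgeF β P)) := by
  unfold pairForm dens
  congr 2
  funext x
  exact domCoprod_eq_wedge2 (β x) (P x)

/-- `⟨dγ, [P]⟩ = ∫ γ(U) μ` where `ι_U μ = dP`: Stokes' theorem for `γ ∧ P`. -/
theorem pairForm_extd_left (hμ : SmoothForm μ) (h0 : ∀ x, μ x ≠ 0) {γ : Form (k + 2) M 1} {P : Form (k + 2) M k}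
    {U : VF (k + 2) M} (hγ : SmoothForm γ) (hP : SmoothForm P) (hU : SmoothVF U) (h : iota U μ = extd P) :
    pairForm μ (extd γ) P = pair μ γ U := by
  have h1 := integ_extd hμ h0 (SmoothForm.extMulF hγ hP)
  have e : dens μ (extd (extMulF γ P)) = fun x => dens μ (wedgeF (extd γ) P) x - γ x (fun _ => U x) := by
    funext x
    refine dens_eq (h0 x) ?_
    rw [extd_extMulF hγ hP]
    refine Eq.trans ?_ (sub_smul (dens μ (wedgeF (extd γ) P) x) (lin1 (γ x) (U x)) (μ x)).symm
    rw [dens_smul_eq (h0 x)]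
    refine congrArg (fun r => wedgeF (extd γ) P x - r) ?_
    change extMul (lin1 (γ x)) (extd P x) = _
    rw [← h]
    exact extMul_curryLeft_top (k := k + 1) (by simp) (μ x) _ (U x)
  rw [e, integ_sub hμ (SmoothForm.dens hμ h0 (hγ.extd.wedgeF hP)).continuous
    (SmoothFun.continuous (hγ.apply fun _ => hU))] at h1
  rw [pairForm_eq]
  exact sub_eq_zero.1 h1

/-- Closed 2-forms pair with classes modulo exact forms. In degree zero the only exact form is `0`. -/
theorem pairForm_exact (hμ : SmoothForm μ) (h0 : ∀ x, μ x ≠ 0) {β : Form (k + 2) M 2} {P : Form (k + 2) M k}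
    (hβ : SmoothForm β) (hd : extd β = 0) (hP : IsExactForm P) : pairForm μ β P = 0 := by
  rw [pairForm_eq]
  cases k with
  | zero =>
    have hP0 : P = 0 := hP
    have : dens μ (wedgeF β P) = fun _ => 0 := by
      funext x
      refine dens_eq (h0 x) ?_
      rw [hP0, zero_smul]
      have h := wedge2_smul_right 0 (β x) (0 : Model (0 + 2) [⋀^Fin 0]→L[ℝ] ℝ)
      rw [zero_smul, zero_smul] at h
      exact h
    rw [this]
    exact integral_zero _ _
  | succ k =>
    obtain ⟨Q, hQ, rfl⟩ := hP
    have h1 := integ_extd hμ h0 (hβ.wedgeF hQ)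
    have : extd (wedgeF β Q) = wedgeF β (extd Q) := funext fun x => extd_wedgeF hβ hQ hd x
    rwa [this] at h1

omit [CompactSpace M] [T2Space M] [MeasurableSpace M] [BorelSpace M] in
theorem dens_wedge_iota (h0 : ∀ x, μ x ≠ 0) (β : Form (k + 2) M 2) (X Y : VF (k + 2) M) :
    dens μ (wedgeF β (iota Y (iota X μ))) = fun x => β x ![X x, Y x] :=
  funext fun x => dens_eq (h0 x) (wedge2_curryLeft_curryLeft (stdB (k + 2)) (β x) (μ x) (X x) (Y x))

omit [CompactSpace M] [T2Space M] [MeasurableSpace M] [BorelSpace M] in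
theorem smooth_form2 {β : Form (k + 2) M 2} {X Y : VF (k + 2) M} (hβ : SmoothForm β) (hX : SmoothVF X) (hY : SmoothVF Y) :
    SmoothFun (n := k + 2) (fun x => β x ![X x, Y x]) := by
  have h := hβ.apply (X := ![X, Y]) (fun i => by fin_cases i <;> assumption)
  have e : (fun x => β x (fun i => (![X, Y] : Fin 2 → VF (k + 2) M) i x)) = fun x => β x ![X x, Y x] := by
    funext x
    refine congrArg (β x) (funext fun i => ?_)
    fin_cases i <;> rfl
  rwa [e] at h

theorem pairForm_add_right (hμ : SmoothForm μ) (h0 : ∀ x, μ x ≠ 0) {β : Form (k + 2) M 2} {P Q : Form (k + 2) M k}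
    (hβ : SmoothForm β) (hP : SmoothForm P) (hQ : SmoothForm Q) :
    pairForm μ β (P + Q) = pairForm μ β P + pairForm μ β Q := by
  rw [pairForm_eq, pairForm_eq, pairForm_eq, ← integ_add hμ (SmoothForm.dens hμ h0 (hβ.wedgeF hP)).continuous
    (SmoothForm.dens hμ h0 (hβ.wedgeF hQ)).continuous]
  refine congrArg _ (funext fun x => dens_eq (h0 x) ?_)
  rw [add_smul, dens_smul_eq (h0 x), dens_smul_eq (h0 x)]
  exact wedge2_add_right _ _ _

theorem pairForm_smul_right (h0 : ∀ x, μ x ≠ 0) (c : ℝ) (β : Form (k + 2) M 2) (P : Form (k + 2) M k) :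
    pairForm μ β (c • P) = c * pairForm μ β P := by
  rw [pairForm_eq, pairForm_eq, ← integ_const_mul]
  refine congrArg _ (funext fun x => dens_eq (h0 x) ?_)
  rw [mul_smul, dens_smul_eq (h0 x)]
  exact wedge2_smul_right _ _ _

theorem pairForm_sub_right (hμ : SmoothForm μ) (h0 : ∀ x, μ x ≠ 0) {β : Form (k + 2) M 2} {P Q : Form (k + 2) M k}
    (hβ : SmoothForm β) (hP : SmoothForm P) (hQ : SmoothForm Q) :
    pairForm μ β (P - Q) = pairForm μ β P - pairForm μ β Q := by
  have h := pairForm_add_right hμ h0 hβ hP hQ.neg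
  have e : -Q = (-1 : ℝ) • Q := (neg_one_smul ℝ Q).symm
  rw [← sub_eq_add_neg, e, pairForm_smul_right h0] at h
  rw [h]; ring

/-- `⟨β, [𝓛_X P]⟩ = ∫ β(U, X) μ` for closed `β`, where `ι_U μ = dP`. -/
theorem pairForm_lieD_right (hμ : SmoothForm μ) (h0 : ∀ x, μ x ≠ 0) {β : Form (k + 2) M 2} {P : Form (k + 2) M k}
    {X U : VF (k + 2) M} (hβ : SmoothForm β) (hd : extd β = 0) (hP : SmoothForm P) (hX : SmoothVF X)
    (h : iota U μ = extd P) : pairForm μ β (lieD X P) = integ μ (fun x => β x ![U x, X x]) := by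
  have h1 : pairForm μ β (iota X (extd P)) = integ μ (fun x => β x ![U x, X x]) := by
    rw [pairForm_eq, ← h, dens_wedge_iota h0]
  cases k with
  | zero => exact h1
  | succ k =>
    have h2 : pairForm μ β (extd (iota X P)) = 0 := pairForm_exact hμ h0 hβ hd ⟨_, SmoothForm.iota hX hP, rfl⟩
    change pairForm μ β (iota X (extd P) + extd (iota X P)) = _
    rw [pairForm_add_right hμ h0 hβ (SmoothForm.iota hX hP.extd) (SmoothForm.iota hX hP).extd, h1, h2, add_zero]

omit [CompactSpace M] [T2Space M] [MeasurableSpace M] [BorelSpace M] in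
theorem lieD_closed {β : Form (k + 2) M 2} (hd : extd β = 0) (X : VF (k + 2) M) : lieD X β = extd (iota X β) := by
  change iota X (extd β) + extd (iota X β) = _
  rw [hd]
  have : iota X (0 : Form (k + 2) M 3) = 0 := funext fun x => rfl
  rw [this, zero_add]

/-- `⟨𝓛_X β, [P]⟩ = ∫ β(X, U) μ` for closed `β`, where `ι_U μ = dP`. -/
theorem pairForm_lieD_left (hμ : SmoothForm μ) (h0 : ∀ x, μ x ≠ 0) {β : Form (k + 2) M 2} {P : Form (k + 2) M k}
    {X U : VF (k + 2) M} (hβ : SmoothForm β) (hd : extd β = 0) (hP : SmoothForm P) (hX : SmoothVF X) (hU : SmoothVF U)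
    (h : iota U μ = extd P) : pairForm μ (lieD X β) P = integ μ (fun x => β x ![X x, U x]) := by
  rw [lieD_closed hd, pairForm_extd_left hμ h0 (SmoothForm.iota hX hβ) hP hU h]
  exact congrArg (integ μ) (funext fun x => (form2_eq (β x) (X x) (U x)).symm)

/-! ### Non-degeneracy of the pairings -/

theorem tsupport_smul_vf {X : VF (k + 2) M} {f : M → ℝ} {T : Set M} (h : tsupport (fun x => (X x : Model (k + 2))) ⊆ T) :
    tsupport (fun x => (f x • X x : Model (k + 2))) ⊆ T := by
  refine (closure_mono fun x hx => ?_).trans h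
  intro h0
  exact hx (by change f x • X x = _; rw [show (X x : Model (k + 2)) = 0 from h0]; exact smul_zero _)

/-- A 1-form vanishes if its pairings with the vector fields supported in a chart vanish. -/
theorem form_eq_zero_of_pair (hμ : SmoothForm μ) (h0 : ∀ x, μ x ≠ 0) {α : Form (k + 2) M 1} (hα : SmoothForm α) (x₀ : M)
    (h : ∀ X : VF (k + 2) M, SmoothVF X →
      tsupport (fun x => (X x : Model (k + 2))) ⊆ (extChartAt (𝓡 (k + 2)) x₀).source → pair μ α X = 0) : α x₀ = 0 := by
  have key : ∀ v : Model (k + 2), α x₀ (fun _ => v) = 0 := by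
    intro v
    obtain ⟨X, hX, hv, hs⟩ := exists_local_vf x₀ v
    have hf : SmoothFun (n := k + 2) (fun x => α x (fun _ => X x)) := hα.apply fun _ => hX
    have h1 := h _ (hX.smul hf) (tsupport_smul_vf hs)
    have h2 := eq_zero_of_integ_eq_zero hμ h0 (f := fun x => α x (fun _ => X x) * α x (fun _ => X x))
      (hf.continuous.mul hf.continuous) (fun x => mul_self_nonneg _) (by
        rw [← h1]
        refine congrArg _ (funext fun x => ?_)
        exact (map_smul (lin1 (α x)) (α x (fun _ => X x)) (X x)).symm) x₀
    have h3 := mul_self_eq_zero.1 h2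
    rwa [hv] at h3
  ext v
  have : v = fun _ => v 0 := funext fun i => by rw [Subsingleton.elim i 0]
  rw [this]
  exact key _

/-- The function is tested against itself. -/
theorem fun_eq_zero_of_integ (hμ : SmoothForm μ) (h0 : ∀ x, μ x ≠ 0) {f : M → ℝ} (hf : SmoothFun (n := k + 2) f)
    (h : ∀ θ : M → ℝ, SmoothFun (n := k + 2) θ → integ μ (fun x => θ x * f x) = 0) (x : M) : f x = 0 :=
  mul_self_eq_zero.1 (eq_zero_of_integ_eq_zero hμ h0 (f := fun x => f x * f x) (hf.continuous.mul hf.continuous)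
    (fun _ => mul_self_nonneg _) (h f hf) x)

/-- The test forms are `ι_Y ι_{fX} μ` with `f = β(X, Y)`, for which the pairing is `∫ β(X, Y)² μ`. -/
theorem form2_eq_zero_of_pairForm (hμ : SmoothForm μ) (h0 : ∀ x, μ x ≠ 0) {β : Form (k + 2) M 2} (hβ : SmoothForm β)
    (h : ∀ P : Form (k + 2) M k, SmoothForm P → pairForm μ β P = 0) (x₀ : M) : β x₀ = 0 := by
  have key : ∀ v w : Model (k + 2), β x₀ ![v, w] = 0 := by
    intro v w
    obtain ⟨X, hX, hv, -⟩ := exists_local_vf x₀ v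
    obtain ⟨Y, hY, hw, -⟩ := exists_local_vf x₀ w
    have hf := smooth_form2 hβ hX hY
    have h1 := h _ (SmoothForm.iota hY (SmoothForm.iota (hX.smul hf) hμ))
    rw [pairForm_eq, dens_wedge_iota h0] at h1
    have h2 := eq_zero_of_integ_eq_zero hμ h0 (f := fun x => β x ![X x, Y x] * β x ![X x, Y x])
      (hf.continuous.mul hf.continuous) (fun x => mul_self_nonneg _) (by
        rw [← h1]
        refine congrArg _ (funext fun x => ?_)
        have e : ∀ (c : ℝ) (a b : Model (k + 2)), β x ![c • a, b] = c * β x ![a, b] := by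
          intro c a b
          rw [form2_eq, form2_eq]
          change lin1 (curryL (β x) (c • a)) b = c * lin1 (curryL (β x) a) b
          rw [map_smul]; rfl
        exact (e (β x ![X x, Y x]) (X x) (Y x)).symm) x₀
    have h3 := mul_self_eq_zero.1 h2
    rwa [hv, hw] at h3
  ext v
  have : v = ![v 0, v 1] := by ext i; fin_cases i <;> rfl
  rw [this]
  exact key _ _

end Volume

/-! ### Smooth families of diffeomorphisms -/
section DiffeoFamilies
variable {n : ℕ} {M : Type u} [TopologicalSpace M] [ChartedSpace (Model n) M] [IsManifold (𝓡 n) ∞ M]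
  {Z : Type} [NormedAddCommGroup Z] [NormedSpace ℝ Z] {S : Set Z} {k : ℕ}

/-- The expression of a family of diffeomorphisms in the preferred charts at `x₀` and `x₁`. -/
def chartMap (c : Z → Diffeo n M) (x₀ x₁ : M) (p : Z × Model n) : Model n :=
  extChartAt (𝓡 n) x₁ (c p.1 ((extChartAt (𝓡 n) x₀).symm p.2))

theorem SmoothFamDiffeo.contMDiffAt {c : Z → Diffeo n M} (hS : IsOpen S) (hc : SmoothFamDiffeo S c) {z : Z} (hz : z ∈ S)
    (x : M) : ContMDiffAt (𝓘(ℝ, Z).prod (𝓡 n)) (𝓡 n) ∞ (fun p : Z × M => c p.1 p.2) (z, x) :=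
  ContMDiffOn.contMDiffAt hc ((hS.prod isOpen_univ).mem_nhds ⟨hz, mem_univ _⟩)

theorem SmoothFamDiffeo.contDiffAt_chartMap {c : Z → Diffeo n M} (hS : IsOpen S) (hc : SmoothFamDiffeo S c) {z : Z} (hz : z ∈ S)
    {x₀ x₁ : M} {y : Model n} (hy : y ∈ (extChartAt (𝓡 n) x₀).target)
    (h1 : c z ((extChartAt (𝓡 n) x₀).symm y) ∈ (extChartAt (𝓡 n) x₁).source) :
    ContDiffAt ℝ ∞ (chartMap c x₀ x₁) (z, y) := by
  have h2 := (hc.contMDiffAt hS hz ((extChartAt (𝓡 n) x₀).symm y)).comp (z, y) (contMDiffAt_prod_symm hy)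
  exact (ContMDiffAt.comp (z, y) (contMDiffAt_chart h1) h2).contDiffAt

theorem SmoothFamDiffeo.eventually_mem {c : Z → Diffeo n M} (hS : IsOpen S) (hc : SmoothFamDiffeo S c) {z : Z} (hz : z ∈ S)
    {x₀ x₁ : M} {y : Model n} (hy : y ∈ (extChartAt (𝓡 n) x₀).target)
    (h1 : c z ((extChartAt (𝓡 n) x₀).symm y) ∈ (extChartAt (𝓡 n) x₁).source) :
    ∀ᶠ p : Z × Model n in 𝓝 (z, y), p.1 ∈ S ∧ p.2 ∈ (extChartAt (𝓡 n) x₀).target ∧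
      c p.1 ((extChartAt (𝓡 n) x₀).symm p.2) ∈ (extChartAt (𝓡 n) x₁).source := by
  have h2 := ((hc.contMDiffAt hS hz ((extChartAt (𝓡 n) x₀).symm y)).comp (z, y) (contMDiffAt_prod_symm hy)).continuousAt
  filter_upwards [eventually_mem_prod hS hz hy, h2.eventually ((isOpen_extChartAt_source x₁).mem_nhds h1)] with p hp hq
  exact ⟨hp.1, hp.2, hq⟩

/-- In charts a diffeomorphism has an invertible derivative; the inverse comes from `φ⁻¹`. -/
theorem hasFDerivAt_chart_diffeo (φ : Diffeo n M) {x₀ x₁ : M} {y : Model n} (hy : y ∈ (extChartAt (𝓡 n) x₀).target)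
    (h1 : φ ((extChartAt (𝓡 n) x₀).symm y) ∈ (extChartAt (𝓡 n) x₁).source) :
    ∃ L : Model n ≃L[ℝ] Model n, HasFDerivAt (fun y => extChartAt (𝓡 n) x₁ (φ ((extChartAt (𝓡 n) x₀).symm y)))
      (L : Model n →L[ℝ] Model n) y := by
  have key : ∀ (φ : Diffeo n M) (x₀ x₁ : M) (y : Model n) (_ : y ∈ (extChartAt (𝓡 n) x₀).target)
      (_ : φ ((extChartAt (𝓡 n) x₀).symm y) ∈ (extChartAt (𝓡 n) x₁).source) (A B : Model n →L[ℝ] Model n),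
      HasFDerivAt (fun y => extChartAt (𝓡 n) x₁ (φ ((extChartAt (𝓡 n) x₀).symm y))) A y →
      HasFDerivAt (fun y => extChartAt (𝓡 n) x₀ (φ.symm ((extChartAt (𝓡 n) x₁).symm y))) B
        (extChartAt (𝓡 n) x₁ (φ ((extChartAt (𝓡 n) x₀).symm y))) → B.comp A = ContinuousLinearMap.id ℝ _ := by
    intro φ x₀ x₁ y hy h1 A B hA hB
    refine HasFDerivAt.unique (hB.comp y hA) ((hasFDerivAt_id y).congr_of_eventuallyEq ?_)
    have hc : ContinuousAt (fun y => φ ((extChartAt (𝓡 n) x₀).symm y)) y :=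
      ContinuousAt.comp (g := φ) φ.continuous.continuousAt (continuousAt_chart_symm hy)
    filter_upwards [(isOpen_tgt x₀).mem_nhds hy, hc.eventually ((isOpen_extChartAt_source x₁).mem_nhds h1)] with y' h2 h3
    simp only [Function.comp, id]
    rw [(extChartAt (𝓡 n) x₁).left_inv h3, φ.symm_apply_apply, (extChartAt (𝓡 n) x₀).right_inv h2]
  set w := extChartAt (𝓡 n) x₁ (φ ((extChartAt (𝓡 n) x₀).symm y)) with hw
  have e1 : (extChartAt (𝓡 n) x₁).symm w = φ ((extChartAt (𝓡 n) x₀).symm y) := (extChartAt (𝓡 n) x₁).left_inv h1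
  have hw1 : w ∈ (extChartAt (𝓡 n) x₁).target := (extChartAt (𝓡 n) x₁).map_source h1
  have h2 : φ.symm ((extChartAt (𝓡 n) x₁).symm w) ∈ (extChartAt (𝓡 n) x₀).source := by
    rw [e1, φ.symm_apply_apply]; exact (extChartAt (𝓡 n) x₀).map_target hy
  have e2 : extChartAt (𝓡 n) x₀ (φ.symm ((extChartAt (𝓡 n) x₁).symm w)) = y := by
    rw [e1, φ.symm_apply_apply, (extChartAt (𝓡 n) x₀).right_inv hy]
  obtain ⟨A, hA⟩ : ∃ A : Model n →L[ℝ] Model n, HasFDerivAt (fun y => extChartAt (𝓡 n) x₁ (φ ((extChartAt (𝓡 n) x₀).symm y))) A y :=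
    ⟨_, hasFDerivAt_chart_comp hy (φ.mdifferentiable (by simp) _) h1⟩
  obtain ⟨B, hB⟩ : ∃ B : Model n →L[ℝ] Model n,
      HasFDerivAt (fun y => extChartAt (𝓡 n) x₀ (φ.symm ((extChartAt (𝓡 n) x₁).symm y))) B w :=
    ⟨_, hasFDerivAt_chart_comp hw1 (φ.symm.mdifferentiable (by simp) _) h2⟩
  have hBA := key φ x₀ x₁ y hy h1 _ _ hA hB
  have hAB := key φ.symm x₁ x₀ w hw1 h2 _ _ hB (by rw [e2]; exact hA)
  exact ⟨ContinuousLinearEquiv.equivOfInverse A B (fun v => DFunLike.congr_fun hBA v) (fun v => DFunLike.congr_fun hAB v), hA⟩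

/-- The inverses of a smooth family of diffeomorphisms form a smooth family: in charts this is the
inverse function theorem for `(z, y) ↦ (z, c_z(y))`. -/
theorem SmoothFamDiffeo.symm [CompleteSpace Z] {c : Z → Diffeo n M} (hS : IsOpen S) (hc : SmoothFamDiffeo S c) :
    SmoothFamDiffeo S (fun z => (c z).symm) := by
  rintro ⟨z, x₁⟩ ⟨hz, -⟩
  refine ContMDiffAt.contMDiffWithinAt ?_
  set x₀ := (c z).symm x₁ with hx₀
  set y := extChartAt (𝓡 n) x₀ x₀ with hy'
  have hy : y ∈ (extChartAt (𝓡 n) x₀).target := mem_extChartAt_target x₀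
  have e0 : (extChartAt (𝓡 n) x₀).symm y = x₀ := extChartAt_to_inv x₀
  have e1 : c z ((extChartAt (𝓡 n) x₀).symm y) = x₁ := by rw [e0, hx₀, (c z).apply_symm_apply]
  have h1 : c z ((extChartAt (𝓡 n) x₀).symm y) ∈ (extChartAt (𝓡 n) x₁).source := by rw [e1]; exact mem_extChartAt_source x₁
  have hG := hc.contDiffAt_chartMap hS hz hy h1
  obtain ⟨L, hL⟩ := hasFDerivAt_chart_diffeo (c z) hy h1
  set G := chartMap c x₀ x₁ with hGdef
  have hGd := (hG.differentiableAt (by simp)).hasFDerivAt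
  have hLy : ∀ v, fderiv ℝ G (z, y) (0, v) = L v := by
    intro v
    have h3 : HasFDerivAt (fun y => G (z, y)) ((fderiv ℝ G (z, y)).comp (ContinuousLinearMap.inr ℝ Z (Model n))) y :=
      hGd.comp y (hasFDerivAt_prodMk_right z y)
    exact DFunLike.congr_fun (h3.unique hL) v
  -- Inverse function theorem for `F(z, y) = (z, G(z, y))`, whose derivative is block triangular.
  let F : Z × Model n → Z × Model n := fun p => (p.1, G p)
  let F' := (ContinuousLinearEquiv.refl ℝ Z).skewProd L ((fderiv ℝ G (z, y)).comp (ContinuousLinearMap.inl ℝ Z (Model n)))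
  have hF : ContDiffAt ℝ ∞ F (z, y) := contDiffAt_fst.prodMk hG
  have hF' : HasFDerivAt F (F' : Z × Model n →L[ℝ] Z × Model n) (z, y) := by
    have h3 : HasFDerivAt F ((ContinuousLinearMap.fst ℝ Z (Model n)).prod (fderiv ℝ G (z, y))) (z, y) := hasFDerivAt_fst.prodMk hGd
    have e : (F' : Z × Model n →L[ℝ] Z × Model n) = (ContinuousLinearMap.fst ℝ Z (Model n)).prod (fderiv ℝ G (z, y)) := by
      refine ContinuousLinearMap.ext fun q => Prod.ext rfl ?_
      change L q.2 + fderiv ℝ G (z, y) (q.1, 0) = fderiv ℝ G (z, y) q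
      rw [← hLy, ← map_add]; simp
    rw [e]; exact h3
  let I := hF.localInverse hF' (by simp)
  have hI : ContDiffAt ℝ ∞ I (z, G (z, y)) := hF.to_localInverse hF' (by simp)
  have hI0 : I (z, G (z, y)) = (z, y) := hF.localInverse_apply_image hF' (by simp)
  have hFI : ∀ᶠ q in 𝓝 (z, G (z, y)), F (I q) = q :=
    (hF.hasStrictFDerivAt' hF' (by simp)).eventually_right_inverse
  have hG0 : G (z, y) = extChartAt (𝓡 n) x₁ x₁ := by
    change extChartAt (𝓡 n) x₁ (c z ((extChartAt (𝓡 n) x₀).symm y)) = _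
    rw [e1]
  have hx₁ := mem_extChartAt_source (I := 𝓡 n) x₁
  -- near `(z, x₁)`, the inverse is `(z, x) ↦ φ₀⁻¹(I(z, φ₁ x).2)`
  have hchart := contMDiffAt_prod_chart (Z := Z) (z := z) hx₁
  have h4 : ContMDiffAt (𝓘(ℝ, Z).prod (𝓡 n)) (𝓡 n) ∞
      (fun p : Z × M => (extChartAt (𝓡 n) x₀).symm (I (p.1, extChartAt (𝓡 n) x₁ p.2)).2) (z, x₁) := by
    rw [hG0] at hI hI0
    have h5 : ContMDiffAt (𝓘(ℝ, Z).prod (𝓡 n)) 𝓘(ℝ, Model n) ∞ (fun p : Z × M => (I (p.1, extChartAt (𝓡 n) x₁ p.2)).2) (z, x₁) :=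
      ContMDiffAt.comp (z, x₁) (f := fun p : Z × M => (p.1, extChartAt (𝓡 n) x₁ p.2)) (g := fun q => (I q).2)
        hI.snd.contMDiffAt hchart
    refine ContMDiffAt.comp (z, x₁) (g := (extChartAt (𝓡 n) x₀).symm) ?_ h5
    change ContMDiffAt _ _ _ _ (I (z, extChartAt (𝓡 n) x₁ x₁)).2
    rw [hI0]; exact contMDiffAt_symm hy
  refine h4.congr_of_eventuallyEq ?_
  rw [hG0] at hI hI0 hFI
  have h6 : ∀ᶠ q in 𝓝 (z, extChartAt (𝓡 n) x₁ x₁), c (I q).1 ((extChartAt (𝓡 n) x₀).symm (I q).2) ∈ (extChartAt (𝓡 n) x₁).source := by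
    have := hI.continuousAt.eventually (p := fun p : Z × Model n => p.1 ∈ S ∧ p.2 ∈ (extChartAt (𝓡 n) x₀).target ∧
      c p.1 ((extChartAt (𝓡 n) x₀).symm p.2) ∈ (extChartAt (𝓡 n) x₁).source) (by
        rw [hI0]; exact hc.eventually_mem hS hz hy h1)
    exact this.mono fun q hq => hq.2.2
  filter_upwards [hchart.continuousAt.eventually hFI, hchart.continuousAt.eventually h6, eventually_mem_source' (Z := Z) (z := z) hx₁]
    with p hp1 hp2 hp3
  have a1 : (I (p.1, extChartAt (𝓡 n) x₁ p.2)).1 = p.1 := congrArg Prod.fst hp1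
  have a2 : G (I (p.1, extChartAt (𝓡 n) x₁ p.2)) = extChartAt (𝓡 n) x₁ p.2 := congrArg Prod.snd hp1
  have a3 := (extChartAt (𝓡 n) x₁).injOn hp2 hp3 a2
  rw [a1] at a3
  change (c p.1).symm p.2 = _
  exact (congrArg (c p.1).symm a3.symm).trans ((c p.1).symm_apply_apply _)

theorem SmoothFamDiffeo.trans_const {c : Z → Diffeo n M} (hc : SmoothFamDiffeo S c) (η : Diffeo n M) :
    SmoothFamDiffeo S (fun z => η.trans (c z)) :=
  ContMDiffOn.comp (t := S ×ˢ univ) (f := fun p : Z × M => (p.1, η p.2)) hc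
    (contMDiff_fst.prodMk (η.contMDiff.comp contMDiff_snd)).contMDiffOn fun _ hp => ⟨hp.1, mem_univ _⟩

theorem SmoothFamDiffeo.comp {Z' : Type} [NormedAddCommGroup Z'] [NormedSpace ℝ Z'] {c : Z → Diffeo n M}
    (h : SmoothFamDiffeo S c) {g : Z' → Z} {S' : Set Z'} (hg : ContDiffOn ℝ ∞ g S') (hm : MapsTo g S' S) :
    SmoothFamDiffeo S' (fun z => c (g z)) :=
  ContMDiffOn.comp (t := S ×ˢ univ) (f := fun p : Z' × M => (g p.1, p.2)) h
    ((hg.contMDiffOn.comp contMDiff_fst.contMDiffOn fun _ hp => hp.1).prodMk contMDiff_snd.contMDiffOn)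
    fun _ hp => ⟨hm hp.1, mem_univ _⟩

theorem smoothFamDiffeo_const (φ : Diffeo n M) (S : Set Z) : SmoothFamDiffeo S (fun _ => φ) :=
  (φ.contMDiff.comp contMDiff_snd).contMDiffOn

/-! ### Push-forwards -/

theorem pullback_comp (f g : M → M) (σ : Form n M k) (hf : MDifferentiable (𝓡 n) (𝓡 n) f) (hg : MDifferentiable (𝓡 n) (𝓡 n) g) :
    pullback (f ∘ g) σ = pullback g (pullback f σ) := by
  funext x
  unfold pullback
  rw [mfderiv_comp x (hf _) (hg x)]
  rfl

theorem pullback_id (σ : Form n M k) : pullback id σ = σ := by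
  funext x; unfold pullback; rw [mfderiv_id]; rfl

theorem pushforward_trans (φ ψ : Diffeo n M) (σ : Form n M k) :
    pushforward (φ.trans ψ) σ = pushforward ψ (pushforward φ σ) :=
  pullback_comp φ.symm ψ.symm σ (φ.symm.mdifferentiable (by simp)) (ψ.symm.mdifferentiable (by simp))

theorem pushforward_refl (σ : Form n M k) : pushforward (Diffeomorph.refl (𝓡 n) M ∞) σ = σ := pullback_id σ

theorem pullback_pushforward (φ : Diffeo n M) (σ : Form n M k) : pullback φ (pushforward φ σ) = σ := by
  unfold pushforward
  rw [← pullback_comp _ _ _ (φ.symm.mdifferentiable (by simp)) (φ.mdifferentiable (by simp))]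
  have : φ.symm ∘ φ = id := funext φ.symm_apply_apply
  rw [this, pullback_id]

theorem SmoothFamForm.pushforward [CompleteSpace Z] {c : Z → Diffeo n M} {σ : Z → Form n M k} (hS : IsOpen S)
    (hc : SmoothFamDiffeo S c) (hσ : SmoothFamForm S σ) : SmoothFamForm S (fun z => CompMHD.pushforward (c z) (σ z)) := by
  have hc' := hc.symm hS
  rw [smoothFamForm_iff hS] at *
  intro x₁ z hz w hw
  set x₀ := (c z).symm ((extChartAt (𝓡 n) x₁).symm w)
  have h1 : (c z).symm ((extChartAt (𝓡 n) x₁).symm w) ∈ (extChartAt (𝓡 n) x₀).source := mem_extChartAt_source x₀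
  have hK := hc'.contDiffAt_chartMap hS hz hw h1
  have hσ' := hσ x₀ z hz (chartMap (fun z => (c z).symm) x₁ x₀ (z, w)) ((extChartAt (𝓡 n) x₀).map_source h1)
  have h2 : ContDiffAt ℝ ∞ (fun p : Z × Model n => chartForm x₀ (σ p.1) (chartMap (fun z => (c z).symm) x₁ x₀ p)) (z, w) :=
    ContDiffAt.comp (f := fun p : Z × Model n => (p.1, chartMap (fun z => (c z).symm) x₁ x₀ p)) (z, w) hσ' (contDiffAt_fst.prodMk hK)
  refine (contDiffAt_form_comp h2 (contDiffAt_fderiv_snd hK)).congr_of_eventuallyEq ?_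
  filter_upwards [hc'.eventually_mem hS hz hw h1] with p hp
  exact chartForm_pullback _ hp.2.1 ((c p.1).symm.mdifferentiable (by simp) _) hp.2.2

theorem SmoothForm.pushforward {φ : Diffeo n M} {σ : Form n M k} (hσ : SmoothForm σ) : SmoothForm (CompMHD.pushforward φ σ) :=
  (SmoothFamForm.pushforward isOpen_univ (smoothFamDiffeo_const φ (univ : Set ℝ)) (hσ.fam univ)).at (mem_univ 0)

/-- The exterior derivative commutes with pull-back. -/
theorem extd_pullback {f : M → M} {σ : Form n M k} (hf : ContMDiff (𝓡 n) (𝓡 n) ∞ f) (hσ : SmoothForm σ) :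
    extd (pullback f σ) = pullback f (extd σ) := by
  funext x
  have hx := mem_extChartAt_target (I := 𝓡 n) x
  have e0 : (extChartAt (𝓡 n) x).symm (extChartAt (𝓡 n) x x) = x := extChartAt_to_inv x
  have h1 : f ((extChartAt (𝓡 n) x).symm (extChartAt (𝓡 n) x x)) ∈ (extChartAt (𝓡 n) (f x)).source := by
    rw [e0]; exact mem_extChartAt_source _
  have hfd : ContDiffAt ℝ ∞ (fun y => extChartAt (𝓡 n) (f x) (f ((extChartAt (𝓡 n) x).symm y))) (extChartAt (𝓡 n) x x) :=
    (ContMDiffAt.comp (extChartAt (𝓡 n) x x) (f := fun y => f ((extChartAt (𝓡 n) x).symm y)) (contMDiffAt_chart h1)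
      (hf.contMDiffAt.comp (extChartAt (𝓡 n) x x) (contMDiffAt_symm hx))).contDiffAt
  rw [extd_apply, ← chartForm_self (pullback f (extd σ)) x,
    chartForm_pullback _ hx (hf.mdifferentiable (by simp) _) h1, chartForm_extd hσ ((extChartAt (𝓡 n) (f x)).map_source h1)]
  have e : chartForm x (pullback f σ) =ᶠ[𝓝 (extChartAt (𝓡 n) x x)] fun y =>
      (chartForm (f x) σ (extChartAt (𝓡 n) (f x) (f ((extChartAt (𝓡 n) x).symm y)))).compContinuousLinearMap
        (fderiv ℝ (fun y => extChartAt (𝓡 n) (f x) (f ((extChartAt (𝓡 n) x).symm y))) y) := by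
    have hc : ContinuousAt (fun y => f ((extChartAt (𝓡 n) x).symm y)) (extChartAt (𝓡 n) x x) :=
      ContinuousAt.comp (g := f) hf.continuous.continuousAt (continuousAt_chart_symm hx)
    filter_upwards [(isOpen_tgt x).mem_nhds hx, hc.eventually ((isOpen_extChartAt_source (f x)).mem_nhds h1)] with y h2 h3
    exact chartForm_pullback _ h2 (hf.mdifferentiable (by simp) _) h3
  rw [e.extDeriv_eq]
  exact extDeriv_pullback (r := ∞) (f := fun y => extChartAt (𝓡 n) (f x) (f ((extChartAt (𝓡 n) x).symm y)))
    ((contDiffAt_chartForm hσ ((extChartAt (𝓡 n) (f x)).map_source h1)).differentiableAt (by simp)) hfd minSmoothness_two_le_infty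

theorem extd_pushforward (φ : Diffeo n M) {σ : Form n M k} (hσ : SmoothForm σ) :
    extd (pushforward φ σ) = pushforward φ (extd σ) := extd_pullback φ.symm.contMDiff hσ

/-! ### Velocities of families of diffeomorphisms -/

theorem fderiv_prod_snd {E F : Type*} [NormedAddCommGroup E] [NormedSpace ℝ E] [NormedAddCommGroup F] [NormedSpace ℝ F]
    {f : Z × E → F} {z : Z} {y : E} (h : DifferentiableAt ℝ f (z, y)) (v : E) :
    fderiv ℝ (fun y => f (z, y)) y v = fderiv ℝ f (z, y) (0, v) := by
  have h3 : HasFDerivAt (fun y => f (z, y)) ((fderiv ℝ f (z, y)).comp (ContinuousLinearMap.inr ℝ Z E)) y :=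
    h.hasFDerivAt.comp y (hasFDerivAt_prodMk_right z y)
  rw [h3.fderiv]; rfl

theorem fderiv_prod_fst {E F : Type*} [NormedAddCommGroup E] [NormedSpace ℝ E] [NormedAddCommGroup F] [NormedSpace ℝ F]
    {f : Z × E → F} {z : Z} {y : E} (h : DifferentiableAt ℝ f (z, y)) (e : Z) :
    fderiv ℝ (fun z => f (z, y)) z e = fderiv ℝ f (z, y) (e, 0) := by
  have h3 : HasFDerivAt (fun z => f (z, y)) ((fderiv ℝ f (z, y)).comp (ContinuousLinearMap.inl ℝ Z E)) z :=
    h.hasFDerivAt.comp z (hasFDerivAt_prodMk_left z y)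
  rw [h3.fderiv]; rfl

theorem fderiv_fderiv_symm {E F : Type*} [NormedAddCommGroup E] [NormedSpace ℝ E] [NormedAddCommGroup F] [NormedSpace ℝ F]
    {f : E → F} {p : E} (h : ContDiffAt ℝ ∞ f p) (a b : E) :
    fderiv ℝ (fun q => fderiv ℝ f q a) p b = fderiv ℝ (fun q => fderiv ℝ f q b) p a := by
  have h1 : DifferentiableAt ℝ (fderiv ℝ f) p := (h.fderiv_right (m := ∞) (by simp)).differentiableAt (by simp)
  have e : ∀ c, fderiv ℝ (fun q => fderiv ℝ f q c) p = (fderiv ℝ (fderiv ℝ f) p).flip c := fun c => by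
    rw [(h1.hasFDerivAt.clm_apply (hasFDerivAt_const c p)).fderiv]; ext; simp
  rw [e, e]
  exact h.isSymmSndFDerivAt minSmoothness_two_le_infty b a

/-- `w = D_e c ∘ c⁻¹` at the parameter `z`, expressed in charts. -/
def IsVelocityDir (S : Set Z) (c : Z → Diffeo n M) (e : Z) (w : Z → VF n M) : Prop :=
  ∀ z ∈ S, ∀ (x₀ x₁ : M) (y : Model n), y ∈ (extChartAt (𝓡 n) x₀).target →
    c z ((extChartAt (𝓡 n) x₀).symm y) ∈ (extChartAt (𝓡 n) x₁).source →
    fderiv ℝ (chartMap c x₀ x₁) (z, y) (e, 0) = chartVF x₁ (w z) (chartMap c x₀ x₁ (z, y))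

/-- The defining equation `c' = w ∘ c` of a velocity, written in a pair of charts. -/
theorem IsVelocity.hasDerivAt {c : ℝ → Diffeo n M} {t : ℝ} {w : VF n M} (h : IsVelocity c t w) {x₁ m : M}
    (hm : c t m ∈ (extChartAt (𝓡 n) x₁).source) :
    HasDerivAt (fun s => extChartAt (𝓡 n) x₁ (c s m)) (chartVF x₁ w (extChartAt (𝓡 n) x₁ (c t m))) t := by
  have h1 := HasMFDerivAt.comp t (mdifferentiableAt_chart hm).hasMFDerivAt (h m)
  have h2 : HasFDerivAt (fun s => extChartAt (𝓡 n) x₁ (c s m))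
      ((dchart x₁ (c t m)).comp (ContinuousLinearMap.toSpanSingleton ℝ (w (c t m) : Model n))) t := h1.hasFDerivAt
  have h3 := h2.hasDerivAt
  have e : chartVF x₁ w (extChartAt (𝓡 n) x₁ (c t m)) = dchart x₁ (c t m) (w (c t m)) := by
    rw [chartVF_apply, (extChartAt (𝓡 n) x₁).left_inv hm]
  rw [e]
  have e2 : (dchart x₁ (c t m)).comp (ContinuousLinearMap.toSpanSingleton ℝ (w (c t m) : Model n)) 1 =
      dchart x₁ (c t m) (w (c t m)) := congrArg _ (one_smul ℝ (w (c t m) : Model n))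
  exact e2 ▸ h3

/-- A velocity along the lines `s ↦ z + s e` is a directional velocity of the family. -/
theorem isVelocityDir_of_isVelocity {c : Z → Diffeo n M} (hS : IsOpen S) (hc : SmoothFamDiffeo S c) {e : Z} {w : Z → VF n M}
    (h : ∀ z ∈ S, IsVelocity (fun s : ℝ => c (z + s • e)) 0 (w z)) : IsVelocityDir S c e w := by
  intro z hz x₀ x₁ y hy h1
  have h1' : c (z + (0 : ℝ) • e) ((extChartAt (𝓡 n) x₀).symm y) ∈ (extChartAt (𝓡 n) x₁).source := by simpa using h1
  have h2 := (h z hz).hasDerivAt h1'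
  have hG := ((hc.contDiffAt_chartMap hS hz hy h1).differentiableAt (by simp)).hasFDerivAt
  have h3 : HasDerivAt (fun s : ℝ => (z + s • e, y)) (e, (0 : Model n)) 0 := by
    have := ((hasDerivAt_id (0 : ℝ)).smul_const e).const_add z
    simpa using this.prodMk (hasDerivAt_const (0 : ℝ) y)
  have h4 := HasFDerivAt.comp_hasDerivAt (x := (0 : ℝ)) (f := fun s : ℝ => (z + s • e, y)) (l := chartMap c x₀ x₁)
    (l' := fderiv ℝ (chartMap c x₀ x₁) (z, y)) (by simpa using hG) h3
  have h5 := h4.unique h2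
  simpa [chartMap] using h5

/-- Velocities depend smoothly on all variables: in charts `w` is the partial derivative of `c`
composed with the inverse family, which is smooth. -/
theorem IsVelocityDir.smooth [CompleteSpace Z] {c : Z → Diffeo n M} {e : Z} {w : Z → VF n M} (hS : IsOpen S)
    (hc : SmoothFamDiffeo S c) (h : IsVelocityDir S c e w) : SmoothFamVF S w := by
  have hc' := hc.symm hS
  rw [smoothFamVF_iff hS]
  intro x₁ z hz y₁ hy₁
  set x₀ := (c z).symm ((extChartAt (𝓡 n) x₁).symm y₁)
  have h1 : (c z).symm ((extChartAt (𝓡 n) x₁).symm y₁) ∈ (extChartAt (𝓡 n) x₀).source := mem_extChartAt_source x₀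
  have hK := hc'.contDiffAt_chartMap hS hz hy₁ h1
  have hy : chartMap (fun z => (c z).symm) x₁ x₀ (z, y₁) ∈ (extChartAt (𝓡 n) x₀).target := (extChartAt (𝓡 n) x₀).map_source h1
  have h2 : c z ((extChartAt (𝓡 n) x₀).symm (chartMap (fun z => (c z).symm) x₁ x₀ (z, y₁))) ∈ (extChartAt (𝓡 n) x₁).source := by
    unfold chartMap
    rw [(extChartAt (𝓡 n) x₀).left_inv h1, (c z).apply_symm_apply]
    exact (extChartAt (𝓡 n) x₁).map_target hy₁
  have hG := (hc.contDiffAt_chartMap hS hz hy h2).fderiv_right (m := ∞) (by simp)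
  have h3 : ContDiffAt ℝ ∞ (fun p : Z × Model n => fderiv ℝ (chartMap c x₀ x₁) (p.1, chartMap (fun z => (c z).symm) x₁ x₀ p)) (z, y₁) :=
    ContDiffAt.comp (f := fun p : Z × Model n => (p.1, chartMap (fun z => (c z).symm) x₁ x₀ p)) (z, y₁) hG (contDiffAt_fst.prodMk hK)
  refine (h3.clm_apply (contDiffAt_const (c := (e, (0 : Model n))))).congr_of_eventuallyEq ?_
  filter_upwards [hc'.eventually_mem hS hz hy₁ h1] with p ⟨hp1, hp2, hp3⟩
  have e1 : c p.1 ((extChartAt (𝓡 n) x₀).symm (chartMap (fun z => (c z).symm) x₁ x₀ p)) = (extChartAt (𝓡 n) x₁).symm p.2 := by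
    unfold chartMap
    rw [(extChartAt (𝓡 n) x₀).left_inv hp3, (c p.1).apply_symm_apply]
  have e2 : chartMap c x₀ x₁ (p.1, chartMap (fun z => (c z).symm) x₁ x₀ p) = p.2 :=
    (congrArg (extChartAt (𝓡 n) x₁) e1).trans ((extChartAt (𝓡 n) x₁).right_inv hp2)
  have h4 := h p.1 hp1 x₀ x₁ (chartMap (fun z => (c z).symm) x₁ x₀ p) ((extChartAt (𝓡 n) x₀).map_source hp3)
    (by rw [e1]; exact (extChartAt (𝓡 n) x₁).map_target hp2)
  rw [e2] at h4
  exact h4.symm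

end DiffeoFamilies

/-! ### Velocities, Lie derivatives and variations -/
section Velocity
variable {n : ℕ} {M : Type u} [TopologicalSpace M] [ChartedSpace (Model n) M] [IsManifold (𝓡 n) ∞ M] {k : ℕ}

theorem IsVelocity.unique {c : ℝ → Diffeo n M} {t : ℝ} {w w' : VF n M} (h : IsVelocity c t w) (h' : IsVelocity c t w') : w = w' := by
  funext x
  obtain ⟨y, rfl⟩ : ∃ y, c t y = x := (c t).toEquiv.surjective x
  have h1 : (ContinuousLinearMap.toSpanSingleton ℝ (w (c t y) : Model n)) = ContinuousLinearMap.toSpanSingleton ℝ (w' (c t y) : Model n) :=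
    hasMFDerivAt_unique (f := fun s => c s y) (x := t) (h y) (h' y)
  have h2 := DFunLike.congr_fun h1 1
  rw [ContinuousLinearMap.toSpanSingleton_apply, ContinuousLinearMap.toSpanSingleton_apply, one_smul, one_smul] at h2
  exact h2

theorem isVelocity_of_hasMFDerivAt {c : ℝ → Diffeo n M} {t : ℝ} {L : M → ℝ →L[ℝ] Model n}
    (h : ∀ y, HasMFDerivAt 𝓘(ℝ, ℝ) (𝓡 n) (fun s => c s y) t (L y)) :
    IsVelocity c t (fun x => L ((c t).symm x) 1) := by
  intro y
  have e : (ContinuousLinearMap.toSpanSingleton ℝ (L ((c t).symm (c t y)) 1) : ℝ →L[ℝ] Model n) = L y := by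
    rw [(c t).symm_apply_apply]
    exact ContinuousLinearMap.ext fun r => by
      rw [ContinuousLinearMap.toSpanSingleton_apply, ← map_smul, smul_eq_mul, mul_one]
  exact e.symm ▸ h y

theorem exists_velocity {c : ℝ → Diffeo n M} {S : Set ℝ} (hS : IsOpen S) (hc : SmoothFamDiffeo S c) {t : ℝ} (ht : t ∈ S) :
    ∃ w : VF n M, IsVelocity c t w := by
  have h : ∀ y : M, MDifferentiableAt 𝓘(ℝ, ℝ) (𝓡 n) (fun s => c s y) t := fun y =>
    (ContMDiffAt.comp t (f := fun s : ℝ => (s, y)) (hc.contMDiffAt hS ht y)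
      (contMDiffAt_id.prodMk contMDiffAt_const)).mdifferentiableAt (by simp)
  exact ⟨_, isVelocity_of_hasMFDerivAt (L := fun y => mfderiv 𝓘(ℝ, ℝ) (𝓡 n) (fun s => c s y) t) fun y => (h y).hasMFDerivAt⟩

theorem IsVelocity.comp_add {c : ℝ → Diffeo n M} {t : ℝ} {w : VF n M} (h : IsVelocity c t w) :
    IsVelocity (fun s => c (t + s)) 0 w := by
  intro y
  have h1 : HasMFDerivAt 𝓘(ℝ, ℝ) 𝓘(ℝ, ℝ) (fun s : ℝ => t + s) 0 (ContinuousLinearMap.id ℝ ℝ) :=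
    ((hasFDerivAt_id (0 : ℝ)).const_add t).hasMFDerivAt
  have h2 : HasMFDerivAt 𝓘(ℝ, ℝ) (𝓡 n) (fun s => c s y) (t + 0) (ContinuousLinearMap.toSpanSingleton ℝ (w (c (t + 0) y))) := by
    rw [add_zero]; exact h y
  exact HasMFDerivAt.comp 0 h2 h1

theorem exists_smooth_velocity {c : ℝ → Diffeo n M} {S : Set ℝ} (hS : IsOpen S) (hc : SmoothFamDiffeo S c) :
    ∃ W : ℝ → VF n M, SmoothFamVF S W ∧ ∀ t ∈ S, IsVelocity c t (W t) := by
  have h : ∀ t, ∃ w : VF n M, t ∈ S → IsVelocity c t w := fun t => by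
    by_cases ht : t ∈ S
    · obtain ⟨w, hw⟩ := exists_velocity hS hc ht; exact ⟨w, fun _ => hw⟩
    · exact ⟨0, fun h => absurd h ht⟩
  choose W hW using h
  refine ⟨W, IsVelocityDir.smooth (e := 1) hS hc (isVelocityDir_of_isVelocity hS hc fun z hz => ?_), hW⟩
  simpa using (hW z hz).comp_add

theorem IsVelocity.smooth {c : ℝ → Diffeo n M} {S : Set ℝ} (hS : IsOpen S) (hc : SmoothFamDiffeo S c) {t : ℝ} (ht : t ∈ S)
    {w : VF n M} (h : IsVelocity c t w) : SmoothVF w := by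
  obtain ⟨W, hW, hV⟩ := exists_smooth_velocity hS hc
  rw [h.unique (hV t ht)]
  exact hW.at ht

/-- Derivative of a push-forward at a time when the diffeomorphism is the identity. It is obtained by
differentiating the identity `(c_s)^* (c_s)_* σ = σ` in a chart. -/
theorem hasDerivAt_pushforward_refl {c : ℝ → Diffeo n M} {S : Set ℝ} (hS : IsOpen S) (hc : SmoothFamDiffeo S c) {t : ℝ} (ht : t ∈ S)
    (h0 : c t = Diffeomorph.refl (𝓡 n) M ∞) {w : VF n M} (hw : IsVelocity c t w) {σ : Form n M (k + 1)} (hσ : SmoothForm σ) (x : M) :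
    HasDerivAt (fun s => pushforward (c s) σ x) (-lieD w σ x) t := by
  have hwS := hw.smooth hS hc ht
  set y₀ := extChartAt (𝓡 n) x x with hy₀
  have hy : y₀ ∈ (extChartAt (𝓡 n) x).target := mem_extChartAt_target x
  have e0 : (extChartAt (𝓡 n) x).symm y₀ = x := extChartAt_to_inv x
  have h0' : ∀ m, c t m = m := fun m => by rw [h0]; rfl
  have h1 : c t ((extChartAt (𝓡 n) x).symm y₀) ∈ (extChartAt (𝓡 n) x).source := by rw [h0', e0]; exact mem_extChartAt_source x
  set B : ℝ × Model n → Model n [⋀^Fin (k + 1)]→L[ℝ] ℝ := fun p => chartForm x (pushforward (c p.1) σ) p.2 with hB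
  have hBs : ContDiffAt ℝ ∞ B (t, y₀) :=
    (smoothFamForm_iff hS).1 (SmoothFamForm.pushforward hS hc (hσ.fam S)) x t ht y₀ hy
  set G := chartMap c x x with hG
  have hGs : ContDiffAt ℝ ∞ G (t, y₀) := hc.contDiffAt_chartMap hS ht hy h1
  have hGt : ∀ y ∈ (extChartAt (𝓡 n) x).target, G (t, y) = y := fun y hy => by
    change extChartAt (𝓡 n) x (c t ((extChartAt (𝓡 n) x).symm y)) = y
    rw [h0', (extChartAt (𝓡 n) x).right_inv hy]
  set X := chartVF x w with hX
  have hXs : ContDiffAt ℝ ∞ X y₀ := hwS.contDiffAt_chart hy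
  have hBt : (fun y => B (t, y)) = chartForm x σ := by
    funext y
    change chartForm x (pushforward (c t) σ) y = _
    rw [h0, pushforward_refl]
  -- the time derivative of the chart expression is `X`
  have hGX : ∀ y ∈ (extChartAt (𝓡 n) x).target, HasDerivAt (fun s => G (s, y)) (X y) t := by
    intro y hy
    have h3 : c t ((extChartAt (𝓡 n) x).symm y) ∈ (extChartAt (𝓡 n) x).source := by
      rw [h0']; exact (extChartAt (𝓡 n) x).map_target hy
    have h2 := hw.hasDerivAt h3
    have e3 : extChartAt (𝓡 n) x (c t ((extChartAt (𝓡 n) x).symm y)) = y := hGt y hy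
    rw [e3] at h2
    exact h2
  have hP : HasDerivAt (fun s => B (s, G (s, y₀))) (fderiv ℝ B (t, y₀) (1, X y₀)) t := by
    have h2 : HasFDerivAt B (fderiv ℝ B (t, y₀)) (t, G (t, y₀)) := by
      rw [hGt y₀ hy]; exact (hBs.differentiableAt (by simp)).hasFDerivAt
    exact h2.comp_hasDerivAt t ((hasDerivAt_id t).prodMk (hGX y₀ hy))
  have hQs : DifferentiableAt ℝ (fun s => fderiv ℝ (fun y => G (s, y)) y₀) t :=
    (ContDiffAt.comp (f := fun s : ℝ => (s, y₀)) t (contDiffAt_fderiv_snd hGs) (by fun_prop)).differentiableAt (by simp)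
  have hnear : ∀ᶠ s in 𝓝 t, DifferentiableAt ℝ G (s, y₀) := by
    have h2 : ∀ᶠ q in 𝓝 (t, y₀), ContDiffAt ℝ 1 G q := (hGs.of_le (by simp)).eventually (by simp)
    have h3 : ContinuousAt (fun s : ℝ => (s, y₀)) t := by fun_prop
    exact (h3.eventually h2).mono fun s hs => hs.differentiableAt (by simp)
  have hQ : HasDerivAt (fun s => fderiv ℝ (fun y => G (s, y)) y₀) (fderiv ℝ X y₀) t := by
    have h2 := hQs.hasDerivAt
    suffices h3 : deriv (fun s => fderiv ℝ (fun y => G (s, y)) y₀) t = fderiv ℝ X y₀ by rwa [h3] at h2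
    refine ContinuousLinearMap.ext fun v => ?_
    have h4 : HasDerivAt (fun s => fderiv ℝ (fun y => G (s, y)) y₀ v) (deriv (fun s => fderiv ℝ (fun y => G (s, y)) y₀) t v) t := by
      have := h2.clm_apply (hasDerivAt_const t v)
      simpa using this
    have hdd : ∀ a : ℝ × Model n, DifferentiableAt ℝ (fun q => fderiv ℝ G q a) (t, y₀) := fun a =>
      ((hGs.fderiv_right (m := ∞) (by simp)).clm_apply contDiffAt_const).differentiableAt (by simp)
    have h5 : HasDerivAt (fun s => fderiv ℝ G (s, y₀) (0, v)) (fderiv ℝ (fun q => fderiv ℝ G q (0, v)) (t, y₀) (1, 0)) t :=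
      HasFDerivAt.comp_hasDerivAt (f := fun s : ℝ => (s, y₀)) t (hdd (0, v)).hasFDerivAt ((hasDerivAt_id t).prodMk (hasDerivAt_const t y₀))
    have h6 : HasDerivAt (fun s => fderiv ℝ (fun y => G (s, y)) y₀ v) (fderiv ℝ (fun q => fderiv ℝ G q (0, v)) (t, y₀) (1, 0)) t :=
      h5.congr_of_eventuallyEq (hnear.mono fun s hs => fderiv_prod_snd hs v)
    rw [h4.unique h6, fderiv_fderiv_symm hGs]
    have h7 : HasFDerivAt (fun y => fderiv ℝ G (t, y) (1, 0)) _ y₀ := (hdd (1, 0)).hasFDerivAt.comp y₀ (hasFDerivAt_prodMk_right t y₀)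
    have h8 : (fun y => fderiv ℝ G (t, y) (1, 0)) =ᶠ[𝓝 y₀] X := by
      have h9 : ∀ᶠ y in 𝓝 y₀, DifferentiableAt ℝ G (t, y) := by
        have h2 : ∀ᶠ q in 𝓝 (t, y₀), ContDiffAt ℝ 1 G q := (hGs.of_le (by simp)).eventually (by simp)
        have h3 : ContinuousAt (fun y : Model n => (t, y)) y₀ := by fun_prop
        exact (h3.eventually h2).mono fun s hs => hs.differentiableAt (by simp)
      filter_upwards [h9, (isOpen_tgt x).mem_nhds hy] with y h10 h11
      rw [← fderiv_prod_fst h10, ← (hGX y h11).deriv]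
      rfl
    rw [← h8.fderiv_eq, h7.fderiv]
    rfl
  have hQt : fderiv ℝ (fun y => G (t, y)) y₀ = ContinuousLinearMap.id ℝ (Model n) := by
    have h2 : (fun y => G (t, y)) =ᶠ[𝓝 y₀] id := by
      filter_upwards [(isOpen_tgt x).mem_nhds hy] with y hy using hGt y hy
    rw [h2.fderiv_eq, fderiv_id]
  -- `σ` is the pullback of its push-forward
  have hconst : (fun s => (B (s, G (s, y₀))).compContinuousLinearMap (fderiv ℝ (fun y => G (s, y)) y₀)) =ᶠ[𝓝 t] fun _ => σ x := by
    have h2 := hc.eventually_mem hS ht hy h1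
    have h3 : ContinuousAt (fun s : ℝ => (s, y₀)) t := by fun_prop
    filter_upwards [h3.eventually h2] with s ⟨hs1, hs2, hs3⟩
    rw [← chartForm_self σ x]
    have h4 := chartForm_pullback (pushforward (c s) σ) hs2 ((c s).mdifferentiable (by simp) _) hs3
    rw [pullback_pushforward] at h4
    exact h4.symm
  have hd := (hP.hasFDerivAt.continuousAlternatingMapCompContinuousLinearMap hQ.hasFDerivAt).unique
    ((hasFDerivAt_const (σ x) t).congr_of_eventuallyEq hconst)
  have hd1 := DFunLike.congr_fun hd 1
  have hG0 := hGt y₀ hy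
  have hd2 : fderiv ℝ B (t, y₀) (1, X y₀) +
      (chartForm x σ y₀).fderivCompContinuousLinearMap (ContinuousLinearMap.id ℝ (Model n)) (fderiv ℝ X y₀) = 0 := by
    have e1 : B (t, G (t, y₀)) = chartForm x σ y₀ := by rw [hG0]; exact congrFun hBt y₀
    rw [hQt, e1] at hd1
    simp only [add_apply, ContinuousLinearMap.comp_apply, ContinuousLinearMap.toSpanSingleton_apply, one_smul] at hd1
    exact hd1
  have hBd := hBs.differentiableAt (by simp)
  have e4 : fderiv ℝ B (t, y₀) (1, X y₀) = fderiv ℝ (fun s => B (s, y₀)) t 1 + fderiv ℝ (chartForm x σ) y₀ (X y₀) := by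
    rw [← hBt, fderiv_prod_fst hBd, fderiv_prod_snd hBd, ← map_add]; simp
  have h10 : HasDerivAt (fun s => B (s, y₀)) (fderiv ℝ (fun s => B (s, y₀)) t 1) t := by
    have : DifferentiableAt ℝ (fun s => B (s, y₀)) t := hBd.comp t (f := fun s : ℝ => (s, y₀)) (by fun_prop)
    exact this.hasFDerivAt.hasDerivAt
  have e5 : (fun s => B (s, y₀)) = fun s => pushforward (c s) σ x := funext fun s => chartForm_self _ x
  have h11 := cartan_formula ((contDiffAt_chartForm hσ hy).differentiableAt (by simp)) (hXs.differentiableAt (by simp))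
  have e6 : lieD w σ x = (extDeriv (chartForm x σ) y₀).curryLeft (X y₀) + extDeriv (fun z => (chartForm x σ z).curryLeft (X z)) y₀ := by
    change (extd σ x).curryLeft (w x) + extd (iota w σ) x = _
    rw [extd_iota_chart, extd_apply, hX, chartVF_self]
  rw [e6, h11, ← e5]
  convert h10 using 1
  rw [e4] at hd2
  refine (eq_neg_of_add_eq_zero_left ?_).symm
  rw [← hd2]; abel

/-- `d/dt (c_t)_* σ = -𝓛_w (c_t)_* σ`, where `w` is the velocity of `c`. -/
theorem hasDerivAt_pushforward {c : ℝ → Diffeo n M} {S : Set ℝ} (hS : IsOpen S) (hc : SmoothFamDiffeo S c) {t : ℝ} (ht : t ∈ S)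
    {w : VF n M} (hw : IsVelocity c t w) {σ : Form n M (k + 1)} (hσ : SmoothForm σ) (x : M) :
    HasDerivAt (fun s => pushforward (c s) σ x) (-lieD w (pushforward (c t) σ) x) t := by
  have h := hasDerivAt_pushforward_refl (c := fun s => (c t).symm.trans (c s)) hS (hc.trans_const _) ht
    (by ext x; exact (c t).apply_symm_apply x) (w := w)
    (fun y => by
      have h1 := hw ((c t).symm y)
      exact h1) (hσ.pushforward (φ := c t)) x
  have e : ∀ s, pushforward ((c t).symm.trans (c s)) (pushforward (c t) σ) = pushforward (c s) σ := fun s => by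
    rw [← pushforward_trans]
    congr 1
    ext x
    change c s ((c t).symm (c t x)) = c s x
    rw [(c t).symm_apply_apply]
  simpa only [e] using h

variable {Z : Type} [NormedAddCommGroup Z] [NormedSpace ℝ Z] {S : Set Z}

/-- The commutator of the partial velocities of a family of diffeomorphisms is a Lie bracket. -/
theorem velocity_bracket [CompleteSpace Z] {c : Z → Diffeo n M} (hS : IsOpen S) (hc : SmoothFamDiffeo S c) {e₁ e₂ : Z} {V W : Z → VF n M}
    (hV : IsVelocityDir S c e₁ V) (hW : IsVelocityDir S c e₂ W) {z : Z} (hz : z ∈ S) (x : M) :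
    fderiv ℝ (F := Model n) (fun z => V z x) z e₂ - fderiv ℝ (F := Model n) (fun z => W z x) z e₁ =
      VectorField.mlieBracket (𝓡 n) (V z) (W z) x := by
  set x₀ := (c z).symm x with hx₀
  set y := extChartAt (𝓡 n) x₀ x₀
  have hy : y ∈ (extChartAt (𝓡 n) x₀).target := mem_extChartAt_target x₀
  have e1 : c z ((extChartAt (𝓡 n) x₀).symm y) = x := by rw [extChartAt_to_inv, hx₀, (c z).apply_symm_apply]
  have h1 : c z ((extChartAt (𝓡 n) x₀).symm y) ∈ (extChartAt (𝓡 n) x).source := by rw [e1]; exact mem_extChartAt_source x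
  set G := chartMap c x₀ x
  have hG : ContDiffAt ℝ ∞ G (z, y) := hc.contDiffAt_chartMap hS hz hy h1
  have hGz : G (z, y) = extChartAt (𝓡 n) x x := congrArg (extChartAt (𝓡 n) x) e1
  have hp := mem_extChartAt_target (I := 𝓡 n) x
  -- The mixed second derivative of the chart expression of `c`, through `∂_a G = U(z, G)`. Computing it in
  -- both orders gives the claim.
  have key : ∀ (a b : Z) (U U' : Z → VF n M), IsVelocityDir S c a U → IsVelocityDir S c b U' →
      fderiv ℝ (fun q => fderiv ℝ G q (a, 0)) (z, y) (b, 0) =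
        fderiv ℝ (F := Model n) (fun z => U z x) z b +
          fderiv ℝ (chartVF x (U z)) (extChartAt (𝓡 n) x x) (chartVF x (U' z) (extChartAt (𝓡 n) x x)) := by
    intro a b U U' hU hU'
    have hUs := (smoothFamVF_iff hS).1 (hU.smooth hS hc) x z hz _ hp
    have hUd := hUs.differentiableAt (by simp)
    have e2 : (fun q => fderiv ℝ G q (a, 0)) =ᶠ[𝓝 (z, y)] fun q => chartVF x (U q.1) (G q) := by
      filter_upwards [hc.eventually_mem hS hz hy h1] with q ⟨hq1, hq2, hq3⟩
      exact hU q.1 hq1 x₀ x q.2 hq2 hq3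
    have h2 : HasFDerivAt (fun p : Z × Model n => chartVF x (U p.1) p.2) (fderiv ℝ (fun p : Z × Model n => chartVF x (U p.1) p.2)
        (z, extChartAt (𝓡 n) x x)) (z, G (z, y)) := by rw [hGz]; exact hUd.hasFDerivAt
    have h3 : HasFDerivAt (fun q : Z × Model n => chartVF x (U q.1) (G q)) _ (z, y) :=
      h2.comp (z, y) (f := fun q : Z × Model n => (q.1, G q)) (hasFDerivAt_fst.prodMk (hG.differentiableAt (by simp)).hasFDerivAt)
    rw [e2.fderiv_eq, h3.fderiv]
    have e3 : fderiv ℝ G (z, y) (b, 0) = chartVF x (U' z) (extChartAt (𝓡 n) x x) := by rw [hU' z hz x₀ x y hy h1]; exact congrArg _ hGz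
    change fderiv ℝ (fun p : Z × Model n => chartVF x (U p.1) p.2) (z, extChartAt (𝓡 n) x x) (b, fderiv ℝ G (z, y) (b, 0)) = _
    have e4 : (fun z => (U z x : Model n)) = fun z => chartVF x (U z) (extChartAt (𝓡 n) x x) :=
      funext fun z => (chartVF_self (U z) x).symm
    rw [e3, e4, fderiv_prod_fst hUd, show chartVF x (U z) = fun y => (fun p : Z × Model n => chartVF x (U p.1) p.2) (z, y) from rfl,
      fderiv_prod_snd hUd, ← map_add]
    simp
  have k1 := key e₁ e₂ V W hV hW
  have k2 := key e₂ e₁ W V hW hV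
  rw [fderiv_fderiv_symm hG, k2] at k1
  rw [mlieBracket_eq_chart, VectorField.lieBracket]
  have e5 : ∀ a b c d : Model n, a + b = c + d → c - a = b - d := fun a b c d h => by
    rw [sub_eq_sub_iff_add_eq_add, ← h, add_comm]
  exact e5 _ _ _ _ k1

end Velocity

section Variation

/-- `y ↦ y + ε X(y)` is a diffeomorphism of the model space when `|ε|` times the Lipschitz constant
of `X` is less than `1`. -/
theorem exists_homeomorph_add_smul {n : ℕ} {X : Model n → Model n} (hX : ContDiff ℝ ∞ X) (hc : HasCompactSupport X) :
    ∃ δ : ℝ, 0 < δ ∧ ∀ ε : ℝ, |ε| < δ → ∃ f : Model n ≃ₜ Model n, (∀ y, f y = y + ε • X y) ∧ ContDiff ℝ ∞ f.symm := by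
  obtain ⟨C, hC⟩ := hX.lipschitzWith_of_hasCompactSupport hc (by simp)
  refine ⟨((C : ℝ) + 1)⁻¹, by positivity, fun ε hε => ?_⟩
  have hlt : |ε| * C < 1 := by
    have h1 : |ε| * ((C : ℝ) + 1) < 1 := by
      rw [← lt_div_iff₀ (by positivity), one_div]; exact hε
    nlinarith [abs_nonneg ε]
  set κ : NNReal := ⟨|ε| * C, by positivity⟩ with hκ
  have happ : ApproximatesLinearOn (fun y => y + ε • X y) ((ContinuousLinearEquiv.refl ℝ (Model n)) : Model n →L[ℝ] Model n) univ κ := by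
    intro x _ y _
    have e : (x + ε • X x) - (y + ε • X y) - (x - y) = ε • (X x - X y) := by rw [smul_sub]; abel
    change ‖(x + ε • X x) - (y + ε • X y) - (x - y)‖ ≤ _
    rw [e, norm_smul, Real.norm_eq_abs, hκ]
    change _ ≤ |ε| * C * ‖x - y‖
    rw [mul_assoc]
    refine mul_le_mul_of_nonneg_left ?_ (abs_nonneg ε)
    simpa [dist_eq_norm] using hC.dist_le_mul x y
  have hN : Subsingleton (Model n) ∨ κ < ‖((ContinuousLinearEquiv.refl ℝ (Model n)).symm : Model n →L[ℝ] Model n)‖₊⁻¹ := by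
    rcases subsingleton_or_nontrivial (Model n) with h | h
    · exact Or.inl h
    · right
      have : ‖((ContinuousLinearEquiv.refl ℝ (Model n)).symm : Model n →L[ℝ] Model n)‖₊ = 1 := by
        ext; exact ContinuousLinearMap.norm_id (𝕜 := ℝ) (E := Model n)
      rw [this, inv_one]
      exact hlt
  let f := happ.toHomeomorph _ hN
  have hf : ∀ y, f y = y + ε • X y := fun y => rfl
  refine ⟨f, hf, ?_⟩
  have hd : ∀ y, HasFDerivAt f (ContinuousLinearMap.id ℝ (Model n) + ε • fderiv ℝ X y) y := fun y =>
    (hasFDerivAt_id y).add (((hX.differentiable (by simp)) y).hasFDerivAt.const_smul ε)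
  have hinj : ∀ y, Function.Injective (ContinuousLinearMap.id ℝ (Model n) + ε • fderiv ℝ X y) := by
    intro y
    rw [injective_iff_map_eq_zero]
    intro v hv
    have h1 : v = -(ε • fderiv ℝ X y v) := eq_neg_of_add_eq_zero_left hv
    have h2 : ‖v‖ ≤ |ε| * (C * ‖v‖) := by
      calc ‖v‖ = |ε| * ‖fderiv ℝ X y v‖ := by conv_lhs => rw [h1, norm_neg, norm_smul, Real.norm_eq_abs]
        _ ≤ |ε| * (C * ‖v‖) := mul_le_mul_of_nonneg_left
          ((ContinuousLinearMap.le_opNorm _ _).trans (mul_le_mul_of_nonneg_right (norm_fderiv_le_of_lipschitz ℝ hC) (norm_nonneg _))) (abs_nonneg ε)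
    by_contra hne
    have h3 : 0 < ‖v‖ := norm_pos_iff.2 hne
    nlinarith
  let f' : Model n → Model n ≃L[ℝ] Model n := fun y =>
    (LinearEquiv.ofInjectiveEndo (ContinuousLinearMap.id ℝ (Model n) + ε • fderiv ℝ X y : Model n →L[ℝ] Model n).toLinearMap (hinj y)).toContinuousLinearEquiv
  refine f.contDiff_symm (f₀' := f') (fun y => ?_) ?_
  · have : (f' y : Model n →L[ℝ] Model n) = ContinuousLinearMap.id ℝ (Model n) + ε • fderiv ℝ X y := by
      ext1 v; rfl
    rw [this]; exact hd y
  · exact contDiff_id.add (hX.const_smul ε)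

variable {n : ℕ} {M : Type u} [TopologicalSpace M] [ChartedSpace (Model n) M] [IsManifold (𝓡 n) ∞ M]

open Classical in
/-- A map of `M` that is given by `f` in the preferred chart at `x₀` and is the identity elsewhere. -/
def extendChart (x₀ : M) (f : Model n → Model n) (x : M) : M :=
  if x ∈ (extChartAt (𝓡 n) x₀).source then (extChartAt (𝓡 n) x₀).symm (f (extChartAt (𝓡 n) x₀ x)) else x

theorem extendChart_of_mem {x₀ x : M} (f : Model n → Model n) (h : x ∈ (extChartAt (𝓡 n) x₀).source) :
    extendChart x₀ f x = (extChartAt (𝓡 n) x₀).symm (f (extChartAt (𝓡 n) x₀ x)) := if_pos h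

theorem extendChart_of_notMem {x₀ x : M} (f : Model n → Model n) (h : x ∉ (extChartAt (𝓡 n) x₀).source) :
    extendChart x₀ f x = x := if_neg h

theorem extendChart_comp {x₀ : M} {f g : Model n → Model n} (hg : MapsTo g (extChartAt (𝓡 n) x₀).target (extChartAt (𝓡 n) x₀).target)
    (h : ∀ y, f (g y) = y) (x : M) : extendChart x₀ f (extendChart x₀ g x) = x := by
  by_cases hx : x ∈ (extChartAt (𝓡 n) x₀).source
  · have h1 := hg ((extChartAt (𝓡 n) x₀).map_source hx)
    rw [extendChart_of_mem g hx, extendChart_of_mem f ((extChartAt (𝓡 n) x₀).map_target h1), (extChartAt (𝓡 n) x₀).right_inv h1, h,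
      (extChartAt (𝓡 n) x₀).left_inv hx]
  · rw [extendChart_of_notMem g hx, extendChart_of_notMem f hx]

/-- The map is smooth in the chart domain, and is the identity near every point outside the closed
set `T`; these two open sets cover the manifold. -/
theorem contMDiffAt_extendChart {Z : Type} [NormedAddCommGroup Z] [NormedSpace ℝ Z] {x₀ : M} {f : Z → Model n → Model n} {T : Set M}
    {z : Z} (hf : ContDiff ℝ ∞ (fun p : Z × Model n => f p.1 p.2)) (hm : MapsTo (f z) (extChartAt (𝓡 n) x₀).target (extChartAt (𝓡 n) x₀).target)
    (hT : IsClosed T) (hTs : T ⊆ (extChartAt (𝓡 n) x₀).source)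
    (hfT : ∀ z, ∀ x ∈ (extChartAt (𝓡 n) x₀).source, x ∉ T → f z (extChartAt (𝓡 n) x₀ x) = extChartAt (𝓡 n) x₀ x) (x : M) :
    ContMDiffAt (𝓘(ℝ, Z).prod (𝓡 n)) (𝓡 n) ∞ (fun p : Z × M => extendChart x₀ (f p.1) p.2) (z, x) := by
  by_cases hx : x ∈ (extChartAt (𝓡 n) x₀).source
  · have h1 : ContMDiffAt (𝓘(ℝ, Z).prod (𝓡 n)) 𝓘(ℝ, Model n) ∞ (fun p : Z × M => f p.1 (extChartAt (𝓡 n) x₀ p.2)) (z, x) :=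
      ContMDiffAt.comp (z, x) (f := fun p : Z × M => (p.1, extChartAt (𝓡 n) x₀ p.2)) hf.contMDiff.contMDiffAt (contMDiffAt_prod_chart hx)
    refine (ContMDiffAt.comp (z, x) (g := (extChartAt (𝓡 n) x₀).symm)
      (contMDiffAt_symm (hm ((extChartAt (𝓡 n) x₀).map_source hx))) h1).congr_of_eventuallyEq ?_
    filter_upwards [eventually_mem_source' (Z := Z) (z := z) hx] with p hp
    exact extendChart_of_mem _ hp
  · refine contMDiffAt_snd.congr_of_eventuallyEq ?_
    have h1 : ∀ᶠ p : Z × M in 𝓝 (z, x), p.2 ∉ T := continuousAt_snd.eventually (hT.isOpen_compl.mem_nhds fun h => hx (hTs h))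
    filter_upwards [h1] with p hp
    by_cases h2 : p.2 ∈ (extChartAt (𝓡 n) x₀).source
    · rw [extendChart_of_mem _ h2, hfT _ _ h2 hp, (extChartAt (𝓡 n) x₀).left_inv h2]
    · exact extendChart_of_notMem _ h2

/-- Every smooth vector field supported in a chart is the initial velocity of a smooth curve of
diffeomorphisms through the identity: in the chart, the curve is `y ↦ y + ε X(y)`. -/
theorem exists_variation [CompactSpace M] [T2Space M] {X : VF n M} (hX : SmoothVF X) {x₀ : M}
    (hs : tsupport (fun x => (X x : Model n)) ⊆ (extChartAt (𝓡 n) x₀).source) :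
    ∃ δ : ℝ, 0 < δ ∧ ∃ ψ : ℝ → Diffeo n M, SmoothFamDiffeo (Ioo (-δ) δ) ψ ∧ ψ 0 = Diffeomorph.refl (𝓡 n) M ∞ ∧ IsVelocity ψ 0 X := by
  set T := tsupport (fun x => (X x : Model n)) with hT
  have hTc : IsClosed T := isClosed_tsupport _
  have hX0 : ∀ x ∉ T, (X x : Model n) = 0 := fun x hx => image_eq_zero_of_notMem_tsupport hx
  have hx0 : ∀ y ∈ (extChartAt (𝓡 n) x₀).target, (extChartAt (𝓡 n) x₀).symm y ∉ T → chartVF x₀ X y = 0 := fun y _ h => by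
    rw [chartVF_apply]; exact (congrArg _ (hX0 _ h)).trans (map_zero (dchart x₀ _))
  obtain ⟨hs1, hs2⟩ := contDiff_indicator (m := ∞) (isOpen_tgt x₀) (isCompact_chart_image hTc hs) (chart_image_subset hs)
    (u := chartVF x₀ X) (fun y hy => (hX.contDiffAt_chart hy).contDiffWithinAt) (fun y hy h => hx0 y hy (symm_notMem hy h))
  set X₀ := (extChartAt (𝓡 n) x₀).target.indicator (chartVF x₀ X) with hX₀
  obtain ⟨δ, hδ, hf⟩ := exists_homeomorph_add_smul hs1 hs2
  have hfix : ∀ (ε : ℝ) (x : M), x ∈ (extChartAt (𝓡 n) x₀).source → x ∉ T → extChartAt (𝓡 n) x₀ x + ε • X₀ (extChartAt (𝓡 n) x₀ x) = extChartAt (𝓡 n) x₀ x := by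
    intro ε x hx hxT
    rw [hX₀, indicator_of_mem ((extChartAt (𝓡 n) x₀).map_source hx), hx0 _ ((extChartAt (𝓡 n) x₀).map_source hx), smul_zero, add_zero]
    rwa [(extChartAt (𝓡 n) x₀).left_inv hx]
  have hjoint : ContDiff ℝ ∞ (fun p : ℝ × Model n => p.2 + p.1 • X₀ p.2) :=
    contDiff_snd.add (contDiff_fst.smul (hs1.comp contDiff_snd))
  -- bijectivity on the target: the map is the identity on its complement
  have hmaps : ∀ ε, |ε| < δ → MapsTo (fun y => y + ε • X₀ y) (extChartAt (𝓡 n) x₀).target (extChartAt (𝓡 n) x₀).target := by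
    intro ε hε y hy
    obtain ⟨f, hf1, -⟩ := hf ε hε
    by_contra hn
    have h1 : f (y + ε • X₀ y) = f y := by
      rw [hf1, hf1 y, hX₀, indicator_of_notMem hn, smul_zero, add_zero]
    exact hn (by have := f.injective h1; change y + ε • X₀ y ∈ _; rw [this]; exact hy)
  have hdiff : ∀ ε : ℝ, ∃ ψ : Diffeo n M, |ε| < δ → ∀ x, ψ x = extendChart x₀ (fun y => y + ε • X₀ y) x := by
    intro ε
    by_cases hε : |ε| < δ
    swap
    · exact ⟨Diffeomorph.refl (𝓡 n) M ∞, fun h => absurd h hε⟩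
    obtain ⟨f, hf1, hf2⟩ := hf ε hε
    have hfe : (fun y => y + ε • X₀ y) = f := funext fun y => (hf1 y).symm
    have hm1 : MapsTo f (extChartAt (𝓡 n) x₀).target (extChartAt (𝓡 n) x₀).target := hfe ▸ hmaps ε hε
    have hm2 : MapsTo f.symm (extChartAt (𝓡 n) x₀).target (extChartAt (𝓡 n) x₀).target := by
      intro y hy
      by_contra hn
      have h1 : f (f.symm y) = f.symm y := by rw [hf1, hX₀, indicator_of_notMem hn, smul_zero, add_zero]
      rw [f.apply_symm_apply] at h1
      exact hn (h1 ▸ hy)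
    have hfT : ∀ x ∈ (extChartAt (𝓡 n) x₀).source, x ∉ T → f (extChartAt (𝓡 n) x₀ x) = extChartAt (𝓡 n) x₀ x := fun x hx hxT => by
      rw [hf1]; exact hfix ε x hx hxT
    have hfT' : ∀ x ∈ (extChartAt (𝓡 n) x₀).source, x ∉ T → f.symm (extChartAt (𝓡 n) x₀ x) = extChartAt (𝓡 n) x₀ x := fun x hx hxT => by
      rw [f.symm_apply_eq]; exact (hfT x hx hxT).symm
    have hsm : ∀ (h : Model n → Model n), ContDiff ℝ ∞ h → MapsTo h (extChartAt (𝓡 n) x₀).target (extChartAt (𝓡 n) x₀).target →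
        (∀ x ∈ (extChartAt (𝓡 n) x₀).source, x ∉ T → h (extChartAt (𝓡 n) x₀ x) = extChartAt (𝓡 n) x₀ x) →
        ContMDiff (𝓡 n) (𝓡 n) ∞ (extendChart x₀ h) := by
      intro h h1 h2 h3 x
      exact ContMDiffAt.comp x (f := fun x : M => ((0 : ℝ), x)) (contMDiffAt_extendChart (Z := ℝ) (f := fun _ => h) (z := 0)
        (h1.comp contDiff_snd) h2 hTc hs (fun _ => h3) x) (contMDiffAt_const.prodMk contMDiffAt_id)
    refine ⟨{ toFun := extendChart x₀ f, invFun := extendChart x₀ f.symm,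
              left_inv := extendChart_comp hm1 f.symm_apply_apply, right_inv := extendChart_comp hm2 f.apply_symm_apply,
              contMDiff_toFun := hsm f (hfe ▸ contDiff_id.add (hs1.const_smul ε)) hm1 hfT,
              contMDiff_invFun := hsm f.symm hf2 hm2 hfT' }, fun _ x => ?_⟩
    exact congrArg (fun h => extendChart x₀ h x) hfe.symm
  choose ψ hψ using hdiff
  have hab : ∀ ε ∈ Ioo (-δ) δ, |ε| < δ := fun ε h => abs_lt.2 h
  have h0 : |(0 : ℝ)| < δ := by simpa using hδ
  have hψ0 : ∀ x, ψ 0 x = x := fun x => by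
    rw [hψ 0 h0]
    have : (fun y => y + (0 : ℝ) • X₀ y) = id := by funext y; simp
    rw [this]
    by_cases hx : x ∈ (extChartAt (𝓡 n) x₀).source
    · rw [extendChart_of_mem _ hx]; exact (extChartAt (𝓡 n) x₀).left_inv hx
    · exact extendChart_of_notMem _ hx
  refine ⟨δ, hδ, ψ, ?_, Diffeomorph.ext hψ0, ?_⟩
  · rintro ⟨ε, x⟩ ⟨hε, -⟩
    have h1 := contMDiffAt_extendChart (Z := ℝ) (f := fun ε y => y + ε • X₀ y) hjoint (hmaps ε (hab ε hε)) hTc hs hfix x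
    refine (h1.congr_of_eventuallyEq ?_).contMDiffWithinAt
    filter_upwards [(continuousAt_fst (p := (ε, x))).eventually (isOpen_Ioo.mem_nhds hε)] with p hp
    exact hψ p.1 (hab _ hp) p.2
  · intro x
    have hev : ∀ᶠ s : ℝ in 𝓝 0, |s| < δ := (continuous_abs.continuousAt (x := (0 : ℝ))).eventually (gt_mem_nhds h0)
    have hX' : X (ψ 0 x) = (X x : Model n) := by rw [hψ0]
    by_cases hx : x ∈ (extChartAt (𝓡 n) x₀).source
    · have hy := (extChartAt (𝓡 n) x₀).map_source hx
      have h1 : HasMFDerivAt 𝓘(ℝ, ℝ) 𝓘(ℝ, Model n) (fun s : ℝ => extChartAt (𝓡 n) x₀ x + s • X₀ (extChartAt (𝓡 n) x₀ x)) 0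
          (ContinuousLinearMap.toSpanSingleton ℝ (X₀ (extChartAt (𝓡 n) x₀ x))) := by
        have := ((hasDerivAt_id (0 : ℝ)).smul_const (X₀ (extChartAt (𝓡 n) x₀ x))).const_add (extChartAt (𝓡 n) x₀ x)
        rw [one_smul] at this
        exact this.hasFDerivAt.hasMFDerivAt
      have h2 := (mdifferentiableAt_symm hy).hasMFDerivAt
      have h2' : HasMFDerivAt 𝓘(ℝ, Model n) (𝓡 n) (extChartAt (𝓡 n) x₀).symm
          (extChartAt (𝓡 n) x₀ x + (0 : ℝ) • X₀ (extChartAt (𝓡 n) x₀ x)) (dsymm x₀ (extChartAt (𝓡 n) x₀ x)) := by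
        rw [zero_smul, add_zero]; exact h2
      have h3 := HasMFDerivAt.comp (0 : ℝ) h2' h1
      have e : (dsymm x₀ (extChartAt (𝓡 n) x₀ x)).comp (ContinuousLinearMap.toSpanSingleton ℝ (X₀ (extChartAt (𝓡 n) x₀ x))) =
          (ContinuousLinearMap.toSpanSingleton ℝ (X (ψ 0 x) : Model n)) := by
        refine ContinuousLinearMap.ext fun r => ?_
        change dsymm x₀ _ (r • X₀ (extChartAt (𝓡 n) x₀ x)) = r • (X (ψ 0 x) : Model n)
        rw [hX', map_smul, hX₀, indicator_of_mem hy]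
        exact congrArg (fun v => r • v) (vf_eq_chartVF X hx).symm
      have h4 : HasMFDerivAt 𝓘(ℝ, ℝ) (𝓡 n) (fun s => ψ s x) 0 ((dsymm x₀ (extChartAt (𝓡 n) x₀ x)).comp (ContinuousLinearMap.toSpanSingleton ℝ (X₀ (extChartAt (𝓡 n) x₀ x)))) := by
        refine HasMFDerivAt.congr_of_eventuallyEq h3 ?_
        filter_upwards [hev] with s hs
        rw [hψ s hs, extendChart_of_mem _ hx]; rfl
      exact e ▸ h4
    · have h1 : (X x : Model n) = 0 := hX0 x fun h => hx (hs h)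
      have h2 : HasMFDerivAt 𝓘(ℝ, ℝ) (𝓡 n) (fun _ : ℝ => x) 0 (0 : ℝ →L[ℝ] Model n) := hasMFDerivAt_const x 0
      have h3 : HasMFDerivAt 𝓘(ℝ, ℝ) (𝓡 n) (fun s => ψ s x) 0 (0 : ℝ →L[ℝ] Model n) := by
        refine HasMFDerivAt.congr_of_eventuallyEq h2 ?_
        filter_upwards [hev] with s hs
        rw [hψ s hs, extendChart_of_notMem _ hx]
      have e : (0 : ℝ →L[ℝ] Model n) = ContinuousLinearMap.toSpanSingleton ℝ (X (ψ 0 x) : Model n) := by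
        rw [hX', h1]
        exact ContinuousLinearMap.ext fun r => (smul_zero r).symm
      exact e ▸ h3

end Variation

/-! ### The metric in charts -/

section MetricCharts

variable {n : ℕ} {M : Type u} [TopologicalSpace M] [ChartedSpace (Model n) M] [IsManifold (𝓡 n) ∞ M]

/-- The metric at `x`, as a bilinear form on `ℝⁿ`. -/
def gAt (g : Metric n M) (x : M) : Model n →L[ℝ] Model n →L[ℝ] ℝ := g.inner x

theorem isInner_gAt (g : Metric n M) (x : M) : IsInner (gAt g x) :=
  ⟨fun v w => g.symm x v w, fun v hv => g.pos x v hv⟩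

/-- The metric in the chart at `x₀`, as a bilinear form depending on a point of the chart. -/
def chartG (g : Metric n M) (x₀ : M) (y : Model n) : Model n →L[ℝ] Model n →L[ℝ] ℝ :=
  (gAt g ((extChartAt (𝓡 n) x₀).symm y)).bilinearComp (dsymm x₀ y) (dsymm x₀ y)

theorem chartG_apply (g : Metric n M) (x₀ : M) (y a b : Model n) :
    chartG g x₀ y a b = gAt g ((extChartAt (𝓡 n) x₀).symm y) (dsymm x₀ y a) (dsymm x₀ y b) := rfl

theorem chartG_self (g : Metric n M) (x : M) : chartG g x (extChartAt (𝓡 n) x x) = gAt g x := by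
  refine ContinuousLinearMap.ext fun a => ContinuousLinearMap.ext fun b => ?_
  rw [chartG_apply, dsymm_self, extChartAt_to_inv]
  rfl

theorem isInner_chartG (g : Metric n M) {x₀ : M} {y : Model n} (hy : y ∈ (extChartAt (𝓡 n) x₀).target) :
    IsInner (chartG g x₀ y) := by
  refine ⟨fun v w => (isInner_gAt g _).symm _ _, fun v hv => (isInner_gAt g _).pos _ fun h => hv ?_⟩
  exact (dchart_dsymm hy v).symm.trans ((congrArg (fun u : Model n => dchart x₀ ((extChartAt (𝓡 n) x₀).symm y) u) h).trans (map_zero _))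

/-- The coefficients of the metric in a chart are smooth. -/
theorem contDiffAt_chartG_apply (g : Metric n M) {x₀ : M} {y : Model n} (hy : y ∈ (extChartAt (𝓡 n) x₀).target)
    (a b : Model n) : ContDiffAt ℝ ∞ (fun y => chartG g x₀ y a b) y := by
  set x := (extChartAt (𝓡 n) x₀).symm y with hx
  have hxs : x ∈ (extChartAt (𝓡 n) x₀).source := (extChartAt (𝓡 n) x₀).map_target hy
  have hE : ∀ a : Model n, ContMDiffAt (𝓘(ℝ, ℝ).prod (𝓡 n)) (𝓡 n).tangent ∞
      (fun p : ℝ × M => (⟨p.2, (dsymm x₀ (extChartAt (𝓡 n) x₀ p.2) a : Model n)⟩ : TangentBundle (𝓡 n) M)) (0, x) := fun a => by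
    refine (contMDiffAt_tangent_iff (X := fun _ x => (dsymm x₀ (extChartAt (𝓡 n) x₀ x) a : Model n)) hxs).2 ?_
    refine (contMDiffAt_const (c := a)).congr_of_eventuallyEq ?_
    filter_upwards [eventually_mem_source' (Z := ℝ) (z := 0) hxs] with q hq
    have h1 := dchart_dsymm ((extChartAt (𝓡 n) x₀).map_source hq) a
    rw [(extChartAt (𝓡 n) x₀).left_inv hq] at h1
    exact h1
  have hg : ContMDiffAt (𝓘(ℝ, ℝ).prod (𝓡 n)) ((𝓡 n).prod 𝓘(ℝ, Model n →L[ℝ] Model n →L[ℝ] ℝ)) ∞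
      (fun p : ℝ × M => Bundle.TotalSpace.mk' (Model n →L[ℝ] Model n →L[ℝ] ℝ)
        (E := fun x : M => TangentSpace (𝓡 n) x →L[ℝ] TangentSpace (𝓡 n) x →L[ℝ] ℝ) p.2 (g.inner p.2)) (0, x) :=
    ContMDiffAt.comp (0, x) (g.contMDiff x) contMDiffAt_snd
  have h := ContMDiffAt.clm_bundle_apply₂ (F₁ := Model n) (F₂ := Model n) (F₃ := ℝ) (E₃ := Bundle.Trivial M ℝ) hg (hE a) (hE b)
  rw [Bundle.contMDiffAt_totalSpace] at h
  have h2 := h.2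
  have h3 : ContMDiffAt 𝓘(ℝ, Model n) (𝓘(ℝ, ℝ).prod (𝓡 n)) ∞
      (fun y => ((0 : ℝ), (extChartAt (𝓡 n) x₀).symm y)) y := contMDiffAt_const.prodMk (contMDiffAt_symm hy)
  refine ((ContMDiffAt.comp y h2 h3).contDiffAt).congr_of_eventuallyEq ?_
  filter_upwards [(isOpen_tgt x₀).mem_nhds hy] with y' hy'
  change _ = gAt g ((extChartAt (𝓡 n) x₀).symm y') (dsymm x₀ (extChartAt (𝓡 n) x₀ ((extChartAt (𝓡 n) x₀).symm y')) a) (dsymm x₀ (extChartAt (𝓡 n) x₀ ((extChartAt (𝓡 n) x₀).symm y')) b)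
  rw [(extChartAt (𝓡 n) x₀).right_inv hy', chartG_apply]

theorem contDiffAt_chartG (g : Metric n M) {x₀ : M} {y : Model n} (hy : y ∈ (extChartAt (𝓡 n) x₀).target) :
    ContDiffAt ℝ ∞ (chartG g x₀) y := by
  have h : ContDiffOn ℝ ∞ (chartG g x₀) (extChartAt (𝓡 n) x₀).target :=
    contDiffOn_clm_apply.2 fun a => contDiffOn_clm_apply.2 fun b y' hy' =>
      (contDiffAt_chartG_apply g hy' a b).contDiffWithinAt
  exact h.contDiffAt ((isOpen_tgt x₀).mem_nhds hy)

theorem contDiffAt_det {D : Type*} [NormedAddCommGroup D] [NormedSpace ℝ D] {m : WithTop ℕ∞}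
    {A : D → Matrix (Fin n) (Fin n) ℝ} {z : D} (hA : ∀ i j, ContDiffAt ℝ m (fun z => A z i j) z) :
    ContDiffAt ℝ m (fun z => (A z).det) z := by
  simp only [Matrix.det_apply']
  exact ContDiffAt.sum fun σ _ => contDiffAt_const.mul (contDiffAt_prod fun i _ => hA _ _)

theorem contDiffAt_matrix_inv {D : Type*} [NormedAddCommGroup D] [NormedSpace ℝ D] {m : WithTop ℕ∞}
    {A : D → Matrix (Fin n) (Fin n) ℝ} {z : D} (hA : ∀ i j, ContDiffAt ℝ m (fun z => A z i j) z)
    (h0 : (A z).det ≠ 0) (i j : Fin n) : ContDiffAt ℝ m (fun z => (A z)⁻¹ i j) z := by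
  simp only [Matrix.inv_def, Ring.inverse_eq_inv', Matrix.smul_apply, smul_eq_mul, Matrix.adjugate_apply]
  refine ((contDiffAt_det hA).inv h0).mul (contDiffAt_det fun a b => ?_)
  by_cases h : a = j
  · subst h; simp only [Matrix.updateRow_self]; exact contDiffAt_const
  · simp only [Matrix.updateRow_ne h]; exact hA a b

theorem contDiffAt_gramInv (g : Metric n M) {x₀ : M} {y : Model n} (hy : y ∈ (extChartAt (𝓡 n) x₀).target)
    (i j : Fin n) : ContDiffAt ℝ ∞ (fun y => (gram (stdB n) (chartG g x₀ y))⁻¹ i j) y := by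
  have h : ∀ a b, ContDiffAt ℝ ∞ (fun y => gram (stdB n) (chartG g x₀ y) a b) y := fun a b =>
    contDiffAt_chartG_apply g hy (stdB n a) (stdB n b)
  have h0 : (gram (stdB n) (chartG g x₀ y)).det ≠ 0 := gram_det_ne_zero _ (isInner_chartG g hy)
  exact contDiffAt_matrix_inv (A := fun y => gram (stdB n) (chartG g x₀ y)) h h0 i j

theorem sharp_apply (g : Metric n M) (α : Form n M 1) (x : M) :
    sharp g α x = sharpV (stdB n) (gAt g x) (lin1 (α x)) := by
  change ∑ i, ∑ j, (invGram g x i j * _) • (stdBasis x i : Model n) = _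
  simp only [sharpV]
  rw [stdBasis_eq]
  have h : invGram g x = (gram (stdB n) (gAt g x))⁻¹ := by
    rw [gram, invGram, stdBasis_eq]; rfl
  rw [h]; rfl

theorem inner_sharp (g : Metric n M) (α : Form n M 1) (x : M) (w : Model n) :
    gAt g x (sharp g α x) w = α x (fun _ => w) := by
  rw [sharp_apply]; exact inner_sharpV _ (isInner_gAt g x) _ _

theorem flat_apply (g : Metric n M) (X : VF n M) (x : M) (w : Fin 1 → Model n) :
    flat g X x w = gAt g x (X x) (w 0) := rfl

theorem flat_sharp (g : Metric n M) (α : Form n M 1) : flat g (sharp g α) = α := by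
  funext x; ext w
  rw [flat_apply, inner_sharp]
  congr 1; funext i; rw [Subsingleton.elim i 0]

theorem sharp_flat (g : Metric n M) (X : VF n M) : sharp g (flat g X) = X := by
  funext x
  exact eq_of_inner_eq (isInner_gAt g x) fun w => inner_sharp g _ x w

theorem chartVF_sharp (g : Metric n M) (α : Form n M 1) {x₀ : M} {y : Model n} (hy : y ∈ (extChartAt (𝓡 n) x₀).target) :
    chartVF x₀ (sharp g α) y = sharpV (stdB n) (chartG g x₀ y) (lin1 (chartForm x₀ α y)) := by
  refine eq_of_inner_eq (isInner_chartG g hy) fun w => ?_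
  rw [inner_sharpV _ (isInner_chartG g hy), chartG_apply]
  have h := dsymm_chartVF (sharp g α) hy
  refine (congrArg (fun v => gAt g ((extChartAt (𝓡 n) x₀).symm y) v (dsymm x₀ y w)) h).trans ?_
  exact inner_sharp g α _ _

theorem chartForm_flat_apply (g : Metric n M) (X : VF n M) {x₀ : M} {y : Model n} (hy : y ∈ (extChartAt (𝓡 n) x₀).target)
    (w : Fin 1 → Model n) : chartForm x₀ (flat g X) y w = chartG g x₀ y (chartVF x₀ X y) (w 0) := by
  rw [chartG_apply]
  have h := dsymm_chartVF X hy
  exact (congrArg (fun v => gAt g ((extChartAt (𝓡 n) x₀).symm y) v (dsymm x₀ y (w 0))) h).symm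

theorem contDiffAt_sharpV (g : Metric n M) {D : Type*} [NormedAddCommGroup D] [NormedSpace ℝ D] {x₀ : M}
    {Y : D → Model n} {a : D → Model n →L[ℝ] ℝ} {z : D} (hz : Y z ∈ (extChartAt (𝓡 n) x₀).target)
    (hY : ContDiffAt ℝ ∞ Y z) (ha : ContDiffAt ℝ ∞ a z) :
    ContDiffAt ℝ ∞ (fun z => sharpV (stdB n) (chartG g x₀ (Y z)) (a z)) z := by
  unfold sharpV
  refine ContDiffAt.sum fun i _ => ContDiffAt.sum fun j _ => ContDiffAt.fun_smul (ContDiffAt.mul ?_ ?_) contDiffAt_const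
  · exact ContDiffAt.comp z (contDiffAt_gramInv g hz i j) hY
  · exact ha.clm_apply contDiffAt_const

variable {Z : Type} [NormedAddCommGroup Z] [NormedSpace ℝ Z] {S : Set Z}

theorem SmoothFamForm.sharp (hS : IsOpen S) (g : Metric n M) {α : Z → Form n M 1} (hα : SmoothFamForm S α) :
    SmoothFamVF S (fun z => CompMHD.sharp g (α z)) := by
  rw [smoothFamVF_iff hS]
  intro x₀ z hz y hy
  have h := contDiffAt_sharpV g (D := Z × Model n) (x₀ := x₀) (Y := fun p => p.2)
    (a := fun p => lin1 (chartForm x₀ (α p.1) p.2)) (z := (z, y)) hy contDiffAt_snd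
    ((lin1 (E := Model n)).contDiff.contDiffAt.comp (z, y) ((smoothFamForm_iff hS).1 hα x₀ z hz y hy))
  refine h.congr_of_eventuallyEq ?_
  filter_upwards [eventually_snd_tgt (z := z) hy] with p hp
  exact chartVF_sharp g _ hp

theorem SmoothFamVF.flat (hS : IsOpen S) (g : Metric n M) {X : Z → VF n M} (hX : SmoothFamVF S X) :
    SmoothFamForm S (fun z => CompMHD.flat g (X z)) := by
  rw [smoothFamForm_iff hS]
  intro x₀ z hz y hy
  refine contDiffAt_form fun w => ?_
  have h : ContDiffAt ℝ ∞ (fun p : Z × Model n => chartG g x₀ p.2 (chartVF x₀ (X p.1) p.2) (w 0)) (z, y) :=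
    ((ContDiffAt.comp (z, y) (contDiffAt_chartG g hy) contDiffAt_snd).clm_apply
      ((smoothFamVF_iff hS).1 hX x₀ z hz y hy)).clm_apply contDiffAt_const
  refine h.congr_of_eventuallyEq ?_
  filter_upwards [eventually_snd_tgt (z := z) hy] with p hp
  exact chartForm_flat_apply g _ hp w

theorem SmoothVF.flat (g : Metric n M) {X : VF n M} (hX : SmoothVF X) : SmoothForm (CompMHD.flat g X) :=
  (SmoothFamVF.flat isOpen_univ g (SmoothVF.fam hX (univ : Set ℝ))).at (mem_univ 0)

/-- The square of the volume form on a basis is a Gram determinant, hence nonzero. -/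
theorem IsRiemannianVolume.ne_zero {g : Metric n M} {μ : Form n M n} (h : IsRiemannianVolume g μ) (x : M) : μ x ≠ 0 := by
  intro h0
  have h1 := h.2 x (stdBasis x)
  rw [h0] at h1
  have h2 : (0 : ℝ) = (gram (stdB n) (gAt g x)).det := by
    rw [gram]; rw [stdBasis_eq] at h1
    exact Eq.trans (by simp) h1
  exact gram_det_ne_zero _ (isInner_gAt g x) h2.symm

end MetricCharts

/-! ### The Hodge star and the variational derivatives of the Hamiltonian -/

section HodgeLinear

variable {E : Type*} [NormedAddCommGroup E] [NormedSpace ℝ E] [FiniteDimensional ℝ E] {k : ℕ}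

/-- Naturality of the Hodge star under linear maps. -/
theorem hodgeV_comp (b c : Module.Basis (Fin (k + 2)) ℝ E) (L : E →L[ℝ] E) (h : ∀ i, L (c i) = b i)
    (G : E →L[ℝ] E →L[ℝ] ℝ) (μ : E [⋀^Fin (k + 2)]→L[ℝ] ℝ) (β : E [⋀^Fin 2]→L[ℝ] ℝ) :
    (hodgeV b G μ β).compContinuousLinearMap L =
      hodgeV c (G.bilinearComp L L) (μ.compContinuousLinearMap L) (β.compContinuousLinearMap L) := by
  have hgram : gram c (G.bilinearComp L L) = gram b G := by
    ext i j
    change G (L (c i)) (L (c j)) = G (b i) (b j)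
    rw [h, h]
  have hd : ∀ i, L (dualVec c (G.bilinearComp L L) i) = dualVec b G i := fun i => by
    simp only [dualVec, hgram, map_sum, map_smul, h]
  ext w
  simp only [hodgeV, ContinuousAlternatingMap.compContinuousLinearMap_apply,
    ContinuousAlternatingMap.smul_apply, ContinuousAlternatingMap.sum_apply, smul_eq_mul]
  congr 1
  refine Finset.sum_congr rfl fun i _ => Finset.sum_congr rfl fun j _ => ?_
  congr 1
  · rw [← hd i, ← hd j]
    congr 1
    funext r; fin_cases r <;> rfl
  · simp only [curryLeft_apply_apply, ContinuousAlternatingMap.compContinuousLinearMap_apply]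
    rw [← h i, ← h j]
    congr 1
    funext r
    refine Fin.cases ?_ (fun r => ?_) r
    · rfl
    · refine Fin.cases ?_ (fun r => ?_) r <;> rfl

omit [FiniteDimensional ℝ E] in
theorem hasDerivAt_form_apply {σ : ℝ → E [⋀^Fin k]→L[ℝ] ℝ} {σ' : E [⋀^Fin k]→L[ℝ] ℝ} {t : ℝ} (h : HasDerivAt σ σ' t)
    (v : Fin k → E) : HasDerivAt (fun s => σ s v) (σ' v) t :=
  (ContinuousAlternatingMap.apply ℝ E ℝ v).hasFDerivAt.comp_hasDerivAt t h

/-- The derivative of `⟨β, β⟩` is `2 ⟨β', β⟩`, by symmetry of the inner product. -/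
theorem hasDerivAt_formInner_self {n : ℕ} (b : Module.Basis (Fin n) ℝ E) {G : E →L[ℝ] E →L[ℝ] ℝ} (hG : IsInner G)
    {β : ℝ → E [⋀^Fin 2]→L[ℝ] ℝ} {β' : E [⋀^Fin 2]→L[ℝ] ℝ} {t : ℝ} (hβ : HasDerivAt β β' t) :
    HasDerivAt (fun s => formInner b G (β s) (β s)) (2 * formInner b G β' (β t)) t := by
  have hev : ∀ v : Fin 2 → E, HasDerivAt (fun s => β s v) (β' v) t := hasDerivAt_form_apply hβ
  have h : HasDerivAt (fun s => formInner b G (β s) (β s))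
      (formInner b G (β t) β' + formInner b G β' (β t)) t := by
    simp only [formInner, ← mul_add, ← Finset.sum_add_distrib]
    refine HasDerivAt.const_mul _ (HasDerivAt.fun_sum fun i _ => HasDerivAt.fun_sum fun j _ => ?_)
    exact (hev _).mul (hev _)
  rw [formInner_comm b hG (β t) β', ← two_mul] at h
  exact h

end HodgeLinear

section HodgeForm

variable {k : ℕ} {M : Type u} [TopologicalSpace M] [ChartedSpace (Model (k + 2)) M] [IsManifold (𝓡 (k + 2)) ∞ M]

theorem hodge_apply (g : Metric (k + 2) M) (μ : Form (k + 2) M (k + 2)) (β : Form (k + 2) M 2) (x : M) :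
    hodge g μ β x = hodgeV (stdB (k + 2)) (gAt g x) (μ x) (β x) := by
  have h : invGram g x = (gram (stdB (k + 2)) (gAt g x))⁻¹ := by
    rw [gram, invGram, stdBasis_eq]; rfl
  have h2 : (stdBasis x : Fin (k + 2) → Model (k + 2)) = stdB (k + 2) := stdBasis_eq x
  simp only [hodgeV, dualVec, ← h, ← h2]
  rfl

/-- The Hodge star may be computed in any chart, because it does not depend on the basis. -/
theorem chartForm_hodge (g : Metric (k + 2) M) (μ : Form (k + 2) M (k + 2)) (β : Form (k + 2) M 2) {x₀ : M}
    {y : Model (k + 2)} (hy : y ∈ (extChartAt (𝓡 (k + 2)) x₀).target) :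
    chartForm x₀ (hodge g μ β) y =
      hodgeV (stdB (k + 2)) (chartG g x₀ y) (chartForm x₀ μ y) (chartForm x₀ β y) := by
  let L : Model (k + 2) ≃L[ℝ] Model (k + 2) := ContinuousLinearEquiv.equivOfInverse (dsymm x₀ y)
    (dchart x₀ ((extChartAt (𝓡 (k + 2)) x₀).symm y)) (dchart_dsymm hy) (dsymm_dchart hy)
  let b := (stdB (k + 2)).map L.toLinearEquiv
  rw [chartForm_apply, hodge_apply, hodgeV_basis (stdB (k + 2)) b (isInner_gAt g _),
    hodgeV_comp b (stdB (k + 2)) (dsymm x₀ y) (fun i => by rw [Module.Basis.map_apply]; rfl)]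
  rfl

theorem dens_wedge_hodge (g : Metric (k + 2) M) {μ : Form (k + 2) M (k + 2)} (h0 : ∀ x, μ x ≠ 0)
    (γ β : Form (k + 2) M 2) (x : M) :
    dens μ (wedgeF γ (hodge g μ β)) x = formInner (stdB (k + 2)) (gAt g x) (γ x) (β x) := by
  refine dens_eq (h0 x) ?_
  change wedge2 (γ x) (hodge g μ β x) = _
  rw [hodge_apply, wedge2_hodgeV]

variable {Z : Type} [NormedAddCommGroup Z] [NormedSpace ℝ Z] {S : Set Z}

theorem SmoothFamForm.hodge (hS : IsOpen S) (g : Metric (k + 2) M) {μ : Form (k + 2) M (k + 2)} (hμ : SmoothForm μ)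
    {β : Z → Form (k + 2) M 2} (hβ : SmoothFamForm S β) :
    SmoothFamForm S (fun z => CompMHD.hodge g μ (β z)) := by
  rw [smoothFamForm_iff hS]
  intro x₀ z hz y hy
  have hd : ∀ i, ContDiffAt ℝ ∞ (fun p : Z × Model (k + 2) => dualVec (stdB (k + 2)) (chartG g x₀ p.2) i) (z, y) := fun i => by
    unfold dualVec
    exact ContDiffAt.sum fun j _ => ContDiffAt.smul_const
      (ContDiffAt.comp (z, y) (contDiffAt_gramInv g hy i j) contDiffAt_snd) _
  have hβ' := (smoothFamForm_iff hS).1 hβ x₀ z hz y hy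
  have hμ' : ContDiffAt ℝ ∞ (fun p : Z × Model (k + 2) => chartForm x₀ μ p.2) (z, y) :=
    ContDiffAt.comp (z, y) (contDiffAt_chartForm hμ hy) contDiffAt_snd
  have h : ContDiffAt ℝ ∞ (fun p : Z × Model (k + 2) => hodgeV (stdB (k + 2)) (chartG g x₀ p.2) (chartForm x₀ μ p.2)
      (chartForm x₀ (β p.1) p.2)) (z, y) := by
    unfold hodgeV
    refine ContDiffAt.const_smul _ (ContDiffAt.sum fun i _ => ContDiffAt.sum fun j _ => ContDiffAt.fun_smul ?_ ?_)
    · have h1 := contDiffAt_form_apply (v := ![fun p : Z × Model (k + 2) => dualVec (stdB (k + 2)) (chartG g x₀ p.2) i,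
        fun p => dualVec (stdB (k + 2)) (chartG g x₀ p.2) j]) hβ' (fun r => by fin_cases r; exacts [hd i, hd j])
      refine h1.congr_of_eventuallyEq (Eventually.of_forall fun p => congrArg _ ?_)
      funext r; fin_cases r <;> rfl
    · exact contDiffAt_curryLeft (contDiffAt_curryLeft hμ' contDiffAt_const) contDiffAt_const
  refine h.congr_of_eventuallyEq ?_
  filter_upwards [eventually_snd_tgt (z := z) hy] with p hp
  exact chartForm_hodge g μ _ hp

theorem SmoothForm.hodge (g : Metric (k + 2) M) {μ : Form (k + 2) M (k + 2)} (hμ : SmoothForm μ) {β : Form (k + 2) M 2}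
    (hβ : SmoothForm β) : SmoothForm (CompMHD.hodge g μ β) :=
  (SmoothFamForm.hodge isOpen_univ g hμ (hβ.fam (univ : Set ℝ))).at (mem_univ 0)

theorem smooth_fam_velocity {g : Metric (k + 2) M} {S : Set ℝ} (hS : IsOpen S) {c : ℝ → CMHDual k M} (hc : SmoothCurve S c)
    (hpos : ∀ t ∈ S, ∀ x, 0 < (c t).ρ x) : SmoothFamVF S (fun t => velocity g (c t)) :=
  SmoothFamVF.smul hS (SmoothFamFun.inv hc.2.1 fun t ht x => (hpos t ht x).ne') (SmoothFamForm.sharp hS g hc.1)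

theorem smooth_velocity (g : Metric (k + 2) M) {ξ : CMHDual k M} (h : ξ.Mem) (hpos : ∀ x, 0 < ξ.ρ x) :
    SmoothVF (velocity g ξ) :=
  (smooth_fam_velocity (g := g) (c := fun _ => ξ) isOpen_univ
    ⟨h.1.fam _, SmoothFun.fam h.2.1 _, h.2.2.1.fam _, fun _ _ => h.2.2.2⟩ (fun _ _ => hpos)).at (mem_univ 0)

/-- The velocity is characterized by `m = ρ v^♭ ⊗ μ`. -/
theorem inner_velocity (g : Metric (k + 2) M) {ξ : CMHDual k M} {x : M} (hpos : 0 < ξ.ρ x) (w : Model (k + 2)) :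
    ξ.ρ x * gAt g x (velocity g ξ x) w = ξ.α x (fun _ => w) := by
  rw [← inner_sharp g ξ.α x w]
  have h : gAt g x (velocity g ξ x) = (ξ.ρ x)⁻¹ • gAt g x (sharp g ξ.α x) := map_smul (gAt g x) _ _
  refine (congrArg (fun L : Model (k + 2) →L[ℝ] ℝ => ξ.ρ x * L w) h).trans ?_
  change ξ.ρ x * ((ξ.ρ x)⁻¹ * _) = _
  exact mul_inv_cancel_left₀ hpos.ne' _

/-- The Bernoulli function `δH̄/δϱ = -½|v|² + e(ρ) + ρ e'(ρ)`. -/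
def bernoulli (g : Metric (k + 2) M) (e : ℝ → ℝ) (ξ : CMHDual k M) : M → ℝ := fun x =>
  -(1 / 2) * g.inner x (velocity g ξ x) (velocity g ξ x) + (e (ξ.ρ x) + ξ.ρ x * deriv e (ξ.ρ x))

/-- The variational derivative of `H̄`. -/
def hamGrad (g : Metric (k + 2) M) (μ : Form (k + 2) M (k + 2)) (e : ℝ → ℝ) (ξ : CMHDual k M) : CMH k M :=
  ⟨velocity g ξ, bernoulli g e ξ, hodge g μ ξ.β⟩

theorem SmoothFamVF.inner {Z : Type} [NormedAddCommGroup Z] [NormedSpace ℝ Z] {S : Set Z} (hS : IsOpen S) (g : Metric (k + 2) M)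
    {X Y : Z → VF (k + 2) M} (hX : SmoothFamVF S X) (hY : SmoothFamVF S Y) :
    SmoothFamFun (k + 2) S (fun z x => gAt g x (X z x) (Y z x)) :=
  SmoothFamForm.apply (X := fun _ => Y) hS (SmoothFamVF.flat hS g hX) (fun _ => hY)

theorem contDiffOn_deriv_Ioi {e : ℝ → ℝ} (he : ContDiffOn ℝ ∞ e (Ioi 0)) : ContDiffOn ℝ ∞ (deriv e) (Ioi 0) :=
  ((contDiffOn_infty_iff_deriv_of_isOpen isOpen_Ioi).1 he).2

theorem smooth_fam_bernoulli {g : Metric (k + 2) M} {e : ℝ → ℝ} (he : ContDiffOn ℝ ∞ e (Ioi 0)) {S : Set ℝ} (hS : IsOpen S)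
    {c : ℝ → CMHDual k M} (hc : SmoothCurve S c) (hpos : ∀ t ∈ S, ∀ x, 0 < (c t).ρ x) :
    SmoothFamFun (k + 2) S (fun t => bernoulli g e (c t)) := by
  have hv := smooth_fam_velocity (g := g) hS hc hpos
  exact ((smoothFamFun_const _).mul (SmoothFamVF.inner hS g hv hv)).add
    ((SmoothFamFun.compReal hc.2.1 he hpos).add (hc.2.1.mul (SmoothFamFun.compReal hc.2.1 (contDiffOn_deriv_Ioi he) hpos)))

theorem SmoothCurve.mem {S : Set ℝ} {c : ℝ → CMHDual k M} (hc : SmoothCurve S c) {t : ℝ} (ht : t ∈ S) : (c t).Mem :=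
  ⟨hc.1.at ht, hc.2.1.at ht, hc.2.2.1.at ht, hc.2.2.2 t ht⟩

theorem CMHDual.Mem.curve {ξ : CMHDual k M} (h : ξ.Mem) (S : Set ℝ) : SmoothCurve S (fun _ => ξ) :=
  ⟨h.1.fam _, SmoothFun.fam h.2.1 _, h.2.2.1.fam _, fun _ _ => h.2.2.2⟩

theorem smooth_hamGrad (g : Metric (k + 2) M) {μ : Form (k + 2) M (k + 2)} (hμ : SmoothForm μ) {e : ℝ → ℝ}
    (he : ContDiffOn ℝ ∞ e (Ioi 0)) {ξ : CMHDual k M} (h : ξ.Mem) (hpos : ∀ x, 0 < ξ.ρ x) :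
    (hamGrad g μ e ξ).Smooth :=
  ⟨smooth_velocity g h hpos, (smooth_fam_bernoulli he isOpen_univ (h.curve univ) (fun _ _ => hpos)).at (mem_univ 0),
    SmoothForm.hodge g hμ h.2.2.1⟩

variable [CompactSpace M] [T2Space M] [MeasurableSpace M] [BorelSpace M]

/-- The derivative of `H̄` along a curve.  The kinetic energy density is `ρ g(v, v) = α(v)`, so that
its derivative is `2 α̇(v) - ρ̇ |v|²`. -/
theorem hasDerivAt_hamBar (g : Metric (k + 2) M) {μ : Form (k + 2) M (k + 2)} (hμ : SmoothForm μ) (h0 : ∀ x, μ x ≠ 0)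
    {e : ℝ → ℝ} (he : ContDiffOn ℝ ∞ e (Ioi 0)) {S : Set ℝ} (hS : IsOpen S)
    {c : ℝ → CMHDual k M} (hc : SmoothCurve S c) (hpos : ∀ t ∈ S, ∀ x, 0 < (c t).ρ x) {t : ℝ} (ht : t ∈ S) :
    HasDerivAt (fun s => hamBar g μ e (c s))
      (dualPair μ ⟨dtForm (fun s => (c s).α) t, dtFun (fun s => (c s).ρ) t, dtForm (fun s => (c s).β) t⟩
        (hamGrad g μ e (c t))) t := by
  have hv := smooth_fam_velocity (g := g) hS hc hpos
  have hα' : SmoothForm (dtForm (fun s => (c s).α) t) := (SmoothFamForm.deriv hS hc.1).at ht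
  have hρ' : SmoothFun (n := k + 2) (dtFun (fun s => (c s).ρ) t) := (SmoothFamFun.deriv hS hc.2.1).at ht
  have hdα : ∀ x, HasDerivAt (fun s => (c s).α x) (dtForm (fun s => (c s).α) t x) t := fun x =>
    ((SmoothFamForm.contDiffAt_param hS hc.1 ht x).differentiableAt (by simp)).hasDerivAt
  have hdβ : ∀ x, HasDerivAt (fun s => (c s).β x) (dtForm (fun s => (c s).β) t x) t := fun x =>
    ((SmoothFamForm.contDiffAt_param hS hc.2.2.1 ht x).differentiableAt (by simp)).hasDerivAt
  have hdρ : ∀ x, HasDerivAt (fun s => (c s).ρ x) (dtFun (fun s => (c s).ρ) t x) t := fun x =>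
    ((SmoothFamFun.contDiffAt_param hS hc.2.1 ht x).differentiableAt (by simp)).hasDerivAt
  -- kinetic energy
  have e1 : ∀ x, deriv (fun s => (c s).α x (fun _ => velocity g (c s) x)) t =
      2 * dtForm (fun s => (c s).α) t x (fun _ => velocity g (c t) x) +
        -(dtFun (fun s => (c s).ρ) t x * gAt g x (velocity g (c t) x) (velocity g (c t) x)) := fun x => by
    obtain ⟨v', hv'⟩ : ∃ v' : Model (k + 2), HasDerivAt (F := Model (k + 2)) (fun s => velocity g (c s) x) v' t :=
      ⟨_, ((SmoothFamVF.contDiffAt_param hS hv ht x).differentiableAt (by simp)).hasDerivAt⟩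
    have hG : HasDerivAt (fun s => gAt g x (velocity g (c s) x)) (gAt g x v') t :=
      (gAt g x).hasFDerivAt.comp_hasDerivAt t hv'
    have a1 : HasDerivAt (fun s => (c s).ρ x * gAt g x (velocity g (c s) x) (velocity g (c s) x))
        (dtFun (fun s => (c s).ρ) t x * gAt g x (velocity g (c t) x) (velocity g (c t) x) +
          (c t).ρ x * (gAt g x v' (velocity g (c t) x) + gAt g x (velocity g (c t) x) v')) t :=
      (hdρ x).mul (hG.clm_apply hv')
    have a2 : HasDerivAt (fun s => (c s).ρ x * gAt g x (velocity g (c s) x) (velocity g (c t) x))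
        (dtFun (fun s => (c s).ρ) t x * gAt g x (velocity g (c t) x) (velocity g (c t) x) +
          (c t).ρ x * (gAt g x v' (velocity g (c t) x))) t := by
      have := (hdρ x).mul (hG.clm_apply (hasDerivAt_const (F := Model (k + 2)) t (velocity g (c t) x)))
      exact this.congr_deriv (by rw [map_zero, add_zero])
    have hnear : ∀ᶠ s in 𝓝 t, s ∈ S := hS.mem_nhds ht
    have a3 : HasDerivAt (fun s => (c s).α x (fun _ => velocity g (c t) x))
        (dtForm (fun s => (c s).α) t x (fun _ => velocity g (c t) x)) t :=
      hasDerivAt_form_apply (hdα x) _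
    have a4 := a3.unique (a2.congr_of_eventuallyEq (by
      filter_upwards [hnear] with s hs
      exact (inner_velocity g (hpos s hs x) _).symm))
    have a5 : HasDerivAt (fun s => (c s).α x (fun _ => velocity g (c s) x)) _ t :=
      a1.congr_of_eventuallyEq (by
        filter_upwards [hnear] with s hs
        exact (inner_velocity g (hpos s hs x) _).symm)
    rw [a5.deriv, a4, (isInner_gAt g x).symm (velocity g (c t) x) v']
    ring
  have k1 := hasDerivAt_integ hμ hS (SmoothFamForm.apply (X := fun _ => fun s => velocity g (c s)) hS hc.1 (fun _ => hv)) ht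
  have e1' := congrArg (integ μ) (funext e1)
  have hsm1 : SmoothFun (n := k + 2) (fun x => dtForm (fun s => (c s).α) t x (fun _ => velocity g (c t) x)) :=
    SmoothForm.apply (X := fun _ => velocity g (c t)) hα' (fun _ => hv.at ht)
  have hsv : SmoothFun (n := k + 2) (fun x => gAt g x (velocity g (c t) x) (velocity g (c t) x)) :=
    (SmoothFamVF.inner hS g hv hv).at ht
  have e1'' := (integ_add hμ (f := fun x => 2 * dtForm (fun s => (c s).α) t x (fun _ => velocity g (c t) x))
    (g := fun x => -(dtFun (fun s => (c s).ρ) t x * gAt g x (velocity g (c t) x) (velocity g (c t) x)))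
    (continuous_const.mul hsm1.continuous) ((hρ'.continuous.mul hsv.continuous).neg))
  have E1 := e1'.trans e1''
  rw [integ_const_mul] at E1
  -- internal energy
  have k2 := hasDerivAt_integ hμ hS ((SmoothFamFun.compReal hc.2.1 he hpos).mul hc.2.1) ht
  have e2 : ∀ x, deriv (fun s => e ((c s).ρ x) * (c s).ρ x) t =
      (e ((c t).ρ x) + (c t).ρ x * deriv e ((c t).ρ x)) * dtFun (fun s => (c s).ρ) t x := fun x => by
    have h1 : HasDerivAt e (deriv e ((c t).ρ x)) ((c t).ρ x) :=
      ((he.contDiffAt (isOpen_Ioi.mem_nhds (hpos t ht x))).differentiableAt (by simp)).hasDerivAt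
    have h2 := (h1.comp t (hdρ x)).mul (hdρ x)
    refine h2.deriv.trans ?_
    simp only [Function.comp]
    ring
  have E2 := congrArg (integ μ) (funext e2)
  -- magnetic energy
  have k3 := hasDerivAt_integ hμ hS (SmoothFamForm.dens hS hμ h0 (SmoothFamForm.wedgeF hS hc.2.2.1
    (SmoothFamForm.hodge hS g hμ hc.2.2.1))) ht
  have e3 : ∀ x, deriv (fun s => dens μ (wedgeF (c s).β (hodge g μ (c s).β)) x) t =
      2 * dens μ (wedgeF (dtForm (fun s => (c s).β) t) (hodge g μ (c t).β)) x := fun x => by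
    simp only [dens_wedge_hodge g h0]
    exact (hasDerivAt_formInner_self _ (isInner_gAt g x) (hdβ x)).deriv
  have E3 := (congrArg (integ μ) (funext e3)).trans (integ_const_mul _ _)
  -- the total energy
  have htot := ((k1.const_mul (1 / 2 : ℝ)).add k2).add (k3.const_mul (1 / 2 : ℝ))
  have hH : (fun s => hamBar g μ e (c s)) = (((fun y => 1 / 2 * integ μ fun x => ((c y).α x) fun _ => velocity g (c y) x) +
      fun s => integ μ fun x => e ((c s).ρ x) * (c s).ρ x) +
      fun y => 1 / 2 * integ μ (dens μ (wedgeF (c y).β (hodge g μ (c y).β)))) := by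
    funext s
    rw [hamBar, pairForm_eq]
    rfl
  rw [hH]
  refine htot.congr_deriv ?_
  have hB : integ μ (fun x => bernoulli g e (c t) x * dtFun (fun s => (c s).ρ) t x) =
      (1 / 2) * integ μ (fun x => -(dtFun (fun s => (c s).ρ) t x * gAt g x (velocity g (c t) x) (velocity g (c t) x))) +
      integ μ (fun x => (e ((c t).ρ x) + (c t).ρ x * deriv e ((c t).ρ x)) * dtFun (fun s => (c s).ρ) t x) := by
    have hs2 : SmoothFamFun (k + 2) S (fun s x => e ((c s).ρ x) + (c s).ρ x * deriv e ((c s).ρ x)) :=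
      (SmoothFamFun.compReal hc.2.1 he hpos).add (hc.2.1.mul (SmoothFamFun.compReal hc.2.1 (contDiffOn_deriv_Ioi he) hpos))
    rw [← integ_const_mul]
    refine Eq.trans (congrArg (integ μ) (funext fun x => ?_)) (integ_add hμ
      (f := fun x => (1 / 2 : ℝ) * -(dtFun (fun s => (c s).ρ) t x * gAt g x (velocity g (c t) x) (velocity g (c t) x)))
      (continuous_const.mul (hρ'.continuous.mul hsv.continuous).neg) ((hs2.at ht).continuous.mul hρ'.continuous))
    change (-(1 / 2) * gAt g x (velocity g (c t) x) (velocity g (c t) x) + _) * _ = _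
    ring
  rw [E1, E2, E3]
  change _ = pair μ _ (velocity g (c t)) + integ μ (fun x => bernoulli g e (c t) x * dtFun (fun s => (c s).ρ) t x) +
    pairForm μ _ (hodge g μ (c t).β)
  rw [hB, pairForm_eq, pair]
  ring

/-- A smooth family of functions on a compact manifold that is positive at `0` is positive near `0`. -/
theorem exists_pos_fam {δ : ℝ} (hδ : 0 < δ) {f : ℝ → M → ℝ} (hf : SmoothFamFun (k + 2) (Ioo (-δ) δ) f) (h : ∀ x, 0 < f 0 x) :
    ∃ δ' : ℝ, 0 < δ' ∧ δ' ≤ δ ∧ ∀ t ∈ Ioo (-δ') δ', ∀ x, 0 < f t x := by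
  have hcont := SmoothFamFun.continuousOn hf
  have h0 : (0 : ℝ) ∈ Ioo (-δ) δ := ⟨by linarith, hδ⟩
  have h1 : ∀ x ∈ (univ : Set M), ∀ᶠ p : ℝ × M in 𝓝 ((0 : ℝ), x), 0 < f p.1 p.2 := fun x _ => by
    have h2 : ContinuousAt (fun p : ℝ × M => f p.1 p.2) (0, x) :=
      hcont.continuousAt ((isOpen_Ioo.prod isOpen_univ).mem_nhds ⟨h0, mem_univ _⟩)
    exact h2.eventually (lt_mem_nhds (h x))
  have h2 := (isCompact_univ (X := M)).eventually_forall_of_forall_eventually (P := fun (t : ℝ) (x : M) => 0 < f t x) (x₀ := (0 : ℝ)) h1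
  obtain ⟨r, hr, hball⟩ := Metric.eventually_nhds_iff.1 h2
  refine ⟨min r δ, lt_min hr hδ, min_le_right _ _, fun t ht x => hball ?_ x (mem_univ x)⟩
  rw [Real.dist_eq, sub_zero, abs_lt]
  exact ⟨by linarith [ht.1, min_le_left r δ], by linarith [ht.2, min_le_left r δ]⟩

theorem SmoothCurve.mono {S T : Set ℝ} {c : ℝ → CMHDual k M} (hc : SmoothCurve S c) (h : T ⊆ S) : SmoothCurve T c :=
  ⟨hc.1.mono h, hc.2.1.mono h, hc.2.2.1.mono h, fun t ht => hc.2.2.2 t (h ht)⟩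

/-- The variational derivative of `H̄` is `(v, -½|v|² + e(ρ) + ρ e'(ρ), [⋆β])`. -/
theorem hasVarDeriv_hamBar (g : Metric (k + 2) M) {μ : Form (k + 2) M (k + 2)} (hμ : SmoothForm μ) (h0 : ∀ x, μ x ≠ 0)
    {e : ℝ → ℝ} (he : ContDiffOn ℝ ∞ e (Ioi 0)) {ξ : CMHDual k M} (hpos : ∀ x, 0 < ξ.ρ x) :
    HasVarDeriv μ (hamBar g μ e) ξ (hamGrad g μ e ξ) := by
  intro δ c hδ hc h
  subst h
  obtain ⟨δ', h1, h2, h3⟩ := exists_pos_fam hδ hc.2.1 hpos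
  have hsub : Ioo (-δ') δ' ⊆ Ioo (-δ) δ := Ioo_subset_Ioo (by linarith) h2
  exact hasDerivAt_hamBar g hμ h0 he isOpen_Ioo (hc.mono hsub) h3 ⟨by linarith, h1⟩

end HodgeForm

/-! ### Pairings, the momentum map and the Lie-Poisson bracket -/

section Pairings

variable {k : ℕ} {M : Type u} [TopologicalSpace M] [ChartedSpace (Model (k + 2)) M] [IsManifold (𝓡 (k + 2)) ∞ M]
  [CompactSpace M] [T2Space M] [MeasurableSpace M] [BorelSpace M] {μ : Form (k + 2) M (k + 2)}

omit [CompactSpace M] [T2Space M] [MeasurableSpace M] [BorelSpace M] in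
theorem smooth_eval {α : Form (k + 2) M 1} {X : VF (k + 2) M} (hα : SmoothForm α) (hX : SmoothVF X) :
    SmoothFun (n := k + 2) (fun x => α x (fun _ => X x)) := hα.apply fun _ => hX

omit [CompactSpace M] [T2Space M] [MeasurableSpace M] [BorelSpace M] in
theorem smooth_zero_vf : SmoothVF (fun _ => 0 : VF (k + 2) M) := by
  rw [smoothVF_iff]
  intro x₀ y hy
  have : chartVF x₀ (fun _ => 0 : VF (k + 2) M) = fun _ => 0 := funext fun y => by
    rw [chartVF_apply]; exact map_zero _
  rw [this]; exact contDiffAt_const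

omit [CompactSpace M] [T2Space M] [MeasurableSpace M] [BorelSpace M] in
theorem smooth_zero_form {j : ℕ} : SmoothForm (0 : Form (k + 2) M j) := by
  intro x₀
  have : chartForm x₀ (0 : Form (k + 2) M j) = fun _ => 0 := funext fun y => by
    ext v; rfl
  rw [this]; exact contDiffOn_const

omit [CompactSpace M] [T2Space M] [MeasurableSpace M] [BorelSpace M] [IsManifold (𝓡 (k + 2)) ∞ M] in
theorem smooth_const (c : ℝ) : SmoothFun (n := k + 2) (fun _ : M => c) := contMDiff_const

omit [CompactSpace M] [T2Space M] [MeasurableSpace M] [BorelSpace M] [IsManifold (𝓡 (k + 2)) ∞ M] in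
theorem smoothFun_sub {f h : M → ℝ} (hf : SmoothFun (n := k + 2) f) (hh : SmoothFun (n := k + 2) h) :
    SmoothFun (n := k + 2) (fun x => f x - h x) := ContMDiff.sub hf hh

omit [CompactSpace M] [T2Space M] [MeasurableSpace M] [BorelSpace M] [IsManifold (𝓡 (k + 2)) ∞ M] in
theorem smoothFun_neg {f : M → ℝ} (hf : SmoothFun (n := k + 2) f) : SmoothFun (n := k + 2) (fun x => -f x) := ContMDiff.neg hf

theorem pair_add_left (hμ : SmoothForm μ) {α γ : Form (k + 2) M 1} {X : VF (k + 2) M} (hα : SmoothForm α)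
    (hγ : SmoothForm γ) (hX : SmoothVF X) : pair μ (α + γ) X = pair μ α X + pair μ γ X :=
  integ_add hμ (smooth_eval hα hX).continuous (smooth_eval hγ hX).continuous

theorem pair_sub_left (hμ : SmoothForm μ) {α γ : Form (k + 2) M 1} {X : VF (k + 2) M} (hα : SmoothForm α)
    (hγ : SmoothForm γ) (hX : SmoothVF X) : pair μ (α - γ) X = pair μ α X - pair μ γ X :=
  integ_sub hμ (smooth_eval hα hX).continuous (smooth_eval hγ hX).continuous

theorem pair_neg_left (α : Form (k + 2) M 1) (X : VF (k + 2) M) : pair μ (-α) X = -pair μ α X := integ_neg _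

theorem pair_sub_right (hμ : SmoothForm μ) {α : Form (k + 2) M 1} {X Y : VF (k + 2) M} (hα : SmoothForm α)
    (hX : SmoothVF X) (hY : SmoothVF Y) : pair μ α (X - Y) = pair μ α X - pair μ α Y :=
  (congrArg (integ μ) (funext fun x => map_sub (lin1 (α x)) (X x) (Y x))).trans
    (integ_sub hμ (smooth_eval hα hX).continuous (smooth_eval hα hY).continuous)

theorem integ_zero : integ μ (fun _ => 0) = 0 := by simp [integ]

theorem pair_zero_right (α : Form (k + 2) M 1) : pair μ α (fun _ => 0) = 0 :=
  (congrArg (integ μ) (funext fun x => map_zero (lin1 (α x)))).trans integ_zero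

theorem pairForm_zero_right (h0 : ∀ x, μ x ≠ 0) (β : Form (k + 2) M 2) : pairForm μ β 0 = 0 := by
  have := pairForm_smul_right h0 0 β (0 : Form (k + 2) M k)
  rwa [zero_smul, zero_mul] at this

omit [CompactSpace M] [T2Space M] [MeasurableSpace M] [BorelSpace M] in
theorem dens_wedge_sub (β γ : Form (k + 2) M 2) (P : Form (k + 2) M k) (x : M) :
    dens μ (wedgeF (β - γ) P) x = dens μ (wedgeF β P) x - dens μ (wedgeF γ P) x := by
  have h : wedge2 (β x - γ x) (P x) = wedge2 (β x) (P x) - wedge2 (γ x) (P x) := by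
    rw [← wedge2L_apply, ← wedge2L_apply, ← wedge2L_apply, map_sub]; rfl
  have h' : wedgeF (β - γ) P x = wedgeF β P x - wedgeF γ P x := h
  rw [dens_apply, dens_apply, dens_apply, h', ← sub_div]; rfl

theorem pairForm_sub_left (hμ : SmoothForm μ) (h0 : ∀ x, μ x ≠ 0) {β γ : Form (k + 2) M 2} {P : Form (k + 2) M k}
    (hβ : SmoothForm β) (hγ : SmoothForm γ) (hP : SmoothForm P) :
    pairForm μ (β - γ) P = pairForm μ β P - pairForm μ γ P := by
  rw [pairForm_eq, pairForm_eq, pairForm_eq]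
  exact (congrArg (integ μ) (funext (dens_wedge_sub β γ P))).trans
    (integ_sub hμ (SmoothForm.dens hμ h0 (hβ.wedgeF hP)).continuous (SmoothForm.dens hμ h0 (hγ.wedgeF hP)).continuous)

theorem pairForm_neg_left (hμ : SmoothForm μ) (h0 : ∀ x, μ x ≠ 0) {β : Form (k + 2) M 2} {P : Form (k + 2) M k}
    (hβ : SmoothForm β) (hP : SmoothForm P) : pairForm μ (-β) P = -pairForm μ β P := by
  have h1 := pairForm_sub_left hμ h0 hβ hβ hP
  have h2 := pairForm_sub_left hμ h0 (hβ.sub hβ) hβ hP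
  rw [sub_self] at h1 h2
  rw [zero_sub] at h2
  linarith

omit [CompactSpace M] [T2Space M] [MeasurableSpace M] [BorelSpace M] in
theorem smooth_smul_dFun {ρ θ : M → ℝ} (hρ : SmoothFun (n := k + 2) ρ) (hθ : SmoothFun (n := k + 2) θ) :
    SmoothForm (fun x => ρ x • dFun θ x : Form (k + 2) M 1) := SmoothForm.smul hρ hθ.dFun

theorem pair_smul_dFun (ρ θ : M → ℝ) (X : VF (k + 2) M) :
    pair μ (fun x => ρ x • dFun θ x) X = integ μ (fun x => lieFun X θ x * ρ x) :=
  congrArg (integ μ) (funext fun _ => mul_comm _ _)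

omit [CompactSpace M] [T2Space M] [MeasurableSpace M] [BorelSpace M] [IsManifold (𝓡 (k + 2)) ∞ M] in
theorem iota_apply_two (U X : VF (k + 2) M) (β : Form (k + 2) M 2) (x : M) :
    iota U β x (fun _ => X x) = β x ![U x, X x] := (form2_eq (β x) (U x) (X x)).symm

theorem pair_iota (U X : VF (k + 2) M) (β : Form (k + 2) M 2) :
    pair μ (iota U β) X = integ μ (fun x => β x ![U x, X x]) :=
  congrArg (integ μ) (funext fun x => iota_apply_two U X β x)

/-- The momentum map of the action of `Diff(M)` on pairs `(ϱ, β)`. -/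
theorem momentum_map (hμ : SmoothForm μ) (h0 : ∀ x, μ x ≠ 0) {ρ θ : M → ℝ} {β : Form (k + 2) M 2} {P : Form (k + 2) M k}
    {U w : VF (k + 2) M} (hρ : SmoothFun (n := k + 2) ρ) (hθ : SmoothFun (n := k + 2) θ) (hβ : SmoothForm β)
    (hd : extd β = 0) (hP : SmoothForm P) (hU : SmoothVF U) (hw : SmoothVF w) (h : iota U μ = extd P) :
    integ μ (fun x => θ x * -divergence μ (fun y => ρ y • w y) x) + pairForm μ (-lieD w β) P =
      pair μ ((fun x => ρ x • dFun θ x) + iota U β) w := by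
  rw [pair_add_left hμ (smooth_smul_dFun hρ hθ) (SmoothForm.iota hU hβ) hw, pair_smul_dFun, pair_iota,
    integ_lieFun_mul hμ h0 hθ hρ hw, pairForm_neg_left hμ h0 (SmoothForm.lieD hw hβ) hP,
    pairForm_lieD_left hμ h0 hβ hd hP hw hU h, ← integ_neg, ← integ_neg]
  congr 1
  · exact congrArg (integ μ) (funext fun x => mul_neg _ _)
  · exact congrArg (integ μ) (funext fun x => by rw [form2_swap (β x) (U x) (w x), neg_neg])

/-- The components of the Hamiltonian vector field of a functional on `𝔠𝔪𝔥^*` with variational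
derivative `a`. -/
def lpField (μ : Form (k + 2) M (k + 2)) (ξ : CMHDual k M) (a : CMH k M) : CMHDual k M :=
  ⟨-(lieDensity μ a.v ξ.α + iota (vecF μ (extd a.P)) ξ.β + fun x => ξ.ρ x • dFun a.θ x),
    fun x => -divergence μ (fun y => ξ.ρ y • a.v y) x, -lieD a.v ξ.β⟩

omit [CompactSpace M] [T2Space M] [MeasurableSpace M] [BorelSpace M] in
theorem smooth_lieDensity (hμ : SmoothForm μ) (h0 : ∀ x, μ x ≠ 0) {α : Form (k + 2) M 1} {X : VF (k + 2) M}
    (hα : SmoothForm α) (hX : SmoothVF X) : SmoothForm (lieDensity μ X α) :=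
  SmoothForm.add (SmoothForm.lieD hX hα) (SmoothForm.smul (smooth_divergence hμ h0 hX) hα)

omit [CompactSpace M] [T2Space M] [MeasurableSpace M] [BorelSpace M] in
theorem smooth_lpField (hμ : SmoothForm μ) (h0 : ∀ x, μ x ≠ 0) {ξ : CMHDual k M} {a : CMH k M} (h : ξ.Mem) (ha : a.Smooth) :
    SmoothForm (lpField μ ξ a).α ∧ SmoothFun (n := k + 2) (lpField μ ξ a).ρ ∧ SmoothForm (lpField μ ξ a).β :=
  ⟨(((smooth_lieDensity hμ h0 h.1 ha.1).add (SmoothForm.iota (SmoothForm.vecF hμ h0 ha.2.2.extd) h.2.2.1)).add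
    (smooth_smul_dFun h.2.1 ha.2.1)).neg, smoothFun_neg (smooth_divergence hμ h0 (ha.1.smul h.2.1)),
    (SmoothForm.lieD ha.1 h.2.2.1).neg⟩

/-- The Lie-Poisson bracket is the pairing of the vector `lpField μ ξ a` with `b`. -/
theorem lpBracket_eq (hμ : SmoothForm μ) (h0 : ∀ x, μ x ≠ 0) {ξ : CMHDual k M} {a b : CMH k M} (h : ξ.Mem)
    (ha : a.Smooth) (hb : b.Smooth) : lpBracket μ ξ a b = dualPair μ (lpField μ ξ a) b := by
  have hU := SmoothForm.vecF hμ h0 ha.2.2.extd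
  have hU' := SmoothForm.vecF hμ h0 hb.2.2.extd
  have hι := iota_vecF h0 (extd a.P)
  have hι' := iota_vecF h0 (extd b.P)
  -- Each Lie derivative that falls on a component of `b` is moved away by an integration by parts.
  have e1 := pair_bracket hμ h0 h.1 ha.1 hb.1
  have e2 : integ μ (fun x => (lieFun a.v b.θ x - lieFun b.v a.θ x) * ξ.ρ x) =
      integ μ (fun x => b.θ x * -divergence μ (fun y => ξ.ρ y • a.v y) x) -
        pair μ (fun x => ξ.ρ x • dFun a.θ x) b.v := by
    rw [pair_smul_dFun]
    have q := integ_lieFun_mul hμ h0 hb.2.1 h.2.1 ha.1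
    rw [← integ_neg] at q
    have q2 : integ μ (fun x => lieFun a.v b.θ x * ξ.ρ x) =
        integ μ (fun x => b.θ x * -divergence μ (fun y => ξ.ρ y • a.v y) x) :=
      q.trans (congrArg (integ μ) (funext fun x => (mul_neg _ _).symm))
    rw [← q2]
    refine Eq.trans (congrArg (integ μ) (funext fun x => sub_mul _ _ _)) (integ_sub hμ
      ((smooth_lieFun hb.2.1 ha.1).continuous.mul h.2.1.continuous) ((smooth_lieFun ha.2.1 hb.1).continuous.mul h.2.1.continuous))
  have e3 : pairForm μ ξ.β (lieD a.v b.P - lieD b.v a.P) =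
      pairForm μ (-lieD a.v ξ.β) b.P - pair μ (iota (vecF μ (extd a.P)) ξ.β) b.v := by
    rw [pairForm_sub_right hμ h0 h.2.2.1 (SmoothForm.lieD ha.1 hb.2.2) (SmoothForm.lieD hb.1 ha.2.2),
      pairForm_lieD_right hμ h0 h.2.2.1 h.2.2.2 hb.2.2 ha.1 hι', pairForm_lieD_right hμ h0 h.2.2.1 h.2.2.2 ha.2.2 hb.1 hι,
      pair_iota, pairForm_neg_left hμ h0 (SmoothForm.lieD ha.1 h.2.2.1) hb.2.2,
      pairForm_lieD_left hμ h0 h.2.2.1 h.2.2.2 hb.2.2 ha.1 hU' hι', ← integ_neg]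
    congr 1
    exact congrArg (integ μ) (funext fun x => form2_swap (ξ.β x) _ _)
  rw [lpBracket, e1, e2, e3]
  change _ = pair μ (-_) b.v + integ μ _ + pairForm μ _ b.P
  rw [pair_neg_left, pair_add_left hμ ((smooth_lieDensity hμ h0 h.1 ha.1).add (SmoothForm.iota hU h.2.2.1))
    (smooth_smul_dFun h.2.1 ha.2.1) hb.1, pair_add_left hμ (smooth_lieDensity hμ h0 h.1 ha.1) (SmoothForm.iota hU h.2.2.1) hb.1]
  change _ = _ + integ μ (fun x => b.θ x * -divergence μ (fun y => ξ.ρ y • a.v y) x) + pairForm μ (-lieD a.v ξ.β) b.P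
  ring

/-- The pairing of `𝔠𝔪𝔥^*` with `𝔠𝔪𝔥` is non-degenerate in its first argument. -/
theorem dualPair_inj (hμ : SmoothForm μ) (h0 : ∀ x, μ x ≠ 0) {ξ ζ : CMHDual k M}
    (h1 : SmoothForm ξ.α) (h2 : SmoothFun (n := k + 2) ξ.ρ) (h3 : SmoothForm ξ.β)
    (k1 : SmoothForm ζ.α) (k2 : SmoothFun (n := k + 2) ζ.ρ) (k3 : SmoothForm ζ.β)
    (h : ∀ b : CMH k M, b.Smooth → dualPair μ ξ b = dualPair μ ζ b) : ξ.α = ζ.α ∧ ξ.ρ = ζ.ρ ∧ ξ.β = ζ.β := by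
  have hz : ∀ ρ : M → ℝ, integ μ (fun x => (0 : M → ℝ) x * ρ x) = 0 := fun ρ =>
    (congrArg (integ μ) (funext fun x => zero_mul _)).trans integ_zero
  refine ⟨funext fun x => sub_eq_zero.1 (form_eq_zero_of_pair hμ h0 (h1.sub k1) x fun X hX _ => ?_),
    funext fun x => sub_eq_zero.1 (fun_eq_zero_of_integ hμ h0 (smoothFun_sub h2 k2) (fun θ hθ => ?_) x),
    funext fun x => sub_eq_zero.1 (form2_eq_zero_of_pairForm hμ h0 (h3.sub k3) (fun P hP => ?_) x)⟩
  · have := h ⟨X, 0, 0⟩ ⟨hX, smooth_const 0, smooth_zero_form⟩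
    simp only [dualPair, hz, pairForm_zero_right h0, add_zero] at this
    rw [pair_sub_left hμ h1 k1 hX, this, sub_self]
  · have := h ⟨fun _ => 0, θ, 0⟩ ⟨smooth_zero_vf, hθ, smooth_zero_form⟩
    simp only [dualPair, pair_zero_right, pairForm_zero_right h0, add_zero, zero_add] at this
    have q := integ_sub hμ (hθ.continuous.mul h2.continuous) (hθ.continuous.mul k2.continuous)
    refine (Eq.trans (congrArg (integ μ) (funext fun x => mul_sub _ _ _)) q).trans (sub_eq_zero.2 this)
  · have := h ⟨fun _ => 0, 0, P⟩ ⟨smooth_zero_vf, smooth_const 0, hP⟩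
    simp only [dualPair, pair_zero_right, hz, zero_add] at this
    rw [pairForm_sub_left hμ h0 h3 k3 hP, this, sub_self]

theorem hasDerivAt_dualPair (hμ : SmoothForm μ) (h0 : ∀ x, μ x ≠ 0) {S : Set ℝ} (hS : IsOpen S) {c : ℝ → CMHDual k M}
    (hc : SmoothCurve S c) {t : ℝ} (ht : t ∈ S) {b : CMH k M} (hb : b.Smooth) :
    HasDerivAt (fun s => dualPair μ (c s) b)
      (dualPair μ ⟨dtForm (fun s => (c s).α) t, dtFun (fun s => (c s).ρ) t, dtForm (fun s => (c s).β) t⟩ b) t := by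
  have k1 := hasDerivAt_integ hμ hS (SmoothFamForm.apply (X := fun _ => fun _ => b.v) hS hc.1 (fun _ => SmoothVF.fam hb.1 S)) ht
  have k2 := hasDerivAt_integ hμ hS ((SmoothFun.fam hb.2.1 S).mul hc.2.1) ht
  have k3 := hasDerivAt_integ hμ hS (SmoothFamForm.dens hS hμ h0 (SmoothFamForm.wedgeF hS hc.2.2.1 (SmoothForm.fam hb.2.2 S))) ht
  have hH : (fun s => dualPair μ (c s) b) = ((fun s => integ μ fun x => (c s).α x (fun _ => b.v x)) +
      fun s => integ μ fun x => b.θ x * (c s).ρ x) + fun s => integ μ (dens μ (wedgeF (c s).β b.P)) := by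
    funext s
    rw [dualPair, pairForm_eq]
    rfl
  rw [hH]
  refine ((k1.add k2).add k3).congr_deriv ?_
  rw [dualPair, pairForm_eq]
  refine congrArg₂ (· + ·) (congrArg₂ (· + ·) ?_ ?_) ?_
  · refine congrArg (integ μ) (funext fun x => ?_)
    exact (hasDerivAt_form_apply ((SmoothFamForm.contDiffAt_param hS hc.1 ht x).differentiableAt (by simp)).hasDerivAt _).deriv
  · refine congrArg (integ μ) (funext fun x => ?_)
    exact (((SmoothFamFun.contDiffAt_param hS hc.2.1 ht x).differentiableAt (by simp)).hasDerivAt.const_mul _).deriv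
  · refine congrArg (integ μ) (funext fun x => ?_)
    have h := ((SmoothFamForm.contDiffAt_param hS hc.2.2.1 ht x).differentiableAt (by simp)).hasDerivAt
    have h2 : HasDerivAt (fun s => wedge2 ((c s).β x) (b.P x)) (wedge2 (dtForm (fun s => (c s).β) t x) (b.P x)) t := by
      have := ((wedge2L (Model (k + 2)) k).flip (b.P x)).hasFDerivAt.comp_hasDerivAt t h
      simp only [ContinuousLinearMap.flip_apply, wedge2L_apply, Function.comp_def] at this
      exact this
    simp only [dens_apply]
    exact ((hasDerivAt_form_apply h2 (stdB (k + 2))).div_const _).deriv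

/-- A linear functional is its own variational derivative. -/
theorem hasVarDeriv_dualPair (hμ : SmoothForm μ) (h0 : ∀ x, μ x ≠ 0) (ξ : CMHDual k M) {b : CMH k M} (hb : b.Smooth) :
    HasVarDeriv μ (fun ζ => dualPair μ ζ b) ξ b :=
  fun δ _ hδ hc _ => hasDerivAt_dualPair hμ h0 isOpen_Ioo hc ⟨by linarith, hδ⟩ hb

end Pairings

/-! ### The projection to the dual of the Lie algebra -/

section Projection

variable {k : ℕ} {M : Type u} [TopologicalSpace M] [ChartedSpace (Model (k + 2)) M] [IsManifold (𝓡 (k + 2)) ∞ M]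
  {μ : Form (k + 2) M (k + 2)} {β₀ : Form (k + 2) M 2}

theorem rhoOf_eq (φ : Diffeo (k + 2) M) : rhoOf μ φ = dens μ (pushforward φ μ) := rfl

theorem rhoOf_smul (h0 : ∀ x, μ x ≠ 0) (φ : Diffeo (k + 2) M) : pushforward φ μ = fun x => rhoOf μ φ x • μ x :=
  funext fun x => (dens_smul_eq (h0 x)).symm

theorem pushforward_eq_of_rhoOf_eq (h0 : ∀ x, μ x ≠ 0) {φ ψ : Diffeo (k + 2) M} (h : rhoOf μ φ = rhoOf μ ψ) :
    pushforward φ μ = pushforward ψ μ := by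
  rw [rhoOf_smul h0, rhoOf_smul h0, h]

theorem extd_pushforward_eq_zero (φ : Diffeo (k + 2) M) (hβ : SmoothForm β₀) (hd : extd β₀ = 0) :
    extd (pushforward φ β₀) = 0 := by
  rw [extd_pushforward φ hβ, hd]
  funext x; ext v; rfl

theorem proj_mem (hμ : SmoothForm μ) (h0 : ∀ x, μ x ≠ 0) (hβ : SmoothForm β₀) (hd : extd β₀ = 0) (φ : Diffeo (k + 2) M)
    {α : Form (k + 2) M 1} (hα : SmoothForm α) : (proj μ β₀ φ α).Mem :=
  ⟨hα, SmoothForm.dens hμ h0 hμ.pushforward, hβ.pushforward, extd_pushforward_eq_zero φ hβ hd⟩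

/-- Two points with the same image differ by `η = φ⁻¹ ∘ φ'`, which preserves `μ` and `β₀`. -/
theorem proj_eq_iff (h0 : ∀ x, μ x ≠ 0) (φ φ' : Diffeo (k + 2) M) (α α' : Form (k + 2) M 1) :
    proj μ β₀ φ α = proj μ β₀ φ' α' ↔ ∃ η ∈ symGroup μ β₀, φ' = η.trans φ ∧ α' = α := by
  constructor
  · intro h
    have h1 : α = α' := congrArg CMHDual.α h
    have h2 : rhoOf μ φ = rhoOf μ φ' := congrArg CMHDual.ρ h
    have h3 : pushforward φ β₀ = pushforward φ' β₀ := congrArg CMHDual.β h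
    have hid : φ.trans φ.symm = Diffeomorph.refl (𝓡 (k + 2)) M ∞ := Diffeomorph.ext fun x => φ.symm_apply_apply x
    refine ⟨φ'.trans φ.symm, ⟨?_, ?_⟩, Diffeomorph.ext fun x => (φ.apply_symm_apply (φ' x)).symm, h1.symm⟩
    · rw [pushforward_trans, ← pushforward_eq_of_rhoOf_eq h0 h2, ← pushforward_trans, hid, pushforward_refl]
    · rw [pushforward_trans, ← h3, ← pushforward_trans, hid, pushforward_refl]
  · rintro ⟨η, ⟨h1, h2⟩, rfl, rfl⟩
    simp only [proj, rhoOf_eq, pushforward_trans, h1, h2]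

theorem smoothCurve_proj (hμ : SmoothForm μ) (h0 : ∀ x, μ x ≠ 0) (hβ : SmoothForm β₀) (hd : extd β₀ = 0) {S : Set ℝ}
    (hS : IsOpen S) {c : ℝ → Diffeo (k + 2) M} {a : ℝ → Form (k + 2) M 1} (hc : SmoothFamDiffeo S c)
    (ha : SmoothFamForm S a) : SmoothCurve S (fun s => proj μ β₀ (c s) (a s)) :=
  ⟨ha, SmoothFamForm.dens hS hμ h0 (SmoothFamForm.pushforward hS hc (hμ.fam S)),
    SmoothFamForm.pushforward hS hc (hβ.fam S), fun _ _ => extd_pushforward_eq_zero _ hβ hd⟩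

variable [CompactSpace M] [T2Space M]

omit [CompactSpace M] [T2Space M] in
theorem lieD_smul_top (X : VF (k + 2) M) (f : M → ℝ) :
    lieD X (fun x => f x • μ x) = extd (iota (fun x => f x • X x) μ) := by
  rw [lieD_top]
  congr 1
  funext x
  exact (congrFun (iota_smul f X μ) x).symm

/-- The continuity equation for `ρ = Jac(φ⁻¹)`. -/
theorem hasDerivAt_rhoOf (hμ : SmoothForm μ) (h0 : ∀ x, μ x ≠ 0) {S : Set ℝ} (hS : IsOpen S) {c : ℝ → Diffeo (k + 2) M}
    (hc : SmoothFamDiffeo S c) {t : ℝ} (ht : t ∈ S) {w : VF (k + 2) M} (hw : IsVelocity c t w) (x : M) :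
    HasDerivAt (fun s => rhoOf μ (c s) x) (-divergence μ (fun y => rhoOf μ (c t) y • w y) x) t := by
  have h := hasDerivAt_pushforward hS hc ht hw hμ x
  have h2 := (hasDerivAt_form_apply h (stdB (k + 2))).div_const (μ x (stdB (k + 2)))
  have e : (fun s => rhoOf μ (c s) x) = fun s => pushforward (c s) μ x (stdB (k + 2)) / μ x (stdB (k + 2)) :=
    funext fun s => by rw [rhoOf_eq, dens_apply]
  rw [e]
  refine h2.congr_deriv ?_
  rw [divergence_eq, dens_apply, rhoOf_smul h0, lieD_smul_top, ← neg_div]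
  rfl

variable [MeasurableSpace M] [BorelSpace M]

/-- The derivative of `Π` along a curve, paired with a constant element of `𝔠𝔪𝔥`. -/
theorem dualPair_proj_deriv (hμ : SmoothForm μ) (h0 : ∀ x, μ x ≠ 0) (hβ : SmoothForm β₀) (hd : extd β₀ = 0) {S : Set ℝ}
    (hS : IsOpen S) {c : ℝ → Diffeo (k + 2) M} {A : ℝ → Form (k + 2) M 1} (hc : SmoothFamDiffeo S c) {t : ℝ} (ht : t ∈ S)
    {w : VF (k + 2) M} (hw : IsVelocity c t w) {a : CMH k M} (ha : a.Smooth) :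
    dualPair μ ⟨dtForm (fun s => (proj μ β₀ (c s) (A s)).α) t, dtFun (fun s => (proj μ β₀ (c s) (A s)).ρ) t,
        dtForm (fun s => (proj μ β₀ (c s) (A s)).β) t⟩ a =
      pair μ ((fun x => rhoOf μ (c t) x • dFun a.θ x) + iota (vecF μ (extd a.P)) (pushforward (c t) β₀)) w +
        pair μ (dtForm A t) a.v := by
  have e1 : dtFun (fun s => (proj μ β₀ (c s) (A s)).ρ) t = fun x => -divergence μ (fun y => rhoOf μ (c t) y • w y) x :=
    funext fun x => (hasDerivAt_rhoOf hμ h0 hS hc ht hw x).deriv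
  have e2 : dtForm (fun s => (proj μ β₀ (c s) (A s)).β) t = -lieD w (pushforward (c t) β₀) :=
    funext fun x => (hasDerivAt_pushforward hS hc ht hw hβ x).deriv
  rw [e1, e2, ← momentum_map hμ h0 (ρ := rhoOf μ (c t)) (SmoothForm.dens hμ h0 hμ.pushforward) ha.2.1 hβ.pushforward
    (extd_pushforward_eq_zero (c t) hβ hd) ha.2.2 (SmoothForm.vecF hμ h0 ha.2.2.extd) (IsVelocity.smooth hS hc ht hw)
    (iota_vecF h0 _), dualPair]
  change pair μ (dtForm A t) a.v + _ + _ = _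
  ring

/-- The covector `(δ(F ∘ Π)/δφ) ∘ φ⁻¹` is the momentum map applied to the variational derivative of `F`. -/
theorem hasCotDeriv_proj (hμ : SmoothForm μ) (h0 : ∀ x, μ x ≠ 0) (hβ : SmoothForm β₀) (hd : extd β₀ = 0)
    {F : CMHDual k M → ℝ} {φ : Diffeo (k + 2) M} {α : Form (k + 2) M 1} {a : CMH k M} (ha : a.Smooth)
    (hF : HasVarDeriv μ F (proj μ β₀ φ α) a) :
    HasCotDeriv μ (fun ψ γ => F (proj μ β₀ ψ γ)) φ α
      ((fun x => rhoOf μ φ x • dFun a.θ x) + iota (vecF μ (extd a.P)) (pushforward φ β₀)) a.v := by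
  intro δ c A w hδ hc hA hc0 hA0 hw
  have h0S : (0 : ℝ) ∈ Ioo (-δ) δ := ⟨by linarith, hδ⟩
  have h := hF δ (fun ε => proj μ β₀ (c ε) (A ε)) hδ (smoothCurve_proj hμ h0 hβ hd isOpen_Ioo hc hA) (by rw [hc0, hA0])
  rw [dualPair_proj_deriv hμ h0 hβ hd isOpen_Ioo hc h0S hw ha, hc0] at h
  exact h

/-- The canonical bracket of the derivatives of `F ∘ Π` and `G ∘ Π` found in `hasCotDeriv_proj` is the
Lie-Poisson bracket of `F` and `G`. -/
theorem canBracket_eq (hμ : SmoothForm μ) (h0 : ∀ x, μ x ≠ 0) (hβ : SmoothForm β₀) (hd : extd β₀ = 0)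
    {φ : Diffeo (k + 2) M} {α : Form (k + 2) M 1} {a b : CMH k M} (ha : a.Smooth) (hb : b.Smooth) :
    canBracket μ α ((fun x => rhoOf μ φ x • dFun a.θ x) + iota (vecF μ (extd a.P)) (pushforward φ β₀)) a.v
      ((fun x => rhoOf μ φ x • dFun b.θ x) + iota (vecF μ (extd b.P)) (pushforward φ β₀)) b.v =
    lpBracket μ (proj μ β₀ φ α) a b := by
  have hρ : SmoothFun (n := k + 2) (rhoOf μ φ) := SmoothForm.dens hμ h0 hμ.pushforward
  have hβ' := hβ.pushforward (φ := φ)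
  have hd' := extd_pushforward_eq_zero φ hβ hd
  have hUa := SmoothForm.vecF hμ h0 ha.2.2.extd
  have hUb := SmoothForm.vecF hμ h0 hb.2.2.extd
  have e1 : integ μ (fun x => (lieFun a.v b.θ x - lieFun b.v a.θ x) * rhoOf μ φ x) =
      integ μ (fun x => lieFun a.v b.θ x * rhoOf μ φ x) - integ μ (fun x => lieFun b.v a.θ x * rhoOf μ φ x) :=
    Eq.trans (congrArg (integ μ) (funext fun x => sub_mul _ _ _)) (integ_sub hμ
      ((smooth_lieFun hb.2.1 ha.1).continuous.mul hρ.continuous) ((smooth_lieFun ha.2.1 hb.1).continuous.mul hρ.continuous))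
  rw [canBracket, lpBracket]
  change _ = pair μ α _ + integ μ (fun x => (lieFun a.v b.θ x - lieFun b.v a.θ x) * rhoOf μ φ x) +
    pairForm μ (pushforward φ β₀) (lieD a.v b.P - lieD b.v a.P)
  rw [e1, pairForm_sub_right hμ h0 hβ' (SmoothForm.lieD ha.1 hb.2.2) (SmoothForm.lieD hb.1 ha.2.2),
    pairForm_lieD_right hμ h0 hβ' hd' hb.2.2 ha.1 (iota_vecF h0 _), pairForm_lieD_right hμ h0 hβ' hd' ha.2.2 hb.1 (iota_vecF h0 _),
    pair_add_left hμ (smooth_smul_dFun hρ ha.2.1) (SmoothForm.iota hUa hβ') hb.1,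
    pair_add_left hμ (smooth_smul_dFun hρ hb.2.1) (SmoothForm.iota hUb hβ') ha.1,
    pair_smul_dFun, pair_smul_dFun, pair_iota, pair_iota]
  ring

end Projection

/-! ### The reduced system and the Lie-Poisson equations -/

section Reduced

variable {k : ℕ} {M : Type u} [TopologicalSpace M] [ChartedSpace (Model (k + 2)) M] [IsManifold (𝓡 (k + 2)) ∞ M]
  [CompactSpace M] [T2Space M] [MeasurableSpace M] [BorelSpace M] {μ : Form (k + 2) M (k + 2)}

/-- Two vector fields are separated by the 1-form `(X - Y)^♭`. -/
theorem vf_eq_of_pair (g : Metric (k + 2) M) (hμ : SmoothForm μ) (h0 : ∀ x, μ x ≠ 0) {X Y : VF (k + 2) M}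
    (hX : SmoothVF X) (hY : SmoothVF Y) (h : ∀ γ : Form (k + 2) M 1, SmoothForm γ → pair μ γ X = pair μ γ Y) : X = Y := by
  have hZ := hX.sub hY
  have hflat := SmoothVF.flat g hZ
  have h1 : pair μ (flat g (X - Y)) (X - Y) = 0 := by rw [pair_sub_right hμ hflat hX hY, h _ hflat, sub_self]
  funext x
  have h2 := eq_zero_of_integ_eq_zero hμ h0 (smooth_eval hflat hZ).continuous (fun x => ?_) h1 x
  · by_contra hne
    exact (g.pos x ((X - Y) x) (sub_ne_zero.2 hne)).ne' h2
  · by_cases hx : (X - Y) x = 0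
    · refine le_of_eq (Eq.symm ?_)
      refine (congrArg (fun v : Model (k + 2) => gAt g x v v) hx).trans ?_
      exact map_zero (gAt g x (0 : Model (k + 2)))
    · exact (g.pos x ((X - Y) x) hx).le

omit [CompactSpace M] [T2Space M] [MeasurableSpace M] [BorelSpace M] [IsManifold (𝓡 (k + 2)) ∞ M] in
theorem smoothFamFun_of_contDiff {Z : Type} [NormedAddCommGroup Z] [NormedSpace ℝ Z] (S : Set Z) {f : Z → ℝ}
    (hf : ContDiff ℝ ∞ f) : SmoothFamFun (k + 2) S (fun (z : Z) (_ : M) => f z) :=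
  (hf.contMDiff.comp contMDiff_fst).contMDiffOn

/-- Two variational derivatives of one functional agree on all tangent directions `(α, ρ, dγ)`. -/
theorem HasVarDeriv.pair_eq (hμ : SmoothForm μ) (h0 : ∀ x, μ x ≠ 0) {F : CMHDual k M → ℝ} {ξ : CMHDual k M}
    (hξ : ξ.Mem) {a b : CMH k M} (ha : a.Smooth) (hb : b.Smooth) (h : HasVarDeriv μ F ξ a) (h' : HasVarDeriv μ F ξ b)
    {α : Form (k + 2) M 1} {ρ : M → ℝ} {γ : Form (k + 2) M 1} (hα : SmoothForm α) (hρ : SmoothFun (n := k + 2) ρ)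
    (hγ : SmoothForm γ) :
    pair μ α a.v + integ μ (fun x => a.θ x * ρ x) + pair μ γ (vecF μ (extd a.P)) =
      pair μ α b.v + integ μ (fun x => b.θ x * ρ x) + pair μ γ (vecF μ (extd b.P)) := by
  have hid := smoothFamFun_of_contDiff (k := k) (M := M) (Ioo (-1 : ℝ) 1) (f := fun z => z) contDiff_id
  -- The straight line through `ξ`. Its last component moves in an exact direction, so it stays closed.
  let c : ℝ → CMHDual k M := fun ε => ⟨ξ.α + fun x => ε • α x, fun x => ξ.ρ x + ε * ρ x, ξ.β + fun x => ε • extd γ x⟩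
  have hc : SmoothCurve (Ioo (-1) 1) c := by
    refine ⟨(hξ.1.fam _).add (SmoothFamForm.smul isOpen_Ioo hid (hα.fam _)),
      (SmoothFun.fam hξ.2.1 _).add (hid.mul (SmoothFun.fam hρ _)),
      (hξ.2.2.1.fam _).add (SmoothFamForm.smul isOpen_Ioo hid (hγ.extd.fam _)), fun t _ => ?_⟩
    have hs : SmoothForm (fun x => t • extd γ x) := SmoothForm.smul (smooth_const t) hγ.extd
    refine (extd_add hξ.2.2.1 hs).trans ?_
    rw [hξ.2.2.2]
    refine (congrArg _ (extd_const_smul t (extd γ))).trans ?_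
    rw [extd_extd hγ, smul_zero, add_zero]
  have hc0 : c 0 = ξ := by
    cases ξ
    simp only [c, zero_smul, zero_mul, add_zero]
    congr 1 <;> exact add_zero _
  have d1 : dtForm (fun ε => (c ε).α) 0 = α := funext fun x => by
    have h1 := ((hasDerivAt_id (0 : ℝ)).smul_const (α x)).const_add (ξ.α x)
    rw [one_smul] at h1
    exact h1.deriv
  have d2 : dtFun (fun ε => (c ε).ρ) 0 = ρ := funext fun x => by
    have h1 := ((hasDerivAt_id (0 : ℝ)).mul_const (ρ x)).const_add (ξ.ρ x)
    rw [one_mul] at h1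
    exact h1.deriv
  have d3 : dtForm (fun ε => (c ε).β) 0 = extd γ := funext fun x => by
    have h1 := ((hasDerivAt_id (0 : ℝ)).smul_const (extd γ x)).const_add (ξ.β x)
    rw [one_smul] at h1
    exact h1.deriv
  have key := (h 1 c one_pos hc hc0).unique (h' 1 c one_pos hc hc0)
  rw [d1, d2, d3] at key
  simp only [dualPair] at key
  rwa [pairForm_extd_left hμ h0 hγ ha.2.2 (SmoothForm.vecF hμ h0 ha.2.2.extd) (iota_vecF h0 _),
    pairForm_extd_left hμ h0 hγ hb.2.2 (SmoothForm.vecF hμ h0 hb.2.2.extd) (iota_vecF h0 _)] at key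

/-- The variational derivative is unique, up to closed summands of its last component. -/
theorem HasVarDeriv.unique (g : Metric (k + 2) M) (hμ : SmoothForm μ) (h0 : ∀ x, μ x ≠ 0) {F : CMHDual k M → ℝ}
    {ξ : CMHDual k M} (hξ : ξ.Mem) {a b : CMH k M} (ha : a.Smooth) (hb : b.Smooth) (h : HasVarDeriv μ F ξ a)
    (h' : HasVarDeriv μ F ξ b) : a.v = b.v ∧ a.θ = b.θ ∧ extd a.P = extd b.P := by
  have key := fun (α : Form (k + 2) M 1) (ρ : M → ℝ) (γ : Form (k + 2) M 1) hα hρ hγ =>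
    HasVarDeriv.pair_eq hμ h0 hξ ha hb h h' (α := α) (ρ := ρ) (γ := γ) hα hρ hγ
  have hz : ∀ X : VF (k + 2) M, pair μ 0 X = 0 := fun X => integ_zero
  have hz2 : ∀ θ : M → ℝ, integ μ (fun x => θ x * 0) = 0 := fun θ =>
    (congrArg (integ μ) (funext fun x => mul_zero _)).trans integ_zero
  have z1 := smooth_zero_form (k := k) (M := M) (j := 1)
  refine ⟨vf_eq_of_pair g hμ h0 ha.1 hb.1 fun γ hγ => ?_, ?_, ?_⟩
  · have := key γ (fun _ => 0) 0 hγ (smooth_const 0) z1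
    rwa [hz, hz, hz2, hz2, add_zero, add_zero, add_zero, add_zero] at this
  · funext x
    refine sub_eq_zero.1 (fun_eq_zero_of_integ hμ h0 (smoothFun_sub ha.2.1 hb.2.1) (fun ρ hρ => ?_) x)
    have := key 0 ρ 0 z1 hρ z1
    rw [hz, hz, hz, hz, add_zero, add_zero, zero_add, zero_add] at this
    have q := integ_sub hμ (ha.2.1.continuous.mul hρ.continuous) (hb.2.1.continuous.mul hρ.continuous)
    exact (Eq.trans (congrArg (integ μ) (funext fun x => (mul_comm _ _).trans (sub_mul _ _ _))) q).trans (sub_eq_zero.2 this)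
  · have hU := vf_eq_of_pair g hμ h0 (SmoothForm.vecF hμ h0 ha.2.2.extd) (SmoothForm.vecF hμ h0 hb.2.2.extd) fun γ hγ => by
      have := key 0 (fun _ => 0) γ z1 (smooth_const 0) hγ
      rwa [hz, hz, hz2, hz2, add_zero, zero_add, zero_add] at this
    rw [← iota_vecF h0 (extd a.P), hU, iota_vecF h0]

omit [CompactSpace M] [T2Space M] [MeasurableSpace M] [BorelSpace M] in
theorem lpField_congr {ξ : CMHDual k M} {a b : CMH k M} (h : a.v = b.v ∧ a.θ = b.θ ∧ extd a.P = extd b.P) :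
    lpField μ ξ a = lpField μ ξ b := by
  simp only [lpField, h.1, h.2.1, h.2.2]

/-- The evolution equation `ξ̇ = X_{H̄}(ξ)` at time `t`, where `X_{H̄}` is the Lie-Poisson vector field of `H̄`. -/
def EvolvesAt (g : Metric (k + 2) M) (μ : Form (k + 2) M (k + 2)) (e : ℝ → ℝ) (ξ : ℝ → CMHDual k M) (t : ℝ) : Prop :=
  dtForm (fun s => (ξ s).α) t = (lpField μ (ξ t) (hamGrad g μ e (ξ t))).α ∧
    dtFun (fun s => (ξ s).ρ) t = (lpField μ (ξ t) (hamGrad g μ e (ξ t))).ρ ∧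
    dtForm (fun s => (ξ s).β) t = (lpField μ (ξ t) (hamGrad g μ e (ξ t))).β

/-- The reduced system is the equation `ξ' = lpField μ ξ δH̄`; the field `u` with `ι_u ϱ = dP` is
`ρ⁻¹ vecF μ (dP)`. -/
theorem solvesReduced_iff (g : Metric (k + 2) M) (hμ : SmoothForm μ) (h0 : ∀ x, μ x ≠ 0) {e : ℝ → ℝ}
    (he : ContDiffOn ℝ ∞ e (Ioi 0)) {J : Set ℝ} {ξ : ℝ → CMHDual k M} (hξ : SmoothCurve J ξ)
    (hpos : ∀ t ∈ J, ∀ x, 0 < (ξ t).ρ x) : SolvesReduced g μ e J ξ ↔ ∀ t ∈ J, EvolvesAt g μ e ξ t := by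
  have hioS : ∀ {j : ℕ} (ρ : M → ℝ) (u : VF (k + 2) M) (β : Form (k + 2) M (j + 1)) x,
      iota (fun x => ρ x • u x) β x = ρ x • iota u β x := fun ρ u β x => congrFun (iota_smul ρ u β) x
  constructor
  · intro h t ht
    obtain ⟨a, u, ha, hu, hF, hdP, -, e1, e2, e3⟩ := h t ht
    have hm := hξ.mem ht
    have huniq := HasVarDeriv.unique g hμ h0 hm ha (smooth_hamGrad g hμ he hm (hpos t ht)) hF
      (hasVarDeriv_hamBar g hμ h0 he (hpos t ht))
    -- Both `ρ u` and `vecF μ (dP)` contract `μ` to `dP`.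
    have hU : vecF μ (extd a.P) = fun x => (ξ t).ρ x • u x := funext fun x => vf_eq_of_iota h0
      ((congrFun (iota_vecF h0 (extd a.P)) x).trans ((hdP x).symm.trans (hioS _ u μ x).symm))
    rw [EvolvesAt, ← lpField_congr huniq]
    refine ⟨funext fun x => ?_, funext fun x => ?_, funext fun x => ?_⟩
    · have h1 := e1 x
      rw [← hioS, ← hU, add_assoc, add_assoc] at h1
      rw [eq_neg_of_add_eq_zero_left h1]
      exact congrArg Neg.neg (add_assoc _ _ _).symm
    · exact eq_neg_of_add_eq_zero_left (e2 x)
    · exact eq_neg_of_add_eq_zero_left (e3 x)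
  · intro h t ht
    obtain ⟨e1, e2, e3⟩ := h t ht
    have hm := hξ.mem ht
    have hsm := smooth_hamGrad g hμ he hm (hpos t ht)
    have hU := SmoothForm.vecF hμ h0 hsm.2.2.extd
    have hinv : SmoothFun (n := k + 2) (fun x => ((ξ t).ρ x)⁻¹) :=
      (SmoothFamFun.inv (SmoothFun.fam hm.2.1 (univ : Set ℝ)) fun _ _ x => (hpos t ht x).ne').at (mem_univ 0)
    have hcancel : (fun x => (ξ t).ρ x • (((ξ t).ρ x)⁻¹ • vecF μ (extd (hamGrad g μ e (ξ t)).P) x) : VF (k + 2) M) =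
        vecF μ (extd (hamGrad g μ e (ξ t)).P) := funext fun x => smul_inv_smul₀ (hpos t ht x).ne' _
    refine ⟨hamGrad g μ e (ξ t), fun x => ((ξ t).ρ x)⁻¹ • vecF μ (extd (hamGrad g μ e (ξ t)).P) x, hsm, hU.smul hinv,
      hasVarDeriv_hamBar g hμ h0 he (hpos t ht), fun x => ?_, fun x => ?_, fun x => ?_, fun x => ?_, fun x => ?_⟩
    · rw [← hioS]
      exact congrFun ((congrArg (fun X => iota X μ) hcancel).trans (iota_vecF h0 _)) x
    · ext w
      refine ((inner_velocity g (hpos t ht x) (w 0)).trans ?_).symm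
      congr 1; funext i; rw [Subsingleton.elim i 0]
    · rw [← hioS, e1, add_assoc, add_assoc]
      have hcc := congrFun (congrArg (fun X => iota X (ξ t).β) hcancel) x
      refine (congrArg (fun r => _ + (_ + (r + _))) hcc).trans ?_
      have hL : (lpField μ (ξ t) (hamGrad g μ e (ξ t))).α x = -(lieDensity μ (hamGrad g μ e (ξ t)).v (ξ t).α x +
        iota (vecF μ (extd (hamGrad g μ e (ξ t)).P)) (ξ t).β x + (ξ t).ρ x • dFun (hamGrad g μ e (ξ t)).θ x) := rfl
      rw [hL, ← add_assoc (lieDensity μ _ _ x)]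
      exact neg_add_cancel _
    · rw [e2]; exact neg_add_cancel _
    · rw [e3]; exact neg_add_cancel _

/-- The Lie-Poisson equations are the equation `ξ' = lpField μ ξ δH̄`. The linear functionals
`⟨·, b⟩` suffice to recover it. -/
theorem liePoisson_iff (g : Metric (k + 2) M) (hμ : SmoothForm μ) (h0 : ∀ x, μ x ≠ 0) {e : ℝ → ℝ}
    (he : ContDiffOn ℝ ∞ e (Ioi 0)) {J : Set ℝ} (hJ : IsOpen J) {ξ : ℝ → CMHDual k M} (hξ : SmoothCurve J ξ)
    (hpos : ∀ t ∈ J, ∀ x, 0 < (ξ t).ρ x) :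
    (∀ t ∈ J, ∀ (F : CMHDual k M → ℝ) (a b : CMH k M), a.Smooth → b.Smooth →
      HasVarDeriv μ (hamBar g μ e) (ξ t) a → HasVarDeriv μ F (ξ t) b →
      HasDerivAt (fun s => F (ξ s)) (lpBracket μ (ξ t) a b) t) ↔ ∀ t ∈ J, EvolvesAt g μ e ξ t := by
  constructor
  · intro h t ht
    have hm := hξ.mem ht
    have hsm := smooth_hamGrad g hμ he hm (hpos t ht)
    have hfs := smooth_lpField hμ h0 hm hsm
    refine dualPair_inj hμ h0 (ξ := ⟨dtForm (fun s => (ξ s).α) t, dtFun (fun s => (ξ s).ρ) t, dtForm (fun s => (ξ s).β) t⟩)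
      ((SmoothFamForm.deriv hJ hξ.1).at ht) ((SmoothFamFun.deriv hJ hξ.2.1).at ht)
      ((SmoothFamForm.deriv hJ hξ.2.2.1).at ht) hfs.1 hfs.2.1 hfs.2.2 fun b hb => ?_
    rw [← lpBracket_eq hμ h0 hm hsm hb]
    exact (hasDerivAt_dualPair hμ h0 hJ hξ ht hb).unique (h t ht _ _ b hsm hb (hasVarDeriv_hamBar g hμ h0 he (hpos t ht))
      (hasVarDeriv_dualPair hμ h0 _ hb))
  · intro h t ht F a b ha hb hH hF
    have hm := hξ.mem ht
    have hsm := smooth_hamGrad g hμ he hm (hpos t ht)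
    have huniq := HasVarDeriv.unique g hμ h0 hm ha hsm hH (hasVarDeriv_hamBar g hμ h0 he (hpos t ht))
    -- The variational derivative of `F` is applied to the curve `ξ` shifted to time `0`.
    obtain ⟨δ, hδ, hball⟩ := Metric.isOpen_iff.1 hJ t ht
    have hmaps : MapsTo (fun ε : ℝ => t + ε) (Ioo (-δ) δ) J := fun ε hε => hball (by
      rw [Metric.mem_ball, Real.dist_eq, add_sub_cancel_left, abs_lt]; exact hε)
    have hadd : ContDiffOn ℝ ∞ (fun ε : ℝ => t + ε) (Ioo (-δ) δ) := (contDiff_const.add contDiff_id).contDiffOn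
    have hc : SmoothCurve (Ioo (-δ) δ) (fun ε => ξ (t + ε)) :=
      ⟨hξ.1.comp hadd hmaps, hξ.2.1.comp hadd hmaps, hξ.2.2.1.comp hadd hmaps, fun ε hε => hξ.2.2.2 _ (hmaps hε)⟩
    have h1 := hF δ _ hδ hc (by rw [add_zero])
    have d1 : dtForm (fun ε => (ξ (t + ε)).α) 0 = dtForm (fun s => (ξ s).α) t := funext fun x =>
      (deriv_comp_const_add (f := fun s => (ξ s).α x) t 0).trans (by rw [add_zero]; rfl)
    have d2 : dtFun (fun ε => (ξ (t + ε)).ρ) 0 = dtFun (fun s => (ξ s).ρ) t := funext fun x =>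
      (deriv_comp_const_add (f := fun s => (ξ s).ρ x) t 0).trans (by rw [add_zero]; rfl)
    have d3 : dtForm (fun ε => (ξ (t + ε)).β) 0 = dtForm (fun s => (ξ s).β) t := funext fun x =>
      (deriv_comp_const_add (f := fun s => (ξ s).β x) t 0).trans (by rw [add_zero]; rfl)
    obtain ⟨e1, e2, e3⟩ := h t ht
    rw [d1, d2, d3, e1, e2, e3, ← lpField_congr huniq] at h1
    rw [lpBracket_eq hμ h0 hm ha hb]
    have h2 : HasDerivAt (fun ε => F (ξ (t + ε))) (dualPair μ (lpField μ (ξ t) a) b) (t - t) := by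
      rw [sub_self]; exact h1
    have h3 := h2.comp_sub_const t t
    simpa only [add_sub_cancel] using h3

end Reduced

/-! ### Hamilton's equations on the cotangent bundle -/

section Hamilton

variable {k : ℕ} {M : Type u} [TopologicalSpace M] [ChartedSpace (Model (k + 2)) M] [IsManifold (𝓡 (k + 2)) ∞ M]

theorem SmoothFamDiffeo.trans {Z : Type} [NormedAddCommGroup Z] [NormedSpace ℝ Z] {S : Set Z} {c d : Z → Diffeo (k + 2) M}
    (hc : SmoothFamDiffeo S c) (hd : SmoothFamDiffeo S d) : SmoothFamDiffeo S (fun z => (c z).trans (d z)) :=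
  ContMDiffOn.comp (t := S ×ˢ univ) (f := fun p : Z × M => (p.1, c p.1 p.2)) hd
    (contMDiff_fst.contMDiffOn.prodMk hc) fun _ hp => ⟨hp.1, mem_univ _⟩

theorem isVelocity_const (φ : Diffeo (k + 2) M) (t : ℝ) : IsVelocity (fun _ => φ) t (fun _ => 0) := by
  intro y
  have h : (ContinuousLinearMap.toSpanSingleton ℝ (0 : Model (k + 2))) = 0 :=
    ContinuousLinearMap.ext fun r => smul_zero r
  have h2 := hasMFDerivAt_const (I := 𝓘(ℝ, ℝ)) (I' := 𝓡 (k + 2)) (φ y) t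
  refine Eq.mp (congrArg (HasMFDerivAt 𝓘(ℝ, ℝ) (𝓡 (k + 2)) (fun _ : ℝ => φ y) t) ?_) h2
  exact h.symm

theorem IsVelocity.congr {c d : ℝ → Diffeo (k + 2) M} {t : ℝ} {w : VF (k + 2) M} (h : IsVelocity c t w)
    (hcd : ∀ᶠ s in 𝓝 t, d s = c s) : IsVelocity d t w := by
  intro y
  have ht : d t = c t := hcd.self_of_nhds
  have h1 := (h y).congr_of_eventuallyEq (f₁ := fun s => d s y) (hcd.mono fun s hs => congrArg (fun f : Diffeo (k + 2) M => f y) hs)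
  rw [ht]
  exact h1

variable {μ : Form (k + 2) M (k + 2)} {β₀ : Form (k + 2) M 2} [CompactSpace M] [T2Space M] [MeasurableSpace M] [BorelSpace M]

theorem hasDerivAt_pair (hμ : SmoothForm μ) {S : Set ℝ} (hS : IsOpen S) {a : ℝ → Form (k + 2) M 1} {X : ℝ → VF (k + 2) M}
    (ha : SmoothFamForm S a) (hX : SmoothFamVF S X) {t : ℝ} (ht : t ∈ S) :
    HasDerivAt (fun s => pair μ (a s) (X s)) (pair μ (dtForm a t) (X t) + pair μ (a t) (dtVF X t)) t := by
  have h := hasDerivAt_integ hμ hS (SmoothFamForm.apply (X := fun _ => X) hS ha (fun _ => hX)) ht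
  refine h.congr_deriv ?_
  have s1 : SmoothForm (dtForm a t) := (SmoothFamForm.deriv hS ha).at ht
  have s2 : SmoothVF (dtVF X t) := (SmoothFamVF.deriv hS hX).at ht
  refine Eq.trans (congrArg (integ μ) (funext fun x => ?_))
    (integ_add hμ (smooth_eval s1 (hX.at ht)).continuous (smooth_eval (ha.at ht) s2).continuous)
  have h1 : HasDerivAt (fun s => lin1 (a s x)) (lin1 (dtForm a t x)) t := by
    have h0 : HasDerivAt (fun s => a s x) (dtForm a t x) t :=
      ((SmoothFamForm.contDiffAt_param hS ha ht x).differentiableAt (by simp)).hasDerivAt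
    exact (lin1 (E := Model (k + 2))).hasFDerivAt.comp_hasDerivAt t h0
  have h2 : HasDerivAt (F := Model (k + 2)) (fun s => X s x) (dtVF X t x) t :=
    ((SmoothFamVF.contDiffAt_param hS hX ht x).differentiableAt (by simp)).hasDerivAt
  exact (h1.clm_apply h2).deriv

/-- The covector `(δH/δφ) ∘ φ⁻¹` of the Hamiltonian `H = H̄ ∘ Π`. -/
def hamForce (g : Metric (k + 2) M) (μ : Form (k + 2) M (k + 2)) (e : ℝ → ℝ) (ξ : CMHDual k M) : Form (k + 2) M 1 :=
  (fun x => ξ.ρ x • dFun (hamGrad g μ e ξ).θ x) + iota (vecF μ (extd (hamGrad g μ e ξ).P)) ξ.β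

omit [CompactSpace M] [T2Space M] [MeasurableSpace M] [BorelSpace M] in
theorem smooth_hamForce (g : Metric (k + 2) M) (hμ : SmoothForm μ) (h0 : ∀ x, μ x ≠ 0) {e : ℝ → ℝ}
    (he : ContDiffOn ℝ ∞ e (Ioi 0)) {ξ : CMHDual k M} (h : ξ.Mem) (hpos : ∀ x, 0 < ξ.ρ x) :
    SmoothForm (hamForce g μ e ξ) :=
  have hs := smooth_hamGrad g hμ he h hpos
  (smooth_smul_dFun h.2.1 hs.2.1).add (SmoothForm.iota (SmoothForm.vecF hμ h0 hs.2.2.extd) h.2.2.1)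

theorem fderiv_prod_snd_one {F : Type*} [NormedAddCommGroup F] [NormedSpace ℝ F] {f : ℝ × ℝ → F} {t ε : ℝ}
    (h : DifferentiableAt ℝ f (t, ε)) : fderiv ℝ f (t, ε) (0, 1) = deriv (fun r => f (t, r)) ε := by
  rw [← fderiv_apply_one_eq_deriv, fderiv_prod_snd h]

theorem fderiv_prod_fst_one {F : Type*} [NormedAddCommGroup F] [NormedSpace ℝ F] {f : ℝ × ℝ → F} {t ε : ℝ}
    (h : DifferentiableAt ℝ f (t, ε)) : fderiv ℝ f (t, ε) (1, 0) = deriv (fun s => f (s, ε)) t := by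
  rw [← fderiv_apply_one_eq_deriv, fderiv_prod_fst h]

/-- The first variation of the phase space Lagrangian `⟨m, φ̇ ∘ φ⁻¹⟩ - H(φ, m)`.  The mixed derivatives
of a variation with velocities `V` and `W` satisfy `∂_ε V - ∂_t W = [V, W]`, and
`⟨α, [V, W]⟩ = -⟨𝓛_V α, W⟩` for densities. -/
theorem first_variation (g : Metric (k + 2) M) (hμ : SmoothForm μ) (h0 : ∀ x, μ x ≠ 0) (hβ : SmoothForm β₀)
    (hd : extd β₀ = 0) {e : ℝ → ℝ} (he : ContDiffOn ℝ ∞ e (Ioi 0)) {J : Set ℝ} (hJ : IsOpen J)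
    {φ : ℝ → Diffeo (k + 2) M} {α : ℝ → Form (k + 2) M 1}
    (hor : ∀ t ∈ J, OrientationPreserving μ (φ t)) {δ : ℝ} (hδ : 0 < δ) {Φ : ℝ → ℝ → Diffeo (k + 2) M}
    {A : ℝ → ℝ → Form (k + 2) M 1} {V W : ℝ → ℝ → VF (k + 2) M}
    (hΦ : SmoothFamDiffeo (J ×ˢ Ioo (-δ) δ) (fun p : ℝ × ℝ => Φ p.1 p.2))
    (hA : SmoothFamForm (J ×ˢ Ioo (-δ) δ) (fun p : ℝ × ℝ => A p.1 p.2))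
    (h00 : ∀ t ∈ J, Φ t 0 = φ t ∧ A t 0 = α t)
    (hVW : ∀ t ∈ J, ∀ ε ∈ Ioo (-δ) δ, IsVelocity (fun s => Φ s ε) t (V t ε) ∧ IsVelocity (fun r => Φ t r) ε (W t ε))
    {t : ℝ} (ht : t ∈ J) {w : VF (k + 2) M} (hw : IsVelocity φ t w) : ∃ c₁ c₂ : ℝ,
      HasDerivAt (fun ε => pair μ (A t ε) (V t ε) - ham g μ e β₀ (Φ t ε) (A t ε)) c₁ 0 ∧
      HasDerivAt (fun s => pair μ (A s 0) (W s 0)) c₂ t ∧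
      c₁ - c₂ = pair μ (dtForm (A t) 0) (w - velocity g (proj μ β₀ (φ t) (α t))) -
        pair μ (dtForm α t + lieDensity μ w (α t) + hamForce g μ e (proj μ β₀ (φ t) (α t))) (W t 0) := by
  set S : Set (ℝ × ℝ) := J ×ˢ Ioo (-δ) δ with hSdef
  have hS : IsOpen S := hJ.prod isOpen_Ioo
  have h0I : (0 : ℝ) ∈ Ioo (-δ) δ := ⟨by linarith, hδ⟩
  have hz : (t, (0 : ℝ)) ∈ S := ⟨ht, h0I⟩
  obtain ⟨hφ0, hα0⟩ := h00 t ht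
  -- the velocities are smooth
  have dV : IsVelocityDir S (fun p : ℝ × ℝ => Φ p.1 p.2) (1, 0) (fun p => V p.1 p.2) :=
    isVelocityDir_of_isVelocity hS hΦ fun z hz => by
      have := (hVW z.1 hz.1 z.2 hz.2).1.comp_add
      simpa using this
  have dW : IsVelocityDir S (fun p : ℝ × ℝ => Φ p.1 p.2) (0, 1) (fun p => W p.1 p.2) :=
    isVelocityDir_of_isVelocity hS hΦ fun z hz => by
      have := (hVW z.1 hz.1 z.2 hz.2).2.comp_add
      simpa using this
  have sV := IsVelocityDir.smooth hS hΦ dV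
  have sW := IsVelocityDir.smooth hS hΦ dW
  have gε : ContDiffOn ℝ ∞ (fun ε : ℝ => (t, ε)) (Ioo (-δ) δ) := (contDiff_const.prodMk contDiff_id).contDiffOn
  have mε : MapsTo (fun ε : ℝ => (t, ε)) (Ioo (-δ) δ) S := fun ε hε => ⟨ht, hε⟩
  have gs : ContDiffOn ℝ ∞ (fun s : ℝ => (s, (0 : ℝ))) J := (contDiff_id.prodMk contDiff_const).contDiffOn
  have ms : MapsTo (fun s : ℝ => (s, (0 : ℝ))) J S := fun s hs => ⟨hs, h0I⟩
  have Φε : SmoothFamDiffeo (Ioo (-δ) δ) (Φ t) := hΦ.comp gε mε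
  have Aε : SmoothFamForm (Ioo (-δ) δ) (A t) := hA.comp gε mε
  have Vε : SmoothFamVF (Ioo (-δ) δ) (V t) := sV.comp gε mε
  have As : SmoothFamForm J (fun s => A s 0) := hA.comp gs ms
  have Ws : SmoothFamVF J (fun s => W s 0) := sW.comp gs ms
  have hwV : V t 0 = w := (hVW t ht 0 h0I).1.unique (hw.congr (by
    filter_upwards [hJ.mem_nhds ht] with s hs
    exact (h00 s hs).1))
  have hαS : dtForm (fun s => A s 0) t = dtForm α t := funext fun x => by
    refine Filter.EventuallyEq.deriv_eq ?_
    filter_upwards [hJ.mem_nhds ht] with s hs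
    rw [(h00 s hs).2]
  -- the derivatives of the three terms
  have hξ : SmoothCurve (Ioo (-δ) δ) (fun ε => proj μ β₀ (Φ t ε) (A t ε)) := smoothCurve_proj hμ h0 hβ hd isOpen_Ioo Φε Aε
  have hm : (proj μ β₀ (φ t) (α t)).Mem := by have := hξ.mem h0I; rwa [hφ0, hα0] at this
  have hpos : ∀ x, 0 < (proj μ β₀ (φ t) (α t)).ρ x := hor t ht
  have hsm := smooth_hamGrad g hμ he hm hpos
  have hH := hasVarDeriv_hamBar g hμ h0 he hpos δ _ hδ hξ (by rw [hφ0, hα0])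
  rw [dualPair_proj_deriv hμ h0 hβ hd isOpen_Ioo Φε h0I (hVW t ht 0 h0I).2 hsm, hφ0] at hH
  have hP := hasDerivAt_pair hμ isOpen_Ioo Aε Vε h0I
  have hQ := hasDerivAt_pair hμ hJ As Ws ht
  refine ⟨_, _, hP.sub hH, hQ, ?_⟩
  -- the bracket
  have hbr : dtVF (V t) 0 - dtVF (fun s => W s 0) t = VectorField.mlieBracket (𝓡 (k + 2)) w (W t 0) := funext fun x => by
    have h1 := velocity_bracket hS hΦ dV dW hz x
    have f1 := ((SmoothFamVF.contDiffAt_param hS sV hz x).differentiableAt (by simp))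
    have f2 := ((SmoothFamVF.contDiffAt_param hS sW hz x).differentiableAt (by simp))
    rw [fderiv_prod_snd_one f1, fderiv_prod_fst_one f2] at h1
    rw [← hwV]
    exact h1
  have sVt : SmoothVF (dtVF (V t) 0) := (SmoothFamVF.deriv isOpen_Ioo Vε).at h0I
  have sWt : SmoothVF (dtVF (fun s => W s 0) t) := (SmoothFamVF.deriv hJ Ws).at ht
  have sα : SmoothForm (α t) := hm.1
  have sW0 : SmoothVF (W t 0) := Ws.at ht
  have sw : SmoothVF w := hwV ▸ Vε.at h0I
  have sv := smooth_velocity g hm hpos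
  have sA' : SmoothForm (dtForm (A t) 0) := (SmoothFamForm.deriv isOpen_Ioo Aε).at h0I
  have sα' : SmoothForm (dtForm α t) := hαS ▸ (SmoothFamForm.deriv hJ As).at ht
  have e1 : pair μ (α t) (dtVF (V t) 0) - pair μ (α t) (dtVF (fun s => W s 0) t) = -pair μ (lieDensity μ w (α t)) (W t 0) := by
    rw [← pair_sub_right hμ sα sVt sWt, hbr, pair_bracket hμ h0 sα sw sW0]
  have hF := smooth_hamForce g hμ h0 he hm hpos
  rw [pair_sub_right hμ sA' sw sv, pair_add_left hμ (sα'.add (smooth_lieDensity hμ h0 sα sw)) hF sW0,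
    pair_add_left hμ sα' (smooth_lieDensity hμ h0 sα sw) sW0, hwV, hαS, hα0]
  have e2 : pair μ ((fun x => rhoOf μ (φ t) x • dFun (hamGrad g μ e (proj μ β₀ (φ t) (α t))).θ x) +
      iota (vecF μ (extd (hamGrad g μ e (proj μ β₀ (φ t) (α t))).P)) (pushforward (φ t) β₀)) (W t 0) =
      pair μ (hamForce g μ e (proj μ β₀ (φ t) (α t))) (W t 0) := rfl
  rw [e2]
  change _ + _ - (_ + pair μ (dtForm (A t) 0) (velocity g (proj μ β₀ (φ t) (α t)))) - _ = _
  linarith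

/-- The Hamilton equation for the momentum: `α̇ + 𝓛_v α + (δH/δφ) ∘ φ⁻¹ = 0`. -/
theorem isHamiltonianCurve_iff (g : Metric (k + 2) M) (hμ : SmoothForm μ) (h0 : ∀ x, μ x ≠ 0) (hβ : SmoothForm β₀)
    (hd : extd β₀ = 0) {e : ℝ → ℝ} (he : ContDiffOn ℝ ∞ e (Ioi 0)) {J : Set ℝ} (hJ : IsOpen J)
    {φ : ℝ → Diffeo (k + 2) M} {α : ℝ → Form (k + 2) M 1} (hφ : SmoothFamDiffeo J φ) (hα : SmoothFamForm J α)
    (hor : ∀ t ∈ J, OrientationPreserving μ (φ t)) :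
    IsHamiltonianCurve μ (ham g μ e β₀) J φ α ↔ ∀ t ∈ J, IsVelocity φ t (velocity g (proj μ β₀ (φ t) (α t))) ∧
      dtForm α t + lieDensity μ (velocity g (proj μ β₀ (φ t) (α t))) (α t) + hamForce g μ e (proj μ β₀ (φ t) (α t)) = 0 := by
  have hξ := smoothCurve_proj hμ h0 hβ hd hJ hφ hα
  constructor
  · intro h t ht
    obtain ⟨w, hw⟩ := exists_velocity hJ hφ ht
    have hm := hξ.mem ht
    have hpos : ∀ x, 0 < (proj μ β₀ (φ t) (α t)).ρ x := hor t ht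
    have sw : SmoothVF w := IsVelocity.smooth hJ hφ ht hw
    -- variations of the momentum alone
    have hwv : w = velocity g (proj μ β₀ (φ t) (α t)) := by
      refine vf_eq_of_pair g hμ h0 sw (smooth_velocity g hm hpos) fun γ hγ => ?_
      obtain ⟨Wφ, -, hWφ⟩ := exists_smooth_velocity hJ hφ
      have hfst : ContDiffOn ℝ ∞ (fun p : ℝ × ℝ => p.1) (J ×ˢ Ioo (-1 : ℝ) 1) := contDiff_fst.contDiffOn
      have hmf : MapsTo (fun p : ℝ × ℝ => p.1) (J ×ˢ Ioo (-1 : ℝ) 1) J := fun p hp => hp.1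
      have hΦ : SmoothFamDiffeo (J ×ˢ Ioo (-1 : ℝ) 1) (fun p : ℝ × ℝ => φ p.1) := hφ.comp hfst hmf
      have hA : SmoothFamForm (J ×ˢ Ioo (-1 : ℝ) 1) (fun p : ℝ × ℝ => α p.1 + fun x => p.2 • γ x) :=
        (hα.comp hfst hmf).add (SmoothFamForm.smul (hJ.prod isOpen_Ioo)
          (smoothFamFun_of_contDiff (k := k) (M := M) _ contDiff_snd) (hγ.fam _))
      have h00 : ∀ s ∈ J, φ s = φ s ∧ (α s + fun x => (0 : ℝ) • γ x) = α s := fun s _ =>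
        ⟨rfl, by simp only [zero_smul]; exact add_zero _⟩
      have hVW : ∀ s ∈ J, ∀ ε ∈ Ioo (-1 : ℝ) 1, IsVelocity (fun s => φ s) s (Wφ s) ∧
          IsVelocity (fun _ => φ s) ε (fun _ => 0) := fun s hs ε _ => ⟨hWφ s hs, isVelocity_const _ _⟩
      obtain ⟨c, hc1, hc2⟩ := h 1 (fun s _ => φ s) (fun s ε => α s + fun x => ε • γ x) (fun s _ => Wφ s)
        (fun _ _ _ => 0) one_pos hΦ hA h00 hVW t ht
      obtain ⟨c₁, c₂, k1, k2, k3⟩ := first_variation g hμ h0 hβ hd he hJ hor one_pos (Φ := fun s _ => φ s)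
        (A := fun s ε => α s + fun x => ε • γ x) (V := fun s _ => Wφ s) (W := fun _ _ _ => 0) hΦ hA h00 hVW ht hw
      rw [← hc1.unique k1, ← hc2.unique k2, sub_self, pair_zero_right, sub_zero] at k3
      have dA : dtForm (fun ε => α t + fun x => ε • γ x) 0 = γ := funext fun x => by
        have h1 := ((hasDerivAt_id (0 : ℝ)).smul_const (γ x)).const_add (α t x)
        rw [one_smul] at h1
        exact h1.deriv
      rw [dA, pair_sub_right hμ hγ sw (smooth_velocity g hm hpos)] at k3
      exact sub_eq_zero.1 k3.symm
    rw [← hwv]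
    refine ⟨hw, funext fun x₀ => ?_⟩
    have sR : SmoothForm (dtForm α t + lieDensity μ w (α t) + hamForce g μ e (proj μ β₀ (φ t) (α t))) :=
      (((SmoothFamForm.deriv hJ hα).at ht).add (smooth_lieDensity hμ h0 hm.1 sw)).add (smooth_hamForce g hμ h0 he hm hpos)
    -- variations of the diffeomorphism alone
    refine form_eq_zero_of_pair hμ h0 sR x₀ fun X hX hXs => ?_
    obtain ⟨δ, hδ, ψ, hψ, hψ0, hψX⟩ := exists_variation hX hXs
    obtain ⟨Wψ, -, hWψ⟩ := exists_smooth_velocity isOpen_Ioo hψ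
    have h0I : (0 : ℝ) ∈ Ioo (-δ) δ := ⟨by linarith, hδ⟩
    have hfst : ContDiffOn ℝ ∞ (fun p : ℝ × ℝ => p.1) (J ×ˢ Ioo (-δ) δ) := contDiff_fst.contDiffOn
    have hmf : MapsTo (fun p : ℝ × ℝ => p.1) (J ×ˢ Ioo (-δ) δ) J := fun p hp => hp.1
    have hsnd : ContDiffOn ℝ ∞ (fun p : ℝ × ℝ => p.2) (J ×ˢ Ioo (-δ) δ) := contDiff_snd.contDiffOn
    have hms : MapsTo (fun p : ℝ × ℝ => p.2) (J ×ˢ Ioo (-δ) δ) (Ioo (-δ) δ) := fun p hp => hp.2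
    have hΦ : SmoothFamDiffeo (J ×ˢ Ioo (-δ) δ) (fun p : ℝ × ℝ => (φ p.1).trans (ψ p.2)) :=
      SmoothFamDiffeo.trans (hφ.comp hfst hmf) (hψ.comp hsnd hms)
    have hA : SmoothFamForm (J ×ˢ Ioo (-δ) δ) (fun p : ℝ × ℝ => α p.1) := hα.comp hfst hmf
    have h00 : ∀ s ∈ J, (φ s).trans (ψ 0) = φ s ∧ α s = α s := fun s _ => ⟨by
      rw [hψ0]; exact Diffeomorph.ext fun x => rfl, rfl⟩
    have hVex : ∀ s ε, ∃ V : VF (k + 2) M, s ∈ J → ε ∈ Ioo (-δ) δ → IsVelocity (fun r => (φ r).trans (ψ ε)) s V := fun s ε => by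
      by_cases hs : s ∈ J
      · obtain ⟨V, hV⟩ := exists_velocity hJ (SmoothFamDiffeo.trans hφ (smoothFamDiffeo_const (ψ ε) J)) hs
        exact ⟨V, fun _ _ => hV⟩
      · exact ⟨w, fun h => absurd h hs⟩
    choose V hV using hVex
    have hVW : ∀ s ∈ J, ∀ ε ∈ Ioo (-δ) δ, IsVelocity (fun r => (φ r).trans (ψ ε)) s (V s ε) ∧
        IsVelocity (fun r => (φ s).trans (ψ r)) ε (Wψ ε) := fun s hs ε hε => ⟨hV s ε hs hε, fun y => hWψ ε hε (φ s y)⟩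
    obtain ⟨c, hc1, hc2⟩ := h δ (fun s ε => (φ s).trans (ψ ε)) (fun s _ => α s) V (fun _ ε => Wψ ε) hδ hΦ hA h00 hVW t ht
    obtain ⟨c₁, c₂, k1, k2, k3⟩ := first_variation g hμ h0 hβ hd he hJ hor hδ (Φ := fun s ε => (φ s).trans (ψ ε))
      (A := fun s _ => α s) (V := V) (W := fun _ ε => Wψ ε) hΦ hA h00 hVW ht hw
    have hX0 : Wψ 0 = X := (hWψ 0 h0I).unique hψX
    have dA : dtForm (fun _ : ℝ => α t) 0 = 0 := funext fun x => deriv_const _ _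
    have hz : ∀ Y : VF (k + 2) M, pair μ 0 Y = 0 := fun Y => integ_zero
    rw [← hc1.unique k1, ← hc2.unique k2, sub_self, dA, hz, zero_sub, hX0] at k3
    exact neg_eq_zero.1 k3.symm
  · intro h δ Φ A V W hδ hΦ hA h00 hVW t ht
    obtain ⟨hw, hE⟩ := h t ht
    obtain ⟨c₁, c₂, k1, k2, k3⟩ := first_variation g hμ h0 hβ hd he hJ hor hδ hΦ hA h00 hVW ht hw
    have hz : ∀ Y : VF (k + 2) M, pair μ 0 Y = 0 := fun Y => integ_zero
    rw [hE, hz, sub_zero, sub_self] at k3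
    have hcc : c₁ = c₂ := sub_eq_zero.1 (k3.trans (pair_zero_right _))
    exact ⟨c₂, hcc ▸ k1, k2⟩

/-- Hamilton's equations amount to `φ' = v ∘ φ` and the reduced system for `Π(φ, m)`. The continuity
and induction equations express that `μ` and `β₀` are pushed forward by `φ`. -/
theorem reduction (g : Metric (k + 2) M) (hμ : SmoothForm μ) (h0 : ∀ x, μ x ≠ 0) (hβ : SmoothForm β₀)
    (hd : extd β₀ = 0) {e : ℝ → ℝ} (he : ContDiffOn ℝ ∞ e (Ioi 0)) {J : Set ℝ} (hJ : IsOpen J)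
    {φ : ℝ → Diffeo (k + 2) M} {α : ℝ → Form (k + 2) M 1} (hφ : SmoothFamDiffeo J φ) (hα : SmoothFamForm J α)
    (hor : ∀ t ∈ J, OrientationPreserving μ (φ t)) :
    IsHamiltonianCurve μ (ham g μ e β₀) J φ α ↔
      (∀ t ∈ J, IsVelocity φ t (velocity g (proj μ β₀ (φ t) (α t)))) ∧
        SolvesReduced g μ e J (fun t => proj μ β₀ (φ t) (α t)) := by
  rw [isHamiltonianCurve_iff g hμ h0 hβ hd he hJ hφ hα hor,
    solvesReduced_iff g hμ h0 he (smoothCurve_proj hμ h0 hβ hd hJ hφ hα) hor, ← forall₂_and]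
  refine forall₂_congr fun t ht => and_congr_right fun hv => ?_
  have hL : (lpField μ (proj μ β₀ (φ t) (α t)) (hamGrad g μ e (proj μ β₀ (φ t) (α t)))).α =
      -(lieDensity μ (velocity g (proj μ β₀ (φ t) (α t))) (α t) + hamForce g μ e (proj μ β₀ (φ t) (α t))) := by
    refine congrArg Neg.neg ?_
    exact (add_assoc _ _ _).trans (congrArg _ (add_comm _ _))
  rw [EvolvesAt, hL, add_assoc]
  have d2 : dtFun (fun s => (proj μ β₀ (φ s) (α s)).ρ) t =
      (lpField μ (proj μ β₀ (φ t) (α t)) (hamGrad g μ e (proj μ β₀ (φ t) (α t)))).ρ :=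
    funext fun x => (hasDerivAt_rhoOf hμ h0 hJ hφ ht hv x).deriv
  have d3 : dtForm (fun s => (proj μ β₀ (φ s) (α s)).β) t =
      (lpField μ (proj μ β₀ (φ t) (α t)) (hamGrad g μ e (proj μ β₀ (φ t) (α t)))).β :=
    funext fun x => (hasDerivAt_pushforward hJ hφ ht hv hβ x).deriv
  exact ⟨fun h => ⟨eq_neg_of_add_eq_zero_left h, d2, d3⟩, fun h => by
    rw [show dtForm α t = _ from h.1]; exact neg_add_cancel _⟩

end Hamilton

/-! ### Vector calculus in dimension three -/

section Orthonormal

variable {E : Type*} [NormedAddCommGroup E] [NormedSpace ℝ E] [FiniteDimensional ℝ E] {n : ℕ}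

theorem exists_orthonormal (hn : Module.finrank ℝ E = n) {G : E →L[ℝ] E →L[ℝ] ℝ} (hG : IsInner G) :
    ∃ b : Module.Basis (Fin n) ℝ E, ∀ i j, G (b i) (b j) = if i = j then 1 else 0 := by
  let B : LinearMap.BilinForm ℝ E := LinearMap.mk₂ ℝ (fun x y => G x y) (fun _ _ _ => by simp) (fun _ _ _ => by simp)
    (fun _ _ _ => by simp) (fun _ _ _ => by simp)
  obtain ⟨v, hv⟩ := LinearMap.BilinForm.exists_orthogonal_basis (B := B) ⟨fun x y => hG.symm x y⟩
  let c := v.reindex (finCongr hn)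
  have hc : ∀ i j, i ≠ j → G (c i) (c j) = 0 := fun i j hij => by
    simp only [c, Module.Basis.reindex_apply]
    exact hv fun h => hij ((finCongr hn).symm.injective h)
  have hp : ∀ i, 0 < G (c i) (c i) := fun i => hG.pos _ (c.ne_zero i)
  have hu : ∀ i, IsUnit (√(G (c i) (c i)))⁻¹ := fun i => (inv_ne_zero (Real.sqrt_pos.2 (hp i)).ne').isUnit
  refine ⟨c.isUnitSMul hu, fun i j => ?_⟩
  rw [Module.Basis.isUnitSMul_apply, Module.Basis.isUnitSMul_apply]
  simp only [map_smul, smul_apply, smul_eq_mul]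
  split_ifs with h
  · subst h
    have h1 := Real.mul_self_sqrt (hp i).le
    have h2 := (Real.sqrt_pos.2 (hp i)).ne'
    generalize √(G (c i) (c i)) = r at h1 h2
    rw [← h1]
    field_simp
  · rw [hc i j h, mul_zero, mul_zero]

theorem inner_eq_sum_repr {b : Module.Basis (Fin n) ℝ E} {G : E →L[ℝ] E →L[ℝ] ℝ}
    (hb : ∀ i j, G (b i) (b j) = if i = j then 1 else 0) (x y : E) : G x y = ∑ i, b.repr x i * b.repr y i := by
  conv_lhs => rw [← b.sum_repr x, ← b.sum_repr y]
  simp only [map_sum, map_smul, sum_apply, smul_apply, smul_eq_mul, hb]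
  simp [mul_comm]

theorem dualVec_orthonormal {b : Module.Basis (Fin n) ℝ E} {G : E →L[ℝ] E →L[ℝ] ℝ} (hG : IsInner G)
    (hb : ∀ i j, G (b i) (b j) = if i = j then 1 else 0) (i : Fin n) : dualVec b G i = b i :=
  eq_of_inner_eq hG fun w => by
    rw [inner_dualVec b hG, inner_eq_sum_repr hb, coordL_apply]
    simp [Finsupp.single_apply]

omit [FiniteDimensional ℝ E] in
/-- A 3-form is a multiple of the determinant, written out in coordinates. -/
theorem three_form_coords (b : Module.Basis (Fin 3) ℝ E) (μ : E [⋀^Fin 3]→L[ℝ] ℝ) (u v w : E) :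
    μ ![u, v, w] = μ b * (b.repr u 0 * (b.repr v 1 * b.repr w 2 - b.repr v 2 * b.repr w 1) -
      b.repr u 1 * (b.repr v 0 * b.repr w 2 - b.repr v 2 * b.repr w 0) +
      b.repr u 2 * (b.repr v 0 * b.repr w 1 - b.repr v 1 * b.repr w 0)) := by
  have h := congrArg (fun f : E [⋀^Fin 3]→ₗ[ℝ] ℝ => f ![u, v, w]) (AlternatingMap.eq_smul_basis_det b μ.toAlternatingMap)
  refine h.trans ?_
  change μ b * b.det ![u, v, w] = _
  rw [Module.Basis.det_apply, Matrix.det_fin_three]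
  simp only [Module.Basis.toMatrix_apply]
  congr 1
  simp
  ring

omit [FiniteDimensional ℝ E] in
theorem curryLeft_two_apply (μ : E [⋀^Fin 3]→L[ℝ] ℝ) (u v w : E) :
    (μ.curryLeft u : E [⋀^Fin 2]→L[ℝ] ℝ) ![v, w] = μ ![u, v, w] := by
  rw [curryLeft_apply_apply]

omit [FiniteDimensional ℝ E] in
theorem curryLeft_curryLeft_one_apply (μ : E [⋀^Fin 3]→L[ℝ] ℝ) (u v w : E) :
    ((μ.curryLeft u : E [⋀^Fin 2]→L[ℝ] ℝ).curryLeft v : E [⋀^Fin 1]→L[ℝ] ℝ) (fun _ => w) = μ ![u, v, w] := by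
  rw [curryLeft_apply_apply, ← curryLeft_two_apply]
  congr 1
  funext i; fin_cases i <;> rfl

/-- In dimension three `⋆(ι_Y μ) = Y^♭`. -/
theorem hodgeV_curryLeft (hE : Module.finrank ℝ E = 3) (b : Module.Basis (Fin 3) ℝ E) {G : E →L[ℝ] E →L[ℝ] ℝ} (hG : IsInner G)
    {μ : E [⋀^Fin 3]→L[ℝ] ℝ} (hμ : ∀ e : Fin 3 → E, (μ e) ^ 2 = (Matrix.of fun i j => G (e i) (e j)).det) (Y w : E) :
    hodgeV (k := 1) b G μ (μ.curryLeft Y) (fun _ => w) = G Y w := by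
  obtain ⟨c, hc⟩ := exists_orthonormal hE hG
  -- On an orthonormal basis the volume form takes the value `1` or `-1`; its sign cancels below.
  have hm : μ c ^ 2 = 1 := by
    rw [hμ c, Matrix.det_fin_three]
    simp [hc]
  rw [hodgeV_basis (k := 1) b c hG]
  simp only [hodgeV, dualVec_orthonormal (n := 1 + 2) hG hc, ContinuousAlternatingMap.smul_apply, ContinuousAlternatingMap.sum_apply,
    smul_eq_mul]
  rw [inner_eq_sum_repr hc]
  have e : ∀ i j : Fin 3, (μ.curryLeft Y : E [⋀^Fin 2]→L[ℝ] ℝ) ![c i, c j] *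
      ((μ.curryLeft (c i) : E [⋀^Fin 2]→L[ℝ] ℝ).curryLeft (c j) : E [⋀^Fin 1]→L[ℝ] ℝ) (fun _ => w) =
      μ ![Y, c i, c j] * μ ![c i, c j, w] := fun i j => by
    rw [curryLeft_two_apply, curryLeft_curryLeft_one_apply]
  refine (congrArg (fun r : ℝ => 1 / 2 * r) (Finset.sum_congr rfl fun i _ => Finset.sum_congr rfl fun j _ => e i j)).trans ?_
  change 1 / 2 * ∑ i : Fin 3, ∑ j : Fin 3, μ ![Y, c i, c j] * μ ![c i, c j, w] = _
  simp only [three_form_coords c μ, Fin.sum_univ_three, Module.Basis.repr_self, Finsupp.single_apply]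
  simp
  linear_combination (c.repr Y 0 * c.repr w 0 + c.repr Y 1 * c.repr w 1 + c.repr Y 2 * c.repr w 2) * hm

end Orthonormal

section ChartCalculus

variable {k : ℕ} {M : Type u} [TopologicalSpace M] [ChartedSpace (Model (k + 2)) M] [IsManifold (𝓡 (k + 2)) ∞ M]

theorem sharpAt_eq (g : Metric (k + 2) M) (x : M) (a : Model (k + 2) → ℝ) :
    sharpAt g x a = sharpV (stdB (k + 2)) (gAt g x) a := by
  change ∑ i, ∑ j, (invGram g x i j * _) • (stdBasis x i : Model (k + 2)) = _
  simp only [sharpV]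
  rw [stdBasis_eq]
  have h : invGram g x = (gram (stdB (k + 2)) (gAt g x))⁻¹ := by
    rw [gram, invGram, stdBasis_eq]; rfl
  rw [h]
  rfl

omit [IsManifold (𝓡 (k + 2)) ∞ M] in
theorem lieBracket_const_right (V : Model (k + 2) → Model (k + 2)) (w p : Model (k + 2)) :
    VectorField.lieBracket ℝ V (fun _ => w) p = -fderiv ℝ V p w := by
  rw [VectorField.lieBracket_eq]
  simp

/-- The Lie derivative of a 1-form in the preferred chart. -/
theorem lieD_one_chart {α : Form (k + 2) M 1} {X : VF (k + 2) M} (hα : SmoothForm α) (hX : SmoothVF X) (x : M) (w : Model (k + 2)) :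
    lieD X α x (fun _ => w) =
      fderiv ℝ (fun y => lin1 (chartForm x α y) w) (extChartAt (𝓡 (k + 2)) x x) (X x) +
        lin1 (α x) (fderiv ℝ (chartVF x X) (extChartAt (𝓡 (k + 2)) x x) w) := by
  have hx := mem_extChartAt_target (I := 𝓡 (k + 2)) x
  have h := lieDerivative_one_apply (W := fun _ => w) ((contDiffAt_chartForm hα hx).differentiableAt (by simp))
    ((hX.contDiffAt_chart hx).differentiableAt (by simp)) (differentiableAt_const w)
  rw [← extd_iota_chart, ← extd_apply, chartForm_self, chartVF_self, lieBracket_const_right] at h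
  refine h.trans ?_
  rw [map_neg, sub_neg_eq_add]

/-- `𝓛_X (f α) = (X f) α + f 𝓛_X α`. -/
theorem lieD_smul {f : M → ℝ} {α : Form (k + 2) M 1} {X : VF (k + 2) M} (hf : SmoothFun (n := k + 2) f) (hα : SmoothForm α)
    (hX : SmoothVF X) (x : M) (w : Model (k + 2)) :
    lieD X (fun x => f x • α x) x (fun _ => w) = lieFun X f x * α x (fun _ => w) + f x * lieD X α x (fun _ => w) := by
  have hx := mem_extChartAt_target (I := 𝓡 (k + 2)) x
  rw [lieD_one_chart (SmoothForm.smul hf hα) hX, lieD_one_chart hα hX, lieFun_chart hf]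
  have h1 := ((fun_chart_differentiableAt hf hx).differentiableAt (by simp)).hasFDerivAt
  have h2 : DifferentiableAt ℝ (fun y => lin1 (chartForm x α y) w) (extChartAt (𝓡 (k + 2)) x x) :=
    (((lin1 (E := Model (k + 2))).differentiableAt.comp _ ((contDiffAt_chartForm hα hx).differentiableAt (by simp))).clm_apply
      (differentiableAt_const w))
  have h3 : (fun y => lin1 (chartForm x (fun x => f x • α x) y) w) =
      fun y => f ((extChartAt (𝓡 (k + 2)) x).symm y) * lin1 (chartForm x α y) w := funext fun y => by
    rw [chartForm_smul, map_smul]; rfl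
  have h4 : HasFDerivAt (fun y => f ((extChartAt (𝓡 (k + 2)) x).symm y) * lin1 (chartForm x α y) w) _
    (extChartAt (𝓡 (k + 2)) x x) := h1.mul h2.hasFDerivAt
  rw [h3, h4.fderiv]
  simp only [smul_apply, smul_eq_mul, map_smul, chartForm_self, extChartAt_to_inv]
  rw [lin1_apply (α x) w]
  change (f x * fderiv ℝ (fun y => lin1 (chartForm x α y) w) (extChartAt (𝓡 (k + 2)) x x) (X x) +
    α x (fun _ => w) * fderiv ℝ (fun y => f ((extChartAt (𝓡 (k + 2)) x).symm y)) (extChartAt (𝓡 (k + 2)) x x) (X x)) + _ = _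
  ring

end ChartCalculus

section MetricDerivative

variable {E : Type*} [NormedAddCommGroup E] [NormedSpace ℝ E] {G : E → E →L[ℝ] E →L[ℝ] ℝ} {V : E → E} {p : E}

theorem fderiv_bilin_const (hG : DifferentiableAt ℝ G p) (a b c : E) :
    fderiv ℝ (fun y => G y a b) p c = fderiv ℝ G p c a b := by
  rw [((hG.hasFDerivAt.clm_apply (hasFDerivAt_const a p)).clm_apply (hasFDerivAt_const b p)).fderiv]
  simp

theorem fderiv_bilin_left (hG : DifferentiableAt ℝ G p) (hV : DifferentiableAt ℝ V p) (b c : E) :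
    fderiv ℝ (fun y => G y (V y) b) p c = fderiv ℝ G p c (V p) b + G p (fderiv ℝ V p c) b := by
  rw [((hG.hasFDerivAt.clm_apply hV.hasFDerivAt).clm_apply (hasFDerivAt_const b p)).fderiv]
  simp [add_comm]

theorem fderiv_bilin_self (hG : DifferentiableAt ℝ G p) (hV : DifferentiableAt ℝ V p) (c : E) :
    fderiv ℝ (fun y => G y (V y) (V y)) p c =
      fderiv ℝ G p c (V p) (V p) + G p (fderiv ℝ V p c) (V p) + G p (V p) (fderiv ℝ V p c) := by
  rw [((hG.hasFDerivAt.clm_apply hV.hasFDerivAt).clm_apply hV.hasFDerivAt).fderiv]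
  simp
  ring

end MetricDerivative

section ChartCalculus

variable {k : ℕ} {M : Type u} [TopologicalSpace M] [ChartedSpace (Model (k + 2)) M] [IsManifold (𝓡 (k + 2)) ∞ M]

/-- The covariant derivative `∇_v v` paired with `w`, in the chart at `x`. -/
theorem inner_covDeriv_self (g : Metric (k + 2) M) (v : VF (k + 2) M) (x : M) (w : Model (k + 2)) :
    gAt g x (covDeriv g v v x) w =
      gAt g x (fderiv ℝ (chartVF x v) (extChartAt (𝓡 (k + 2)) x x) (v x)) w +
        (fderiv ℝ (chartG g x) (extChartAt (𝓡 (k + 2)) x x) (v x) (v x) w -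
          1 / 2 * fderiv ℝ (chartG g x) (extChartAt (𝓡 (k + 2)) x x) w (v x) (v x)) := by
  have hx := mem_extChartAt_target (I := 𝓡 (k + 2)) x
  set p : Model (k + 2) := extChartAt (𝓡 (k + 2)) x x with hp
  have hG : DifferentiableAt ℝ (chartG g x) p := (contDiffAt_chartG g hx).differentiableAt (by simp)
  have hVp : chartVF x v p = (v x : Model (k + 2)) := chartVF_self v x
  let DG := fderiv ℝ (chartG g x) p
  -- The Christoffel symbols of the first kind, contracted twice with `v`.
  let ℓ : Model (k + 2) →L[ℝ] ℝ := DG (v x) (v x) - (1 / 2 : ℝ) • ((DG.flip (v x)).flip (v x))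
  have hGab : ∀ a b c : Model (k + 2), fderiv ℝ (chartMetric g x a b) p c = DG c a b := fun a b c =>
    fderiv_bilin_const hG a b c
  have e1 : ∀ a : Model (k + 2), (mfderiv 𝓘(ℝ, Model (k + 2)) (𝓡 (k + 2)) (extChartAt (𝓡 (k + 2)) x).symm p a : Model (k + 2)) = a :=
    fun a => congrArg (fun L : Model (k + 2) →L[ℝ] Model (k + 2) => L a) (dsymm_self x)
  have e2 : ∀ a : Model (k + 2), (mfderiv (𝓡 (k + 2)) 𝓘(ℝ, Model (k + 2)) (extChartAt (𝓡 (k + 2)) x) x a : Model (k + 2)) = a :=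
    fun a => congrArg (fun L : Model (k + 2) →L[ℝ] Model (k + 2) => L a) (dchart_self x)
  have key : ∀ V : Model (k + 2), V = (v x : Model (k + 2)) → ∀ b : Model (k + 2),
      (fderiv ℝ (chartMetric g x V b) p V + fderiv ℝ (chartMetric g x V b) p V - fderiv ℝ (chartMetric g x V V) p b) / 2 = ℓ b := by
    intro V hV b
    have hb : DG V V b - 1 / 2 * DG b V V = ℓ b := by subst hV; rfl
    rw [hGab, hGab, ← hb]
    ring
  have hs := inner_sharpV (stdB (k + 2)) (isInner_gAt g x) ℓ w
  have hc : covDeriv g v v x =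
      ((fderiv ℝ (chartVF x v) p (v x) : Model (k + 2)) + sharpV (stdB (k + 2)) (gAt g x) ℓ : Model (k + 2)) := by
    rw [← sharpAt_eq]
    refine congrArg₂ (fun r s : Model (k + 2) => r + s) ((e1 (fderiv ℝ (chartVF x v) p (chartVF x v p))).trans (congrArg _ hVp)) ?_
    refine congrArg (fun a : Model (k + 2) → ℝ => (sharpAt g x a : Model (k + 2))) (funext fun a => ?_)
    exact (key _ hVp _).trans (congrArg ℓ (e2 a))
  refine (congrArg (fun r : Model (k + 2) => gAt g x r w) hc).trans ?_
  rw [map_add, add_apply, hs]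
  rfl

/-- `𝓛_v v^♭ = (∇_v v)^♭ + ½ d|v|²`. -/
theorem lieD_flat (g : Metric (k + 2) M) {v : VF (k + 2) M} (hv : SmoothVF v) (x : M) (w : Model (k + 2)) :
    lieD v (flat g v) x (fun _ => w) =
      gAt g x (covDeriv g v v x) w + 1 / 2 * dFun (fun x => gAt g x (v x) (v x)) x (fun _ => w) := by
  have hx := mem_extChartAt_target (I := 𝓡 (k + 2)) x
  have hG : DifferentiableAt ℝ (chartG g x) (extChartAt (𝓡 (k + 2)) x x) := (contDiffAt_chartG g hx).differentiableAt (by simp)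
  have hV : DifferentiableAt ℝ (chartVF x v) (extChartAt (𝓡 (k + 2)) x x) := (hv.contDiffAt_chart hx).differentiableAt (by simp)
  have hsq : SmoothFun (n := k + 2) (fun x => gAt g x (v x) (v x)) :=
    (SmoothFamVF.inner isOpen_univ g (SmoothVF.fam hv (univ : Set ℝ)) (SmoothVF.fam hv univ)).at (mem_univ 0)
  have h2 : (fun y => gAt g ((extChartAt (𝓡 (k + 2)) x).symm y) (v ((extChartAt (𝓡 (k + 2)) x).symm y))
      (v ((extChartAt (𝓡 (k + 2)) x).symm y))) =ᶠ[𝓝 (extChartAt (𝓡 (k + 2)) x x)] fun y => chartG g x y (chartVF x v y) (chartVF x v y) := by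
    filter_upwards [eventually_tgt x] with y hy
    rw [chartG_apply]
    have := dsymm_chartVF v hy
    exact (congrArg (fun r : Model (k + 2) => gAt g ((extChartAt (𝓡 (k + 2)) x).symm y) r r) this).symm
  have hlen : dFun (fun x => gAt g x (v x) (v x)) x (fun _ => w) =
      fderiv ℝ (chartG g x) (extChartAt (𝓡 (k + 2)) x x) w (v x) (v x) +
        2 * gAt g x (v x) (fderiv ℝ (chartVF x v) (extChartAt (𝓡 (k + 2)) x x) w) := by
    rw [dFun_apply' hsq, h2.fderiv_eq, fderiv_bilin_self hG hV, chartG_self, (isInner_gAt g x).symm (fderiv ℝ _ _ _) _]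
    have := chartVF_self v x
    refine (congrArg (fun r : Model (k + 2) => fderiv ℝ (chartG g x) (extChartAt (𝓡 (k + 2)) x x) w r r +
      gAt g x r (fderiv ℝ (chartVF x v) (extChartAt (𝓡 (k + 2)) x x) w) +
      gAt g x r (fderiv ℝ (chartVF x v) (extChartAt (𝓡 (k + 2)) x x) w)) this).trans ?_
    ring
  have hfl : (fun y => lin1 (chartForm x (flat g v) y) w) =ᶠ[𝓝 (extChartAt (𝓡 (k + 2)) x x)] fun y => chartG g x y (chartVF x v y) w := by
    filter_upwards [eventually_tgt x] with y hy
    exact chartForm_flat_apply g v hy (fun _ => w)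
  rw [lieD_one_chart (SmoothVF.flat g hv) hv, inner_covDeriv_self, hlen, hfl.fderiv_eq]
  have e5 : lin1 (flat g v x) (fderiv ℝ (chartVF x v) (extChartAt (𝓡 (k + 2)) x x) w) =
    gAt g x (v x) (fderiv ℝ (chartVF x v) (extChartAt (𝓡 (k + 2)) x x) w) := rfl
  have := chartVF_self v x
  have e6 := fderiv_bilin_left hG hV w (v x : Model (k + 2))
  rw [chartG_self] at e6
  refine (congrArg₂ (fun r s : ℝ => r + s) e6 e5).trans ?_
  refine (congrArg (fun r : Model (k + 2) => fderiv ℝ (chartG g x) (extChartAt (𝓡 (k + 2)) x x) (v x) r w +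
    gAt g x (fderiv ℝ (chartVF x v) (extChartAt (𝓡 (k + 2)) x x) (v x)) w +
      gAt g x (v x) (fderiv ℝ (chartVF x v) (extChartAt (𝓡 (k + 2)) x x) w)) this).trans ?_
  ring

end ChartCalculus

/-! ### Compressible magnetohydrodynamics -/

section Momentum

variable {k : ℕ} {M : Type u} [TopologicalSpace M] [ChartedSpace (Model (k + 2)) M] [IsManifold (𝓡 (k + 2)) ∞ M]
  {μ : Form (k + 2) M (k + 2)}

/-- The chain rule `d(h ∘ ρ) = (h' ∘ ρ) dρ`. -/
theorem dFun_comp {ρ : M → ℝ} {h : ℝ → ℝ} (hρ : SmoothFun (n := k + 2) ρ) (hpos : ∀ x, 0 < ρ x) (hh : ContDiffOn ℝ ∞ h (Ioi 0))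
    (x : M) (w : Model (k + 2)) :
    dFun (fun x => h (ρ x)) x (fun _ => w) = deriv h (ρ x) * dFun ρ x (fun _ => w) := by
  have hx := mem_extChartAt_target (I := 𝓡 (k + 2)) x
  have hs : SmoothFun (n := k + 2) (fun x => h (ρ x)) :=
    ((hρ.fam (univ : Set ℝ)).compReal hh fun _ _ x => hpos x).at (mem_univ (0 : ℝ))
  rw [dFun_apply' hs, dFun_apply' hρ]
  have h1 := ((fun_chart_differentiableAt hρ hx).differentiableAt (by simp)).hasFDerivAt
  have h2 : HasDerivAt h (deriv h (ρ x)) (ρ ((extChartAt (𝓡 (k + 2)) x).symm (extChartAt (𝓡 (k + 2)) x x))) := by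
    rw [extChartAt_to_inv]
    exact ((hh.contDiffAt (isOpen_Ioi.mem_nhds (hpos x))).differentiableAt (by simp)).hasDerivAt
  have h3 : HasFDerivAt (fun y => h (ρ ((extChartAt (𝓡 (k + 2)) x).symm y))) _ (extChartAt (𝓡 (k + 2)) x x) :=
    h2.comp_hasFDerivAt (f := fun y => ρ ((extChartAt (𝓡 (k + 2)) x).symm y)) _ h1
  rw [h3.fderiv]
  rfl

theorem dFun_mul_add {f h : M → ℝ} (hf : SmoothFun (n := k + 2) f) (hh : SmoothFun (n := k + 2) h) (c : ℝ)
    (x : M) (w : Model (k + 2)) :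
    dFun (fun x => c * f x + h x) x (fun _ => w) = c * dFun f x (fun _ => w) + dFun h x (fun _ => w) := by
  have hx := mem_extChartAt_target (I := 𝓡 (k + 2)) x
  have hs : SmoothFun (n := k + 2) (fun x => c * f x + h x) :=
    (((smoothFamFun_const c).mul (hf.fam (univ : Set ℝ))).add (hh.fam univ)).at (mem_univ (0 : ℝ))
  rw [dFun_apply' hs, dFun_apply' hf, dFun_apply' hh]
  have h1 := ((fun_chart_differentiableAt hf hx).differentiableAt (by simp)).hasFDerivAt
  have h2 := ((fun_chart_differentiableAt hh hx).differentiableAt (by simp)).hasFDerivAt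
  have h3 : HasFDerivAt (fun y => c * f ((extChartAt (𝓡 (k + 2)) x).symm y) + h ((extChartAt (𝓡 (k + 2)) x).symm y)) _
    (extChartAt (𝓡 (k + 2)) x x) := (h1.const_mul c).add h2
  rw [h3.fderiv]
  rfl

/-- The specific enthalpy `e + ρ e'` and the pressure `ρ² e'` are related by `ρ d(e + ρ e') = d(ρ² e')`. -/
theorem enthalpy_pressure {ρ : M → ℝ} {e : ℝ → ℝ} (hρ : SmoothFun (n := k + 2) ρ) (hpos : ∀ x, 0 < ρ x)
    (he : ContDiffOn ℝ ∞ e (Ioi 0)) (x : M) (w : Model (k + 2)) :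
    ρ x * dFun (fun x => e (ρ x) + ρ x * deriv e (ρ x)) x (fun _ => w) =
      dFun (fun x => ρ x ^ 2 * deriv e (ρ x)) x (fun _ => w) := by
  have hd := contDiffOn_deriv_Ioi he
  have h1 := dFun_comp (h := fun r => e r + r * deriv e r) hρ hpos (he.add (contDiffOn_id.mul hd)) x w
  have h2 := dFun_comp (h := fun r => r ^ 2 * deriv e r) hρ hpos ((contDiffOn_id.pow 2).mul hd) x w
  refine (congrArg (fun r : ℝ => ρ x * r) h1).trans (Eq.trans ?_ h2.symm)
  have a1 := ((he.contDiffAt (isOpen_Ioi.mem_nhds (hpos x))).differentiableAt (by simp)).hasDerivAt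
  have a2 := ((hd.contDiffAt (isOpen_Ioi.mem_nhds (hpos x))).differentiableAt (by simp)).hasDerivAt
  have b1 : HasDerivAt (fun r => e r + r * deriv e r) _ (ρ x) := a1.add ((hasDerivAt_id (ρ x)).mul a2)
  have b2 : HasDerivAt (fun r => r ^ 2 * deriv e r) _ (ρ x) := (hasDerivAt_pow 2 (ρ x)).mul a2
  rw [b1.deriv, b2.deriv]
  simp only [id]
  push_cast
  ring

/-- The momentum balance of a compressible fluid: for `m = ρ v^♭ ⊗ μ` the residual of the momentum
equation is the residual of the continuity equation times `v^♭` plus `ρ` times the Euler residual. -/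
theorem momentum_residual (g : Metric (k + 2) M) (hμ : SmoothForm μ) (h0 : ∀ x, μ x ≠ 0) {e : ℝ → ℝ}
    (he : ContDiffOn ℝ ∞ e (Ioi 0)) {J : Set ℝ} (hJ : IsOpen J) {v : ℝ → VF (k + 2) M} {ρ : ℝ → M → ℝ}
    (hv : SmoothFamVF J v) (hρ : SmoothFamFun (k + 2) J ρ) (hpos : ∀ t ∈ J, ∀ x, 0 < ρ t x) {t : ℝ} (ht : t ∈ J)
    (x : M) (w : Model (k + 2)) :
    dtForm (fun s x => ρ s x • flat g (v s) x) t x (fun _ => w) +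
        lieDensity μ (v t) (fun x => ρ t x • flat g (v t) x) x (fun _ => w) +
        ρ t x * dFun (fun x => -(1 / 2) * gAt g x (v t x) (v t x) + (e (ρ t x) + ρ t x * deriv e (ρ t x))) x (fun _ => w) =
      (dtFun ρ t x + divergence μ (fun y => ρ t y • v t y) x) * gAt g x (v t x) w +
        (ρ t x * gAt g x (dtVF v t x) w + ρ t x * gAt g x (covDeriv g (v t) (v t) x) w +
          dFun (fun y => ρ t y ^ 2 * deriv e (ρ t y)) x (fun _ => w)) := by
  have hvt := hv.at ht
  have hρt := hρ.at ht
  -- the time derivative of the momentum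
  have e1 : dtForm (fun s x => ρ s x • flat g (v s) x) t x (fun _ => w) =
      dtFun ρ t x * gAt g x (v t x) w + ρ t x * gAt g x (dtVF v t x) w := by
    have hα := SmoothFamForm.smul hJ hρ (hv.flat hJ g)
    have h1 := hasDerivAt_form_apply ((hα.contDiffAt_param hJ ht x).differentiableAt (by simp)).hasDerivAt (fun _ => w)
    have h2 : HasDerivAt (fun s => ρ s x) (dtFun ρ t x) t :=
      ((hρ.contDiffAt_param hJ ht x).differentiableAt (by simp)).hasDerivAt
    have h3 : HasDerivAt (F := Model (k + 2)) (fun s => v s x) (dtVF v t x) t :=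
      ((hv.contDiffAt_param hJ ht x).differentiableAt (by simp)).hasDerivAt
    have h4 : HasDerivAt (fun s => gAt g x (v s x) w) (gAt g x (dtVF v t x) w) t :=
      ((gAt g x).flip w).hasFDerivAt.comp_hasDerivAt t h3
    exact h1.unique (h2.mul h4)
  -- the Lie derivative of the momentum
  have e2 : lieDensity μ (v t) (fun x => ρ t x • flat g (v t) x) x (fun _ => w) =
      lieFun (v t) (ρ t) x * gAt g x (v t x) w +
        ρ t x * (gAt g x (covDeriv g (v t) (v t) x) w + 1 / 2 * dFun (fun x => gAt g x (v t x) (v t x)) x (fun _ => w)) +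
        divergence μ (v t) x * (ρ t x * gAt g x (v t x) w) := by
    have h1 := lieD_smul hρt (SmoothVF.flat g hvt) hvt x w
    rw [lieD_flat g hvt] at h1
    exact congrArg (fun r : ℝ => r + divergence μ (v t) x * (ρ t x * gAt g x (v t x) w)) h1
  have hsq : SmoothFun (n := k + 2) (fun x => gAt g x (v t x) (v t x)) :=
    (SmoothFamVF.inner isOpen_univ g (hvt.fam (univ : Set ℝ)) (hvt.fam univ)).at (mem_univ 0)
  have hd := contDiffOn_deriv_Ioi he
  have hent : SmoothFun (n := k + 2) (fun x => e (ρ t x) + ρ t x * deriv e (ρ t x)) :=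
    ((hρt.fam (univ : Set ℝ)).compReal (he.add (contDiffOn_id.mul hd)) fun _ _ x => hpos t ht x).at (mem_univ (0 : ℝ))
  have e3 := dFun_mul_add hsq hent (-(1 / 2)) x w
  have e4 := enthalpy_pressure hρt (hpos t ht) he x w
  have e5 := divergence_smul hμ h0 hρt hvt x
  rw [e1, e2, e3, ← e4, e5]
  ring

end Momentum

section Three

variable {M : Type u} [TopologicalSpace M] [ChartedSpace (Model 3) M] [IsManifold (𝓡 3) ∞ M]
  {g : Metric 3 M} {μ : Form 3 M 3}

/-- `⋆ ι_Y μ = Y^♭`. -/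
theorem hodge_iota (hμ : IsRiemannianVolume g μ) (Y : VF 3 M) : hodge (k := 1) g μ (iota Y μ) = flat g Y := by
  funext x
  refine ContinuousAlternatingMap.ext fun w => ?_
  obtain ⟨a, rfl⟩ : ∃ a : Model 3, w = fun _ => a := ⟨w 0, funext fun i => by rw [Subsingleton.elim i 0]⟩
  refine (congrArg (fun f : Model 3 [⋀^Fin 1]→L[ℝ] ℝ => f fun _ => a) (hodge_apply (k := 1) g μ (iota Y μ) x)).trans ?_
  exact hodgeV_curryLeft (finrank_model 3) (stdB 3) (isInner_gAt g x) (hμ.2 x) (Y x) a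

/-- `ι_{(⋆σ)^♯} μ = σ`. -/
theorem iota_sharp_hodge (hμ : IsRiemannianVolume g μ) (σ : Form 3 M 2) :
    iota (sharp g (hodge (k := 1) g μ σ)) μ = σ := by
  have h : iota (vecF (k := 1) μ σ : VF 3 M) μ = σ := iota_vecF (k := 1) hμ.ne_zero σ
  conv_lhs => rw [← h]
  rw [hodge_iota hμ, sharp_flat, h]

theorem iota_curl (hμ : IsRiemannianVolume g μ) (X : VF 3 M) : iota (curl g μ X) μ = extd (flat g X) :=
  iota_sharp_hodge hμ _

theorem flat_cross (X Y : VF 3 M) : flat g (cross g μ X Y) = iota Y (iota X μ) := flat_sharp g _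

theorem vf_eq_of_iota_three (hμ : IsRiemannianVolume g μ) {X Y : VF 3 M} (h : iota X μ = iota Y μ) : X = Y :=
  funext fun x => vf_eq_of_iota (k := 1) hμ.ne_zero (congrFun h x)

theorem vecF_extd_flat (hμ : IsRiemannianVolume g μ) (B : VF 3 M) : vecF (k := 1) μ (extd (flat g B)) = curl g μ B :=
  vf_eq_of_iota_three hμ ((iota_vecF (k := 1) hμ.ne_zero _).trans (iota_curl hμ B).symm)

theorem velocity_ofMHD [CompactSpace M] [T2Space M] [MeasurableSpace M] {ρ : M → ℝ} (hpos : ∀ x, 0 < ρ x) (v B : VF 3 M) :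
    velocity (k := 1) g (ofMHD g μ v ρ B) = v :=
  funext fun x => eq_of_inner_eq (isInner_gAt g x) fun w =>
    mul_left_cancel₀ (hpos x).ne' (inner_velocity (k := 1) g (ξ := ofMHD g μ v ρ B) (hpos x) w)

/-- `d ι_B μ = (div B) μ`. -/
theorem closed_iff_divergence (hμ : IsRiemannianVolume g μ) (B : VF 3 M) :
    extd (iota B μ) = 0 ↔ divergence μ B = 0 := by
  rw [show divergence μ B = dens μ (extd (iota B μ)) from divergence_eq (k := 1) μ B]
  constructor <;> intro h
  · rw [h]
    exact funext fun x => zero_div _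
  · funext x
    have h1 := dens_smul_eq (σ := extd (iota B μ)) (hμ.ne_zero x)
    rw [congrFun h x] at h1
    exact h1.symm.trans (zero_smul ℝ _)

theorem smoothCurve_ofMHD (hμ : IsRiemannianVolume g μ) {J : Set ℝ} (hJ : IsOpen J) {v B : ℝ → VF 3 M} {ρ : ℝ → M → ℝ}
    (hv : SmoothFamVF J v) (hB : SmoothFamVF J B) (hρ : SmoothFamFun 3 J ρ) (hd : ∀ t ∈ J, divergence μ (B t) = 0) :
    SmoothCurve (k := 1) J (fun t => ofMHD g μ (v t) (ρ t) (B t)) :=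
  ⟨SmoothFamForm.smul hJ hρ (hv.flat hJ g), hρ, SmoothFamForm.iota hJ hB (hμ.1.fam J),
    fun t ht => (closed_iff_divergence hμ (B t)).2 (hd t ht)⟩

/-- Every curve with positive density comes from a velocity and a magnetic vector field. -/
theorem exists_ofMHD [CompactSpace M] [T2Space M] [MeasurableSpace M] (hμ : IsRiemannianVolume g μ) {J : Set ℝ} (hJ : IsOpen J)
    {ξ : ℝ → CMHDual 1 M} (hξ : SmoothCurve J ξ) (hpos : ∀ t ∈ J, ∀ x, 0 < (ξ t).ρ x) :
    ∃ v B : ℝ → VF 3 M, SmoothFamVF J v ∧ SmoothFamVF J B ∧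
      (∀ t ∈ J, ξ t = ofMHD g μ (v t) (ξ t).ρ (B t)) ∧
      ∀ v' B' : ℝ → VF 3 M, (∀ t ∈ J, ξ t = ofMHD g μ (v' t) (ξ t).ρ (B' t)) →
        ∀ t ∈ J, v' t = v t ∧ B' t = B t := by
  refine ⟨fun t => velocity (k := 1) g (ξ t), fun t => vecF (k := 1) μ (ξ t).β, smooth_fam_velocity (k := 1) hJ hξ hpos,
    SmoothFamForm.vecF (k := 1) hJ hμ.1 hμ.ne_zero hξ.2.2.1, fun t ht => ?_, fun v' B' h t ht => ⟨?_, ?_⟩⟩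
  · have hα : (ξ t).α = fun x => (ξ t).ρ x • flat g (velocity (k := 1) g (ξ t)) x := by
      funext x
      refine ContinuousAlternatingMap.ext fun w => ?_
      obtain ⟨a, rfl⟩ : ∃ a : Model 3, w = fun _ => a := ⟨w 0, funext fun i => by rw [Subsingleton.elim i 0]⟩
      exact (inner_velocity (k := 1) g (hpos t ht x) a).symm
    have hβ : (ξ t).β = iota (vecF (k := 1) μ (ξ t).β : VF 3 M) μ := (iota_vecF (k := 1) hμ.ne_zero _).symm
    calc ξ t = ⟨(ξ t).α, (ξ t).ρ, (ξ t).β⟩ := rfl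
      _ = ⟨fun x => (ξ t).ρ x • flat g (velocity (k := 1) g (ξ t)) x, (ξ t).ρ, iota (vecF (k := 1) μ (ξ t).β : VF 3 M) μ⟩ :=
        congrArg₂ (fun a b => (⟨a, (ξ t).ρ, b⟩ : CMHDual 1 M)) hα hβ
  · have h1 : velocity (k := 1) g (ξ t) = velocity (k := 1) g (ofMHD g μ (v' t) (ξ t).ρ (B' t)) :=
      congrArg (velocity (k := 1) g) (h t ht)
    exact (h1.trans (velocity_ofMHD (hpos t ht) _ _)).symm
  · refine vf_eq_of_iota_three hμ (Eq.trans ?_ (iota_vecF (k := 1) hμ.ne_zero (ξ t).β).symm)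
    exact (congrArg CMHDual.β (h t ht)).symm

theorem hamGrad_ofMHD [CompactSpace M] [T2Space M] [MeasurableSpace M] (hμ : IsRiemannianVolume g μ) (e : ℝ → ℝ) {ρ : M → ℝ}
    (hpos : ∀ x, 0 < ρ x) (v B : VF 3 M) :
    hamGrad (k := 1) g μ e (ofMHD g μ v ρ B) =
      ⟨v, fun x => -(1 / 2) * gAt g x (v x) (v x) + (e (ρ x) + ρ x * deriv e (ρ x)), flat g B⟩ := by
  have h1 := velocity_ofMHD (g := g) (μ := μ) hpos v B
  have h2 : bernoulli (k := 1) g e (ofMHD g μ v ρ B) =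
      fun x => -(1 / 2) * gAt g x (v x) (v x) + (e (ρ x) + ρ x * deriv e (ρ x)) :=
    congrArg (fun (V : VF 3 M) x => -(1 / 2) * gAt g x (V x) (V x) + (e (ρ x) + ρ x * deriv e (ρ x))) h1
  have h3 : hodge (k := 1) g μ (ofMHD g μ v ρ B).β = flat g B := hodge_iota hμ B
  rw [hamGrad, h1, h2, h3]

/-- The induction equation for `ι_B μ` in terms of `B`. -/
theorem dtForm_iota_add (hμ : IsRiemannianVolume g μ) {J : Set ℝ} (hJ : IsOpen J) {B : ℝ → VF 3 M} (hB : SmoothFamVF J B) {t : ℝ}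
    (ht : t ∈ J) (hd : divergence μ (B t) = 0) (v : VF 3 M) (x : M) :
    dtForm (k := 1) (fun s => iota (B s) μ) t x + lieD v (iota (B t) μ) x =
      iota (fun x => (dtVF (k := 1) B t x + curl g μ (cross g μ (B t) v) x : Model 3)) μ x := by
  have h1 : lieD v (iota (B t) μ) = iota (curl g μ (cross g μ (B t) v)) μ := by
    rw [iota_curl hμ, flat_cross]
    exact lieD_closed (k := 1) ((closed_iff_divergence hμ (B t)).2 hd) v
  have h2 : HasDerivAt (F := Model 3) (fun s => B s x) (dtVF (k := 1) B t x) t :=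
    ((hB.contDiffAt_param hJ ht x).differentiableAt (by simp)).hasDerivAt
  have h3 : dtForm (k := 1) (fun s => iota (B s) μ) t x = (μ x).curryLeft (dtVF (k := 1) B t x : Model 3) :=
    ((curryL (μ x)).hasFDerivAt.comp_hasDerivAt t h2).deriv
  rw [h1, h3]
  exact (map_add (curryL (μ x)) (dtVF (k := 1) B t x : Model 3) (curl g μ (cross g μ (B t) v) x : Model 3)).symm

/-- In dimension three the reduced equations are those of compressible magnetohydrodynamics. -/
theorem evolvesAt_ofMHD_iff [CompactSpace M] [T2Space M] [MeasurableSpace M] (hμ : IsRiemannianVolume g μ) {e : ℝ → ℝ}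
    (he : ContDiffOn ℝ ∞ e (Ioi 0)) {J : Set ℝ} (hJ : IsOpen J) {v B : ℝ → VF 3 M} {ρ : ℝ → M → ℝ} (hv : SmoothFamVF J v)
    (hB : SmoothFamVF J B) (hρ : SmoothFamFun 3 J ρ) (hpos : ∀ t ∈ J, ∀ x, 0 < ρ t x) (hd : ∀ t ∈ J, divergence μ (B t) = 0)
    {t : ℝ} (ht : t ∈ J) :
    EvolvesAt (k := 1) g μ e (fun t => ofMHD g μ (v t) (ρ t) (B t)) t ↔ ∀ x : M,
      dtVF (k := 1) v t x + covDeriv g (v t) (v t) x +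
        (ρ t x)⁻¹ • cross g μ (B t) (curl g μ (B t)) x +
        (ρ t x)⁻¹ • grad g (fun y => (ρ t y) ^ 2 * deriv e (ρ t y)) x = 0 ∧
      dtFun ρ t x + divergence μ (fun y => ρ t y • v t y) x = 0 ∧
      dtVF (k := 1) B t x + curl g μ (cross g μ (B t) (v t)) x = 0 := by
  set θ : M → ℝ := fun x => -(1 / 2) * gAt g x (v t x) (v t x) + (e (ρ t x) + ρ t x * deriv e (ρ t x)) with hθ
  have hgrad := hamGrad_ofMHD hμ e (hpos t ht) (v t) (B t)
  have hev : EvolvesAt (k := 1) g μ e (fun t => ofMHD g μ (v t) (ρ t) (B t)) t ↔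
      dtForm (k := 1) (fun s x => ρ s x • flat g (v s) x) t =
        -(lieDensity (k := 1) μ (v t) (fun x => ρ t x • flat g (v t) x) +
          iota (curl g μ (B t)) (iota (B t) μ) + fun x => ρ t x • dFun θ x) ∧
      dtFun ρ t = (fun x => -divergence μ (fun y => ρ t y • v t y) x) ∧
      dtForm (k := 1) (fun s => iota (B s) μ) t = -lieD (v t) (iota (B t) μ) := by
    rw [EvolvesAt, hgrad, ← vecF_extd_flat hμ (B t)]
    rfl
  rw [hev]
  set R : M → Model 3 := fun x => dtVF (k := 1) v t x + covDeriv g (v t) (v t) x +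
        (ρ t x)⁻¹ • cross g μ (B t) (curl g μ (B t)) x +
        (ρ t x)⁻¹ • grad g (fun y => (ρ t y) ^ 2 * deriv e (ρ t y)) x with hR
  -- the momentum equation paired with a vector
  have key : ∀ (x : M) (w : Model 3),
      dtForm (k := 1) (fun s x => ρ s x • flat g (v s) x) t x (fun _ => w) +
        (lieDensity (k := 1) μ (v t) (fun x => ρ t x • flat g (v t) x) x (fun _ => w) +
          iota (curl g μ (B t)) (iota (B t) μ) x (fun _ => w) + ρ t x * dFun θ x (fun _ => w)) =
      (dtFun ρ t x + divergence μ (fun y => ρ t y • v t y) x) * gAt g x (v t x) w + ρ t x * gAt g x (R x) w := by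
    intro x w
    have h1 := momentum_residual (k := 1) g hμ.1 hμ.ne_zero he hJ hv hρ hpos ht x w
    have h2 := inner_sharp g (iota (curl g μ (B t)) (iota (B t) μ)) x w
    have h3 := inner_sharp g (dFun (fun y => (ρ t y) ^ 2 * deriv e (ρ t y))) x w
    have h4 : gAt g x (R x) w = gAt g x (dtVF (k := 1) v t x) w + gAt g x (covDeriv g (v t) (v t) x) w +
        (ρ t x)⁻¹ * gAt g x (cross g μ (B t) (curl g μ (B t)) x) w +
        (ρ t x)⁻¹ * gAt g x (grad g (fun y => (ρ t y) ^ 2 * deriv e (ρ t y)) x) w := by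
      have : ∀ (a b c d : Model 3) (r : ℝ), gAt g x (a + b + r • c + r • d) w =
          gAt g x a w + gAt g x b w + r * gAt g x c w + r * gAt g x d w := fun a b c d r => by simp
      exact this _ _ _ _ _
    have h2' : gAt g x (cross g μ (B t) (curl g μ (B t)) x) w = iota (curl g μ (B t)) (iota (B t) μ) x (fun _ => w) := h2
    have h3' : gAt g x (grad g (fun y => (ρ t y) ^ 2 * deriv e (ρ t y)) x) w =
      dFun (fun y => (ρ t y) ^ 2 * deriv e (ρ t y)) x (fun _ => w) := h3
    have hr := (hpos t ht x).ne'
    rw [h4, h2', h3']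
    refine Eq.trans ?_ ((congrArg (fun r : ℝ => r + iota (curl g μ (B t)) (iota (B t) μ) x (fun _ => w)) h1).trans ?_)
    · ring
    · field_simp
      ring
  -- The induction equation.
  have h3 : dtForm (k := 1) (fun s => iota (B s) μ) t = -lieD (v t) (iota (B t) μ) ↔
      ∀ x, dtVF (k := 1) B t x + curl g μ (cross g μ (B t) (v t)) x = 0 := by
    rw [eq_neg_iff_add_eq_zero, funext_iff]
    refine forall_congr' fun x => ?_
    have h4 := dtForm_iota_add hμ hJ hB ht (hd t ht) (v t) x
    constructor <;> intro h
    · refine vf_eq_of_iota (k := 1) (X := fun x => (dtVF (k := 1) B t x + curl g μ (cross g μ (B t) (v t)) x : Model 3))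
        (Y := fun _ => (0 : Model 3)) hμ.ne_zero ((h4.symm.trans h).trans ?_)
      exact (map_zero (curryL (μ x))).symm
    · exact h4.trans ((congrArg (fun u : Model 3 => (μ x).curryLeft u) h).trans (map_zero (curryL (μ x))))
  rw [h3]
  constructor
  -- By the continuity equation the first term on the right of `key` vanishes; then `ρ` cancels.
  · rintro ⟨e1, e2, e3⟩ x
    have e2' : dtFun ρ t x + divergence μ (fun y => ρ t y • v t y) x = 0 := by
      rw [e2]; exact neg_add_cancel _
    refine ⟨?_, e2', e3 x⟩
    refine eq_of_inner_eq (isInner_gAt g x) (x := R x) (y := 0) fun w => ?_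
    have h1 := key x w
    rw [e2', zero_mul, zero_add, e1] at h1
    have h5 : ρ t x * gAt g x (R x) w = 0 := h1.symm.trans (neg_add_cancel _)
    rw [map_zero, zero_apply]
    exact (mul_eq_zero.1 h5).resolve_left (hpos t ht x).ne'
  · intro h
    refine ⟨?_, funext fun x => eq_neg_of_add_eq_zero_left (h x).2.1, fun x => (h x).2.2⟩
    rw [eq_neg_iff_add_eq_zero]
    funext x
    refine ContinuousAlternatingMap.ext fun w => ?_
    obtain ⟨a, rfl⟩ : ∃ a : Model 3, w = fun _ => a := ⟨w 0, funext fun i => by rw [Subsingleton.elim i 0]⟩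
    refine (key x a).trans ?_
    have h1 : R x = 0 := (h x).1
    rw [(h x).2.1, h1, zero_mul, map_zero]
    simp

end Three

end CompMHD

end

theorem mainTheorem2 :
    (∀ (k : ℕ) (M : Type u) [TopologicalSpace M] [ChartedSpace (Model (k + 2)) M]
      [IsManifold (𝓡 (k + 2)) ∞ M] [CompactSpace M] [T2Space M] [MeasurableSpace M] [BorelSpace M]
      (g : Metric (k + 2) M) (μ : Form (k + 2) M (k + 2)) (β₀ : Form (k + 2) M 2) (e : ℝ → ℝ),
      IsRiemannianVolume g μ → SmoothForm β₀ → extd β₀ = 0 → ContDiffOn ℝ ∞ e (Ioi 0) →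
      -- `Π` maps into `𝔠𝔪𝔥^*` and embeds the quotient by `𝒢`
      (∀ φ α, OrientationPreserving μ φ → SmoothForm α → (proj μ β₀ φ α).Mem) ∧
      (∀ φ φ' α α', OrientationPreserving μ φ → OrientationPreserving μ φ' →
        (proj μ β₀ φ α = proj μ β₀ φ' α' ↔
          ∃ η ∈ symGroup μ β₀, φ' = η.trans φ ∧ α' = α)) ∧
      -- the pairing of closed 2-forms with `Ω^{n-2}(M)` descends to classes modulo exact forms
      (∀ (β : Form (k + 2) M 2) (P : Form (k + 2) M k), SmoothForm β → extd β = 0 →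
        IsExactForm P → pairForm μ β P = 0) ∧
      -- `Π` is a Poisson map
      (∀ (F G : CMHDual k M → ℝ) (φ : Diffeo (k + 2) M) (α : Form (k + 2) M 1) (a b : CMH k M),
        OrientationPreserving μ φ → SmoothForm α → a.Smooth → b.Smooth →
        HasVarDeriv μ F (proj μ β₀ φ α) a → HasVarDeriv μ G (proj μ β₀ φ α) b →
        ∃ ν₁ ν₂ : Form (k + 2) M 1, SmoothForm ν₁ ∧ SmoothForm ν₂ ∧
          HasCotDeriv μ (fun ψ γ => F (proj μ β₀ ψ γ)) φ α ν₁ a.v ∧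
          HasCotDeriv μ (fun ψ γ => G (proj μ β₀ ψ γ)) φ α ν₂ b.v ∧
          canBracket μ α ν₁ a.v ν₂ b.v = lpBracket μ (proj μ β₀ φ α) a b) ∧
      -- the momentum map of the cotangent action of `Diff(M)` on `T^*(Dens(M) × Ω²_cl(M))`
      (∀ (ρ θ : M → ℝ) (β : Form (k + 2) M 2) (P : Form (k + 2) M k) (u w : VF (k + 2) M),
        SmoothFun (n := k + 2) ρ → SmoothFun (n := k + 2) θ → SmoothForm β → extd β = 0 →
        SmoothForm P → SmoothVF u → SmoothVF w → (∀ x, ρ x • iota u μ x = extd P x) →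
        integ μ (fun x => θ x * -divergence μ (fun y => ρ y • w y) x) +
            pairForm μ (-lieD w β) P =
          pair μ (fun x => ρ x • (dFun θ x + iota u β x)) w) ∧
      -- the Hamiltonian is `𝒢`-invariant and equals `H̄ ∘ Π`
      (∀ φ α, ham g μ e β₀ φ α = hamBar g μ e (proj μ β₀ φ α)) ∧
      (∀ φ α, ∀ η ∈ symGroup μ β₀, ham g μ e β₀ (η.trans φ) α = ham g μ e β₀ φ α) ∧
      -- the variational derivatives of `H̄`
      (∀ ξ : CMHDual k M, ξ.Mem → (∀ x, 0 < ξ.ρ x) →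
        HasVarDeriv μ (hamBar g μ e) ξ
          ⟨velocity g ξ,
            fun x => -(1 / 2) * g.inner x (velocity g ξ x) (velocity g ξ x) +
              (e (ξ.ρ x) + ξ.ρ x * deriv e (ξ.ρ x)),
            hodge g μ ξ.β⟩) ∧
      -- the Lie-Poisson equations of `H̄` are the reduced system
      (∀ (J : Set ℝ) (ξ : ℝ → CMHDual k M), IsOpen J → SmoothCurve J ξ →
        (∀ t ∈ J, ∀ x, 0 < (ξ t).ρ x) →
        ((∀ t ∈ J, ∀ (F : CMHDual k M → ℝ) (a b : CMH k M), a.Smooth → b.Smooth →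
            HasVarDeriv μ (hamBar g μ e) (ξ t) a → HasVarDeriv μ F (ξ t) b →
            HasDerivAt (fun s => F (ξ s)) (lpBracket μ (ξ t) a b) t) ↔
          SolvesReduced g μ e J ξ)) ∧
      -- the equations of motion on `T^*Diff(M)` reduce to the system
      (∀ (J : Set ℝ) (φ : ℝ → Diffeo (k + 2) M) (α : ℝ → Form (k + 2) M 1), IsOpen J →
        SmoothFamDiffeo J φ → SmoothFamForm J α → (∀ t ∈ J, OrientationPreserving μ (φ t)) →
        (IsHamiltonianCurve μ (ham g μ e β₀) J φ α ↔
          (∀ t ∈ J, IsVelocity φ t (velocity g (proj μ β₀ (φ t) (α t)))) ∧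
            SolvesReduced g μ e J (fun t => proj μ β₀ (φ t) (α t))))) ∧
    -- on a 3-manifold the reduced system is compressible MHD with `β = ι_B μ`
    (∀ (M : Type u) [TopologicalSpace M] [ChartedSpace (Model 3) M]
      [IsManifold (𝓡 3) ∞ M] [CompactSpace M] [T2Space M] [MeasurableSpace M] [BorelSpace M]
      (g : Metric 3 M) (μ : Form 3 M 3) (e : ℝ → ℝ) (J : Set ℝ),
      IsRiemannianVolume g μ → ContDiffOn ℝ ∞ e (Ioi 0) → IsOpen J →
      (∀ ξ : ℝ → CMHDual 1 M, SmoothCurve J ξ → (∀ t ∈ J, ∀ x, 0 < (ξ t).ρ x) →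
        ∃ v B : ℝ → VF 3 M, SmoothFamVF J v ∧ SmoothFamVF J B ∧
          (∀ t ∈ J, ξ t = ofMHD g μ (v t) (ξ t).ρ (B t)) ∧
          ∀ v' B' : ℝ → VF 3 M, (∀ t ∈ J, ξ t = ofMHD g μ (v' t) (ξ t).ρ (B' t)) →
            ∀ t ∈ J, v' t = v t ∧ B' t = B t) ∧
      (∀ (v B : ℝ → VF 3 M) (ρ : ℝ → M → ℝ), SmoothFamVF J v → SmoothFamVF J B →
        SmoothFamFun 3 J ρ → (∀ t ∈ J, ∀ x, 0 < ρ t x) →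
        (∀ t ∈ J, extd (iota (B t) μ) = 0 ↔ divergence μ (B t) = 0) ∧
        ((∀ t ∈ J, divergence μ (B t) = 0) →
          (SolvesReduced g μ e J (fun t => ofMHD g μ (v t) (ρ t) (B t)) ↔
            SolvesMHD g μ e J v ρ B)))) := by
  refine ⟨?_, ?_⟩
  · intro k M _ _ _ _ _ _ _ g μ β₀ e hμ hβ hd he
    have h0 := hμ.ne_zero
    refine ⟨fun φ α _ hα => proj_mem hμ.1 h0 hβ hd φ hα, fun φ φ' α α' _ _ => proj_eq_iff h0 φ φ' α α',
      fun β P hβ' hd' hP => pairForm_exact hμ.1 h0 hβ' hd' hP, fun F G φ α a b _ _ ha hb hF hG => ?_,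
      fun ρ θ β P u w hρ hθ hβ' hd' hP hu hw h => ?_, fun φ α => rfl, fun φ α η hη => ?_,
      fun ξ _ hpos => hasVarDeriv_hamBar g hμ.1 h0 he hpos,
      fun J ξ hJ hξ hpos => (liePoisson_iff g hμ.1 h0 he hJ hξ hpos).trans (solvesReduced_iff g hμ.1 h0 he hξ hpos).symm,
      fun J φ α hJ hφ hα hor => reduction g hμ.1 h0 hβ hd he hJ hφ hα hor⟩
    · have hρ : SmoothFun (n := k + 2) (rhoOf μ φ) := hμ.1.dens h0 hμ.1.pushforward
      have hs : ∀ a : CMH k M, a.Smooth →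
          SmoothForm ((fun x => rhoOf μ φ x • dFun a.θ x) + iota (vecF μ (extd a.P)) (pushforward φ β₀)) := fun a ha =>
        (SmoothForm.smul hρ (SmoothFun.dFun ha.2.1)).add (SmoothForm.iota (SmoothForm.vecF hμ.1 h0 ha.2.2.extd) hβ.pushforward)
      exact ⟨_, _, hs a ha, hs b hb, hasCotDeriv_proj hμ.1 h0 hβ hd ha hF, hasCotDeriv_proj hμ.1 h0 hβ hd hb hG,
        canBracket_eq hμ.1 h0 hβ hd ha hb⟩
    -- The condition `ρ ι_u μ = dP` says that the field `ρ u` contracts `μ` to `dP`.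
    · have hU : iota (fun x => ρ x • u x) μ = extd P := (iota_smul ρ u μ).trans (funext h)
      refine (momentum_map hμ.1 h0 hρ hθ hβ' hd' hP (SmoothVF.smul hρ hu) hw hU).trans ?_
      refine congrArg (fun α => pair μ α w) (funext fun x => ?_)
      rw [smul_add]
      exact congrArg (fun r => ρ x • dFun θ x + r) (congrFun (iota_smul ρ u β) x)
    · have h1 : pushforward (η.trans φ) μ = pushforward φ μ := by rw [pushforward_trans, hη.1]
      have h2 : pushforward (η.trans φ) β₀ = pushforward φ β₀ := by rw [pushforward_trans, hη.2]
      have h3 : rhoOf μ (η.trans φ) = rhoOf μ φ := by rw [rhoOf, rhoOf, h1]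
      rw [ham, ham, h2, h3]
  · intro M _ _ _ _ _ _ _ g μ e J hμ he hJ
    refine ⟨fun ξ hξ hpos => exists_ofMHD hμ hJ hξ hpos, fun v B ρ hv hB hρ hpos =>
      ⟨fun t _ => closed_iff_divergence hμ (B t), fun hd => ?_⟩⟩
    refine (solvesReduced_iff (k := 1) g hμ.1 hμ.ne_zero he (smoothCurve_ofMHD hμ hJ hv hB hρ hd) hpos).trans ?_
    exact forall₂_congr fun t ht => evolvesAt_ofMHD_iff hμ he hJ hv hB hρ hpos hd ht
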